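/- **Setting.** Let $M\ge 0$ be an integer and let $H^\infty(x;y)=h(x-y)$, $x,y\in\mathbb Z$, be a finite-range, translation-invariant, self-adjoint one-particle Hamiltonian with $M\times M$ blocks: $h(z)=0$ for all but finitely many $z$ and $h(-z)=h(z)^*$. Let $\hat H(k)=\sum_z e^{-ikz}h(z)$ and $\mu\in\mathbb R$. Assume that there are $\Delta>0$, an integer $N\ge 0$, pairwise disjoint open arcs $I_1,\dots,I_N$ of the circle $\mathbb T=\mathbb R/2\pi\mathbb Z$ and strictly monotone smooth functions $e_\omega:I_\omega\to\mathbb R$ such that, for each $k\in\mathbb T$, $$\sigma(\hat H(k))\cap(\mu-\Delta,\mu+\Delta)=\{e_\omega(k):\ 1\le\omega\le N,\ k\in I_\omega\},$$ that $e_\omega(k)$ is a non-degenerate eigenvalue of $\hat H(k)$ for $k\in I_\omega$, and that for each $\omega$ there is $k_F^\omega\in I_\omega$ with $e_\omega(k_F^\omega)=\mu$ and $v_\omega:=e_\omega'(k_F^\omega)\ne 0$. For $\nu\in\{0,1\}$ put $v_\omega^0=1$, $v_\omega^1=v_\omega$, $\chi_{\nu,\omega}=\frac{v_\omega^\nu}{2\pi|v_\omega|}$.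 Let $\mu_\infty:\mathbb R\to\mathbb R$ be smooth with compact support, $\hat\mu_\infty(q)=\int e^{-iqy}\mu_\infty(y)\,dy$; let $\alpha\in(0,1)$ and let $\chi$ be a smooth cutoff function with values in $[0,1]$, $\chi(t)=1$ for $t\le1$ and $\chi(t)=0$ for $t\ge2$. **Finite volume.** For odd $L$, on $\Gamma_L=\{-\lfloor L/2\rfloor,\dots,\lfloor L/2\rfloor\}$ with periodic boundary conditions, let $B_L=\frac{2\pi}{L}\{0,\dots,L-1\}$, let $\mathcal H=\sum a^*_{x,\rho}H_{\rho\rho'}(x;y)a_{y,\rho'}$, $H(x;y)=\sum_n H^\infty(x+nL;y)$, be the fermionic Fock space Hamiltonian, $\mathcal N$ the number operator, $\langle\cdot\rangle_{\beta,L}$ the Gibbs state $\propto e^{-\beta(\mathcal H-\mu\mathcal N)}$ and $\gamma_s(\mathcal O)=e^{s(\mathcal H-\mu\mathcal N)}\mathcal Oe^{-s(\mathcal H-\mu\mathcal N)}$. With $\hat a_k=\sum_x e^{-ikx}a_x$, the density ($\nu=0$) and the current ($\nu=1$) are $$j_{\nu,x}=\frac1L\sum_{p\in B_L}e^{ipx}\,\frac1L\sum_{k\in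 B_L}(\hat a^*_{k-p},\hat J_\nu(k,p)\hat a_k),\qquad \hat J_0=1,\quad \hat J_1(k,p)=i\,\frac{\hat H(k)-\hat H(k-p)}{1-e^{-ip}},$$ with $\hat J_1(k,p)=\partial_k\hat H(k)$ for $p\in2\pi\mathbb Z$. For $\theta,\eta>0$ let $\mu(\theta x)=\sum_{m\in\mathbb Z}\mu_\infty(\theta(x+mL))$, let $\mu_\alpha(\theta x)=\frac1L\sum_{p\in B_L}e^{ipx}\chi(\theta^{\alpha-1}|p|_{\mathbb T})\sum_{y\in\Gamma_L}e^{-ipy}\mu(\theta y)$, where $|p|_{\mathbb T}=\min_n|p+2\pi n|$, let $\mathcal P=\theta\sum_x\mu_\alpha(\theta x)j_{0,x}$, and let $\eta_\beta$ be the least element of $\frac{2\pi}\beta\mathbb N$ with $\eta_\beta\ge\eta$. The first-order (Kubo) term of the Duhamel expansion of the response of $j_{\nu,x}$, divided by $\theta$, is $$\chi^{\beta,L,(1)}_\nu(x;\eta,\theta)=-\frac1\theta\int_0^\beta e^{-i\eta_\beta s}\big(\langle\gamma_s(\mathcal P)\,j_{\nu,x}\rangle_{\beta,L}-\langle\mathcal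 P\rangle_{\beta,L}\langle j_{\nu,x}\rangle_{\beta,L}\big)\,ds .$$ **Infinite volume, zero temperature.** With $g(k_0,k)=(ik_0+\hat H(k)-\mu)^{-1}$ let $$K_\nu(p_0,p)=-\int_{\mathbb R\times\mathbb T}\mathrm{Tr}\big(\hat J_\nu(k,-p)\,g(k_0,k)\,g(k_0+p_0,k+p)\big)\frac{dk_0\,dk}{(2\pi)^2},$$ and, with $\hat\mu(q)=\sum_{n\in\mathbb Z}\hat\mu_\infty(q+2\pi n/\theta)$, $$\chi^{\rm lin}_\nu(x;\eta,\theta)=-\int_{|q|\le\pi/\theta}\hat\mu(-q)\,\chi(\theta^\alpha|q|)\,e^{-iq\theta x}\,K_\nu(\eta,\theta q)\,\frac{dq}{2\pi}.$$ For $\delta>0$ write $K_\nu=S_{1;\nu}+R_{1;\nu}$, where, with $g_\omega(q_0,q)=\chi\big(\sqrt{q_0^2+v_\omega^2q^2}/\delta\big)/(iq_0+v_\omega q)$, $$S_{1;\nu}(p_0,p)=-\sum_\omega v_\omega^\nu\int_{\mathbb R^2}g_\omega(k_0,k)\,g_\omega(k_0+p_0,k+p)\,\frac{dk_0\,dk}{(2\pi)^2}.$$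 **Proposition (Evaluation of the linear response).** 1. For all $\nu$, $x\in\mathbb Z$, $\eta,\theta>0$, $\lim_{\beta\to\infty}\lim_{L\to\infty}\chi_\nu^{\beta,L,(1)}(x;\eta,\theta)=\chi_\nu^{\rm lin}(x;\eta,\theta)$; both limits exist. 2. (The constant remainder.) By the lattice continuity equation, $K_\nu(p_0,0)=0$ for $p_0\neq0$, and for each $\delta>0$ $$\lim_{(p_0,p)\to(0,0)}R_{1;\nu}(p_0,p)=\sum_{\omega}\frac{v_\omega^\nu}{4\pi|v_\omega|}.$$ 3. There are $C$ and $\theta_0>0$ such that for all $\nu$, all $x\in\mathbb Z$ and all $\eta,a>0$ with $\theta=a\eta<\theta_0$, $$\Big|\chi_\nu^{\rm lin}(x;\eta,\theta)+\sum_{\omega=1}^N\chi_{\nu,\omega}\int_{\mathbb R}\hat\mu_\infty(q)e^{iq\theta x}\frac{v_\omega q}{-i/a+v_\omega q}\frac{dq}{2\pi}\Big|\le C\theta^{1-\alpha}.$$ 4. Let $\theta=a\eta$. As $\eta\to0^+$, uniformly in $x\in\mathbb Z$: (i) if $a=a(\eta)\to0$, then $\chi_\nu^{\rm lin}(x;\eta,\theta)=O(a)$;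 (ii) if $a>0$ is constant, then $$\chi_\nu^{\rm lin}(x;\eta,\theta)=-\sum_{\omega}\chi_{\nu,\omega}\Big[\mu_\infty(\theta x)-\frac1{a|v_\omega|}\int_{\{y:\,y/v_\omega>0\}}\mu_\infty(\theta x-y)\,e^{-y/(av_\omega)}\,dy\Big]+O(\eta^{1-\alpha});$$ (iii) if $a=a(\eta)\to\infty$ and $a\eta\to0$, then $$\chi_\nu^{\rm lin}(x;\eta,\theta)=-\mu_\infty(\theta x)\sum_\omega\chi_{\nu,\omega}+O(1/a)+O(\theta^{1-\alpha}).$$ In (i) and (iii) the constants do not depend on the function $a(\cdot)$. -/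

import Mathlib

open scoped Matrix Topology

noncomputable section

namespace LinearResponse

/-! ### One-particle setting

`h z` is the `M × M` block `H^∞(x + z; x)` of a translation-invariant Hamiltonian on `ℤ × {1, …, M}`.
It is finite-ranged, because `h` is finitely supported. -/

/-- A finite-range, translation-invariant one-particle kernel with `M` internal degrees of freedom. -/
abbrev Hopping (M : ℕ) := ℤ →₀ Matrix (Fin M) (Fin M) ℂ

/-- Self-adjointness of the one-particle Hamiltonian with kernel `H^∞(x; y) = h (x - y)`. -/
def Hopping.SelfAdjoint {M : ℕ} (h : Hopping M) : Prop := ∀ z : ℤ, h (-z) = (h z)ᴴ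

/-- The phase `e^{i t}` of a real number `t`. -/
def phase (t : ℝ) : ℂ := Complex.exp (Complex.I * (t : ℂ))

/-- The Bloch Hamiltonian `Ĥ(k) = ∑_z e^{-ikz} h(z)`. -/
def bloch {M : ℕ} (h : Hopping M) (k : ℝ) : Matrix (Fin M) (Fin M) ℂ :=
  ∑ z ∈ h.support, phase (-(k * z)) • h z

/-- The entrywise derivative `∂_k Ĥ(k)`. -/
def blochDeriv {M : ℕ} (h : Hopping M) (k : ℝ) : Matrix (Fin M) (Fin M) ℂ :=
  Matrix.of fun ρ ρ' => deriv (fun t : ℝ => bloch h t ρ ρ') k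

open Classical in
/-- The vertex functions: `Ĵ_0(k,p) = 1` and `Ĵ_1(k,p) = i (Ĥ(k) - Ĥ(k-p)) / (1 - e^{-ip})`; the
latter has a removable singularity at `p ∈ 2πℤ`, where its value is `∂_k Ĥ(k)`. -/
def vertex {M : ℕ} (h : Hopping M) (ν : Fin 2) (k p : ℝ) : Matrix (Fin M) (Fin M) ℂ :=
  if ν = 0 then 1
  else if phase (-p) = 1 then blochDeriv h k
  else (Complex.I / (1 - phase (-p))) • (bloch h k - bloch h (k - p))

/-- The assumption on the low energy spectrum at the chemical potential `μ`.  The arcs `I_ω` of the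
circle `ℝ / 2πℤ` are represented by open intervals `(lo ω, hi ω)` of length at most `2π`.  The
equation for the spectrum inside the window `(μ - Δ, μ + Δ)` is imposed at each quasi-momentum. -/
structure LowEnergySpectrum {M : ℕ} (h : Hopping M) (μ : ℝ) (N : ℕ) where
  Δ : ℝ
  Δ_pos : 0 < Δ
  lo : Fin N → ℝ
  hi : Fin N → ℝ
  hi_le : ∀ ω, hi ω ≤ lo ω + 2 * Real.pi
  disjoint : ∀ ω ω', ω ≠ ω' → ∀ k ∈ Set.Ioo (lo ω) (hi ω), ∀ k' ∈ Set.Ioo (lo ω') (hi ω'),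
    ∀ n : ℤ, k' ≠ k + 2 * Real.pi * n
  /-- the band functions -/
  e : Fin N → ℝ → ℝ
  smooth : ∀ ω, ContDiffOn ℝ (⊤ : ℕ∞) (e ω) (Set.Ioo (lo ω) (hi ω))
  strictMono : ∀ ω, StrictMonoOn (e ω) (Set.Ioo (lo ω) (hi ω)) ∨
    StrictAntiOn (e ω) (Set.Ioo (lo ω) (hi ω))
  spectrum_eq : ∀ k E : ℝ,
    ((E : ℂ) ∈ spectrum ℂ (bloch h k) ∧ E ∈ Set.Ioo (μ - Δ) (μ + Δ)) ↔
      ∃ ω, ∃ n : ℤ, k + 2 * Real.pi * n ∈ Set.Ioo (lo ω) (hi ω) ∧ E = e ω (k + 2 * Real.pi * n)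
  nondegenerate : ∀ ω, ∀ k ∈ Set.Ioo (lo ω) (hi ω),
    Module.finrank ℂ (Module.End.eigenspace (Matrix.toLin' (bloch h k)) (e ω k : ℂ)) = 1
  /-- the Fermi points -/
  kF : Fin N → ℝ
  kF_mem : ∀ ω, kF ω ∈ Set.Ioo (lo ω) (hi ω)
  e_kF : ∀ ω, e ω (kF ω) = μ
  velocity_ne_zero : ∀ ω, deriv (e ω) (kF ω) ≠ 0

/-- The Fermi velocities `v_ω = ∂_k e_ω(k_F^ω)`. -/
def LowEnergySpectrum.v {M N : ℕ} {h : Hopping M} {μ : ℝ} (A : LowEnergySpectrum h μ N)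
    (ω : Fin N) : ℝ := deriv (A.e ω) (A.kF ω)

/-- The coefficient `χ_{ν,ω} = v_ω^ν / (2π |v_ω|)`, with `v^0 = 1`, `v^1 = v`. -/
def LowEnergySpectrum.coeff {M N : ℕ} {h : Hopping M} {μ : ℝ} (A : LowEnergySpectrum h μ N)
    (ν : Fin 2) (ω : Fin N) : ℝ := A.v ω ^ (ν : ℕ) / (2 * Real.pi * |A.v ω|)

/-- A smooth cutoff function `χ : ℝ⁺ → [0,1]` (extended by `1` to the negative half-line). -/
structure IsCutoff (χ : ℝ → ℝ) : Prop where
  smooth : ContDiff ℝ (⊤ : ℕ∞) χ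
  nonneg : ∀ t, 0 ≤ χ t
  le_one : ∀ t, χ t ≤ 1
  eq_one : ∀ t, t ≤ 1 → χ t = 1
  eq_zero : ∀ t, 2 ≤ t → χ t = 0

/-! ### Lattice fermions in finite volume

The lattice has `L = 2ℓ + 1` sites. The fermionic Fock space over the finitely many modes
`(x, ρ)` is written in its occupation number basis, which is indexed by the finite sets of modes. -/

/-- The sites of `Γ_L = [-ℓ, ℓ] ∩ ℤ`, where `L = 2ℓ + 1`. -/
abbrev Site (ℓ : ℕ) := {x : ℤ // x ∈ Finset.Icc (-(ℓ : ℤ)) ℓ}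

/-- The decorated lattice `Λ_L = Γ_L × {1, …, M}`, ordered lexicographically. -/
abbrev Mode (ℓ M : ℕ) := Site ℓ ×ₗ Fin M

/-- The mode `(x, ρ)`. -/
abbrev mode {ℓ M : ℕ} (x : Site ℓ) (ρ : Fin M) : Mode ℓ M := toLex (x, ρ)

/-- Operators on the fermionic Fock space. -/
abbrev FockOp (ℓ M : ℕ) := Matrix (Finset (Mode ℓ M)) (Finset (Mode ℓ M)) ℂ

/-- The annihilation operator of the mode `m`. -/
def annihil {ℓ M : ℕ} (m : Mode ℓ M) : FockOp ℓ M :=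
  Matrix.of fun S T => if m ∈ T ∧ S = T.erase m then (-1) ^ (T.filter (· < m)).card else 0

/-- The creation operator of the mode `m`. -/
def creat {ℓ M : ℕ} (m : Mode ℓ M) : FockOp ℓ M := (annihil m)ᴴ

/-- The periodized one-particle Hamiltonian `H(x; y) = ∑_n H^∞(x + nL; y)`. -/
def hopL {M : ℕ} (h : Hopping M) (ℓ : ℕ) (x y : Site ℓ) : Matrix (Fin M) (Fin M) ℂ :=
  ∑ᶠ n : ℤ, h (x.1 + n * (2 * ℓ + 1) - y.1)

/-- The many-body Hamiltonian `𝓗 = ∑ a*_x H(x; y) a_y`. -/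
def hamiltonian {M : ℕ} (h : Hopping M) (ℓ : ℕ) : FockOp ℓ M :=
  ∑ x : Site ℓ, ∑ ρ : Fin M, ∑ y : Site ℓ, ∑ ρ' : Fin M,
    hopL h ℓ x y ρ ρ' • (creat (mode x ρ) * annihil (mode y ρ'))

/-- The density operator `n_x = ∑_ρ a*_{(x,ρ)} a_{(x,ρ)}`. -/
def density (M : ℕ) {ℓ : ℕ} (x : Site ℓ) : FockOp ℓ M :=
  ∑ ρ : Fin M, creat (mode x ρ) * annihil (mode x ρ)

/-- The number operator. -/
def number (ℓ M : ℕ) : FockOp ℓ M := ∑ x : Site ℓ, density M x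

/-- The grand-canonical Hamiltonian `𝓗 - μ 𝓝`. -/
def grandHam {M : ℕ} (h : Hopping M) (μ : ℝ) (ℓ : ℕ) : FockOp ℓ M :=
  hamiltonian h ℓ - (μ : ℂ) • number ℓ M

/-- The Gibbs state `⟨O⟩_{β,L} = Tr (O e^{-β(𝓗 - μ𝓝)}) / Tr e^{-β(𝓗 - μ𝓝)}`. -/
def gibbs {M : ℕ} (h : Hopping M) (μ β : ℝ) (ℓ : ℕ) (O : FockOp ℓ M) : ℂ :=
  (O * NormedSpace.exp (-((β : ℂ) • grandHam h μ ℓ))).trace /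
    (NormedSpace.exp (-((β : ℂ) • grandHam h μ ℓ))).trace

/-- Imaginary time evolution `γ_s(O) = e^{s(𝓗 - μ𝓝)} O e^{-s(𝓗 - μ𝓝)}`. -/
def imagEvol {M : ℕ} (h : Hopping M) (μ : ℝ) (ℓ : ℕ) (s : ℝ) (O : FockOp ℓ M) : FockOp ℓ M :=
  NormedSpace.exp ((s : ℂ) • grandHam h μ ℓ) * O * NormedSpace.exp (-((s : ℂ) • grandHam h μ ℓ))

/-- The Euclidean time-ordered cumulant `⟨T γ_s(A); B⟩_{β,L}` for even operators `A`, `B` at times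
`s ∈ [0, β)` and `0`. -/
def euclidCumulant {M : ℕ} (h : Hopping M) (μ β : ℝ) (ℓ : ℕ) (s : ℝ) (A B : FockOp ℓ M) : ℂ :=
  gibbs h μ β ℓ (imagEvol h μ ℓ s A * B) - gibbs h μ β ℓ A * gibbs h μ β ℓ B

/-- The `n`-th allowed quasi-momentum, `2πn / L`. -/
def momentum (ℓ : ℕ) (n : Fin (2 * ℓ + 1)) : ℝ := 2 * Real.pi * (n : ℕ) / (2 * ℓ + 1)

/-- The Bloch transform `â_{(k,ρ)} = ∑_x a_{(x,ρ)} e^{-ikx}`. -/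
def annihilHat {M : ℕ} (ℓ : ℕ) (k : ℝ) (ρ : Fin M) : FockOp ℓ M :=
  ∑ x : Site ℓ, phase (-(k * x.1)) • annihil (mode x ρ)

/-- The Bloch transform `ĵ_{ν,p} = L⁻¹ ∑_k (â*_{k-p}, Ĵ_ν(k,p) â_k)` of the density (`ν = 0`) and of
the current (`ν = 1`). -/
def currentHat {M : ℕ} (h : Hopping M) (ℓ : ℕ) (ν : Fin 2) (p : ℝ) : FockOp ℓ M :=
  (1 / (2 * ℓ + 1) : ℂ) • ∑ n, ∑ ρ, ∑ ρ', vertex h ν (momentum ℓ n) p ρ ρ' •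
    ((annihilHat ℓ (momentum ℓ n - p) ρ)ᴴ * annihilHat ℓ (momentum ℓ n) ρ')

/-- The density and the current at the site `x`: `j_{ν,x} = L⁻¹ ∑_p e^{ipx} ĵ_{ν,p}`. -/
def current {M : ℕ} (h : Hopping M) (ℓ : ℕ) (ν : Fin 2) (x : ℤ) : FockOp ℓ M :=
  (1 / (2 * ℓ + 1) : ℂ) • ∑ n, phase (momentum ℓ n * x) • currentHat h ℓ ν (momentum ℓ n)

/-- The periodized potential `μ(θx) = ∑_a μ_∞(θ(x + aL))`. -/
def potential (μinf : ℝ → ℝ) (θ : ℝ) (ℓ : ℕ) (x : ℤ) : ℝ :=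
  ∑' a : ℤ, μinf (θ * (x + a * (2 * ℓ + 1)))

/-- The Bloch transform `μ̂_θ(p) = ∑_{x ∈ Γ_L} e^{-ipx} μ(θx)`. -/
def potentialHat (μinf : ℝ → ℝ) (θ : ℝ) (ℓ : ℕ) (p : ℝ) : ℂ :=
  ∑ x : Site ℓ, phase (-(p * x.1)) * (potential μinf θ ℓ x.1 : ℂ)

/-- The potential with large momenta cut off:
`μ_α(θx) = L⁻¹ ∑_p e^{ipx} μ̂_θ(p) χ(θ^{α-1} |p|_𝕋)`. -/
def potentialCut (χ : ℝ → ℝ) (α : ℝ) (μinf : ℝ → ℝ) (θ : ℝ) (ℓ : ℕ) (x : ℤ) : ℂ :=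
  (1 / (2 * ℓ + 1) : ℂ) * ∑ n, phase (momentum ℓ n * x) * potentialHat μinf θ ℓ (momentum ℓ n) *
    (χ (θ ^ (α - 1) * ‖(momentum ℓ n : AddCircle (2 * Real.pi))‖) : ℂ)

/-- The perturbation `𝓟 = θ ∑_x μ_α(θx) n_x`. -/
def perturbation (M : ℕ) (χ : ℝ → ℝ) (α : ℝ) (μinf : ℝ → ℝ) (θ : ℝ) (ℓ : ℕ) : FockOp ℓ M :=
  (θ : ℂ) • ∑ x : Site ℓ, potentialCut χ α μinf θ ℓ x.1 • density M x

/-- The best approximation from above of `η` in `(2π/β) ℕ`. -/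
def etaBeta (β η : ℝ) : ℝ := 2 * Real.pi / β * (⌈β * η / (2 * Real.pi)⌉₊ : ℝ)

/-- The first-order term (divided by `θ`) at time `0` of the Duhamel series in imaginary time for the
response of `j_{ν,x}`, at inverse temperature `β` and on `L = 2ℓ + 1` sites:
`-θ⁻¹ ∫_0^β e^{-i η_β s} ⟨T γ_s(𝓟); j_{ν,x}⟩_{β,L} ds`. -/
def firstOrderFinite {M : ℕ} (h : Hopping M) (μ : ℝ) (χ : ℝ → ℝ) (α : ℝ) (μinf : ℝ → ℝ)
    (ν : Fin 2) (x : ℤ) (η θ β : ℝ) (ℓ : ℕ) : ℂ :=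
  -(1 / (θ : ℂ)) * ∫ s in (0 : ℝ)..β, phase (-(etaBeta β η * s)) *
    euclidCumulant h μ β ℓ s (perturbation M χ α μinf θ ℓ) (current h ℓ ν x)

/-! ### Infinite volume and zero temperature -/

/-- The propagator `g(k₀, k) = (i k₀ + Ĥ(k) - μ)⁻¹`. -/
def propagator {M : ℕ} (h : Hopping M) (μ k₀ k : ℝ) : Matrix (Fin M) (Fin M) ℂ :=
  (bloch h k + (Complex.I * (k₀ : ℂ) - (μ : ℂ)) • (1 : Matrix (Fin M) (Fin M) ℂ))⁻¹

/-- The density-current (`ν = 1`) and density-density (`ν = 0`) correlation at zero temperature and in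
infinite volume, `-∫_{ℝ × 𝕋} Tr (Ĵ_ν(k,-p) g(k₀,k) g(k₀+p₀,k+p)) dk₀ dk / (2π)²`. -/
def correlation {M : ℕ} (h : Hopping M) (μ : ℝ) (ν : Fin 2) (p₀ p : ℝ) : ℂ :=
  -∫ κ in (Set.univ ×ˢ Set.Ioc (-Real.pi) Real.pi : Set (ℝ × ℝ)),
    (vertex h ν κ.2 (-p) * propagator h μ κ.1 κ.2 * propagator h μ (κ.1 + p₀) (κ.2 + p)).trace /
      (2 * Real.pi : ℂ) ^ 2

/-- The linear propagator with cutoff of a chiral fermion of velocity `v`, at momentum `(q₀, q)`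
measured from the Fermi point: `χ(√(q₀² + v²q²)/δ) / (i q₀ + v q)`. -/
def chiralPropagator (χ : ℝ → ℝ) (δ v q₀ q : ℝ) : ℂ :=
  (χ (√(q₀ ^ 2 + v ^ 2 * q ^ 2) / δ) : ℂ) / (Complex.I * (q₀ : ℂ) + (v : ℂ) * (q : ℂ))

/-- The relativistic bubble diagram. -/
def bubble (χ : ℝ → ℝ) (δ v p₀ p : ℝ) : ℂ :=
  -∫ κ : ℝ × ℝ, chiralPropagator χ δ v κ.1 κ.2 * chiralPropagator χ δ v (κ.1 + p₀) (κ.2 + p) /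
    (2 * Real.pi : ℂ) ^ 2

/-- The singular part `S_{1;ν} = ∑_ω v_ω^ν 𝔅_δ^ω` of the correlation. -/
def singularPart {M N : ℕ} {h : Hopping M} {μ : ℝ} (A : LowEnergySpectrum h μ N) (χ : ℝ → ℝ) (δ : ℝ)
    (ν : Fin 2) (p₀ p : ℝ) : ℂ :=
  ∑ ω, ((A.v ω ^ (ν : ℕ) : ℝ) : ℂ) * bubble χ δ (A.v ω) p₀ p

/-- The remainder `R_{1;ν}`: the correlation minus its singular part. -/
def remainder {M N : ℕ} {h : Hopping M} {μ : ℝ} (A : LowEnergySpectrum h μ N) (χ : ℝ → ℝ) (δ : ℝ)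
    (ν : Fin 2) (p₀ p : ℝ) : ℂ :=
  correlation h μ ν p₀ p - singularPart A χ δ ν p₀ p

/-- The Fourier transform `μ̂_∞(q) = ∫ e^{-iqy} μ_∞(y) dy`. -/
def fourier (μinf : ℝ → ℝ) (q : ℝ) : ℂ := ∫ y : ℝ, phase (-(q * y)) * (μinf y : ℂ)

/-- The function `μ̂(q) = ∑_n μ̂_∞(q + 2πn/θ)` on the torus of length `2π/θ`. -/
def torusFourier (μinf : ℝ → ℝ) (θ q : ℝ) : ℂ := ∑' n : ℤ, fourier μinf (q + 2 * Real.pi * n / θ)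

/-- The linear response at zero temperature and in infinite volume,
`χ_ν^lin(x;η,θ) = -∫_{|q| ≤ π/θ} μ̂(-q) χ(θ^α |q|) e^{-iθqx} (S_{1;ν} + R_{1;ν})(η, θq) dq/2π`. -/
def linResp {M : ℕ} (h : Hopping M) (μ : ℝ) (χ : ℝ → ℝ) (α : ℝ) (μinf : ℝ → ℝ)
    (ν : Fin 2) (x : ℤ) (η θ : ℝ) : ℂ :=
  -∫ q in Set.Ioc (-(Real.pi / θ)) (Real.pi / θ),
    torusFourier μinf θ (-q) * (χ (θ ^ α * |q|) : ℂ) * phase (-(θ * q * x)) *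
      correlation h μ ν η (θ * q) / (2 * Real.pi : ℂ)

end LinearResponse

end

noncomputable section
namespace LinearResponse

/-! ### Phases -/

/-! The frequency integral in K_ν(p₀,p) has a closed form: for two nonzero levels E, E' it equals 2π
(f(E) - f(E')) / (E - E' - i p₀), where f is the zero-temperature occupation
(`integral_inv_mul_inv`). Hence K_ν is -1/(2π) times an integral over k of a double sum over the
levels a of Ĥ(k) - μ and b of Ĥ(k+p) - μ, weighted by ⟨a|b⟩⟨b|Ĵ|a⟩ (`lindhard`, `correlation_eq`). A
pair counts only if its levels lie on opposite sides of zero. Since (E_a - E_b)⟨a|b⟩ = ⟨a|Ĥ(k) -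
Ĥ(k+p)|b⟩ = O(p), a pair separated by a fixed gap contributes O(p), uniformly in p₀. The only
dangerous pair is a band e_ω with itself, for k within |p| of its Fermi point. There the band is
replaced by its tangent; the continuity equation turns the current vertex into the velocity, and the
error is O(1) on a set of measure O(p). The tangent model integrates exactly, because translating an
occupied half-line by p changes its length by ±p. The outcome is
`LowEnergySpectrum.exists_correlation_bounds`: K_ν = ∑ χ_{ν,ω} v p / (v p + i p₀) + O(|p|) uniformly
in p₀, and |K_ν| ≤ C |p|/|p₀|.

For the remainder, put w = v p + i p₀. Partial fractions reduce the bubble to F(w)/w with F(w) = ∫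
χ(|z|/δ) χ(|z+w|/δ) / z. Here F(0) = 0 by oddness, and DF(0)w = -(π/2) w̄ whatever the shape of χ.
So the bubble behaves like w̄ / (4π|v| w), and w̄ = 2vp - w splits this into the leading term of K_ν
minus the constant 1/(4π|v|) (`tendsto_bubble`).

In the linear response three replacements are made: the periodized Fourier transform by μ̂_∞ (error
θ² by decay), the cutoff by 1 (moments of μ̂_∞), and K_ν by its leading term (error θ|q|). The total
error is O(θ). The remaining multiplier is 1 - 1/(1 + i a v q), and the second term is the transform
of a one-sided exponential; this gives (ii), and (iii) follows because that term has size 1/a. Case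
(i) uses only |K_ν| ≤ C|p|/|p₀|.

In finite volume the Gibbs state is quasi-free in the Bloch eigenmodes, and the KMS relation
together with the anticommutation relations gives the cumulant of two quadratic operators
(`IsCAR.thermal_cumulant`). The result is a double sum over quasi-momenta of continuous bounded
functions, so L → ∞ is a Riemann sum limit. Integrating over s at the Matsubara frequency η_β
produces divided differences of the Fermi function, bounded by 1/η uniformly in β. Dominated
convergence as β → ∞ returns the zero-temperature integrand, and Poisson summation matches the
weights with `linResp`. -/

lemma phase_zero : phase 0 = 1 := by simp [phase]

lemma phase_add (s t : ℝ) : phase (s + t) = phase s * phase t := by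
  simp only [phase, ← Complex.exp_add]; push_cast; ring_nf

lemma norm_phase (t : ℝ) : ‖phase t‖ = 1 := by
  rw [phase, mul_comm]; exact Complex.norm_exp_ofReal_mul_I t

lemma star_phase (t : ℝ) : star (phase t) = phase (-t) := by
  simp only [phase, RCLike.star_def, ← Complex.exp_conj]; simp

lemma continuous_phase : Continuous phase := by
  unfold phase; fun_prop

@[fun_prop]
lemma _root_.Continuous.phase {X : Type*} [TopologicalSpace X] {f : X → ℝ} (hf : Continuous f) :
    Continuous fun x => LinearResponse.phase (f x) := continuous_phase.comp hf

@[fun_prop]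
lemma _root_.Measurable.phase {X : Type*} [MeasurableSpace X] {f : X → ℝ} (hf : Measurable f) :
    Measurable fun x => LinearResponse.phase (f x) := continuous_phase.measurable.comp hf

lemma phase_two_pi_int (n : ℤ) : phase (2 * Real.pi * n) = 1 := by
  rw [phase, Complex.exp_eq_one_iff]
  exact ⟨n, by push_cast; ring⟩

lemma phase_eq_one_iff (t : ℝ) : phase t = 1 ↔ ∃ n : ℤ, t = 2 * Real.pi * n := by
  constructor
  · intro h
    rw [phase, Complex.exp_eq_one_iff] at h
    obtain ⟨n, hn⟩ := h
    refine ⟨n, ?_⟩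
    have h2 : (t : ℂ) = ((2 * Real.pi * n : ℝ) : ℂ) := by
      apply mul_left_cancel₀ Complex.I_ne_zero
      rw [hn]; push_cast; ring
    exact_mod_cast h2
  · rintro ⟨n, rfl⟩; exact phase_two_pi_int n

lemma phase_add_two_pi_mul_int (t : ℝ) (m z : ℤ) :
    phase (-((t + 2 * Real.pi * m) * z)) = phase (-(t * z)) := by
  have : -((t + 2 * Real.pi * m) * z) = -(t * z) + 2 * Real.pi * ((-(m * z) : ℤ) : ℝ) := by
    push_cast; ring
  rw [this, phase_add, phase_two_pi_int, mul_one]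

lemma phase_add_two_pi (t : ℝ) (m : ℤ) : phase (t + 2 * Real.pi * m) = phase t := by
  rw [phase_add, phase_two_pi_int, mul_one]

lemma norm_phase_sub_one_le (t : ℝ) : ‖phase t - 1‖ ≤ |t| := by
  simpa [phase] using Real.norm_exp_I_mul_ofReal_sub_one_le (x := t)

lemma norm_phase_sub_phase_le (s t : ℝ) : ‖phase s - phase t‖ ≤ |s - t| := by
  have : phase s - phase t = phase t * (phase (s - t) - 1) := by
    rw [mul_sub, ← phase_add]; ring_nf
  rw [this, norm_mul, norm_phase, one_mul]
  exact norm_phase_sub_one_le _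

lemma hasDerivAt_phase_neg_mul (z k : ℝ) :
    HasDerivAt (fun t : ℝ => phase (-(t * z))) (-Complex.I * z * phase (-(k * z))) k := by
  unfold phase
  have h1 : HasDerivAt (fun t : ℝ => (((-(t * z) : ℝ)) : ℂ)) ((-z : ℝ) : ℂ) k := by
    have : HasDerivAt (fun t : ℝ => -(t * z)) (-z) k := by
      simpa using ((hasDerivAt_id k).mul_const z).fun_neg
    exact this.ofReal_comp
  have h2 := (h1.const_mul Complex.I).cexp
  convert h2 using 1
  push_cast; ring

/-! ### Entrywise size of matrices -/

variable {M : ℕ}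

/-- The sum of the absolute values of the entries. -/
def entrySum (X : Matrix (Fin M) (Fin M) ℂ) : ℝ := ∑ i, ∑ j, ‖X i j‖

lemma entrySum_nonneg (X : Matrix (Fin M) (Fin M) ℂ) : 0 ≤ entrySum X :=
  Finset.sum_nonneg fun _ _ => Finset.sum_nonneg fun _ _ => norm_nonneg _

lemma entrySum_add_le (X Y : Matrix (Fin M) (Fin M) ℂ) :
    entrySum (X + Y) ≤ entrySum X + entrySum Y := by
  simp only [entrySum, ← Finset.sum_add_distrib, Matrix.add_apply]
  gcongr
  exact norm_add_le _ _

lemma entrySum_smul (c : ℂ) (X : Matrix (Fin M) (Fin M) ℂ) :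
    entrySum (c • X) = ‖c‖ * entrySum X := by
  simp [entrySum, Finset.mul_sum]

lemma entrySum_zero : entrySum (0 : Matrix (Fin M) (Fin M) ℂ) = 0 := by simp [entrySum]

lemma entrySum_sum_le {ι : Type*} (s : Finset ι) (f : ι → Matrix (Fin M) (Fin M) ℂ) :
    entrySum (∑ i ∈ s, f i) ≤ ∑ i ∈ s, entrySum (f i) := by
  classical
  induction s using Finset.induction_on with
  | empty => simp [entrySum_zero]
  | insert a s ha ih =>
    rw [Finset.sum_insert ha, Finset.sum_insert ha]
    exact (entrySum_add_le _ _).trans (by gcongr)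

lemma norm_sum_sum_mul_le (x y : Fin M → ℂ) (hx : ∀ i, ‖x i‖ ≤ 1) (hy : ∀ i, ‖y i‖ ≤ 1)
    (X : Matrix (Fin M) (Fin M) ℂ) : ‖∑ j, (∑ i, x i * X i j) * y j‖ ≤ entrySum X := by
  rw [entrySum, Finset.sum_comm]
  refine (norm_sum_le _ _).trans (Finset.sum_le_sum fun j _ => ?_)
  rw [norm_mul]
  calc ‖∑ i, x i * X i j‖ * ‖y j‖ ≤ (∑ i, ‖X i j‖) * 1 := by
        gcongr
        · refine (norm_sum_le _ _).trans (Finset.sum_le_sum fun i _ => ?_)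
          rw [norm_mul]
          exact mul_le_of_le_one_left (norm_nonneg _) (hx i)
        · exact hy j
    _ = _ := mul_one _

/-! ### The Bloch Hamiltonian and the vertex functions -/

variable (h : Hopping M)

lemma bloch_apply (k : ℝ) (ρ ρ' : Fin M) :
    bloch h k ρ ρ' = ∑ z ∈ h.support, phase (-(k * z)) * h z ρ ρ' := by
  simp [bloch, Matrix.sum_apply]

lemma bloch_isHermitian {h : Hopping M} (hh : h.SelfAdjoint) (k : ℝ) :
    (bloch h k).IsHermitian := by
  unfold Matrix.IsHermitian bloch
  rw [Matrix.conjTranspose_sum]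
  have hs : ∀ z, z ∈ h.support ↔ -z ∈ h.support := by
    intro z
    simp [Finsupp.mem_support_iff, hh z]
  refine Finset.sum_bij (fun z _ => -z) (fun z hz => (hs z).1 hz) (by simp)
    (fun z hz => ⟨-z, (hs z).1 hz, by simp⟩) ?_
  intro z _
  rw [Matrix.conjTranspose_smul, star_phase, ← hh z]
  congr 2
  push_cast; ring

lemma bloch_add_two_pi (k : ℝ) (m : ℤ) : bloch h (k + 2 * Real.pi * m) = bloch h k := by
  simp only [bloch, phase_add_two_pi_mul_int]

@[fun_prop]
lemma continuous_bloch : Continuous (bloch h) := by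
  unfold bloch; fun_prop

/-- A Lipschitz constant for `Ĥ`, also a bound for the current vertex. -/
def hopMoment : ℝ := ∑ z ∈ h.support, |(z : ℝ)| * entrySum (h z)

lemma hopMoment_nonneg : 0 ≤ hopMoment h :=
  Finset.sum_nonneg fun _ _ => mul_nonneg (abs_nonneg _) (entrySum_nonneg _)

lemma entrySum_bloch_sub_le (k k' : ℝ) :
    entrySum (bloch h k - bloch h k') ≤ hopMoment h * |k - k'| := by
  have : bloch h k - bloch h k'
      = ∑ z ∈ h.support, (phase (-(k * z)) - phase (-(k' * z))) • h z := by
    simp only [bloch, sub_smul, Finset.sum_sub_distrib]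
  rw [this, hopMoment, Finset.sum_mul]
  refine (entrySum_sum_le _ _).trans (Finset.sum_le_sum fun z _ => ?_)
  rw [entrySum_smul]
  calc _ ≤ |-(k * z) - -(k' * z)| * entrySum (h z) := by
        gcongr
        · exact entrySum_nonneg _
        · exact norm_phase_sub_phase_le _ _
    _ = _ := by
        have : -(k * z) - -(k' * z) = (z : ℝ) * (-(k - k')) := by ring
        rw [this, abs_mul, abs_neg]; ring

lemma blochDeriv_eq (k : ℝ) :
    blochDeriv h k = ∑ z ∈ h.support, (phase (-(k * z)) * (-Complex.I * z)) • h z := by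
  ext ρ ρ'
  simp only [blochDeriv, Matrix.of_apply, bloch_apply, Matrix.sum_apply, Matrix.smul_apply,
    smul_eq_mul]
  refine HasDerivAt.deriv (HasDerivAt.fun_sum fun z _ => ?_)
  refine ((hasDerivAt_phase_neg_mul (z : ℝ) k).mul_const (h z ρ ρ')).congr_deriv ?_
  push_cast; ring

/-- The function `i (1 - e^{ipz}) / (1 - e^{-ip})`, continuously extended to `p ∈ 2πℤ`. -/
def vertexCoeff (z : ℤ) (p : ℝ) : ℂ :=
  Complex.I * (∑ j ∈ Finset.range (-z).toNat, phase (-(p * j)) -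
    ∑ j ∈ Finset.range z.toNat, phase (p * (j + 1)))

lemma sum_phase_mul (p : ℝ) (n : ℕ) :
    (∑ j ∈ Finset.range n, phase (-(p * j))) * (1 - phase (-p)) = 1 - phase (-(p * n)) := by
  induction n with
  | zero => simp [phase_zero]
  | succ n ih =>
    rw [Finset.sum_range_succ, add_mul, ih, mul_sub, mul_one, ← phase_add]
    push_cast; ring_nf

lemma sum_phase_succ_mul (p : ℝ) (n : ℕ) :
    (∑ j ∈ Finset.range n, phase (p * (j + 1))) * (1 - phase (-p)) = phase (p * n) - 1 := by
  induction n with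
  | zero => simp [phase_zero]
  | succ n ih =>
    rw [Finset.sum_range_succ, add_mul, ih, mul_sub, mul_one, ← phase_add]
    push_cast; ring_nf

/-- Both geometric sums telescope against 1 - e^{-ip}. The truncation `toNat` empties one of them
according to the sign of z. -/
lemma vertexCoeff_mul (z : ℤ) (p : ℝ) :
    vertexCoeff z p * (1 - phase (-p)) = Complex.I * (1 - phase (p * z)) := by
  rw [vertexCoeff, mul_assoc, sub_mul, sum_phase_mul, sum_phase_succ_mul]
  rcases le_total 0 z with hz | hz
  · lift z to ℕ using hz
    simp [phase_zero]
  · obtain ⟨n, rfl⟩ : ∃ n : ℕ, z = -n := ⟨(-z).toNat, by omega⟩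
    simp [phase_zero]

lemma vertexCoeff_of_phase_eq_one (z : ℤ) {p : ℝ} (hp : phase (-p) = 1) :
    vertexCoeff z p = -Complex.I * z := by
  obtain ⟨n, hn⟩ := (phase_eq_one_iff _).1 hp
  have h1 : ∀ j : ℕ, phase (-(p * j)) = 1 := fun j =>
    (phase_eq_one_iff _).2 ⟨n * j, by push_cast; linear_combination (j : ℝ) * hn⟩
  have h2 : ∀ j : ℕ, phase (p * (j + 1)) = 1 := fun j =>
    (phase_eq_one_iff _).2 ⟨-(n * (j + 1)), by push_cast; linear_combination -((j : ℝ) + 1) * hn⟩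
  simp only [vertexCoeff, h1, h2, Finset.sum_const, Finset.card_range, nsmul_eq_mul, mul_one]
  have : (((-z).toNat : ℤ) - (z.toNat : ℤ) : ℤ) = -z := by omega
  have h3 : (((-z).toNat : ℂ) - (z.toNat : ℂ)) = -z := by exact_mod_cast congrArg (Int.cast : ℤ → ℂ) this
  rw [h3]; ring

@[fun_prop]
lemma continuous_vertexCoeff (z : ℤ) : Continuous (vertexCoeff z) := by
  unfold vertexCoeff; fun_prop

lemma norm_vertexCoeff_le (z : ℤ) (p : ℝ) : ‖vertexCoeff z p‖ ≤ |(z : ℝ)| := by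
  have h1 : ‖∑ j ∈ Finset.range (-z).toNat, phase (-(p * j))‖ ≤ (-z).toNat := by
    refine (norm_sum_le _ _).trans ?_
    simp [norm_phase]
  have h2 : ‖∑ j ∈ Finset.range z.toNat, phase (p * (j + 1))‖ ≤ z.toNat := by
    refine (norm_sum_le _ _).trans ?_
    simp [norm_phase]
  rw [vertexCoeff, norm_mul, Complex.norm_I, one_mul]
  refine (norm_sub_le _ _).trans ((add_le_add h1 h2).trans (le_of_eq ?_))
  have : (((-z).toNat : ℤ) + (z.toNat : ℤ) : ℤ) = |z| := by
    rcases le_total 0 z with hz | hz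
    · rw [abs_of_nonneg hz]; omega
    · rw [abs_of_nonpos hz]; omega
  exact_mod_cast congrArg (Int.cast : ℤ → ℝ) this

lemma vertex_zero (k p : ℝ) : vertex h 0 k p = 1 := by simp [vertex]

/-- A single trigonometric polynomial covers both branches of the definition, so the removable
singularity at p ∈ 2πℤ disappears. Continuity, periodicity and the uniform bound are all read off
from this form. -/
lemma vertex_one (k p : ℝ) :
    vertex h 1 k p = ∑ z ∈ h.support, (phase (-(k * z)) * vertexCoeff z p) • h z := by
  unfold vertex
  rw [if_neg (by decide)]
  split_ifs with hp
  · simp only [blochDeriv_eq, vertexCoeff_of_phase_eq_one _ hp]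
  · have h0 : 1 - phase (-p) ≠ 0 := sub_ne_zero.2 (Ne.symm hp)
    simp only [bloch]
    rw [← Finset.sum_sub_distrib, Finset.smul_sum]
    refine Finset.sum_congr rfl fun z _ => ?_
    rw [← sub_smul, smul_smul]
    congr 1
    have h1 : phase (-((k - p) * z)) = phase (-(k * z)) * phase (p * z) := by
      rw [← phase_add]; ring_nf
    rw [h1]
    have := vertexCoeff_mul z p
    field_simp
    linear_combination -phase (-(k * z)) * this

/-- The lattice continuity equation, multiplied out so that it also holds for p ∈ 2πℤ. Between
eigenvectors of Ĥ(k) and Ĥ(k-p) it expresses the current by energy differences and overlaps. -/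
lemma vertex_smul_sub (k p : ℝ) :
    (1 - phase (-p)) • vertex h 1 k p = Complex.I • (bloch h k - bloch h (k - p)) := by
  rw [vertex_one, Finset.smul_sum]
  simp only [bloch]
  rw [← Finset.sum_sub_distrib, Finset.smul_sum]
  refine Finset.sum_congr rfl fun z _ => ?_
  rw [← sub_smul, smul_smul, smul_smul]
  congr 1
  have h1 : phase (-((k - p) * z)) = phase (-(k * z)) * phase (p * z) := by
    rw [← phase_add]; ring_nf
  rw [h1]
  linear_combination phase (-(k * z)) * vertexCoeff_mul z p

/-- A bound for the entries of both vertex functions. -/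
def vertexBound : ℝ := M + hopMoment h

lemma vertexBound_nonneg : 0 ≤ vertexBound h := add_nonneg (Nat.cast_nonneg _) (hopMoment_nonneg h)

lemma entrySum_vertex_le (ν : Fin 2) (k p : ℝ) : entrySum (vertex h ν k p) ≤ vertexBound h := by
  fin_cases ν
  · simp only [Fin.zero_eta, Fin.isValue, vertex_zero, vertexBound]
    have : entrySum (1 : Matrix (Fin M) (Fin M) ℂ) = M := by
      simp only [entrySum, Matrix.one_apply]
      have : ∀ i : Fin M, ∑ j : Fin M, ‖(if i = j then (1 : ℂ) else 0)‖ = 1 := by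
        intro i
        rw [Finset.sum_eq_single i] <;> simp +contextual [eq_comm]
      simp [this]
    linarith [hopMoment_nonneg h]
  · simp only [Fin.mk_one, Fin.isValue, vertex_one, vertexBound]
    have : entrySum (∑ z ∈ h.support, (phase (-(k * z)) * vertexCoeff z p) • h z)
        ≤ hopMoment h := by
      refine (entrySum_sum_le _ _).trans (Finset.sum_le_sum fun z _ => ?_)
      rw [entrySum_smul, norm_mul, norm_phase, one_mul]
      exact mul_le_mul_of_nonneg_right (norm_vertexCoeff_le z p) (entrySum_nonneg _)
    linarith [(Nat.cast_nonneg M : (0 : ℝ) ≤ M)]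

lemma continuous_vertex (ν : Fin 2) : Continuous fun x : ℝ × ℝ => vertex h ν x.1 x.2 := by
  fin_cases ν
  · simp only [Fin.zero_eta, Fin.isValue, vertex_zero]; exact continuous_const
  · simp only [Fin.mk_one, Fin.isValue, vertex_one]; fun_prop

lemma vertex_add_two_pi (ν : Fin 2) (k p : ℝ) (m n : ℤ) :
    vertex h ν (k + 2 * Real.pi * m) (p + 2 * Real.pi * n) = vertex h ν k p := by
  have hc : ∀ z, vertexCoeff z (p + 2 * Real.pi * n) = vertexCoeff z p := by
    intro z
    have e1 : ∀ j : ℕ, phase (-((p + 2 * Real.pi * n) * j)) = phase (-(p * j)) := fun j => by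
      simpa using phase_add_two_pi_mul_int p n j
    have e2 : ∀ j : ℕ, phase ((p + 2 * Real.pi * n) * (j + 1)) = phase (p * (j + 1)) := fun j => by
      have := phase_add_two_pi_mul_int p n (-(j + 1))
      push_cast at this
      convert this using 2 <;> ring
    simp only [vertexCoeff, e1, e2]
  fin_cases ν
  · simp [vertex_zero]
  · simp only [Fin.mk_one, Fin.isValue, vertex_one, hc, phase_add_two_pi_mul_int]

end LinearResponse
end

noncomputable section
namespace LinearResponse

/-! ### Pairs of Hermitian matrices in their eigenbases -/

section Hermitian
variable {M : ℕ} {A B : Matrix (Fin M) (Fin M) ℂ} (hA : A.IsHermitian) (hB : B.IsHermitian)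

/-- The unitary matrix of eigenvectors. -/
def eigU : Matrix (Fin M) (Fin M) ℂ := hA.eigenvectorUnitary

lemma eigU_star_mul : (eigU hA)ᴴ * eigU hA = 1 :=
  Matrix.mem_unitaryGroup_iff'.1 hA.eigenvectorUnitary.2

lemma eigU_mul_star : eigU hA * (eigU hA)ᴴ = 1 :=
  Matrix.mem_unitaryGroup_iff.1 hA.eigenvectorUnitary.2

/-- Functional calculus. -/
def matFun (φ : ℝ → ℂ) : Matrix (Fin M) (Fin M) ℂ :=
  eigU hA * Matrix.diagonal (fun a => φ (hA.eigenvalues a)) * (eigU hA)ᴴ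

lemma matFun_id : matFun hA (fun x => (x : ℂ)) = A := by
  have := hA.spectral_theorem
  rw [Unitary.conjStarAlgAut_apply] at this
  exact this.symm

lemma matFun_one : matFun hA (fun _ => 1) = 1 := by
  simp [matFun, eigU_mul_star]

lemma matFun_add (φ ψ : ℝ → ℂ) : matFun hA φ + matFun hA ψ = matFun hA (fun x => φ x + ψ x) := by
  simp only [matFun]
  rw [← add_mul, ← mul_add, Matrix.diagonal_add]

lemma matFun_mul (φ ψ : ℝ → ℂ) : matFun hA φ * matFun hA ψ = matFun hA (fun x => φ x * ψ x) := by
  simp only [matFun]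
  calc _ = eigU hA * (Matrix.diagonal (fun a => φ (hA.eigenvalues a)) * ((eigU hA)ᴴ * eigU hA) *
        Matrix.diagonal (fun a => ψ (hA.eigenvalues a))) * (eigU hA)ᴴ := by
        simp only [mul_assoc]
    _ = _ := by rw [eigU_star_mul, mul_one, Matrix.diagonal_mul_diagonal]

lemma matFun_smul (c : ℂ) (φ : ℝ → ℂ) : c • matFun hA φ = matFun hA (fun x => c * φ x) := by
  have h1 : c • (1 : Matrix (Fin M) (Fin M) ℂ) = matFun hA (fun _ => c) := by
    simp only [matFun]
    have : Matrix.diagonal (fun _ : Fin M => c) = c • 1 := by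
      rw [← Matrix.diagonal_one, ← Matrix.diagonal_smul]; congr 1; ext; simp
    rw [this, Matrix.mul_smul, mul_one, Matrix.smul_mul, eigU_mul_star]
  rw [← matFun_mul, ← h1, Matrix.smul_mul, one_mul]

lemma matFun_congr {φ ψ : ℝ → ℂ} (hφ : ∀ a, φ (hA.eigenvalues a) = ψ (hA.eigenvalues a)) :
    matFun hA φ = matFun hA ψ := by
  simp only [matFun, hφ]

lemma inv_eq_matFun {φ ψ : ℝ → ℂ}
    (hφ : ∀ a, φ (hA.eigenvalues a) * ψ (hA.eigenvalues a) = 1) :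
    (matFun hA φ)⁻¹ = matFun hA ψ := by
  apply Matrix.inv_eq_right_inv
  rw [matFun_mul, matFun_congr hA (ψ := fun _ => 1) hφ, matFun_one]

lemma inv_add_smul_one (z : ℂ) (hz : ∀ a, (hA.eigenvalues a : ℂ) + z ≠ 0) :
    (A + z • (1 : Matrix (Fin M) (Fin M) ℂ))⁻¹ = matFun hA (fun x => ((x : ℂ) + z)⁻¹) := by
  have : A + z • (1 : Matrix (Fin M) (Fin M) ℂ) = matFun hA (fun x => (x : ℂ) + z) := by
    rw [← matFun_add hA (fun x => (x : ℂ)) (fun _ => z), matFun_id, ← matFun_one hA, matFun_smul]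
    simp
  rw [this]
  exact inv_eq_matFun hA fun a => mul_inv_cancel₀ (hz a)

lemma exp_smul_eq_matFun (z : ℂ) :
    NormedSpace.exp (z • A) = matFun hA (fun x => Complex.exp (z * x)) := by
  have hu : IsUnit (eigU hA) := IsUnit.of_mul_eq_one _ (eigU_mul_star hA)
  have hinv : (eigU hA)⁻¹ = (eigU hA)ᴴ := Matrix.inv_eq_right_inv (eigU_mul_star hA)
  conv_lhs => rw [← matFun_id hA, matFun_smul, matFun, ← hinv]
  rw [Matrix.exp_conj _ _ hu, Matrix.exp_diagonal, matFun, hinv]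
  congr 3
  ext a
  rw [Pi.coe_exp, Complex.exp_eq_exp_ℂ]

/-- The overlap matrix of two eigenbases. -/
def overlap : Matrix (Fin M) (Fin M) ℂ := (eigU hA)ᴴ * eigU hB

/-- `∑_{a,b} φ(λ_a, μ_b) ⟨a|b⟩ ⟨b|J|a⟩` for the eigenbases of two Hermitian matrices. -/
def pairSum (φ : ℝ → ℝ → ℂ) (J : Matrix (Fin M) (Fin M) ℂ) : ℂ :=
  ∑ a, ∑ b, φ (hA.eigenvalues a) (hB.eigenvalues b) *
    (overlap hA hB a b * ((eigU hB)ᴴ * J * eigU hA) b a)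

/-- Cyclicity of the trace collects the two eigenvector matrices into overlaps. The trace ignores
the choice of eigenbasis, which need not be continuous in k; so regularity is proved on the trace
and estimates are made on the double sum. -/
lemma trace_mul_matFun_mul_matFun (φ ψ : ℝ → ℂ) (J : Matrix (Fin M) (Fin M) ℂ) :
    (J * matFun hA φ * matFun hB ψ).trace = pairSum hA hB (fun x y => φ x * ψ y) J := by
  have : (J * matFun hA φ * matFun hB ψ).trace =
      ((Matrix.diagonal (fun a => φ (hA.eigenvalues a)) * overlap hA hB) *
        (Matrix.diagonal (fun a => ψ (hB.eigenvalues a)) *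
        ((eigU hB)ᴴ * J * eigU hA))).trace := by
    rw [Matrix.trace_mul_comm, Matrix.trace_mul_comm]
    simp only [matFun, overlap]
    have : J * (eigU hA * Matrix.diagonal (fun a => φ (hA.eigenvalues a)) * (eigU hA)ᴴ) *
        (eigU hB * Matrix.diagonal (fun a => ψ (hB.eigenvalues a)) * (eigU hB)ᴴ) =
        (J * eigU hA) * ((Matrix.diagonal (fun a => φ (hA.eigenvalues a)) *
        ((eigU hA)ᴴ * eigU hB)) * (Matrix.diagonal (fun a => ψ (hB.eigenvalues a)) *
          (eigU hB)ᴴ)) := by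
      simp only [mul_assoc]
    rw [this, Matrix.trace_mul_comm]
    simp only [mul_assoc]
  rw [this, pairSum, Matrix.trace]
  refine Finset.sum_congr rfl fun a _ => ?_
  rw [Matrix.diag_apply, Matrix.mul_apply]
  refine Finset.sum_congr rfl fun b _ => ?_
  rw [Matrix.diagonal_mul, Matrix.diagonal_mul]
  ring

lemma pairSum_congr {φ ψ : ℝ → ℝ → ℂ} (J : Matrix (Fin M) (Fin M) ℂ)
    (hφ : ∀ a b, φ (hA.eigenvalues a) (hB.eigenvalues b) =
      ψ (hA.eigenvalues a) (hB.eigenvalues b)) :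
    pairSum hA hB φ J = pairSum hA hB ψ J := by
  simp only [pairSum, hφ]

/-- The eigenbases depend on the Hermiticity proofs, whose types mention the matrices. Equal
matrices are therefore exchanged by substitution rather than by rewriting. -/
lemma pairSum_eq_of_eq {A' B' : Matrix (Fin M) (Fin M) ℂ} (hA' : A'.IsHermitian)
    (hB' : B'.IsHermitian) (h1 : A = A') (h2 : B = B') (φ : ℝ → ℝ → ℂ)
    (J : Matrix (Fin M) (Fin M) ℂ) : pairSum hA hB φ J = pairSum hA' hB' φ J := by
  subst h1 h2; rfl

lemma norm_eigU_le (i a : Fin M) : ‖eigU hA i a‖ ≤ 1 :=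
  entry_norm_bound_of_unitary hA.eigenvectorUnitary.2 i a

lemma norm_conj_eigU_mul_le (X : Matrix (Fin M) (Fin M) ℂ) (a b : Fin M) :
    ‖((eigU hA)ᴴ * X * eigU hB) a b‖ ≤ entrySum X := by
  simp only [Matrix.mul_apply]
  refine norm_sum_sum_mul_le _ _ (fun i => ?_) (fun j => norm_eigU_le hB j b) X
  rw [Matrix.conjTranspose_apply, norm_star]
  exact norm_eigU_le hA i a

lemma overlap_mem_unitary : overlap hA hB ∈ Matrix.unitaryGroup (Fin M) ℂ :=
  mul_mem (Unitary.star_mem hA.eigenvectorUnitary.2) hB.eigenvectorUnitary.2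

lemma norm_overlap_le (a b : Fin M) : ‖overlap hA hB a b‖ ≤ 1 :=
  entry_norm_bound_of_unitary (overlap_mem_unitary hA hB) a b

lemma sum_normSq_overlap (a : Fin M) : ∑ b, ‖overlap hA hB a b‖ ^ 2 = 1 := by
  have := Matrix.mem_unitaryGroup_iff.1 (overlap_mem_unitary hA hB)
  have h2 := congrFun (congrFun this a) a
  rw [Matrix.mul_apply, Matrix.one_apply_eq] at h2
  have h3 : ∀ b, overlap hA hB a b * star (overlap hA hB) b a = ((‖overlap hA hB a b‖ ^ 2 : ℝ) : ℂ) := by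
    intro b
    rw [Matrix.star_apply, RCLike.star_def, Complex.mul_conj, Complex.normSq_eq_norm_sq]
  simp only [h3] at h2
  exact_mod_cast h2

lemma conjTranspose_mul_eigen : (eigU hA)ᴴ * A =
    Matrix.diagonal (fun a => (hA.eigenvalues a : ℂ)) * (eigU hA)ᴴ := by
  have : (eigU hA)ᴴ * matFun hA (fun x => (x : ℂ)) =
      Matrix.diagonal (fun a => (hA.eigenvalues a : ℂ)) * (eigU hA)ᴴ := by
    simp only [matFun, ← mul_assoc]
    rw [eigU_star_mul, one_mul]
  rwa [matFun_id] at this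

lemma mul_eigU : A * eigU hA = eigU hA * Matrix.diagonal (fun a => (hA.eigenvalues a : ℂ)) := by
  have : matFun hA (fun x => (x : ℂ)) * eigU hA =
      eigU hA * Matrix.diagonal (fun a => (hA.eigenvalues a : ℂ)) := by
    rw [matFun, mul_assoc, eigU_star_mul, mul_one]
  rwa [matFun_id] at this

/-- Let A act to the left and B to the right on their own eigenvectors. -/
lemma conj_eigU_sub_apply (a b : Fin M) :
    ((eigU hA)ᴴ * (A - B) * eigU hB) a b =
      ((hA.eigenvalues a : ℂ) - hB.eigenvalues b) * overlap hA hB a b := by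
  have : (eigU hA)ᴴ * (A - B) * eigU hB =
      Matrix.diagonal (fun a => (hA.eigenvalues a : ℂ)) * overlap hA hB -
      overlap hA hB * Matrix.diagonal (fun a => (hB.eigenvalues a : ℂ)) := by
    rw [mul_sub, sub_mul, conjTranspose_mul_eigen, mul_assoc _ B, mul_eigU, overlap]
    simp only [mul_assoc]
  rw [this, Matrix.sub_apply, Matrix.diagonal_mul, Matrix.mul_diagonal]
  ring

/-- Perturbation theory without differentiating eigenvectors: separated levels of two nearby
matrices have small overlap. All O(p) gains below come from here. -/
lemma abs_sub_mul_norm_overlap_le (a b : Fin M) :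
    |hA.eigenvalues a - hB.eigenvalues b| * ‖overlap hA hB a b‖ ≤ entrySum (A - B) := by
  have := norm_conj_eigU_mul_le hA hB (A - B) a b
  rw [conj_eigU_sub_apply, norm_mul, ← Complex.ofReal_sub, Complex.norm_real] at this
  exact this

lemma overlap_conjTranspose (a b : Fin M) : overlap hB hA b a = star (overlap hA hB a b) := by
  have : overlap hB hA = (overlap hA hB)ᴴ := by simp [overlap]
  rw [this, Matrix.conjTranspose_apply]

lemma eigU_mulVec (a : Fin M) :
    A *ᵥ (fun i => eigU hA i a) = (hA.eigenvalues a : ℂ) • fun i => eigU hA i a := by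
  ext i
  have := congrFun (congrFun (mul_eigU hA) i) a
  rw [Matrix.mul_apply, Matrix.mul_diagonal] at this
  simp only [Matrix.mulVec, dotProduct, Pi.smul_apply, smul_eq_mul]
  rw [this, mul_comm]

lemma sum_normSq_eigU (a : Fin M) : ∑ i, ‖eigU hA i a‖ ^ 2 = 1 := by
  have h2 := congrFun (congrFun (eigU_star_mul hA) a) a
  rw [Matrix.mul_apply, Matrix.one_apply_eq] at h2
  have h3 : ∀ b, (eigU hA)ᴴ a b * (eigU hA) b a = ((‖eigU hA b a‖ ^ 2 : ℝ) : ℂ) := by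
    intro b
    rw [Matrix.conjTranspose_apply, mul_comm, RCLike.star_def, Complex.mul_conj,
      Complex.normSq_eq_norm_sq]
  simp only [h3] at h2
  exact_mod_cast h2

end Hermitian

end LinearResponse
end

noncomputable section
namespace LinearResponse

/-! ### The spectrum near the chemical potential -/

section Spectrum
variable {M : ℕ}

/-- `Ĥ(k) - μ`. -/
def shifted (h : Hopping M) (μ k : ℝ) : Matrix (Fin M) (Fin M) ℂ :=
  bloch h k - (μ : ℂ) • (1 : Matrix (Fin M) (Fin M) ℂ)

lemma shifted_isHermitian {h : Hopping M} (hh : h.SelfAdjoint) (μ k : ℝ) : (shifted h μ k).IsHermitian := by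
  refine (bloch_isHermitian hh k).sub ?_
  rw [Matrix.IsHermitian, Matrix.conjTranspose_smul, Matrix.conjTranspose_one]
  simp

variable {h : Hopping M} (hh : h.SelfAdjoint) (μ : ℝ)

variable (h) in
@[fun_prop]
lemma continuous_shifted : Continuous (shifted h μ) := by
  unfold shifted; fun_prop

variable (h) in
lemma shifted_add_two_pi (k : ℝ) (m : ℤ) : shifted h μ (k + 2 * Real.pi * m) = shifted h μ k := by
  simp only [shifted, bloch_add_two_pi]

variable (h) in
lemma shifted_sub_shifted (k k' : ℝ) : shifted h μ k - shifted h μ k' = bloch h k - bloch h k' := by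
  simp only [shifted, sub_sub_sub_cancel_right]

variable (h) in
lemma entrySum_shifted_sub_le (k k' : ℝ) :
    entrySum (shifted h μ k - shifted h μ k') ≤ hopMoment h * |k - k'| := by
  rw [shifted_sub_shifted]; exact entrySum_bloch_sub_le h k k'

variable (h) in
lemma propagator_eq (k₀ k : ℝ) : propagator h μ k₀ k =
    (shifted h μ k + (Complex.I * k₀) • (1 : Matrix (Fin M) (Fin M) ℂ))⁻¹ := by
  rw [propagator, shifted, sub_smul]
  congr 1
  abel

/-- The eigenvalues of `Ĥ(k) - μ`. -/
def ev (k : ℝ) : Fin M → ℝ := (shifted_isHermitian hh μ k).eigenvalues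

lemma ev_add_two_pi (k : ℝ) (m : ℤ) : ev hh μ (k + 2 * Real.pi * m) = ev hh μ k := by
  have : ∀ {A B : Matrix (Fin M) (Fin M) ℂ} (hA : A.IsHermitian) (hB : B.IsHermitian), A = B →
      hA.eigenvalues = hB.eigenvalues := by
    intro A B hA hB hAB; subst hAB; rfl
  exact this _ _ (shifted_add_two_pi h μ k m)

lemma bloch_mulVec_eigU (k : ℝ) (a : Fin M) :
    bloch h k *ᵥ (fun i => eigU (shifted_isHermitian hh μ k) i a) =
      ((ev hh μ k a + μ : ℝ) : ℂ) • fun i => eigU (shifted_isHermitian hh μ k) i a := by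
  have h1 := eigU_mulVec (shifted_isHermitian hh μ k) a
  have h2 : bloch h k = shifted h μ k + (μ : ℂ) • (1 : Matrix (Fin M) (Fin M) ℂ) := by
    simp [shifted]
  rw [h2, Matrix.add_mulVec, h1, Matrix.smul_mulVec, Matrix.one_mulVec, ← add_smul]
  simp [ev]

lemma ev_mem_spectrum (k : ℝ) (a : Fin M) :
    ((ev hh μ k a + μ : ℝ) : ℂ) ∈ spectrum ℂ (bloch h k) := by
  rw [← Matrix.spectrum_toLin']
  refine Module.End.HasEigenvalue.mem_spectrum (Module.End.hasEigenvalue_of_hasEigenvector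
    (x := fun i => eigU (shifted_isHermitian hh μ k) i a) ⟨?_, ?_⟩)
  · rw [Module.End.mem_eigenspace_iff, Matrix.toLin'_apply]
    exact bloch_mulVec_eigU hh μ k a
  · intro h0
    have := sum_normSq_eigU (shifted_isHermitian hh μ k) a
    have h2 : ∀ i, eigU (shifted_isHermitian hh μ k) i a = 0 := fun i => congrFun h0 i
    simp [h2] at this

/-- If E + μ-shift missed every eigenvalue, functional calculus would supply an inverse of E - Ĥ(k).
-/
lemma exists_ev_of_mem_spectrum {k E : ℝ} (hE : (E : ℂ) ∈ spectrum ℂ (bloch h k)) :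
    ∃ a, ev hh μ k a + μ = E := by
  by_contra! hne
  apply spectrum.mem_iff.1 hE
  rw [Algebra.algebraMap_eq_smul_one]
  have hz : ∀ a, ((shifted_isHermitian hh μ k).eigenvalues a : ℂ) + ((μ - E : ℝ) : ℂ) ≠ 0 := by
    intro a h0
    have h0' : (shifted_isHermitian hh μ k).eigenvalues a + (μ - E) = 0 := by exact_mod_cast h0
    exact hne a (by rw [ev]; linarith)
  have h1 := matFun_mul (shifted_isHermitian hh μ k) (fun x => (x : ℂ) + ((μ - E : ℝ) : ℂ))
    (fun x => ((x : ℂ) + ((μ - E : ℝ) : ℂ))⁻¹)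
  rw [matFun_congr (φ := fun x => ((x : ℂ) + ((μ - E : ℝ) : ℂ)) * ((x : ℂ) + ((μ - E : ℝ) : ℂ))⁻¹)
    (ψ := fun _ => 1) _ (fun a => mul_inv_cancel₀ (hz a)), matFun_one,
    ← matFun_add _ (fun x => (x : ℂ)) (fun _ => ((μ - E : ℝ) : ℂ)), matFun_id] at h1
  have h2 : matFun (shifted_isHermitian hh μ k) (fun _ => ((μ - E : ℝ) : ℂ)) =
      ((μ - E : ℝ) : ℂ) • (1 : Matrix (Fin M) (Fin M) ℂ) := by
    rw [← matFun_one (shifted_isHermitian hh μ k), matFun_smul]; simp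
  have h3 : shifted h μ k + ((μ - E : ℝ) : ℂ) • (1 : Matrix (Fin M) (Fin M) ℂ) =
      -((E : ℂ) • (1 : Matrix (Fin M) (Fin M) ℂ) - bloch h k) := by
    push_cast
    rw [shifted, sub_smul]; abel
  rw [h2, h3] at h1
  exact (IsUnit.neg_iff _).1 (IsUnit.of_mul_eq_one _ h1)

/-- Two different indices would give orthonormal vectors in a one-dimensional eigenspace, hence
proportional and orthogonal at once. -/
lemma ev_injOn_of_finrank_eq_one {k E : ℝ}
    (hE : Module.finrank ℂ (Module.End.eigenspace (Matrix.toLin' (bloch h k)) (E : ℂ)) = 1)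
    {a b : Fin M} (ha : ev hh μ k a + μ = E) (hb : ev hh μ k b + μ = E) : a = b := by
  by_contra hab
  have hmem : ∀ c, ev hh μ k c + μ = E → (fun i => eigU (shifted_isHermitian hh μ k) i c) ∈
      Module.End.eigenspace (Matrix.toLin' (bloch h k)) (E : ℂ) := by
    intro c hc
    rw [Module.End.mem_eigenspace_iff, Matrix.toLin'_apply, bloch_mulVec_eigU hh, hc]
  have hn := sum_normSq_eigU (shifted_isHermitian hh μ k)
  have hne : (⟨_, hmem a ha⟩ : Module.End.eigenspace (Matrix.toLin' (bloch h k)) (E : ℂ)) ≠ 0 := by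
    intro h0
    have h2 : ∀ i, eigU (shifted_isHermitian hh μ k) i a = 0 := fun i =>
      congrFun (congrArg Subtype.val h0) i
    have := hn a
    simp [h2] at this
  obtain ⟨c, hc⟩ := (finrank_eq_one_iff_of_nonzero' _ hne).1 hE ⟨_, hmem b hb⟩
  have h3 : ∀ i, eigU (shifted_isHermitian hh μ k) i b =
      c * eigU (shifted_isHermitian hh μ k) i a := fun i => by
    have := congrFun (congrArg Subtype.val hc) i
    simpa using this.symm
  have h4 := congrFun (congrFun (eigU_star_mul (shifted_isHermitian hh μ k)) a) b
  have h5 := congrFun (congrFun (eigU_star_mul (shifted_isHermitian hh μ k)) b) b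
  have h6 := congrFun (congrFun (eigU_star_mul (shifted_isHermitian hh μ k)) a) a
  rw [Matrix.mul_apply, Matrix.one_apply_ne hab] at h4
  rw [Matrix.mul_apply, Matrix.one_apply_eq] at h5 h6
  simp only [h3] at h4
  have h7 : c = 0 := by
    have : c * ∑ x, (eigU (shifted_isHermitian hh μ k))ᴴ a x *
        eigU (shifted_isHermitian hh μ k) x a = 0 := by
      rw [← h4, Finset.mul_sum]
      exact Finset.sum_congr rfl fun _ _ => by ring
    rwa [h6, mul_one] at this
  simp [h3, h7] at h5

end Spectrum

/-! ### The bands near the Fermi points and the gap away from them -/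

section Bands
variable {M N : ℕ} {h : Hopping M} (hh : h.SelfAdjoint) {μ : ℝ} (A : LowEnergySpectrum h μ N)

/-- A level inside the window is some e_ω' at a translate of k. Disjointness of the arcs forces ω' =
ω, their length forces the trivial translate, and nondegeneracy leaves one index of the eigenbasis.
-/
lemma LowEnergySpectrum.exists_band (ω : Fin N) {k : ℝ} (hk : k ∈ Set.Ioo (A.lo ω) (A.hi ω)) :
    ∃ a₀, ev hh μ k a₀ = A.e ω k - μ ∧ ∀ a, a ≠ a₀ → A.Δ ≤ |ev hh μ k a| := by
  have h1 := (A.spectrum_eq k (A.e ω k)).2 ⟨ω, 0, by simpa using hk, by simp⟩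
  obtain ⟨a₀, ha₀⟩ := exists_ev_of_mem_spectrum hh μ h1.1
  refine ⟨a₀, by linarith, fun a ha => ?_⟩
  by_contra! hlt
  apply ha
  rw [abs_lt] at hlt
  obtain ⟨ω', n, hn, he⟩ := (A.spectrum_eq k (ev hh μ k a + μ)).1
    ⟨ev_mem_spectrum hh μ k a, ⟨by linarith, by linarith⟩⟩
  have hω : ω = ω' := by
    by_contra hne
    exact A.disjoint ω ω' hne k hk _ hn n rfl
  subst hω
  -- Both k and k + 2πn lie in an open interval of length at most 2π, so |n| < 1.
  have hn0 : n = 0 := by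
    have := A.hi_le ω
    have hpi := Real.pi_pos
    have h3 : ((n : ℝ)) < 1 := by
      by_contra! h4
      nlinarith [hn.2, hk.1]
    have h5 : (-1 : ℝ) < n := by
      by_contra! h4
      nlinarith [hn.1, hk.2]
    have h6 : n < 1 := by exact_mod_cast h3
    have h7 : -1 < n := by exact_mod_cast h5
    omega
  subst hn0
  refine ev_injOn_of_finrank_eq_one hh μ (A.nondegenerate ω k hk) ?_ ha₀
  simpa using he

lemma LowEnergySpectrum.mu_notMem_spectrum {k : ℝ}
    (hk : ∀ ω, ∀ n : ℤ, k + 2 * Real.pi * n ≠ A.kF ω) : (μ : ℂ) ∉ spectrum ℂ (bloch h k) := by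
  intro hμ
  obtain ⟨ω, n, hn, he⟩ := (A.spectrum_eq k μ).1
    ⟨hμ, by linarith [A.Δ_pos], by linarith [A.Δ_pos]⟩
  refine hk ω n ?_
  replace he := (A.e_kF ω).trans he
  rcases A.strictMono ω with hm | hm
  · exact (hm.injOn (A.kF_mem ω) hn he).symm
  · exact (hm.injOn (A.kF_mem ω) hn he).symm

lemma LowEnergySpectrum.ev_ne_zero {k : ℝ}
    (hk : ∀ ω, ∀ n : ℤ, k + 2 * Real.pi * n ≠ A.kF ω) (a : Fin M) : ev hh μ k a ≠ 0 := by
  intro h0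
  apply A.mu_notMem_spectrum hk
  have := ev_mem_spectrum hh μ k a
  rwa [h0, zero_add] at this

/-- Compactness of the Brillouin zone minus the r-neighbourhoods, times a unit sphere: ‖(Ĥ(k) - μ)v‖
is continuous and positive there. Using vectors instead of eigenvalues avoids any continuity
statement about the latter. -/
lemma LowEnergySpectrum.exists_gap {r : ℝ} (hr : 0 < r) :
    ∃ g > 0, ∀ k, (∀ ω, ∀ n : ℤ, r ≤ |k + 2 * Real.pi * n - A.kF ω|) → ∀ a, g ≤ |ev hh μ k a| := by
  let Z : Set ℝ := {k | ∀ ω, ∀ n : ℤ, r ≤ |k + 2 * Real.pi * n - A.kF ω|}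
  have hZ : IsClosed Z := by
    have : Z = ⋂ ω, ⋂ n : ℤ, {k | r ≤ |k + 2 * Real.pi * n - A.kF ω|} := by
      ext k; simp [Z]
    rw [this]
    exact isClosed_iInter fun ω => isClosed_iInter fun n =>
      isClosed_le continuous_const (by fun_prop)
  have hK : IsCompact ((Set.Icc (-Real.pi) Real.pi ∩ Z) ×ˢ
      Metric.sphere (0 : Fin M → ℂ) 1) :=
    (isCompact_Icc.inter_right hZ).prod (isCompact_sphere _ _)
  obtain ⟨g, hg, hgap⟩ := hK.exists_forall_le' (f := fun x => ‖shifted h μ x.1 *ᵥ x.2‖)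
    (a := 0) (Continuous.continuousOn (by fun_prop)) (by
      rintro ⟨k, v⟩ ⟨⟨_, hk⟩, hv⟩
      rw [norm_pos_iff]
      intro h0
      have hv0 : v ≠ 0 := by rintro rfl; simp at hv
      apply A.mu_notMem_spectrum (k := k)
      · intro ω n hne
        have := hk ω n
        rw [hne, sub_self, abs_zero] at this
        linarith
      · rw [← Matrix.spectrum_toLin']
        refine Module.End.HasEigenvalue.mem_spectrum
          (Module.End.hasEigenvalue_of_hasEigenvector (x := v) ⟨?_, hv0⟩)
        rw [Module.End.mem_eigenspace_iff, Matrix.toLin'_apply]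
        simp only [shifted] at h0
        rw [Matrix.sub_mulVec, Matrix.smul_mulVec, Matrix.one_mulVec, sub_eq_zero] at h0
        exact h0)
  refine ⟨g, hg, fun k hk a => ?_⟩
  obtain ⟨m, hm⟩ : ∃ m : ℤ, k + 2 * Real.pi * m ∈ Set.Ioc (-Real.pi) Real.pi := by
    refine ⟨-toIocDiv Real.two_pi_pos (-Real.pi) k, ?_⟩
    have := sub_toIocDiv_zsmul_mem_Ioc Real.two_pi_pos (-Real.pi) k
    simp only [zsmul_eq_mul] at this
    have e1 : k + 2 * Real.pi * ((-toIocDiv Real.two_pi_pos (-Real.pi) k : ℤ) : ℝ) =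
        k - (toIocDiv Real.two_pi_pos (-Real.pi) k : ℝ) * (2 * Real.pi) := by push_cast; ring
    rw [e1]
    have e2 : -Real.pi + 2 * Real.pi = Real.pi := by ring
    rwa [e2] at this
  rw [← ev_add_two_pi hh μ k m]
  set k' := k + 2 * Real.pi * m with hk'
  have hk'Z : k' ∈ Z := by
    intro ω n
    have := hk ω (m + n)
    rw [hk']
    convert this using 2
    push_cast; ring
  let u : Fin M → ℂ := fun i => eigU (shifted_isHermitian hh μ k') i a
  have hu0 : u ≠ 0 := by
    intro h0
    have := sum_normSq_eigU (shifted_isHermitian hh μ k') a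
    have h2 : ∀ i, eigU (shifted_isHermitian hh μ k') i a = 0 := fun i => congrFun h0 i
    simp [h2] at this
  have hun : 0 < ‖u‖ := norm_pos_iff.2 hu0
  -- The columns of `eigU` have Euclidean norm one, but the sphere is that of the supremum norm;
  -- hence the rescaling.
  have h3 := hgap ⟨k', ((‖u‖⁻¹ : ℝ) : ℂ) • u⟩ ⟨⟨Set.Ioc_subset_Icc_self hm, hk'Z⟩, by
    rw [mem_sphere_zero_iff_norm, norm_smul, Complex.norm_real, norm_inv, norm_norm,
      inv_mul_cancel₀ hun.ne']⟩
  have h4 : shifted h μ k' *ᵥ u = (ev hh μ k' a : ℂ) • u :=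
    eigU_mulVec (shifted_isHermitian hh μ k') a
  simp only [Matrix.mulVec_smul, h4] at h3
  rw [norm_smul, norm_smul, Complex.norm_real, Complex.norm_real, norm_inv, norm_norm] at h3
  calc g ≤ ‖u‖⁻¹ * (‖ev hh μ k' a‖ * ‖u‖) := h3
    _ = |ev hh μ k' a| := by rw [Real.norm_eq_abs]; field_simp

end Bands

/-- The derivative is Lipschitz near x₀; apply the mean value inequality to f minus its tangent on
the segment from x₀ to x. -/
lemma exists_quadratic_bound {f : ℝ → ℝ} {x₀ : ℝ} (hf : ContDiffAt ℝ 2 f x₀) :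
    ∃ C ≥ 0, ∀ᶠ x in 𝓝 x₀, |f x - f x₀ - deriv f x₀ * (x - x₀)| ≤ C * (x - x₀) ^ 2 := by
  have h1 : ContDiffAt ℝ 1 (deriv f) x₀ := by
    have h2 : ContDiffAt ℝ 1 (fderiv ℝ f) x₀ := hf.fderiv_right (by norm_num)
    have : deriv f = fun x => fderiv ℝ f x 1 := by ext x; simp
    rw [this]
    exact h2.clm_apply contDiffAt_const
  obtain ⟨K, t, ht, hK⟩ := h1.exists_lipschitzOnWith
  have hd : ∀ᶠ x in 𝓝 x₀, DifferentiableAt ℝ f x :=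
    (hf.eventually (by simp)).mono fun x hx => hx.differentiableAt (by simp)
  obtain ⟨ε, hε, hball⟩ := Metric.eventually_nhds_iff_ball.1 (hd.and ht)
  refine ⟨K, K.2, ?_⟩
  filter_upwards [Metric.ball_mem_nhds x₀ hε] with x hx
  have hseg : ∀ y ∈ segment ℝ x₀ x, y ∈ Metric.ball x₀ ε ∧ |y - x₀| ≤ |x - x₀| := by
    intro y hy
    refine ⟨(convex_ball x₀ ε).segment_subset (Metric.mem_ball_self hε) hx hy, ?_⟩
    obtain ⟨s, t, hs, ht, hst, rfl⟩ := hy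
    have : s • x₀ + t • x - x₀ = t * (x - x₀) := by
      simp only [smul_eq_mul]; linear_combination x₀ * hst
    rw [this, abs_mul, abs_of_nonneg ht]
    exact mul_le_of_le_one_left (abs_nonneg _) (by linarith)
  have hmv := (convex_segment x₀ x).norm_image_sub_le_of_norm_hasDerivWithin_le
    (f := fun y => f y - deriv f x₀ * y) (f' := fun y => deriv f y - deriv f x₀)
    (C := K * |x - x₀|) (x := x₀) (y := x)
    (fun y hy => by
      have h2 := (hball y (hseg y hy).1).1.hasDerivAt
      exact (h2.sub (by simpa using (hasDerivAt_id y).const_mul (deriv f x₀))).hasDerivWithinAt)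
    (fun y hy => by
      have h2 := hK.norm_sub_le (hball y (hseg y hy).1).2 (hball x₀ (Metric.mem_ball_self hε)).2
      refine h2.trans ?_
      gcongr
      exact (hseg y hy).2)
    (left_mem_segment ℝ x₀ x) (right_mem_segment ℝ x₀ x)
  rw [Real.norm_eq_abs, Real.norm_eq_abs] at hmv
  calc _ = |f x - deriv f x₀ * x - (f x₀ - deriv f x₀ * x₀)| := by congr 1; ring
    _ ≤ _ := hmv
    _ = _ := by rw [mul_assoc, abs_mul_abs_self]; ring

/-- Quantitative information on the bands near the Fermi points. -/
lemma LowEnergySpectrum.exists_radius {M N : ℕ} {h : Hopping M} {μ : ℝ}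
    (A : LowEnergySpectrum h μ N) :
    ∃ C ≥ 0, ∃ r > 0, ∀ ω, C * r ≤ |A.v ω| / 4 ∧ ∀ k, |k - A.kF ω| < r →
      k ∈ Set.Ioo (A.lo ω) (A.hi ω) ∧ |A.e ω k - μ| ≤ A.Δ / 2 ∧
      |A.e ω k - μ - A.v ω * (k - A.kF ω)| ≤ C * (k - A.kF ω) ^ 2 := by
  have hsm : ∀ ω, ContDiffAt ℝ 2 (A.e ω) (A.kF ω) := fun ω =>
    ((A.smooth ω).contDiffAt (isOpen_Ioo.mem_nhds (A.kF_mem ω))).of_le (WithTop.coe_le_coe.2 (le_top : (2 : ℕ∞) ≤ ⊤))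
  choose C hC0 hC using fun ω => exists_quadratic_bound (hsm ω)
  have hCs : ∀ ω, C ω ≤ ∑ ω, C ω := fun ω =>
    Finset.single_le_sum (fun i _ => hC0 i) (Finset.mem_univ ω)
  refine ⟨∑ ω, C ω, Finset.sum_nonneg fun ω _ => hC0 ω, ?_⟩
  -- One constant serves all bands, and r is chosen after it. The factor 1/4 keeps the quadratic
  -- error below half of the linear term, so that the sign of the band energy is that of its
  -- tangent.
  have key : ∀ᶠ r in 𝓝[>] (0 : ℝ), ∀ ω, (∑ ω, C ω) * r ≤ |A.v ω| / 4 ∧ ∀ k, |k - A.kF ω| < r →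
      k ∈ Set.Ioo (A.lo ω) (A.hi ω) ∧ |A.e ω k - μ| ≤ A.Δ / 2 ∧
      |A.e ω k - μ - A.v ω * (k - A.kF ω)| ≤ (∑ ω, C ω) * (k - A.kF ω) ^ 2 := by
    rw [Filter.eventually_all]
    intro ω
    have h1 : ∀ᶠ k in 𝓝 (A.kF ω), k ∈ Set.Ioo (A.lo ω) (A.hi ω) ∧ |A.e ω k - μ| ≤ A.Δ / 2 ∧
        |A.e ω k - μ - A.v ω * (k - A.kF ω)| ≤ (∑ ω, C ω) * (k - A.kF ω) ^ 2 := by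
      refine Filter.Eventually.and (isOpen_Ioo.mem_nhds (A.kF_mem ω)) (Filter.Eventually.and ?_ ?_)
      · have hc : ContinuousAt (fun k => |A.e ω k - μ|) (A.kF ω) :=
          ((hsm ω).continuousAt.sub continuousAt_const).abs
        have : |A.e ω (A.kF ω) - μ| < A.Δ / 2 := by
          rw [A.e_kF, sub_self, abs_zero]; linarith [A.Δ_pos]
        exact (hc.eventually (gt_mem_nhds this)).mono fun _ h => h.le
      · filter_upwards [hC ω] with k hk
        rw [A.e_kF] at hk
        exact hk.trans (by gcongr; exact hCs ω)
    obtain ⟨ε, hε, hb⟩ := Metric.eventually_nhds_iff.1 h1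
    have hv : 0 < |A.v ω| / 4 := by
      have := abs_pos.2 (A.velocity_ne_zero ω)
      unfold LowEnergySpectrum.v
      linarith
    have h2 : ∀ᶠ r in 𝓝 (0 : ℝ), (∑ ω, C ω) * r < |A.v ω| / 4 := by
      have : ContinuousAt (fun r : ℝ => (∑ ω, C ω) * r) 0 := by fun_prop
      exact this.eventually (gt_mem_nhds (by simpa using hv))
    filter_upwards [h2.filter_mono nhdsWithin_le_nhds,
      (gt_mem_nhds hε).filter_mono nhdsWithin_le_nhds] with r hr1 hr2
    exact ⟨hr1.le, fun k hk => hb (by rw [Real.dist_eq]; linarith)⟩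
  obtain ⟨r, hr, hr0⟩ := (key.and self_mem_nhdsWithin).exists
  exact ⟨r, hr0, hr⟩

end LinearResponse
end

noncomputable section
namespace LinearResponse

open MeasureTheory

/-! ### The integral over the Matsubara frequency -/

/-- The zero temperature occupation number of a level of energy `x` relative to the chemical
potential. -/
def occ (x : ℝ) : ℝ := if x < 0 then 1 else 0

lemma add_I_mul_ne_zero {E : ℝ} (hE : E ≠ 0) (t : ℝ) : (E : ℂ) + Complex.I * t ≠ 0 := by
  intro h0
  have := congrArg Complex.re h0
  simp at this
  exact hE this

lemma norm_add_I_mul (E t : ℝ) : ‖(E : ℂ) + Complex.I * t‖ = √(E ^ 2 + t ^ 2) := by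
  rw [mul_comm]; exact Complex.norm_add_mul_I E t

lemma normSq_add_I_mul (E t : ℝ) : ‖(E : ℂ) + Complex.I * t‖ ^ 2 = E ^ 2 + t ^ 2 := by
  rw [norm_add_I_mul, Real.sq_sqrt (by positivity)]

lemma integrable_inv_sq_add_sq {E : ℝ} (hE : E ≠ 0) :
    Integrable fun t : ℝ => (E ^ 2 + t ^ 2)⁻¹ := by
  have h1 := (integrable_inv_one_add_sq.comp_div hE).const_mul ((E ^ 2)⁻¹)
  refine h1.congr (Filter.Eventually.of_forall fun t => ?_)
  simp only
  rw [← mul_inv]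
  congr 1
  field_simp

lemma integrable_inv_mul_inv {E E' : ℝ} (hE : E ≠ 0) (hE' : E' ≠ 0) (p₀ : ℝ) :
    Integrable fun t : ℝ => ((E : ℂ) + Complex.I * t)⁻¹ *
      ((E' : ℂ) + Complex.I * ((t + p₀ : ℝ) : ℂ))⁻¹ := by
  have h1 := (integrable_inv_sq_add_sq hE).add ((integrable_inv_sq_add_sq hE').comp_add_right p₀)
  refine h1.mono' ?_ (Filter.Eventually.of_forall fun t => ?_)
  · refine Continuous.aestronglyMeasurable (Continuous.mul ?_ ?_)
    · exact Continuous.inv₀ (by fun_prop) fun t => add_I_mul_ne_zero hE t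
    · exact Continuous.inv₀ (by fun_prop) fun t => add_I_mul_ne_zero hE' _
  · rw [norm_mul, norm_inv, norm_inv]
    simp only [Pi.add_apply]
    rw [← normSq_add_I_mul, ← normSq_add_I_mul, ← inv_pow, ← inv_pow]
    set a := ‖(E : ℂ) + Complex.I * t‖⁻¹
    set b := ‖(E' : ℂ) + Complex.I * ((t + p₀ : ℝ) : ℂ)‖⁻¹
    nlinarith [sq_nonneg (a - b), sq_nonneg a, sq_nonneg b]

/-- A primitive of `(E + i t)⁻¹`. -/
def resolventPrim (E t : ℝ) : ℂ :=
  (Real.arctan (t / E) : ℂ) - Complex.I * ((Real.log (E ^ 2 + t ^ 2) / 2 : ℝ) : ℂ)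

lemma hasDerivAt_resolventPrim {E : ℝ} (hE : E ≠ 0) (t : ℝ) :
    HasDerivAt (resolventPrim E) ((E : ℂ) + Complex.I * t)⁻¹ t := by
  have hpos : 0 < E ^ 2 + t ^ 2 := by positivity
  have h1 : HasDerivAt (fun t : ℝ => Real.arctan (t / E)) (E / (E ^ 2 + t ^ 2)) t := by
    have := ((hasDerivAt_id t).div_const E).arctan
    refine this.congr_deriv ?_
    simp only [id]
    field_simp
  have h2 : HasDerivAt (fun t : ℝ => Real.log (E ^ 2 + t ^ 2) / 2) (t / (E ^ 2 + t ^ 2)) t := by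
    have h3 : HasDerivAt (fun t : ℝ => E ^ 2 + t ^ 2) (2 * t) t := by
      have := ((hasDerivAt_id t).pow 2).const_add (E ^ 2)
      simpa using this
    refine ((h3.log hpos.ne').div_const 2).congr_deriv ?_
    field_simp
  refine (h1.ofReal_comp.sub (h2.ofReal_comp.const_mul Complex.I)).congr_deriv ?_
  have h0 := add_I_mul_ne_zero hE t
  have h4 : ((E ^ 2 + t ^ 2 : ℝ) : ℂ) = (E + Complex.I * t) * (E - Complex.I * t) := by
    push_cast; linear_combination (t : ℂ) ^ 2 * Complex.I_sq
  have h5 : ((E ^ 2 + t ^ 2 : ℝ) : ℂ) ≠ 0 := by exact_mod_cast hpos.ne'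
  rw [Complex.ofReal_div, Complex.ofReal_div]
  refine eq_inv_of_mul_eq_one_left ?_
  field_simp
  rw [h4]; ring

/-- The logarithms in the two primitives diverge separately but cancel in the difference. In the
variable 1/t both ends of the line become the same continuity statement at 0. -/
lemma tendsto_log_ratio {E E' : ℝ} (p₀ : ℝ) {l : Filter ℝ}
    (hl : Filter.Tendsto (fun t : ℝ => t⁻¹) l (𝓝 0)) (hl0 : ∀ᶠ t in l, t ≠ 0)
    (hE : E ≠ 0) (hE' : E' ≠ 0) :
    Filter.Tendsto (fun t : ℝ => Real.log (E ^ 2 + t ^ 2) - Real.log (E' ^ 2 + (t + p₀) ^ 2)) l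
      (𝓝 0) := by
  have h1 : Filter.Tendsto (fun s : ℝ => Real.log ((E ^ 2 * s ^ 2 + 1) /
      (E' ^ 2 * s ^ 2 + (1 + p₀ * s) ^ 2))) (𝓝 0) (𝓝 0) := by
    have : ContinuousAt (fun s : ℝ => Real.log ((E ^ 2 * s ^ 2 + 1) /
        (E' ^ 2 * s ^ 2 + (1 + p₀ * s) ^ 2))) 0 := by
      refine ContinuousAt.log (ContinuousAt.div (by fun_prop) (by fun_prop) (by norm_num))
        (by norm_num)
    simpa [ContinuousAt] using this
  refine (h1.comp hl).congr' ?_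
  filter_upwards [hl0] with t ht
  have e1 : 0 < E ^ 2 + t ^ 2 := by positivity
  have e2 : 0 < E' ^ 2 + (t + p₀) ^ 2 := by positivity
  rw [Function.comp, ← Real.log_div e1.ne' e2.ne']
  congr 1
  have e3 : E' ^ 2 * t⁻¹ ^ 2 + (1 + p₀ * t⁻¹) ^ 2 = (E' ^ 2 + (t + p₀) ^ 2) * t⁻¹ ^ 2 := by
    field_simp
  have e4 : E ^ 2 * t⁻¹ ^ 2 + 1 = (E ^ 2 + t ^ 2) * t⁻¹ ^ 2 := by field_simp
  rw [e3, e4, mul_div_mul_right]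
  positivity

lemma tendsto_arctan_div_atTop {E : ℝ} (hE : E ≠ 0) :
    Filter.Tendsto (fun t : ℝ => Real.arctan (t / E)) Filter.atTop
      (𝓝 ((1 - 2 * occ E) * (Real.pi / 2))) := by
  rcases lt_or_gt_of_ne hE with h | h
  · have : (1 - 2 * occ E) * (Real.pi / 2) = -(Real.pi / 2) := by simp [occ, h]; ring
    rw [this]
    exact (tendsto_nhds_of_tendsto_nhdsWithin Real.tendsto_arctan_atBot).comp
      (Filter.tendsto_id.atTop_div_const_of_neg h)
  · have : (1 - 2 * occ E) * (Real.pi / 2) = (Real.pi / 2) := by simp [occ, h.not_gt]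
    rw [this]
    exact (tendsto_nhds_of_tendsto_nhdsWithin Real.tendsto_arctan_atTop).comp
      (Filter.tendsto_id.atTop_div_const h)

lemma tendsto_arctan_div_atBot {E : ℝ} (hE : E ≠ 0) :
    Filter.Tendsto (fun t : ℝ => Real.arctan (t / E)) Filter.atBot
      (𝓝 (-((1 - 2 * occ E) * (Real.pi / 2)))) := by
  have := ((tendsto_arctan_div_atTop hE).comp Filter.tendsto_neg_atBot_atTop).neg
  refine this.congr fun t => ?_
  simp [neg_div, Real.arctan_neg]

/-- Partial fractions. The logarithms drop out at infinity, and each arctangent jumps by ±π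
according to the sign of its energy, which is how the occupation numbers enter. -/
lemma integral_inv_mul_inv {E E' : ℝ} (hE : E ≠ 0) (hE' : E' ≠ 0) (p₀ : ℝ) :
    ∫ t : ℝ, ((E : ℂ) + Complex.I * t)⁻¹ * ((E' : ℂ) + Complex.I * ((t + p₀ : ℝ) : ℂ))⁻¹ =
      2 * Real.pi * (((occ E - occ E' : ℝ) : ℂ) / (E - E' - Complex.I * p₀)) := by
  have hint := integrable_inv_mul_inv hE hE' p₀
  -- A vanishing denominator means a double pole. The integral is then 0, in agreement with 0/0 = 0
  -- on the right.
  by_cases hD : (E : ℂ) - E' - Complex.I * p₀ = 0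
  · have hEE : E = E' := by
      have := congrArg Complex.re hD
      simp at this; linarith
    have hp : p₀ = 0 := by
      have := congrArg Complex.im hD
      simpa using this
    subst hEE hp
    have hder : ∀ t : ℝ, HasDerivAt (fun t : ℝ => Complex.I * ((E : ℂ) + Complex.I * t)⁻¹)
        (((E : ℂ) + Complex.I * t)⁻¹ * ((E : ℂ) + Complex.I * ((t + 0 : ℝ) : ℂ))⁻¹) t := by
      intro t
      have h1 : HasDerivAt (fun t : ℝ => (E : ℂ) + Complex.I * t) Complex.I t := by
        have := ((Complex.ofRealCLM.hasDerivAt (x := t)).const_mul Complex.I).const_add (E : ℂ)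
        simpa using this
      have h0 := add_I_mul_ne_zero hE t
      refine ((h1.inv h0).const_mul Complex.I).congr_deriv ?_
      rw [add_zero]
      field_simp
      simp
    have hz : ∀ l : Filter ℝ, Filter.Tendsto (fun t : ℝ => |t|) l Filter.atTop →
        Filter.Tendsto (fun t : ℝ => Complex.I * ((E : ℂ) + Complex.I * t)⁻¹) l (𝓝 0) := by
      intro l hl
      rw [tendsto_zero_iff_norm_tendsto_zero]
      refine squeeze_zero' (Filter.Eventually.of_forall fun _ => norm_nonneg _) ?_
        hl.inv_tendsto_atTop
      filter_upwards [hl.eventually (Filter.eventually_gt_atTop 0)] with t ht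
      rw [norm_mul, Complex.norm_I, one_mul, norm_inv, Pi.inv_apply]
      refine inv_anti₀ ht ?_
      rw [norm_add_I_mul]
      exact Real.abs_le_sqrt (by nlinarith [sq_nonneg E])
    rw [integral_of_hasDerivAt_of_tendsto hder hint
      (hz _ Filter.tendsto_abs_atBot_atTop) (hz _ Filter.tendsto_abs_atTop_atTop)]
    simp
  · set D : ℂ := (E : ℂ) - E' - Complex.I * p₀ with hDdef
    have hder : ∀ t : ℝ, HasDerivAt
        (fun t : ℝ => (resolventPrim E t - resolventPrim E' (t + p₀)) * (-D)⁻¹)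
        (((E : ℂ) + Complex.I * t)⁻¹ * ((E' : ℂ) + Complex.I * ((t + p₀ : ℝ) : ℂ))⁻¹) t := by
      intro t
      refine (((hasDerivAt_resolventPrim hE t).sub
        ((hasDerivAt_resolventPrim hE' (t + p₀)).comp_add_const t p₀)).mul_const _).congr_deriv ?_
      have h1 := add_I_mul_ne_zero hE t
      have h2 := add_I_mul_ne_zero hE' (t + p₀)
      have h3 : -D ≠ 0 := neg_ne_zero.2 hD
      have h4 : (E' : ℂ) + Complex.I * ((t + p₀ : ℝ) : ℂ) - (E + Complex.I * t) = -D := by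
        rw [hDdef]; push_cast; ring
      rw [inv_sub_inv h1 h2, h4]
      field_simp
    have hlim : ∀ (l : Filter ℝ) (x y : ℝ), Filter.Tendsto (fun t : ℝ => t⁻¹) l (𝓝 0) →
        (∀ᶠ t in l, t ≠ 0) → Filter.Tendsto (fun t : ℝ => Real.arctan (t / E)) l (𝓝 x) →
        Filter.Tendsto (fun t : ℝ => Real.arctan ((t + p₀) / E')) l (𝓝 y) →
        Filter.Tendsto (fun t : ℝ => (resolventPrim E t - resolventPrim E' (t + p₀)) * (-D)⁻¹) l
          (𝓝 (((x - y : ℝ) : ℂ) * (-D)⁻¹)) := by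
      intro l x y hl hl0 hx hy
      have h1 := (Complex.continuous_ofReal.tendsto _).comp (hx.sub hy)
      have h2 := (Complex.continuous_ofReal.tendsto _).comp
        ((tendsto_log_ratio p₀ hl hl0 hE hE').div_const 2)
      have h3 := (h1.sub (h2.const_mul Complex.I)).mul_const ((-D)⁻¹)
      simp only [zero_div, Complex.ofReal_zero, mul_zero, sub_zero] at h3
      refine h3.congr fun t => ?_
      simp only [resolventPrim, Function.comp]
      push_cast
      ring
    rw [integral_of_hasDerivAt_of_tendsto hder hint
      (hlim _ _ _ tendsto_inv_atBot_zero (Filter.eventually_ne_atBot 0)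
        (tendsto_arctan_div_atBot hE)
        ((tendsto_arctan_div_atBot hE').comp (Filter.tendsto_atBot_add_const_right _ p₀
          Filter.tendsto_id)))
      (hlim _ _ _ tendsto_inv_atTop_zero (Filter.eventually_ne_atTop 0)
        (tendsto_arctan_div_atTop hE)
        ((tendsto_arctan_div_atTop hE').comp (Filter.tendsto_atTop_add_const_right _ p₀
          Filter.tendsto_id)))]
    push_cast
    have h3 : -D ≠ 0 := neg_ne_zero.2 hD
    field_simp
    ring

/-! ### Integrability of inverse square roots -/

lemma integrable_abs_rpow_div : Integrable fun t : ℝ => |t| ^ (-(1 / 2) : ℝ) * (1 + |t|)⁻¹ := by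
  have h1 : IntegrableOn (fun y : ℝ => y ^ (-(1 / 2) : ℝ) * (1 + y)⁻¹) (Set.Ioi 0) := by
    rw [← Set.Ioc_union_Ioi_eq_Ioi zero_le_one]
    refine IntegrableOn.union ?_ ?_
    · have h2 : IntegrableOn (fun y : ℝ => y ^ (-(1 / 2) : ℝ)) (Set.Ioc 0 1) :=
        (intervalIntegrable_iff_integrableOn_Ioc_of_le zero_le_one).1
          (intervalIntegral.intervalIntegrable_rpow' (by norm_num))
      refine Integrable.mono' h2 (Measurable.aestronglyMeasurable (by fun_prop)) ?_
      filter_upwards [ae_restrict_mem measurableSet_Ioc] with y hy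
      have hy0 : 0 < y := hy.1
      rw [norm_mul, norm_inv, Real.norm_of_nonneg (by positivity), Real.norm_of_nonneg (by positivity)]
      exact mul_le_of_le_one_right (by positivity) (inv_le_one_of_one_le₀ (by linarith))
    · have h2 : IntegrableOn (fun y : ℝ => y ^ (-(3 / 2) : ℝ)) (Set.Ioi 1) :=
        integrableOn_Ioi_rpow_of_lt (by norm_num) zero_lt_one
      refine Integrable.mono' h2 (Measurable.aestronglyMeasurable (by fun_prop)) ?_
      filter_upwards [ae_restrict_mem measurableSet_Ioi] with y hy
      have hy0 : 0 < y := zero_lt_one.trans hy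
      rw [norm_mul, norm_inv, Real.norm_of_nonneg (by positivity), Real.norm_of_nonneg (by positivity)]
      have : y ^ (-(3 / 2) : ℝ) = y ^ (-(1 / 2) : ℝ) * y⁻¹ := by
        rw [← Real.rpow_neg_one y, ← Real.rpow_add hy0]; norm_num
      rw [this]
      gcongr
      linarith
  have := (integrable_fun_norm_addHaar (volume : Measure ℝ)
    (f := fun y : ℝ => y ^ (-(1 / 2) : ℝ) * (1 + y)⁻¹)).2 (by simpa using h1)
  simpa using this

/-- From E² + t² ≥ |E||t|. The point singularity of the propagator splits into one factor integrable
in the frequency and one integrable in the momentum. -/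
lemma inv_norm_add_I_mul_le {E t : ℝ} (hE : E ≠ 0) (ht : t ≠ 0) :
    ‖(E : ℂ) + Complex.I * t‖⁻¹ ≤ |t| ^ (-(1 / 2) : ℝ) * |E| ^ (-(1 / 2) : ℝ) := by
  have hE' := abs_pos.2 hE
  have ht' := abs_pos.2 ht
  rw [← Real.mul_rpow ht'.le hE'.le, Real.rpow_neg (by positivity), ← Real.sqrt_eq_rpow]
  refine inv_anti₀ (by positivity) ?_
  rw [norm_add_I_mul]
  refine Real.sqrt_le_sqrt ?_
  nlinarith [sq_nonneg (|t| - |E|), sq_abs t, sq_abs E, mul_pos hE' ht']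

end LinearResponse
end

noncomputable section
namespace LinearResponse

open MeasureTheory

/-! ### The correlation as an integral over the Brillouin zone -/

section
variable {M : ℕ}

lemma measurable_propagator_apply (h : Hopping M) (μ : ℝ) (i j : Fin M) :
    Measurable fun x : ℝ × ℝ => propagator h μ x.1 x.2 i j := by
  have hc : Continuous fun x : ℝ × ℝ => bloch h x.2 +
      (Complex.I * (x.1 : ℂ) - (μ : ℂ)) • (1 : Matrix (Fin M) (Fin M) ℂ) := by fun_prop
  simp only [propagator, Matrix.inv_def, Matrix.smul_apply, Ring.inverse_eq_inv', smul_eq_mul]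
  exact (hc.matrix_det.measurable.inv).mul (hc.matrix_adjugate.matrix_elem i j).measurable

lemma measurable_correlation_integrand (h : Hopping M) (μ : ℝ) (ν : Fin 2) (p₀ : ℝ) :
    Measurable fun x : ℝ × (ℝ × ℝ) => (vertex h ν x.2.2 (-x.1) * propagator h μ x.2.1 x.2.2 *
      propagator h μ (x.2.1 + p₀) (x.2.2 + x.1)).trace / (2 * Real.pi : ℂ) ^ 2 := by
  simp only [Matrix.trace, Matrix.diag_apply, Matrix.mul_apply]
  refine Measurable.div_const (Finset.measurable_sum _ fun i _ => Finset.measurable_sum _ fun j _ =>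
    (Finset.measurable_sum _ fun l _ => ?_).mul ?_) _
  · refine Measurable.mul ?_ ?_
    · exact (((continuous_vertex h ν).comp (g := fun x : ℝ × ℝ => vertex h ν x.1 x.2)
        (f := fun x : ℝ × (ℝ × ℝ) => (x.2.2, -x.1)) (by fun_prop)).matrix_elem i l).measurable
    · exact (measurable_propagator_apply h μ l j).comp measurable_snd
  · exact (measurable_propagator_apply h μ j i).comp
      (f := fun x : ℝ × (ℝ × ℝ) => (x.2.1 + p₀, x.2.2 + x.1)) (by fun_prop)

lemma norm_pairSum_le {A B : Matrix (Fin M) (Fin M) ℂ} (hA : A.IsHermitian) (hB : B.IsHermitian)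
    {φ : ℝ → ℝ → ℂ} {c : ℝ} (J : Matrix (Fin M) (Fin M) ℂ)
    (hφ : ∀ a b, ‖φ (hA.eigenvalues a) (hB.eigenvalues b)‖ * ‖overlap hA hB a b‖ ≤ c) :
    ‖pairSum hA hB φ J‖ ≤ (M : ℝ) ^ 2 * (c * entrySum J) := by
  have : ∀ a b, ‖φ (hA.eigenvalues a) (hB.eigenvalues b) *
      (overlap hA hB a b * ((eigU hB)ᴴ * J * eigU hA) b a)‖ ≤ c * entrySum J := by
    intro a b
    rw [norm_mul, norm_mul, ← mul_assoc]
    exact mul_le_mul (hφ a b) (norm_conj_eigU_mul_le hB hA J b a) (norm_nonneg _)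
      (le_trans (by positivity) (hφ a b))
  refine (norm_sum_le _ _).trans ?_
  refine (Finset.sum_le_sum fun a _ => (norm_sum_le _ _).trans
    (Finset.sum_le_sum fun b _ => this a b)).trans ?_
  simp only [Finset.sum_const, Finset.card_univ, Fintype.card_fin, nsmul_eq_mul]
  exact le_of_eq (by ring)

lemma norm_pairSum_le' {A B : Matrix (Fin M) (Fin M) ℂ} (hA : A.IsHermitian) (hB : B.IsHermitian)
    {φ : ℝ → ℝ → ℂ} {c : ℝ} (J : Matrix (Fin M) (Fin M) ℂ)
    (hφ : ∀ a b, ‖φ (hA.eigenvalues a) (hB.eigenvalues b)‖ ≤ c) :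
    ‖pairSum hA hB φ J‖ ≤ (M : ℝ) ^ 2 * (c * entrySum J) :=
  norm_pairSum_le hA hB J fun a b => (mul_le_of_le_one_right (norm_nonneg _)
    (norm_overlap_le hA hB a b)).trans (hφ a b)

variable {h : Hopping M} (hh : h.SelfAdjoint) (μ : ℝ)

/-- The integrand `∑_{a,b} (f(λ_a) - f(λ'_b)) / (λ_a - λ'_b - i p₀) ⟨a|b⟩ ⟨b|Ĵ|a⟩`, where `λ_a` and
`λ'_b` are the levels at `k` and `k + p`. -/
def lindhard (ν : Fin 2) (p₀ p k : ℝ) : ℂ :=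
  pairSum (shifted_isHermitian hh μ k) (shifted_isHermitian hh μ (k + p))
    (fun x y => ((occ x - occ y : ℝ) : ℂ) / (x - y - Complex.I * p₀)) (vertex h ν k (-p))

lemma lindhard_add_two_pi (ν : Fin 2) (p₀ p k : ℝ) (m : ℤ) :
    lindhard hh μ ν p₀ p (k + 2 * Real.pi * m) = lindhard hh μ ν p₀ p k := by
  unfold lindhard
  have h1 := vertex_add_two_pi h ν k (-p) m 0
  simp only [Int.cast_zero, mul_zero, add_zero] at h1
  rw [h1]
  refine pairSum_eq_of_eq _ _ _ _ (shifted_add_two_pi h μ k m) ?_ _ _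
  rw [← shifted_add_two_pi h μ (k + p) m]
  congr 1; ring

lemma ae_ne_fermi {N : ℕ} (A : LowEnergySpectrum h μ N) (p : ℝ) :
    ∀ᵐ k : ℝ, ∀ ω, ∀ n : ℤ, k + p + 2 * Real.pi * n ≠ A.kF ω := by
  rw [ae_all_iff]; intro ω
  rw [ae_all_iff]; intro n
  filter_upwards [compl_mem_ae_iff.2 (measure_singleton (A.kF ω - 2 * Real.pi * n - p))] with k hk h0
  apply hk
  simp only [Set.mem_singleton_iff]
  linarith

/-- A bound for the inverse square roots of the energies. -/
def fermiWeight {N : ℕ} (A : LowEnergySpectrum h μ N) (k : ℝ) : ℝ :=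
  1 + ∑ ω, |Real.sin ((k - A.kF ω) / 2)| ^ (-(1 / 2) : ℝ)

lemma fermiWeight_nonneg {N : ℕ} (A : LowEnergySpectrum h μ N) (k : ℝ) : 0 ≤ fermiWeight μ A k :=
  add_nonneg zero_le_one (Finset.sum_nonneg fun _ _ => by positivity)

/-- By periodicity one period suffices; there |sin(t/2)| ≥ |t|/π, and |t|^(-1/2) is locally
integrable. The sine is a periodic substitute for the distance to a Fermi point. -/
lemma intervalIntegrable_abs_sin_rpow (a b : ℝ) :
    IntervalIntegrable (fun t => |Real.sin (t / 2)| ^ (-(1 / 2) : ℝ)) volume a b := by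
  have hper : Function.Periodic (fun t => |Real.sin (t / 2)| ^ (-(1 / 2) : ℝ)) (2 * Real.pi) := by
    intro t
    simp only
    rw [show (t + 2 * Real.pi) / 2 = t / 2 + Real.pi by ring, Real.sin_add_pi, abs_neg]
  have hbase : IntervalIntegrable (fun t => |Real.sin (t / 2)| ^ (-(1 / 2) : ℝ)) volume
      (-Real.pi) (-Real.pi + 2 * Real.pi) := by
    rw [intervalIntegrable_iff_integrableOn_Icc_of_le (by linarith [Real.pi_pos])]
    have hl : LocallyIntegrable (fun t : ℝ => Real.pi ^ (1 / 2 : ℝ) * |t| ^ (-(1 / 2) : ℝ)) :=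
      locallyIntegrable_of_norm_le_rpow (α := 1 / 2) (C := Real.pi ^ (1 / 2 : ℝ)) (by simp)
        (by norm_num) (Filter.Eventually.of_forall fun t => by
          rw [Real.norm_of_nonneg (by positivity), Real.norm_eq_abs])
        (Measurable.aestronglyMeasurable (by fun_prop))
    refine Integrable.mono' (hl.integrableOn_isCompact isCompact_Icc)
      (Measurable.aestronglyMeasurable (by fun_prop)) ?_
    filter_upwards [ae_restrict_mem measurableSet_Icc,
      (compl_mem_ae_iff.2 (measure_singleton 0) : ∀ᵐ t ∂(volume.restrict _), t ∈ ({0}ᶜ : Set ℝ))]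
      with t ht ht0
    have ht0' : 0 < |t| := abs_pos.2 ht0
    have htpi : |t| ≤ Real.pi := abs_le.2 ⟨ht.1, by linarith [ht.2]⟩
    have hs : |t| / Real.pi ≤ |Real.sin (t / 2)| := by
      have h1 := Real.mul_le_sin (x := |t| / 2) (by positivity) (by linarith)
      have h2 : Real.sin (|t| / 2) ≤ |Real.sin (t / 2)| := by
        rcases abs_cases t with ⟨h, _⟩ | ⟨h, _⟩
        · rw [h]; exact le_abs_self _
        · rw [h, neg_div, Real.sin_neg]; exact neg_le_abs _
      refine le_trans (le_of_eq ?_) (h1.trans h2)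
      field_simp
    rw [Real.norm_of_nonneg (by positivity)]
    calc |Real.sin (t / 2)| ^ (-(1 / 2) : ℝ) ≤ (|t| / Real.pi) ^ (-(1 / 2) : ℝ) :=
          Real.rpow_le_rpow_of_nonpos (by positivity) hs (by norm_num)
      _ = _ := by
          rw [Real.div_rpow ht0'.le Real.pi_pos.le, Real.rpow_neg Real.pi_pos.le, div_inv_eq_mul,
            mul_comm]
  exact hper.intervalIntegrable (by positivity) hbase a b

lemma integrableOn_fermiWeight {N : ℕ} (A : LowEnergySpectrum h μ N) (p : ℝ) :
    IntegrableOn (fun k => fermiWeight μ A (k + p)) (Set.Ioc (-Real.pi) Real.pi) := by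
  rw [← intervalIntegrable_iff_integrableOn_Ioc_of_le (by linarith [Real.pi_pos])]
  unfold fermiWeight
  refine intervalIntegrable_const.add ?_
  have : (fun k => ∑ ω, |Real.sin ((k + p - A.kF ω) / 2)| ^ (-(1 / 2) : ℝ)) =
      ∑ ω, fun k => |Real.sin ((k + p - A.kF ω) / 2)| ^ (-(1 / 2) : ℝ) := by
    ext k; simp
  rw [this]
  refine IntervalIntegrable.sum _ fun ω _ => ?_
  have := (intervalIntegrable_abs_sin_rpow (-Real.pi + (p - A.kF ω))
    (Real.pi + (p - A.kF ω))).comp_add_right (p - A.kF ω)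
  simp only [add_sub_cancel_right] at this
  refine this.congr fun k _ => ?_
  simp only [add_sub_assoc]

/-- Away from the Fermi points use the gap. Near one of them, every level but one is at least Δ away
from zero, and the remaining one is dominated by its linear part. -/
lemma LowEnergySpectrum.exists_lower_bound {N : ℕ} (A : LowEnergySpectrum h μ N) :
    ∃ c > 0, ∀ k a, (∃ ω, c * |Real.sin ((k - A.kF ω) / 2)| ≤ |ev hh μ k a|) ∨
      c ≤ |ev hh μ k a| := by
  obtain ⟨C, hC, r, hr, hA⟩ := A.exists_radius
  obtain ⟨g, hg, hgap⟩ := A.exists_gap hh hr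
  obtain ⟨c₁, hc₁, hc₁v⟩ : ∃ c > 0, ∀ ω, c ≤ |A.v ω| := by
    rcases isEmpty_or_nonempty (Fin N) with hN | hN
    · exact ⟨1, one_pos, fun ω => hN.elim ω⟩
    · obtain ⟨ω₀, hω₀⟩ := Finite.exists_min fun ω => |A.v ω|
      exact ⟨_, abs_pos.2 (A.velocity_ne_zero ω₀), hω₀⟩
  refine ⟨min (min c₁ A.Δ) g, lt_min (lt_min hc₁ A.Δ_pos) hg, fun k a => ?_⟩
  by_cases hk : ∀ ω, ∀ n : ℤ, r ≤ |k + 2 * Real.pi * n - A.kF ω|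
  · exact Or.inr ((min_le_right _ _).trans (hgap k hk a))
  · push Not at hk
    obtain ⟨ω, n, hn⟩ := hk
    obtain ⟨h1, h2⟩ := hA ω
    obtain ⟨hI, _, hq⟩ := h2 _ hn
    obtain ⟨a₀, ha₀, hother⟩ := A.exists_band hh ω hI
    rw [ev_add_two_pi] at ha₀ hother
    by_cases haa : a = a₀
    · subst haa
      refine Or.inl ⟨ω, ?_⟩
      set q := k + 2 * Real.pi * n - A.kF ω with hqdef
      have hs : |Real.sin ((k - A.kF ω) / 2)| ≤ |q| / 2 := by
        have e1 : (k - A.kF ω) / 2 = q / 2 - n * Real.pi := by rw [hqdef]; ring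
        have e2 : |Real.sin (q / 2 - n * Real.pi)| = |Real.sin (q / 2)| := by
          rw [Real.sin_sub_int_mul_pi, abs_mul]; simp
        rw [e1, e2]
        have := Real.abs_sin_le_abs (x := q / 2)
        rwa [abs_div, abs_two] at this
      rw [ha₀]
      have h3 : |A.v ω| * |q| - C * q ^ 2 ≤ |A.e ω (k + 2 * Real.pi * n) - μ| := by
        rw [← abs_mul]
        have := abs_sub_abs_le_abs_sub (A.v ω * q) (A.e ω (k + 2 * Real.pi * n) - μ)
        rw [abs_sub_comm (A.v ω * q)] at this
        linarith
      have h4 : C * q ^ 2 ≤ |A.v ω| / 4 * |q| := by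
        rw [← sq_abs, pow_two, ← mul_assoc]
        refine mul_le_mul_of_nonneg_right (le_trans ?_ h1) (abs_nonneg _)
        exact mul_le_mul_of_nonneg_left hn.le hC
      have h5 : min (min c₁ A.Δ) g ≤ |A.v ω| :=
        (min_le_left _ _).trans ((min_le_left _ _).trans (hc₁v ω))
      have h6 : min (min c₁ A.Δ) g * |Real.sin ((k - A.kF ω) / 2)| ≤ |A.v ω| * (|q| / 2) :=
        mul_le_mul h5 hs (abs_nonneg _) (abs_nonneg _)
      nlinarith [abs_nonneg (A.v ω), abs_nonneg q, mul_nonneg (abs_nonneg (A.v ω)) (abs_nonneg q)]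
    · exact Or.inr ((min_le_left _ _).trans ((min_le_right _ _).trans (hother a haa)))

lemma LowEnergySpectrum.exists_weight_bound {N : ℕ} (A : LowEnergySpectrum h μ N) :
    ∃ C ≥ 0, ∀ k, (∀ ω, ∀ n : ℤ, k + 2 * Real.pi * n ≠ A.kF ω) → ∀ a,
      |ev hh μ k a| ^ (-(1 / 2) : ℝ) ≤ C * fermiWeight μ A k := by
  obtain ⟨c, hc, hA⟩ := A.exists_lower_bound hh
  refine ⟨c ^ (-(1 / 2) : ℝ), by positivity, fun k hk a => ?_⟩
  have hsum : 0 ≤ ∑ ω, |Real.sin ((k - A.kF ω) / 2)| ^ (-(1 / 2) : ℝ) :=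
    Finset.sum_nonneg fun _ _ => by positivity
  rcases hA k a with ⟨ω, hω⟩ | hca
  · have hs : 0 < |Real.sin ((k - A.kF ω) / 2)| := by
      rw [abs_pos]
      intro h0
      obtain ⟨n, hn⟩ := Real.sin_eq_zero_iff.1 h0
      apply hk ω (-n)
      push_cast; linarith
    calc |ev hh μ k a| ^ (-(1 / 2) : ℝ)
        ≤ (c * |Real.sin ((k - A.kF ω) / 2)|) ^ (-(1 / 2) : ℝ) :=
          Real.rpow_le_rpow_of_nonpos (by positivity) hω (by norm_num)
      _ = c ^ (-(1 / 2) : ℝ) * |Real.sin ((k - A.kF ω) / 2)| ^ (-(1 / 2) : ℝ) :=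
          Real.mul_rpow hc.le hs.le
      _ ≤ _ := by
          refine mul_le_mul_of_nonneg_left ?_ (by positivity)
          have := Finset.single_le_sum (f := fun ω => |Real.sin ((k - A.kF ω) / 2)| ^ (-(1 / 2) : ℝ))
            (fun i _ => by positivity) (Finset.mem_univ ω)
          rw [fermiWeight]; linarith
  · calc |ev hh μ k a| ^ (-(1 / 2) : ℝ) ≤ c ^ (-(1 / 2) : ℝ) :=
          Real.rpow_le_rpow_of_nonpos hc hca (by norm_num)
      _ ≤ _ := le_mul_of_one_le_right (by positivity) (by rw [fermiWeight]; linarith)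

/-- Write 1/(xy) = (1/x + 1/y)/(x + y). The sum x + y stays bounded below and grows with |t|, so
only one propagator at a time is singular, and the factor 1/(1+|t|) gives integrability at infinity.
-/
lemma norm_inv_mul_inv_le {E E' t p₀ c : ℝ} (hE : E ≠ 0) (hE' : E' ≠ 0) (ht : t ≠ 0)
    (ht' : t + p₀ ≠ 0) (hc : 0 < c) (hsum : c ≤ |p₀| + |E| + |E'|) :
    ‖((E : ℂ) + Complex.I * t)⁻¹ * ((E' : ℂ) + Complex.I * ((t + p₀ : ℝ) : ℂ))⁻¹‖ ≤
      3 / min c 1 * (1 + |p₀|) * (|t| ^ (-(1 / 2) : ℝ) * (1 + |t|)⁻¹ * |E| ^ (-(1 / 2) : ℝ) +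
        |t + p₀| ^ (-(1 / 2) : ℝ) * (1 + |t + p₀|)⁻¹ * |E'| ^ (-(1 / 2) : ℝ)) := by
  rw [norm_mul, norm_inv, norm_inv]
  have h1 := inv_norm_add_I_mul_le hE ht
  have h2 := inv_norm_add_I_mul_le hE' ht'
  set x := ‖(E : ℂ) + Complex.I * t‖ with hx
  set y := ‖(E' : ℂ) + Complex.I * ((t + p₀ : ℝ) : ℂ)‖ with hy
  have hx0 : 0 < x := norm_pos_iff.2 (add_I_mul_ne_zero hE t)
  have hy0 : 0 < y := norm_pos_iff.2 (add_I_mul_ne_zero hE' _)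
  have hxE : |E| ≤ x := by
    rw [hx, norm_add_I_mul]; exact Real.abs_le_sqrt (by nlinarith [sq_nonneg t])
  have hxt : |t| ≤ x := by
    rw [hx, norm_add_I_mul]; exact Real.abs_le_sqrt (by nlinarith [sq_nonneg E])
  have hyE : |E'| ≤ y := by
    rw [hy, norm_add_I_mul]; exact Real.abs_le_sqrt (by nlinarith [sq_nonneg (t + p₀)])
  have hyt : |t + p₀| ≤ y := by
    rw [hy, norm_add_I_mul]; exact Real.abs_le_sqrt (by nlinarith [sq_nonneg E'])
  have hp : |p₀| ≤ |t| + |t + p₀| := by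
    have := abs_sub (t + p₀) t
    rw [add_sub_cancel_left] at this
    linarith
  have hm : 0 < min c 1 := lt_min hc one_pos
  -- Each of |p₀|, |E| + |E'| and |t| is at most x + y; the first two together dominate c. Hence the
  -- factor 3.
  have h3 : min c 1 * (1 + |t|) ≤ 3 * (x + y) := by
    have e1 : min c 1 ≤ c := min_le_left _ _
    have e2 : min c 1 * |t| ≤ 1 * |t| := mul_le_mul_of_nonneg_right (min_le_right _ _) (abs_nonneg _)
    nlinarith
  have h4 : x⁻¹ * y⁻¹ = (x⁻¹ + y⁻¹) * (x + y)⁻¹ := by field_simp; ring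
  have h5 : (x + y)⁻¹ ≤ 3 / min c 1 * (1 + |t|)⁻¹ := by
    have : 3 / min c 1 * (1 + |t|)⁻¹ = (min c 1 * (1 + |t|) / 3)⁻¹ := by field_simp
    rw [this]
    exact inv_anti₀ (by positivity) (by linarith)
  have h6 : (1 + |t|)⁻¹ ≤ (1 + |p₀|) * (1 + |t + p₀|)⁻¹ := by
    have : (1 + |p₀|) * (1 + |t + p₀|)⁻¹ = ((1 + |t + p₀|) / (1 + |p₀|))⁻¹ := by field_simp
    rw [this]
    refine inv_anti₀ (by positivity) ?_
    rw [div_le_iff₀ (by positivity)]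
    nlinarith [abs_add_le t p₀, abs_nonneg t, abs_nonneg p₀, mul_nonneg (abs_nonneg t) (abs_nonneg p₀)]
  have h7 : (1 + |t|)⁻¹ ≤ (1 + |p₀|) * (1 + |t|)⁻¹ :=
    le_mul_of_one_le_left (by positivity) (by linarith [abs_nonneg p₀])
  rw [h4]
  calc (x⁻¹ + y⁻¹) * (x + y)⁻¹ ≤ (x⁻¹ + y⁻¹) * (3 / min c 1 * (1 + |t|)⁻¹) := by gcongr
    _ = 3 / min c 1 * (x⁻¹ * (1 + |t|)⁻¹ + y⁻¹ * (1 + |t|)⁻¹) := by ring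
    _ ≤ 3 / min c 1 * ((|t| ^ (-(1 / 2) : ℝ) * |E| ^ (-(1 / 2) : ℝ)) * ((1 + |p₀|) * (1 + |t|)⁻¹) +
        (|t + p₀| ^ (-(1 / 2) : ℝ) * |E'| ^ (-(1 / 2) : ℝ)) * ((1 + |p₀|) * (1 + |t + p₀|)⁻¹)) := by
        gcongr
    _ = _ := by ring

lemma trace_propagator_eq (ν : Fin 2) {p₀ p t k : ℝ} (h1 : ∀ a, ev hh μ k a ≠ 0)
    (h2 : ∀ a, ev hh μ (k + p) a ≠ 0) :
    (vertex h ν k (-p) * propagator h μ t k * propagator h μ (t + p₀) (k + p)).trace =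
      pairSum (shifted_isHermitian hh μ k) (shifted_isHermitian hh μ (k + p))
        (fun x y => ((x : ℂ) + Complex.I * t)⁻¹ * ((y : ℂ) + Complex.I * ((t + p₀ : ℝ) : ℂ))⁻¹)
        (vertex h ν k (-p)) := by
  rw [propagator_eq, propagator_eq,
    inv_add_smul_one (shifted_isHermitian hh μ k) _ (fun a => add_I_mul_ne_zero (h1 a) t),
    inv_add_smul_one (shifted_isHermitian hh μ (k + p)) _
      (fun a => add_I_mul_ne_zero (h2 a) (t + p₀)), trace_mul_matFun_mul_matFun]

/-- The hypothesis `hsum` prevents the two propagators from being singular at the same point. It is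
immediate for p₀ ≠ 0, and holds for p₀ = 0 if p is small and nonzero. -/
lemma integrable_correlation {N : ℕ} (A : LowEnergySpectrum h μ N) (ν : Fin 2) {p₀ p c : ℝ} (hc : 0 < c)
    (hsum : ∀ k a b, c ≤ |p₀| + |ev hh μ k a| + |ev hh μ (k + p) b|) :
    Integrable (fun κ : ℝ × ℝ => (vertex h ν κ.2 (-p) * propagator h μ κ.1 κ.2 *
      propagator h μ (κ.1 + p₀) (κ.2 + p)).trace / (2 * Real.pi : ℂ) ^ 2)
      (volume.prod (volume.restrict (Set.Ioc (-Real.pi) Real.pi))) := by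
  obtain ⟨C, hC, hW⟩ := A.exists_weight_bound hh
  set u : ℝ → ℝ := fun t => |t| ^ (-(1 / 2) : ℝ) * (1 + |t|)⁻¹ with hu
  have hu0 : ∀ t, 0 ≤ u t := fun t => by positivity
  set B : ℝ := (M : ℝ) ^ 2 * ((3 / min c 1 * (1 + |p₀|) * C) * vertexBound h) / ‖(2 * Real.pi : ℂ) ^ 2‖
  have hdom : Integrable (fun κ : ℝ × ℝ => B * ((u κ.1 + u (κ.1 + p₀)) *
      (fermiWeight μ A (κ.2 + 0) + fermiWeight μ A (κ.2 + p))))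
      (volume.prod (volume.restrict (Set.Ioc (-Real.pi) Real.pi))) :=
    ((integrable_abs_rpow_div.add (integrable_abs_rpow_div.comp_add_right p₀)).mul_prod
      ((integrableOn_fermiWeight μ A 0).add (integrableOn_fermiWeight μ A p))).const_mul B
  refine hdom.mono' ((measurable_correlation_integrand h μ ν p₀).comp
    measurable_prodMk_left).aestronglyMeasurable ?_
  have hk1 : ∀ᵐ κ : ℝ × ℝ ∂(volume.prod (volume.restrict (Set.Ioc (-Real.pi) Real.pi))),
      ∀ ω, ∀ n : ℤ, κ.2 + 0 + 2 * Real.pi * n ≠ A.kF ω :=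
    Measure.quasiMeasurePreserving_snd.ae (ae_restrict_of_ae (ae_ne_fermi μ A 0))
  have hk2 : ∀ᵐ κ : ℝ × ℝ ∂(volume.prod (volume.restrict (Set.Ioc (-Real.pi) Real.pi))),
      ∀ ω, ∀ n : ℤ, κ.2 + p + 2 * Real.pi * n ≠ A.kF ω :=
    Measure.quasiMeasurePreserving_snd.ae (ae_restrict_of_ae (ae_ne_fermi μ A p))
  have ht : ∀ᵐ κ : ℝ × ℝ ∂(volume.prod (volume.restrict (Set.Ioc (-Real.pi) Real.pi))),
      κ.1 ∈ ({0, -p₀}ᶜ : Set ℝ) :=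
    Measure.quasiMeasurePreserving_fst.ae
      (compl_mem_ae_iff.2 ((Set.toFinite {0, -p₀}).measure_zero volume))
  filter_upwards [hk1, hk2, ht] with κ h1 h2 h3
  obtain ⟨t, k⟩ := κ
  simp only [add_zero] at h1 h2 h3 ⊢
  have ht0 : t ≠ 0 := fun h => h3 (by simp [h])
  have ht1 : t + p₀ ≠ 0 := fun h => h3 (by
    have : t = -p₀ := by linarith
    simp [this])
  have he1 := A.ev_ne_zero hh h1
  have he2 := A.ev_ne_zero hh h2
  rw [norm_div, trace_propagator_eq hh μ ν he1 he2]
  have hb := norm_pairSum_le' (shifted_isHermitian hh μ k) (shifted_isHermitian hh μ (k + p))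
    (φ := fun x y => ((x : ℂ) + Complex.I * t)⁻¹ * ((y : ℂ) + Complex.I * ((t + p₀ : ℝ) : ℂ))⁻¹)
    (c := 3 / min c 1 * (1 + |p₀|) * C * ((u t + u (t + p₀)) *
      (fermiWeight μ A k + fermiWeight μ A (k + p)))) (vertex h ν k (-p)) (by
      intro a b
      refine (norm_inv_mul_inv_le (he1 a) (he2 b) ht0 ht1 hc (hsum k a b)).trans ?_
      have w1 := hW k h1 a
      have w2 := hW (k + p) h2 b
      have f1 := fermiWeight_nonneg μ A k
      have f2 := fermiWeight_nonneg μ A (k + p)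
      have hm : 0 < min c 1 := lt_min hc one_pos
      calc _ ≤ 3 / min c 1 * (1 + |p₀|) * (u t * (C * fermiWeight μ A k) +
            u (t + p₀) * (C * fermiWeight μ A (k + p))) := by
            refine mul_le_mul_of_nonneg_left ?_ (by positivity)
            exact add_le_add (mul_le_mul_of_nonneg_left w1 (hu0 _))
              (mul_le_mul_of_nonneg_left w2 (hu0 _))
        _ = 3 / min c 1 * (1 + |p₀|) * C * (u t * fermiWeight μ A k +
            u (t + p₀) * fermiWeight μ A (k + p)) := by ring
        _ ≤ _ := by
            refine mul_le_mul_of_nonneg_left ?_ (by positivity)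
            nlinarith [mul_nonneg (hu0 t) f2, mul_nonneg (hu0 (t + p₀)) f1])
  refine (div_le_div_of_nonneg_right hb (norm_nonneg _)).trans ?_
  have hm : 0 < min c 1 := lt_min hc one_pos
  have f1 := fermiWeight_nonneg μ A k
  have f2 := fermiWeight_nonneg μ A (k + p)
  have hX : 0 ≤ 3 / min c 1 * (1 + |p₀|) * C * ((u t + u (t + p₀)) *
      (fermiWeight μ A k + fermiWeight μ A (k + p))) :=
    mul_nonneg (by positivity) (mul_nonneg (add_nonneg (hu0 _) (hu0 _)) (add_nonneg f1 f2))
  calc _ ≤ (M : ℝ) ^ 2 * ((3 / min c 1 * (1 + |p₀|) * C * ((u t + u (t + p₀)) *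
      (fermiWeight μ A k + fermiWeight μ A (k + p)))) * vertexBound h) /
        ‖(2 * Real.pi : ℂ) ^ 2‖ := by
        gcongr
        exact entrySum_vertex_le h ν k (-p)
    _ = _ := by simp only [B]; ring

lemma integral_pairSum_eq (ν : Fin 2) {p₀ p k : ℝ} (h1 : ∀ a, ev hh μ k a ≠ 0)
    (h2 : ∀ a, ev hh μ (k + p) a ≠ 0) :
    ∫ t : ℝ, pairSum (shifted_isHermitian hh μ k) (shifted_isHermitian hh μ (k + p))
        (fun x y => ((x : ℂ) + Complex.I * t)⁻¹ * ((y : ℂ) + Complex.I * ((t + p₀ : ℝ) : ℂ))⁻¹)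
        (vertex h ν k (-p)) = 2 * Real.pi * lindhard hh μ ν p₀ p k := by
  have hi : ∀ a b, Integrable fun t : ℝ =>
      (((shifted_isHermitian hh μ k).eigenvalues a : ℂ) + Complex.I * t)⁻¹ *
        (((shifted_isHermitian hh μ (k + p)).eigenvalues b : ℂ) +
          Complex.I * ((t + p₀ : ℝ) : ℂ))⁻¹ :=
    fun a b => integrable_inv_mul_inv (h1 a) (h2 b) p₀
  simp only [pairSum, lindhard]
  rw [integral_finsetSum _ fun a _ => integrable_finsetSum _ fun b _ => (hi a b).mul_const _,
    Finset.mul_sum]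
  refine Finset.sum_congr rfl fun a _ => ?_
  rw [integral_finsetSum _ fun b _ => (hi a b).mul_const _, Finset.mul_sum]
  refine Finset.sum_congr rfl fun b _ => ?_
  have := integral_inv_mul_inv (E := (shifted_isHermitian hh μ k).eigenvalues a)
    (E' := (shifted_isHermitian hh μ (k + p)).eigenvalues b) (h1 a) (h2 b) p₀
  rw [integral_mul_const, this]
  ring

/-- Fubini with the frequency integrated first, for almost every k, namely where no level vanishes
at k or at k + p. -/
lemma correlation_eq {N : ℕ} (A : LowEnergySpectrum h μ N) (ν : Fin 2) {p₀ p c : ℝ} (hc : 0 < c)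
    (hsum : ∀ k a b, c ≤ |p₀| + |ev hh μ k a| + |ev hh μ (k + p) b|) :
    IntegrableOn (lindhard hh μ ν p₀ p) (Set.Ioc (-Real.pi) Real.pi) ∧
    correlation h μ ν p₀ p =
      -(∫ k in Set.Ioc (-Real.pi) Real.pi, lindhard hh μ ν p₀ p k) / (2 * Real.pi) := by
  have hint := integrable_correlation hh μ A ν hc hsum
  have hae : (fun k => ∫ t : ℝ, (vertex h ν k (-p) * propagator h μ t k *
      propagator h μ (t + p₀) (k + p)).trace / (2 * Real.pi : ℂ) ^ 2)
      =ᵐ[volume.restrict (Set.Ioc (-Real.pi) Real.pi)]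
      fun k => lindhard hh μ ν p₀ p k / (2 * Real.pi) := by
    filter_upwards [ae_restrict_of_ae (ae_ne_fermi μ A 0), ae_restrict_of_ae (ae_ne_fermi μ A p)]
      with k h1 h2
    simp only [add_zero] at h1
    have he1 := A.ev_ne_zero hh h1
    have he2 := A.ev_ne_zero hh h2
    simp only [trace_propagator_eq hh μ ν he1 he2]
    rw [integral_div, integral_pairSum_eq hh μ ν he1 he2]
    have : (Real.pi : ℂ) ≠ 0 := by exact_mod_cast Real.pi_ne_zero
    field_simp
  have hpi : (2 * Real.pi : ℂ) ≠ 0 := by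
    have : (Real.pi : ℂ) ≠ 0 := by exact_mod_cast Real.pi_ne_zero
    simp [this]
  constructor
  · have h1 := ((hint.integral_prod_right).congr hae).mul_const (2 * Real.pi : ℂ)
    refine h1.congr (Filter.Eventually.of_forall fun k => ?_)
    simp only
    rw [div_mul_cancel₀ _ hpi]
  · rw [correlation, Measure.volume_eq_prod, ← Measure.prod_restrict, Measure.restrict_univ,
      integral_prod_symm _ hint, integral_congr_ae hae, integral_div]
    ring

end
end LinearResponse
end

noncomputable section
namespace LinearResponse

open MeasureTheory

/-! ### Occupation numbers -/

lemma occ_nonneg (x : ℝ) : 0 ≤ occ x := by unfold occ; split_ifs <;> norm_num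

lemma occ_le_one (x : ℝ) : occ x ≤ 1 := by unfold occ; split_ifs <;> norm_num

lemma abs_occ_sub_le (x y : ℝ) : |occ x - occ y| ≤ 1 := by
  rw [abs_le]
  constructor <;> linarith [occ_nonneg x, occ_nonneg y, occ_le_one x, occ_le_one y]

lemma abs_le_abs_sub_of_occ_ne {x y : ℝ} (h : occ x ≠ occ y) : |x| ≤ |x - y| ∧ |y| ≤ |x - y| := by
  unfold occ at h
  split_ifs at h with h1 h2 h2
  · exact absurd rfl h
  · rw [abs_of_neg h1, abs_of_nonneg (not_lt.1 h2), abs_of_neg (by linarith [not_lt.1 h2])]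
    constructor <;> linarith [not_lt.1 h2]
  · rw [abs_of_neg h2, abs_of_nonneg (not_lt.1 h1), abs_of_pos (by linarith [not_lt.1 h1])]
    constructor <;> linarith [not_lt.1 h1]
  · exact absurd rfl h

/-- A perturbation by at most half of |y| cannot change the sign; for y = 0 it forces x = 0. -/
lemma occ_eq_occ_of_abs_sub_le {x y : ℝ} (h : |x - y| ≤ |y| / 2) : occ x = occ y := by
  by_contra hne
  have h1 := (abs_le_abs_sub_of_occ_ne hne).2
  have h2 : |y| = 0 := by linarith [abs_nonneg y]
  have h3 : |x - y| ≤ 0 := by linarith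
  rw [abs_eq_zero] at h2
  have h4 : x - y = 0 := abs_eq_zero.1 (le_antisymm h3 (abs_nonneg _))
  apply hne
  rw [show x = y by linarith]

lemma measurable_occ : Measurable occ :=
  Measurable.ite measurableSet_Iio measurable_const measurable_const

lemma setIntegral_occ {v R p : ℝ} (hv : v ≠ 0) (hp : |p| ≤ R) :
    ∫ q in Set.Ioc (-R) R, occ (v * (q + p)) = R - v / |v| * p := by
  rw [abs_le] at hp
  rcases lt_or_gt_of_ne hv with h | h
  · have h1 : (fun q : ℝ => occ (v * (q + p))) = (Set.Ioi (-p)).indicator fun _ => (1 : ℝ) := by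
      ext q
      by_cases hq : -p < q
      · rw [Set.indicator_of_mem (Set.mem_Ioi.2 hq), occ,
          if_pos (mul_neg_of_neg_of_pos h (by linarith))]
      · rw [Set.indicator_of_notMem (by simpa using hq), occ,
          if_neg (not_lt.2 (mul_nonneg_of_nonpos_of_nonpos h.le (by linarith)))]
    rw [h1, setIntegral_indicator measurableSet_Ioi]
    have h2 : Set.Ioc (-R) R ∩ Set.Ioi (-p) = Set.Ioc (-p) R := by
      ext x; simp only [Set.mem_inter_iff, Set.mem_Ioc, Set.mem_Ioi]
      constructor
      · rintro ⟨⟨_, h⟩, h'⟩; exact ⟨h', h⟩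
      · rintro ⟨h, h'⟩; exact ⟨⟨by linarith, h'⟩, h⟩
    rw [h2, setIntegral_const, Measure.real, Real.volume_Ioc, ENNReal.toReal_ofReal (by linarith),
      abs_of_neg h, div_neg, div_self hv]
    simp
  · have h1 : (fun q : ℝ => occ (v * (q + p))) = (Set.Iio (-p)).indicator fun _ => (1 : ℝ) := by
      ext q
      by_cases hq : q < -p
      · rw [Set.indicator_of_mem (Set.mem_Iio.2 hq), occ,
          if_pos (mul_neg_of_pos_of_neg h (by linarith))]
      · rw [Set.indicator_of_notMem (by simpa using hq), occ,
          if_neg (not_lt.2 (mul_nonneg h.le (by linarith)))]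
    rw [h1, setIntegral_indicator measurableSet_Iio]
    have h2 : (Set.Ioc (-R) R ∩ Set.Iio (-p) : Set ℝ) =ᵐ[volume] Set.Ioc (-R) (-p) := by
      have h3 : Set.Ioc (-R) R ∩ Set.Iio (-p) = Set.Ioo (-R) (-p) := by
        ext x; simp only [Set.mem_inter_iff, Set.mem_Ioc, Set.mem_Iio, Set.mem_Ioo]
        constructor
        · rintro ⟨⟨h, _⟩, h'⟩; exact ⟨h, h'⟩
        · rintro ⟨h, h'⟩; exact ⟨⟨h, by linarith⟩, h'⟩
      rw [h3]
      exact Ioo_ae_eq_Ioc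
    rw [setIntegral_congr_set h2, setIntegral_const, Measure.real, Real.volume_Ioc,
      ENNReal.toReal_ofReal (by linarith), abs_of_pos h, div_self hv]
    simp; ring

/-! ### Chiral terms -/

/-- The contribution of a linear band of velocity `v` to `lindhard`, at distance `q` from the
Fermi point. -/
def chiralTerm (ν : Fin 2) (v p₀ p q : ℝ) : ℂ :=
  ((v ^ (ν : ℕ) : ℝ) : ℂ) * ((occ (v * q) - occ (v * (q + p)) : ℝ) : ℂ) /
    (-(v * p) - Complex.I * p₀)

lemma occ_mul_eq {v p q : ℝ} (hq : |p| < |q|) : occ (v * q) = occ (v * (q + p)) := by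
  by_contra hne
  have h1 := (abs_le_abs_sub_of_occ_ne hne).1
  rw [show v * q - v * (q + p) = v * -p by ring, abs_mul, abs_mul, abs_neg] at h1
  have hv : v ≠ 0 := by rintro rfl; simp at hne
  have := le_of_mul_le_mul_left h1 (abs_pos.2 hv)
  linarith

lemma abs_le_of_occ_mul_ne {v p q : ℝ} (hne : occ (v * q) ≠ occ (v * (q + p))) :
    |q| ≤ |p| ∧ |q + p| ≤ |p| := by
  have h1 := abs_le_abs_sub_of_occ_ne hne
  rw [show v * q - v * (q + p) = v * -p by ring, abs_mul, abs_mul, abs_mul, abs_neg] at h1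
  have hv : v ≠ 0 := by rintro rfl; simp at hne
  exact ⟨le_of_mul_le_mul_left h1.1 (abs_pos.2 hv), le_of_mul_le_mul_left h1.2 (abs_pos.2 hv)⟩

lemma chiralTerm_eq_zero {ν : Fin 2} {v p₀ p q : ℝ} (hq : |p| < |q|) :
    chiralTerm ν v p₀ p q = 0 := by
  rw [chiralTerm, occ_mul_eq hq]; simp

lemma integrableOn_occ_mul (v p R : ℝ) :
    IntegrableOn (fun q => occ (v * (q + p))) (Set.Ioc (-R) R) := by
  refine Measure.integrableOn_of_bounded (M := 1) (by simp)
    (measurable_occ.comp (by fun_prop)).aestronglyMeasurable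
    (Filter.Eventually.of_forall fun q => ?_)
  rw [Real.norm_of_nonneg (occ_nonneg _)]; exact occ_le_one _

/-- The occupied half-lines for q and q + p differ by an interval of signed length (v/|v|) p, while
the denominator does not depend on q. This is the source of the leading term. -/
lemma setIntegral_chiralTerm (ν : Fin 2) {v p₀ p : ℝ} (hv : v ≠ 0) (hp : |p| ≤ Real.pi) :
    IntegrableOn (chiralTerm ν v p₀ p) (Set.Ioc (-Real.pi) Real.pi) ∧
    ∫ q in Set.Ioc (-Real.pi) Real.pi, chiralTerm ν v p₀ p q =
      -(((v ^ (ν : ℕ) / |v| : ℝ) : ℂ) * ((v * p : ℂ) / (v * p + Complex.I * p₀))) := by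
  have h0 := integrableOn_occ_mul v 0 Real.pi
  have h1 := integrableOn_occ_mul v p Real.pi
  simp only [add_zero] at h0
  have h2 : ∫ q in Set.Ioc (-Real.pi) Real.pi, (occ (v * q) - occ (v * (q + p))) = v / |v| * p := by
    rw [integral_sub h0 h1, setIntegral_occ hv hp]
    have := setIntegral_occ (R := Real.pi) (p := 0) hv (by simp [Real.pi_pos.le])
    simp only [add_zero, mul_zero, sub_zero] at this
    rw [this]; ring
  constructor
  · exact (((h0.sub h1).ofReal (𝕜 := ℂ)).const_mul _).div_const _
  · simp only [chiralTerm]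
    rw [integral_div, integral_const_mul, integral_complex_ofReal, h2]
    have : (-(v * p : ℂ) - Complex.I * p₀) = -(v * p + Complex.I * p₀) := by ring
    rw [this, div_neg, mul_div_assoc, neg_inj]
    push_cast
    ring

/-! ### The position relative to a Fermi point -/

/-- The representative in `(-π, π]` of `k - c` modulo `2π`. -/
def relPos (c k : ℝ) : ℝ := toIocMod Real.two_pi_pos (c - Real.pi) k - c

lemma exists_relPos_eq (c k : ℝ) : ∃ n : ℤ, relPos c k = k + 2 * Real.pi * n - c := by
  refine ⟨-toIocDiv Real.two_pi_pos (c - Real.pi) k, ?_⟩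
  rw [relPos, toIocMod, zsmul_eq_mul]
  push_cast; ring

lemma abs_relPos_le (c k : ℝ) : |relPos c k| ≤ Real.pi := by
  have := toIocMod_mem_Ioc Real.two_pi_pos (c - Real.pi) k
  rw [abs_le, relPos]
  constructor <;> linarith [this.1, this.2]

/-- `relPos` is periodic, and on the period centred at c it is just k - c. -/
lemma integral_comp_relPos {E : Type*} [NormedAddCommGroup E] [NormedSpace ℝ E] (c : ℝ)
    (F : ℝ → E) (hF : IntegrableOn F (Set.Ioc (-Real.pi) Real.pi)) :
    IntegrableOn (fun k => F (relPos c k)) (Set.Ioc (-Real.pi) Real.pi) ∧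
    ∫ k in Set.Ioc (-Real.pi) Real.pi, F (relPos c k) =
      ∫ q in Set.Ioc (-Real.pi) Real.pi, F q := by
  have hpi : -Real.pi ≤ Real.pi := by linarith [Real.pi_pos]
  have hper : Function.Periodic (fun k => F (relPos c k)) (2 * Real.pi) := by
    intro k; simp only [relPos, toIocMod_add_right]
  have hcongr : Set.EqOn (fun k => F (k - c)) (fun k => F (relPos c k))
      (Set.Ioc (-Real.pi + c) (Real.pi + c)) := by
    intro k hk
    simp only [relPos]
    rw [(toIocMod_eq_self Real.two_pi_pos).2]
    constructor <;> linarith [hk.1, hk.2]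
  have h1 : IntervalIntegrable F volume (-Real.pi) Real.pi :=
    (intervalIntegrable_iff_integrableOn_Ioc_of_le hpi).2 hF
  have h2 := h1.comp_sub_right c
  have h3 : IntervalIntegrable (fun k => F (relPos c k)) volume (-Real.pi + c) (Real.pi + c) := by
    refine h2.congr ?_
    rw [Set.uIoc_of_le (by linarith)]
    exact hcongr
  have e : Real.pi + c = -Real.pi + c + 2 * Real.pi := by ring
  constructor
  · rw [← intervalIntegrable_iff_integrableOn_Ioc_of_le hpi]
    exact hper.intervalIntegrable (by positivity) (by rwa [← e]) _ _
  · rw [← intervalIntegral.integral_of_le hpi, ← intervalIntegral.integral_of_le hpi]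
    have h4 := hper.intervalIntegral_add_eq (-Real.pi) (-Real.pi + c)
    rw [show -Real.pi + 2 * Real.pi = Real.pi by ring, ← e] at h4
    rw [h4]
    have h5 : ∫ k in (-Real.pi + c)..(Real.pi + c), F (relPos c k) =
        ∫ k in (-Real.pi + c)..(Real.pi + c), F (k - c) := by
      rw [intervalIntegral.integral_of_le (by linarith), intervalIntegral.integral_of_le (by linarith)]
      exact (setIntegral_congr_fun measurableSet_Ioc hcongr).symm
    rw [h5, intervalIntegral.integral_comp_sub_right]
    congr 1 <;> ring

/-! ### Bounds for single pairs of levels -/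

lemma norm_occ_div_le {x y p₀ D : ℝ} (hD : 0 < D) (h : occ x ≠ occ y → D ≤ max |x - y| |p₀|) :
    ‖((occ x - occ y : ℝ) : ℂ) / (x - y - Complex.I * p₀)‖ ≤ 1 / D := by
  by_cases hxy : occ x = occ y
  · rw [hxy, sub_self]; simp [hD.le]
  · have h1 : D ≤ ‖(x : ℂ) - y - Complex.I * p₀‖ := by
      refine (h hxy).trans (max_le ?_ ?_)
      · have := Complex.abs_re_le_norm ((x : ℂ) - y - Complex.I * p₀)
        simpa using this
      · have := Complex.abs_im_le_norm ((x : ℂ) - y - Complex.I * p₀)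
        simpa using this
    rw [norm_div, Complex.norm_real, Real.norm_eq_abs]
    exact div_le_div₀ zero_le_one (abs_occ_sub_le x y) hD h1

lemma norm_sum_sum_sub_le {M : ℕ} (t : Fin M → Fin M → ℂ) (a₀ b₀ : Fin M) {B : ℝ} (hB : 0 ≤ B)
    (ht : ∀ a b, (a, b) ≠ (a₀, b₀) → ‖t a b‖ ≤ B) :
    ‖∑ a, ∑ b, t a b - t a₀ b₀‖ ≤ (M : ℝ) ^ 2 * B := by
  have h1 : ∑ a, ∑ b, t a b = ∑ x : Fin M × Fin M, t x.1 x.2 := by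
    rw [Fintype.sum_prod_type]
  have h2 : ∑ x : Fin M × Fin M, t x.1 x.2 - t a₀ b₀ =
      ∑ x : Fin M × Fin M, (if x = (a₀, b₀) then 0 else t x.1 x.2) := by
    have h3 : ∀ x : Fin M × Fin M, (if x = (a₀, b₀) then 0 else t x.1 x.2) =
        t x.1 x.2 - (if x = (a₀, b₀) then t a₀ b₀ else 0) := by
      intro x
      split_ifs with hx
      · simp [hx]
      · simp
    simp only [h3, Finset.sum_sub_distrib, Finset.sum_ite_eq', Finset.mem_univ, if_true]
  rw [h1, h2]
  refine (norm_sum_le _ _).trans ?_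
  have h3 : ∀ x ∈ (Finset.univ : Finset (Fin M × Fin M)),
      ‖(if x = (a₀, b₀) then 0 else t x.1 x.2)‖ ≤ B := by
    intro x _
    split_ifs with hx
    · simpa using hB
    · exact ht _ _ hx
  refine (Finset.sum_le_card_nsmul _ _ _ h3).trans (le_of_eq ?_)
  simp [pow_two]

/-! ### Matrix elements between two eigenbases -/

section Pair
variable {M : ℕ} {A B : Matrix (Fin M) (Fin M) ℂ} (hA : A.IsHermitian) (hB : B.IsHermitian)

/-- The gap is used twice: once to make the overlap O(A - B), once in the denominator. In the second
place D may be g, for bounds uniform in p₀, or |p₀|, for bounds proportional to 1/|p₀|. -/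
lemma norm_pair_le {p₀ g D : ℝ} (hg : 0 < g) (hD : 0 < D) (hDg : D ≤ max g |p₀|)
    (J : Matrix (Fin M) (Fin M) ℂ) (a b : Fin M)
    (hgap : occ (hA.eigenvalues a) ≠ occ (hB.eigenvalues b) →
      g ≤ |hA.eigenvalues a - hB.eigenvalues b|) :
    ‖((occ (hA.eigenvalues a) - occ (hB.eigenvalues b) : ℝ) : ℂ) /
      (hA.eigenvalues a - hB.eigenvalues b - Complex.I * p₀) *
      (overlap hA hB a b * ((eigU hB)ᴴ * J * eigU hA) b a)‖ ≤
      entrySum (A - B) * entrySum J / (g * D) := by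
  by_cases hne : occ (hA.eigenvalues a) = occ (hB.eigenvalues b)
  · rw [hne, sub_self]
    simp only [Complex.ofReal_zero, zero_div, zero_mul, norm_zero]
    exact div_nonneg (mul_nonneg (entrySum_nonneg _) (entrySum_nonneg _)) (by positivity)
  · have h1 := hgap hne
    have h2 := norm_occ_div_le (x := hA.eigenvalues a) (y := hB.eigenvalues b) (p₀ := p₀) hD
      fun _ => hDg.trans (max_le_max h1 le_rfl)
    have h3 := abs_sub_mul_norm_overlap_le hA hB a b
    have h4 := norm_conj_eigU_mul_le hB hA J b a
    have h5 : ‖overlap hA hB a b‖ ≤ entrySum (A - B) / g := by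
      rw [le_div_iff₀ hg, mul_comm]
      exact (mul_le_mul_of_nonneg_right h1 (norm_nonneg _)).trans h3
    rw [norm_mul, norm_mul]
    calc _ ≤ 1 / D * (entrySum (A - B) / g * entrySum J) := by
          refine mul_le_mul h2 (mul_le_mul h5 h4 (norm_nonneg _) ?_) (by positivity) (by positivity)
          exact div_nonneg (entrySum_nonneg _) hg.le
      _ = _ := by field_simp

/-- The rows of the overlap matrix are unit vectors, and the entries other than b₀ are small by the
gap. So the deficit is quadratic in A - B. -/
lemma one_sub_normSq_overlap_le {g : ℝ} (hg : 0 < g) (a₀ b₀ : Fin M)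
    (hgap : ∀ b, b ≠ b₀ → g ≤ |hA.eigenvalues a₀ - hB.eigenvalues b|) :
    1 - ‖overlap hA hB a₀ b₀‖ ^ 2 ≤ M * (entrySum (A - B) / g) ^ 2 := by
  have h1 := sum_normSq_overlap hA hB a₀
  rw [← Finset.sum_erase_add _ _ (Finset.mem_univ b₀)] at h1
  have h2 : ∀ b ∈ Finset.univ.erase b₀, ‖overlap hA hB a₀ b‖ ^ 2 ≤ (entrySum (A - B) / g) ^ 2 := by
    intro b hb
    have h3 := abs_sub_mul_norm_overlap_le hA hB a₀ b
    refine pow_le_pow_left₀ (norm_nonneg _) ?_ 2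
    rw [le_div_iff₀ hg, mul_comm]
    exact (mul_le_mul_of_nonneg_right (hgap b (Finset.ne_of_mem_erase hb)) (norm_nonneg _)).trans h3
  have h4 := Finset.sum_le_card_nsmul _ _ _ h2
  have h5 : ((Finset.univ.erase b₀).card : ℝ) ≤ M := by
    exact_mod_cast (Finset.card_le_univ _).trans (by simp)
  rw [nsmul_eq_mul] at h4
  have h6 := mul_le_mul_of_nonneg_right h5 (sq_nonneg (entrySum (A - B) / g))
  linarith

lemma conj_vertex_zero (a b : Fin M) :
    ((eigU hB)ᴴ * (1 : Matrix (Fin M) (Fin M) ℂ) * eigU hA) b a = star (overlap hA hB a b) := by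
  rw [mul_one, ← overlap_conjTranspose, overlap]

lemma conj_eigU_sub_apply' (a b : Fin M) : ((eigU hB)ᴴ * (A - B) * eigU hA) b a =
    ((hA.eigenvalues a : ℂ) - hB.eigenvalues b) * star (overlap hA hB a b) := by
  have := conj_eigU_sub_apply hB hA b a
  rw [← overlap_conjTranspose, ← neg_sub A B, Matrix.mul_neg, Matrix.neg_mul, Matrix.neg_apply] at *
  linear_combination -this

end Pair

end LinearResponse
end

noncomputable section
namespace LinearResponse

open MeasureTheory

/-! ### Pointwise comparison with the chiral terms -/

lemma norm_one_sub_phase_add_le {p : ℝ} (hp : |p| ≤ 1) :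
    ‖1 - phase p + Complex.I * p‖ ≤ p ^ 2 := by
  have := Complex.norm_exp_sub_one_sub_id_le (x := Complex.I * p) (by simpa using hp)
  rw [show 1 - phase p + Complex.I * p = -(Complex.exp (Complex.I * p) - 1 - Complex.I * p) by
    rw [phase]; ring, norm_neg]
  refine this.trans (le_of_eq ?_)
  rw [norm_mul, Complex.norm_I, one_mul, Complex.norm_real, Real.norm_eq_abs, sq_abs]

lemma half_abs_le_norm_one_sub_phase {p : ℝ} (hp : |p| ≤ 1 / 2) : |p| / 2 ≤ ‖1 - phase p‖ := by
  have h1 := norm_one_sub_phase_add_le (hp.trans (by norm_num))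
  have h2 : ‖Complex.I * (p : ℂ)‖ = |p| := by simp
  have h3 := norm_sub_le_norm_add (Complex.I * (p : ℂ)) (1 - phase p)
  rw [add_comm] at h3
  have h4 : p ^ 2 ≤ |p| / 2 := by
    rw [← sq_abs]; nlinarith [abs_nonneg p]
  linarith

/-- The real parts alone bound both denominators below by multiples of |v||p|, hence uniformly in
p₀. Against them stand an O(p) error in the numerator and an O(p²) error in the denominator, so the
difference is O(1). -/
lemma norm_chiral_diff_le {v C K p p₀ d w : ℝ} {c : ℂ} (hv : v ≠ 0) (hC : 0 ≤ C)
    (hp : p ≠ 0) (hCp : C * |p| ≤ |v| / 8) (hd : |d + v * p| ≤ 2 * C * p ^ 2)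
    (hc : ‖c - w‖ ≤ K * |p|) :
    ‖c / (d - Complex.I * p₀) - w / (-(v * p) - Complex.I * p₀)‖ ≤
      2 * K / |v| + |w| * (4 * C / v ^ 2) := by
  have hp' := abs_pos.2 hp
  have hv' := abs_pos.2 hv
  have hd1 : |d + v * p| ≤ |v| * |p| / 2 := by
    refine hd.trans ?_
    rw [← sq_abs]
    nlinarith
  have hd2 : |v| * |p| / 2 ≤ |d| := by
    have h1 := abs_sub_abs_le_abs_sub (v * p) (-d)
    rw [abs_neg, abs_mul, sub_neg_eq_add, add_comm (v * p)] at h1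
    linarith
  have hn1 : |v| * |p| / 2 ≤ ‖(d : ℂ) - Complex.I * p₀‖ := by
    refine hd2.trans ?_
    have := Complex.abs_re_le_norm ((d : ℂ) - Complex.I * p₀)
    simpa using this
  have hn2 : |v| * |p| ≤ ‖(-(v * p) - Complex.I * p₀ : ℂ)‖ := by
    have := Complex.abs_re_le_norm (-(v * p) - Complex.I * p₀ : ℂ)
    simpa [abs_mul] using this
  have hpos1 : 0 < ‖(d : ℂ) - Complex.I * p₀‖ := lt_of_lt_of_le (by positivity) hn1
  have hpos2 : 0 < ‖(-(v * p) - Complex.I * p₀ : ℂ)‖ := lt_of_lt_of_le (by positivity) hn2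
  have hne1 := norm_pos_iff.1 hpos1
  have hne2 := norm_pos_iff.1 hpos2
  have key : c / (d - Complex.I * p₀) - w / (-(v * p) - Complex.I * p₀) =
      (c - w) / (d - Complex.I * p₀) +
      w * (-((d + v * p : ℝ) : ℂ)) / ((d - Complex.I * p₀) * (-(v * p) - Complex.I * p₀)) := by
    have e1 : (w : ℂ) / (-(v * p) - Complex.I * p₀) = w / (d - Complex.I * p₀) -
        w * (-((d + v * p : ℝ) : ℂ)) / ((d - Complex.I * p₀) * (-(v * p) - Complex.I * p₀)) := by
      rw [div_sub_div _ _ hne1 (mul_ne_zero hne1 hne2), div_eq_div_iff hne2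
        (mul_ne_zero hne1 (mul_ne_zero hne1 hne2))]
      push_cast; ring
    rw [e1, sub_div]; ring
  rw [key]
  refine (norm_add_le _ _).trans (add_le_add ?_ ?_)
  · rw [norm_div, div_le_iff₀ hpos1]
    calc ‖c - w‖ ≤ K * |p| := hc
      _ = 2 * K / |v| * (|v| * |p| / 2) := by field_simp
      _ ≤ _ := by
        have hK : 0 ≤ K := by
          by_contra! hK
          nlinarith [norm_nonneg (c - w)]
        gcongr
  · rw [norm_div, norm_mul, norm_mul, norm_neg, Complex.norm_real, Complex.norm_real,
      Real.norm_eq_abs, Real.norm_eq_abs, mul_div_assoc]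
    refine mul_le_mul_of_nonneg_left ?_ (abs_nonneg _)
    rw [div_le_iff₀ (mul_pos hpos1 hpos2)]
    calc |d + v * p| ≤ 2 * C * p ^ 2 := hd
      _ = 4 * C / v ^ 2 * ((|v| * |p| / 2) * (|v| * |p|)) := by
        rw [← sq_abs v, ← sq_abs p]; field_simp; ring
      _ ≤ _ := by gcongr

/-- With d ≈ -vp and 1 - e^{ip} ≈ -ip the quotient tends to v: the lattice current between
neighbouring band states is the Fermi velocity up to O(p). -/
lemma norm_current_factor_sub_le {v C K p d s : ℝ} (hC : 0 ≤ C) (hp : p ≠ 0)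
    (hp1 : |p| ≤ 1 / 2) (hd : |d + v * p| ≤ 2 * C * p ^ 2) (hs0 : 0 ≤ s) (hs1 : s ≤ 1)
    (hs : 1 - s ≤ K * |p|) :
    ‖Complex.I * d / (1 - phase p) * s - v‖ ≤ (4 * C + 2 * |v| + |v| * K) * |p| := by
  have hp' := abs_pos.2 hp
  have h1 := half_abs_le_norm_one_sub_phase hp1
  have hpos : 0 < ‖1 - phase p‖ := lt_of_lt_of_le (by positivity) h1
  have hne := norm_pos_iff.1 hpos
  have e1 : Complex.I * d / (1 - phase p) - v =
      (Complex.I * ((d + v * p : ℝ) : ℂ) - v * (1 - phase p + Complex.I * p)) / (1 - phase p) := by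
    rw [eq_div_iff hne, sub_mul, div_mul_cancel₀ _ hne]
    push_cast; ring
  have h2 : ‖Complex.I * d / (1 - phase p) - v‖ ≤ (4 * C + 2 * |v|) * |p| := by
    rw [e1, norm_div, div_le_iff₀ hpos]
    have h3 : ‖Complex.I * ((d + v * p : ℝ) : ℂ) - v * (1 - phase p + Complex.I * p)‖ ≤
        2 * C * p ^ 2 + |v| * p ^ 2 := by
      refine (norm_sub_le _ _).trans (add_le_add ?_ ?_)
      · rw [norm_mul, Complex.norm_I, one_mul, Complex.norm_real]; exact hd
      · rw [norm_mul, Complex.norm_real, Real.norm_eq_abs]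
        exact mul_le_mul_of_nonneg_left
          (norm_one_sub_phase_add_le (hp1.trans (by norm_num))) (abs_nonneg _)
    refine h3.trans ?_
    calc 2 * C * p ^ 2 + |v| * p ^ 2 = (4 * C + 2 * |v|) * |p| * (|p| / 2) := by
          rw [← sq_abs p]; ring
      _ ≤ _ := by gcongr
  have e2 : Complex.I * d / (1 - phase p) * s - v =
      (Complex.I * d / (1 - phase p) - v) * s - v * ((1 - s : ℝ) : ℂ) := by push_cast; ring
  rw [e2]
  refine (norm_sub_le _ _).trans ?_
  rw [norm_mul, norm_mul, Complex.norm_real, Complex.norm_real, Complex.norm_real,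
    Real.norm_of_nonneg hs0, Real.norm_of_nonneg (by linarith : 0 ≤ 1 - s), Real.norm_eq_abs]
  calc _ ≤ (4 * C + 2 * |v|) * |p| * 1 + |v| * (K * |p|) := by gcongr
    _ = _ := by ring

/-! ### Contributions of single pairs of levels to the Lindhard integrand -/

section
variable {M : ℕ} {h : Hopping M} (hh : h.SelfAdjoint) (μ : ℝ)

/-- The contribution of one pair of levels to `lindhard`. -/
def lindhardPair (ν : Fin 2) (p₀ p k : ℝ) (a b : Fin M) : ℂ :=
  ((occ (ev hh μ k a) - occ (ev hh μ (k + p) b) : ℝ) : ℂ) /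
    (ev hh μ k a - ev hh μ (k + p) b - Complex.I * p₀) *
    (overlap (shifted_isHermitian hh μ k) (shifted_isHermitian hh μ (k + p)) a b *
      ((eigU (shifted_isHermitian hh μ (k + p)))ᴴ * vertex h ν k (-p) *
        eigU (shifted_isHermitian hh μ k)) b a)

lemma lindhard_eq_sum (ν : Fin 2) (p₀ p k : ℝ) :
    lindhard hh μ ν p₀ p k = ∑ a, ∑ b, lindhardPair hh μ ν p₀ p k a b := rfl

lemma norm_lindhardPair_le (ν : Fin 2) {p₀ p k g D : ℝ} (hg : 0 < g) (hD : 0 < D)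
    (hDg : D ≤ max g |p₀|) (a b : Fin M)
    (hgap : occ (ev hh μ k a) ≠ occ (ev hh μ (k + p) b) →
      g ≤ |ev hh μ k a - ev hh μ (k + p) b|) :
    ‖lindhardPair hh μ ν p₀ p k a b‖ ≤ hopMoment h * vertexBound h / g * |p| / D := by
  refine (norm_pair_le (shifted_isHermitian hh μ k) (shifted_isHermitian hh μ (k + p)) hg hD hDg
    (vertex h ν k (-p)) a b hgap).trans ?_
  have h1 := entrySum_shifted_sub_le h μ k (k + p)
  rw [sub_add_cancel_left, abs_neg] at h1
  have h2 := entrySum_vertex_le h ν k (-p)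
  have := entrySum_nonneg (vertex h ν k (-p))
  have := hopMoment_nonneg h
  calc _ ≤ (hopMoment h * |p|) * vertexBound h / (g * D) := by gcongr
    _ = _ := by field_simp

/-- Needs no gap: the imaginary part of the denominator is p₀. -/
lemma norm_lindhardPair_le' (ν : Fin 2) {p₀ p k : ℝ} (hp₀ : p₀ ≠ 0) (a b : Fin M) :
    ‖lindhardPair hh μ ν p₀ p k a b‖ ≤ vertexBound h / |p₀| := by
  have h2 := norm_occ_div_le (x := ev hh μ k a) (y := ev hh μ (k + p) b) (p₀ := p₀)
    (abs_pos.2 hp₀) fun _ => le_max_right _ _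
  have h3 := (norm_conj_eigU_mul_le (shifted_isHermitian hh μ (k + p)) (shifted_isHermitian hh μ k)
    (vertex h ν k (-p)) b a).trans (entrySum_vertex_le h ν k (-p))
  have h4 := norm_overlap_le (shifted_isHermitian hh μ k) (shifted_isHermitian hh μ (k + p)) a b
  rw [lindhardPair, norm_mul, norm_mul]
  calc _ ≤ 1 / |p₀| * (1 * vertexBound h) :=
        mul_le_mul h2 (mul_le_mul h4 h3 (norm_nonneg _) zero_le_one) (by positivity) (by positivity)
    _ = _ := by ring

/-- A contributing pair has levels of opposite occupation, so its energy difference is at least the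
distance of the first level from zero. A gap at k alone is enough. -/
lemma norm_lindhard_le_of_gap (ν : Fin 2) {p₀ p k g D : ℝ} (hg : 0 < g) (hD : 0 < D)
    (hDg : D ≤ max g |p₀|) (hgap : ∀ a, g ≤ |ev hh μ k a|) :
    ‖lindhard hh μ ν p₀ p k‖ ≤ (M : ℝ) ^ 2 * (hopMoment h * vertexBound h / g * |p| / D) := by
  rw [lindhard_eq_sum]
  refine (norm_sum_le _ _).trans ((Finset.sum_le_sum fun a _ => (norm_sum_le _ _).trans
    (Finset.sum_le_sum fun b _ => norm_lindhardPair_le hh μ ν hg hD hDg a b fun hne =>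
      (hgap a).trans (abs_le_abs_sub_of_occ_ne hne).1)).trans (le_of_eq ?_))
  simp only [Finset.sum_const, Finset.card_univ, Fintype.card_fin, nsmul_eq_mul]
  ring

/-- Every pair other than (a₀, b₀) contains a level at distance g from zero, which bounds its energy
difference as soon as the occupations differ. -/
lemma norm_lindhard_sub_pair_le (ν : Fin 2) {p₀ p k g D : ℝ} (hg : 0 < g) (hD : 0 < D)
    (hDg : D ≤ max g |p₀|) {a₀ b₀ : Fin M} (ha : ∀ a, a ≠ a₀ → g ≤ |ev hh μ k a|)
    (hb : ∀ b, b ≠ b₀ → g ≤ |ev hh μ (k + p) b|) :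
    ‖lindhard hh μ ν p₀ p k - lindhardPair hh μ ν p₀ p k a₀ b₀‖ ≤
      (M : ℝ) ^ 2 * (hopMoment h * vertexBound h / g * |p| / D) := by
  rw [lindhard_eq_sum]
  refine norm_sum_sum_sub_le _ a₀ b₀ ?_ fun a b hab => ?_
  · have := hopMoment_nonneg h
    have := vertexBound_nonneg h
    positivity
  · refine norm_lindhardPair_le hh μ ν hg hD hDg a b fun hne => ?_
    by_cases haa : a = a₀
    · have hbb : b ≠ b₀ := fun hbb => hab (by rw [haa, hbb])
      exact (hb b hbb).trans (abs_le_abs_sub_of_occ_ne hne).2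
    · exact (ha a haa).trans (abs_le_abs_sub_of_occ_ne hne).1

/-- By the continuity equation the current matrix element is an energy difference times the
conjugate overlap. Density and current thus take the same form with |⟨a|b⟩|², and the phases of the
eigenvectors disappear. -/
lemma lindhardPair_eq (ν : Fin 2) {p₀ p k : ℝ} (hp : phase p ≠ 1) (a b : Fin M) :
    lindhardPair hh μ ν p₀ p k a b =
      ((occ (ev hh μ k a) - occ (ev hh μ (k + p) b) : ℝ) : ℂ) *
      ((if ν = 0 then 1 else
        Complex.I * ((ev hh μ k a - ev hh μ (k + p) b : ℝ) : ℂ) / (1 - phase p)) *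
      ((‖overlap (shifted_isHermitian hh μ k) (shifted_isHermitian hh μ (k + p)) a b‖ ^ 2 : ℝ) : ℂ) /
      (((ev hh μ k a - ev hh μ (k + p) b : ℝ) : ℂ) - Complex.I * p₀)) := by
  set W := overlap (shifted_isHermitian hh μ k) (shifted_isHermitian hh μ (k + p)) a b with hW
  have hnsq : ((‖W‖ ^ 2 : ℝ) : ℂ) = W * star W := by
    rw [RCLike.star_def, Complex.mul_conj, Complex.normSq_eq_norm_sq]
  have hJ : ((eigU (shifted_isHermitian hh μ (k + p)))ᴴ * vertex h ν k (-p) *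
        eigU (shifted_isHermitian hh μ k)) b a = (if ν = 0 then 1 else
        Complex.I * ((ev hh μ k a - ev hh μ (k + p) b : ℝ) : ℂ) / (1 - phase p)) * star W := by
    fin_cases ν
    · simp only [Fin.zero_eta, Fin.isValue, vertex_zero, if_true, one_mul]
      exact conj_vertex_zero _ _ a b
    · simp only [Fin.mk_one, Fin.isValue, one_ne_zero, if_false]
      have hne : 1 - phase p ≠ 0 := sub_ne_zero.2 (Ne.symm hp)
      have h1 := vertex_smul_sub h k (-p)
      rw [neg_neg, sub_neg_eq_add, ← shifted_sub_shifted h μ] at h1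
      have h2 := congrArg (fun X => ((eigU (shifted_isHermitian hh μ (k + p)))ᴴ * X *
        eigU (shifted_isHermitian hh μ k)) b a) h1
      simp only [Matrix.mul_smul, Matrix.smul_mul, Matrix.smul_apply, smul_eq_mul] at h2
      rw [conj_eigU_sub_apply'] at h2
      have h3 : (1 - phase p) * ((eigU (shifted_isHermitian hh μ (k + p)))ᴴ * vertex h 1 k (-p) *
          eigU (shifted_isHermitian hh μ k)) b a =
          Complex.I * (((ev hh μ k a : ℂ) - ev hh μ (k + p) b) * star W) := h2
      rw [div_mul_eq_mul_div, eq_div_iff hne, mul_comm, h3]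
      push_cast; ring
  rw [lindhardPair, hJ, hnsq]
  push_cast
  ring

end

/-! ### The main pair of levels at a Fermi point -/

section
variable {M N : ℕ} {h : Hopping M} (hh : h.SelfAdjoint) {μ : ℝ} (A : LowEnergySpectrum h μ N)

/-- A bound for the deviation of the main pair of levels from the chiral term. -/
def chiralErr (M : ℕ) (L Δ C v : ℝ) : ℝ :=
  2 * (4 * C + 2 * |v| + (1 + |v|) * (M * (2 * L / Δ) ^ 2)) / |v| + (1 + |v|) * (4 * C / v ^ 2)

lemma chiralErr_nonneg {M : ℕ} {L Δ C v : ℝ} (hC : 0 ≤ C) : 0 ≤ chiralErr M L Δ C v := by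
  unfold chiralErr; positivity

/-- The band at k and at k + p has the occupations of its tangent, so the pair contributes only when
both points are within |p| of the Fermi point. There the energy difference is -vp + O(p²) and the
numerator is v^ν + O(p), which leaves an error of order one. -/
lemma LowEnergySpectrum.norm_pair_sub_chiral_le {C r : ℝ} (hC : 0 ≤ C) (ω : Fin N)
    (hCr : C * r ≤ |A.v ω| / 4)
    (hA : ∀ k, |k - A.kF ω| < r → k ∈ Set.Ioo (A.lo ω) (A.hi ω) ∧ |A.e ω k - μ| ≤ A.Δ / 2 ∧
      |A.e ω k - μ - A.v ω * (k - A.kF ω)| ≤ C * (k - A.kF ω) ^ 2)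
    (ν : Fin 2) (p₀ : ℝ) {p k : ℝ} (hp : p ≠ 0) (hp1 : |p| ≤ 1 / 2) (hpr : |p| < r / 2)
    (hk : |k - A.kF ω| < r / 2) :
    ∃ a₀ b₀, (∀ a, a ≠ a₀ → A.Δ / 2 ≤ |ev hh μ k a|) ∧
      (∀ b, b ≠ b₀ → A.Δ / 2 ≤ |ev hh μ (k + p) b|) ∧
      (|p| < |k - A.kF ω| → lindhardPair hh μ ν p₀ p k a₀ b₀ = 0) ∧
      ‖lindhardPair hh μ ν p₀ p k a₀ b₀ - chiralTerm ν (A.v ω) p₀ p (k - A.kF ω)‖ ≤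
        chiralErr M (hopMoment h) A.Δ C (A.v ω) := by
  have hr : 0 < r := by linarith [abs_nonneg p]
  have hv : A.v ω ≠ 0 := A.velocity_ne_zero ω
  have hv' := abs_pos.2 hv
  have hp' := abs_pos.2 hp
  have hΔ := A.Δ_pos
  obtain ⟨hI1, hw1, hq1⟩ := hA k (by linarith)
  have hkp : |k + p - A.kF ω| < r := by
    have := abs_add_le (k - A.kF ω) p
    rw [show k + p - A.kF ω = k - A.kF ω + p by ring]
    linarith
  obtain ⟨hI2, hw2, hq2⟩ := hA (k + p) hkp
  obtain ⟨a₀, ha₀, ha⟩ := A.exists_band hh ω hI1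
  obtain ⟨b₀, hb₀, hb⟩ := A.exists_band hh ω hI2
  set q := k - A.kF ω with hq
  have hqp : k + p - A.kF ω = q + p := by rw [hq]; ring
  rw [hqp] at hq2 hkp
  -- The quadratic error is at most half of the linear energy, as `occ_eq_occ_of_abs_sub_le`
  -- requires.
  have hsmall : ∀ x, |x| < r → C * x ^ 2 ≤ |A.v ω * x| / 2 := by
    intro x hx
    rw [abs_mul, ← sq_abs]
    have : C * |x| ≤ C * r := mul_le_mul_of_nonneg_left hx.le hC
    nlinarith [abs_nonneg x, mul_nonneg (abs_nonneg x) (abs_nonneg (A.v ω))]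
  have ho1 : occ (ev hh μ k a₀) = occ (A.v ω * q) := by
    rw [ha₀]; exact occ_eq_occ_of_abs_sub_le (hq1.trans (hsmall q (by linarith)))
  have ho2 : occ (ev hh μ (k + p) b₀) = occ (A.v ω * (q + p)) := by
    rw [hb₀]; exact occ_eq_occ_of_abs_sub_le (hq2.trans (hsmall (q + p) hkp))
  have hphase : phase p ≠ 1 := by
    intro h1
    have := half_abs_le_norm_one_sub_phase hp1
    rw [h1, sub_self, norm_zero] at this
    linarith
  refine ⟨a₀, b₀, fun a h1 => by linarith [ha a h1], fun b h1 => by linarith [hb b h1], ?_, ?_⟩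
  · intro h1
    rw [lindhardPair, ho1, ho2, occ_mul_eq h1]; simp
  · rw [lindhardPair_eq hh μ ν hphase, chiralTerm, ho1, ho2]
    by_cases hne : occ (A.v ω * q) = occ (A.v ω * (q + p))
    · rw [hne]
      simpa using chiralErr_nonneg hC
    · obtain ⟨hqa, hqb⟩ := abs_le_of_occ_mul_ne hne
      set d := ev hh μ k a₀ - ev hh μ (k + p) b₀ with hd
      set s := ‖overlap (shifted_isHermitian hh μ k) (shifted_isHermitian hh μ (k + p)) a₀ b₀‖ ^ 2
      have hs0 : 0 ≤ s := by positivity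
      have hs1 : s ≤ 1 := pow_le_one₀ (norm_nonneg _) (norm_overlap_le _ _ _ _)
      have hdp : |d + A.v ω * p| ≤ 2 * C * p ^ 2 := by
        have e1 : d + A.v ω * p = (A.e ω k - μ - A.v ω * q) -
            (A.e ω (k + p) - μ - A.v ω * (q + p)) := by rw [hd, ha₀, hb₀]; ring
        have e2 : C * q ^ 2 ≤ C * p ^ 2 := mul_le_mul_of_nonneg_left (sq_le_sq.2 hqa) hC
        have e3 : C * (q + p) ^ 2 ≤ C * p ^ 2 := mul_le_mul_of_nonneg_left (sq_le_sq.2 hqb) hC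
        rw [e1]
        refine (abs_sub _ _).trans ?_
        linarith
      -- The deficit is in fact O(p²); one factor |p| ≤ 1 is given away. The gap Δ/2 is Δ for the
      -- other levels minus Δ/2 for the band.
      have hsK : 1 - s ≤ (M * (2 * hopMoment h / A.Δ) ^ 2) * |p| := by
        have h1 := one_sub_normSq_overlap_le (shifted_isHermitian hh μ k)
          (shifted_isHermitian hh μ (k + p)) (g := A.Δ / 2) (by linarith) a₀ b₀ (by
            intro b h1
            have h2 := hb b h1
            have h3 := abs_sub_abs_le_abs_sub (ev hh μ (k + p) b) (ev hh μ k a₀)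
            rw [abs_sub_comm] at h3
            rw [← ha₀] at hw1
            change A.Δ / 2 ≤ |ev hh μ k a₀ - ev hh μ (k + p) b|
            linarith)
        refine h1.trans ?_
        have h2 := entrySum_shifted_sub_le h μ k (k + p)
        rw [sub_add_cancel_left, abs_neg] at h2
        have h3 : (entrySum (shifted h μ k - shifted h μ (k + p)) / (A.Δ / 2)) ^ 2 ≤
            (hopMoment h * |p| / (A.Δ / 2)) ^ 2 := by
          refine pow_le_pow_left₀ (div_nonneg (entrySum_nonneg _) (by linarith)) ?_ 2
          gcongr
        have h4 : (hopMoment h * |p| / (A.Δ / 2)) ^ 2 = (2 * hopMoment h / A.Δ) ^ 2 * |p| * |p| := by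
          field_simp
        have h5 : (2 * hopMoment h / A.Δ) ^ 2 * |p| * |p| ≤ (2 * hopMoment h / A.Δ) ^ 2 * |p| * 1 := by
          gcongr; linarith
        calc _ ≤ (M : ℝ) * ((2 * hopMoment h / A.Δ) ^ 2 * |p| * 1) := by
              gcongr; exact h3.trans (h4.le.trans h5)
          _ = _ := by ring
      have hCp : C * |p| ≤ |A.v ω| / 8 := by
        have : C * |p| ≤ C * (r / 2) := mul_le_mul_of_nonneg_left hpr.le hC
        linarith
      set K := (M * (2 * hopMoment h / A.Δ) ^ 2 : ℝ) with hK
      have hK0 : 0 ≤ K := by positivity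
      have hcs : ‖(if ν = 0 then 1 else Complex.I * (d : ℂ) / (1 - phase p)) * (s : ℂ) -
          ((A.v ω ^ (ν : ℕ) : ℝ) : ℂ)‖ ≤ (4 * C + 2 * |A.v ω| + (1 + |A.v ω|) * K) * |p| := by
        fin_cases ν
        · simp only [Fin.zero_eta, Fin.isValue, if_true, one_mul, pow_zero]
          rw [← Complex.ofReal_sub, Complex.norm_real, Real.norm_eq_abs, abs_sub_comm,
            abs_of_nonneg (by linarith)]
          refine hsK.trans (mul_le_mul_of_nonneg_right ?_ hp'.le)
          nlinarith [mul_nonneg (abs_nonneg (A.v ω)) hK0]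
        · simp only [Fin.mk_one, Fin.isValue, one_ne_zero, if_false, pow_one]
          refine (norm_current_factor_sub_le hC hp hp1 hdp hs0 hs1 hsK).trans
            (mul_le_mul_of_nonneg_right ?_ hp'.le)
          nlinarith
      have hmain := norm_chiral_diff_le (p₀ := p₀) hv hC hp hCp hdp hcs
      have hocc : ‖((occ (A.v ω * q) - occ (A.v ω * (q + p)) : ℝ) : ℂ)‖ ≤ 1 := by
        rw [Complex.norm_real]; exact abs_occ_sub_le _ _
      have hwv : |A.v ω ^ (ν : ℕ)| ≤ 1 + |A.v ω| := by
        fin_cases ν <;> simp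
      rw [mul_comm ((A.v ω ^ (ν : ℕ) : ℝ) : ℂ), mul_div_assoc _ ((A.v ω ^ (ν : ℕ) : ℝ) : ℂ),
        ← mul_sub, norm_mul]
      refine (mul_le_of_le_one_left (norm_nonneg _) hocc).trans (hmain.trans ?_)
      rw [chiralErr]
      gcongr

/-- The indicator function of the set of momenta at distance at most `|p|` from a Fermi point. -/
def nearInd (ω : Fin N) (p k : ℝ) : ℝ := if |relPos (A.kF ω) k| ≤ |p| then 1 else 0

lemma nearInd_nonneg (ω : Fin N) (p k : ℝ) : 0 ≤ nearInd A ω p k := by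
  unfold nearInd; split_ifs <;> norm_num

-- The error is O(|p|) everywhere plus O(1) within |p| of a Fermi point, so its integral over k is
-- O(|p|). The second bound is the same estimate with one denominator replaced by |p₀|.
set_option maxHeartbeats 800000 in
lemma LowEnergySpectrum.exists_pointwise_bound :
    ∃ C ≥ 0, ∃ r > 0, r ≤ 1 / 2 ∧ ∀ (ν : Fin 2) (p₀ p k : ℝ), p ≠ 0 → |p| < r →
      ‖lindhard hh μ ν p₀ p k - ∑ ω, chiralTerm ν (A.v ω) p₀ p (relPos (A.kF ω) k)‖ ≤
        C * |p| + C * ∑ ω, nearInd A ω p k ∧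
      (p₀ ≠ 0 → ‖lindhard hh μ ν p₀ p k‖ ≤ (C * |p| + C * ∑ ω, nearInd A ω p k) / |p₀|) := by
  obtain ⟨C₀, hC₀, r, hr, hA⟩ := A.exists_radius
  obtain ⟨r', hr'0, hr'r, hr'π⟩ : ∃ r' > 0, r' ≤ r ∧ r' ≤ Real.pi :=
    ⟨min r Real.pi, lt_min hr Real.pi_pos, min_le_left _ _, min_le_right _ _⟩
  replace hA : ∀ ω, C₀ * r' ≤ |A.v ω| / 4 ∧ ∀ k, |k - A.kF ω| < r' →
      k ∈ Set.Ioo (A.lo ω) (A.hi ω) ∧ |A.e ω k - μ| ≤ A.Δ / 2 ∧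
      |A.e ω k - μ - A.v ω * (k - A.kF ω)| ≤ C₀ * (k - A.kF ω) ^ 2 := fun ω =>
    ⟨(mul_le_mul_of_nonneg_left hr'r hC₀).trans (hA ω).1, fun k hk => (hA ω).2 k (hk.trans_le hr'r)⟩
  obtain ⟨g₀, hg₀, hgap⟩ := A.exists_gap hh (half_pos hr'0)
  obtain ⟨g, hg, hgg₀, hgΔ⟩ : ∃ g > 0, g ≤ g₀ ∧ g ≤ A.Δ / 2 :=
    ⟨min g₀ (A.Δ / 2), lt_min hg₀ (half_pos A.Δ_pos), min_le_left _ _, min_le_right _ _⟩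
  have hL := hopMoment_nonneg h
  have hVB := vertexBound_nonneg h
  set B : ℝ := (M : ℝ) ^ 2 * (hopMoment h * vertexBound h / g) with hB
  have hB0 : 0 ≤ B := by positivity
  set E : ℝ := ∑ ω, chiralErr M (hopMoment h) A.Δ C₀ (A.v ω) with hE
  have hE0 : 0 ≤ E := Finset.sum_nonneg fun _ _ => chiralErr_nonneg hC₀
  -- The summands bound, in order: gapped pairs with denominator g, gapped pairs with denominator
  -- |p₀|, the main pair minus its chiral term, and the main pair by itself.
  set C : ℝ := B / g + B + E + vertexBound h with hC
  have hBg : 0 ≤ B / g := by positivity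
  have hC0 : 0 ≤ C := by positivity
  refine ⟨C, hC0, min (r' / 2) (1 / 2), lt_min (half_pos hr'0) (by norm_num), min_le_right _ _, ?_⟩
  intro ν p₀ p k hp hpr
  have hp1 : |p| ≤ 1 / 2 := (hpr.trans_le (min_le_right _ _)).le
  replace hpr : |p| < r' / 2 := hpr.trans_le (min_le_left _ _)
  have hp' := abs_pos.2 hp
  have hind : ∀ ω, 0 ≤ nearInd A ω p k := fun ω => nearInd_nonneg A ω p k
  have hsum0 : 0 ≤ ∑ ω, nearInd A ω p k := Finset.sum_nonneg fun ω _ => hind ω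
  by_cases hfar : ∀ ω, r' / 2 ≤ |relPos (A.kF ω) k|
  · have hgk : ∀ a, g ≤ |ev hh μ k a| := by
      intro a
      refine hgg₀.trans (hgap k (fun ω n => ?_) a)
      obtain ⟨m, hm⟩ := exists_relPos_eq (A.kF ω) k
      by_cases hmn : n = m
      · rw [hmn, ← hm]; exact hfar ω
      -- Translates other than the nearest one are at distance at least 2π - π from the Fermi point.
      · have h1 : (1 : ℝ) ≤ |((n - m : ℤ) : ℝ)| := by
          rw [← Int.cast_abs]
          exact_mod_cast Int.one_le_abs (sub_ne_zero.2 hmn)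
        have h2 : k + 2 * Real.pi * n - A.kF ω =
            2 * Real.pi * ((n - m : ℤ) : ℝ) + relPos (A.kF ω) k := by
          rw [hm]; push_cast; ring
        have h3 := abs_relPos_le (A.kF ω) k
        have h4 := abs_sub_abs_le_abs_sub (2 * Real.pi * ((n - m : ℤ) : ℝ)) (-relPos (A.kF ω) k)
        rw [sub_neg_eq_add, abs_neg, abs_mul, abs_of_pos Real.two_pi_pos] at h4
        rw [h2]
        nlinarith [Real.pi_pos]
    have hz : ∑ ω, chiralTerm ν (A.v ω) p₀ p (relPos (A.kF ω) k) = 0 :=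
      Finset.sum_eq_zero fun ω _ => chiralTerm_eq_zero (hpr.trans_le (hfar ω))
    constructor
    · rw [hz, sub_zero]
      refine (norm_lindhard_le_of_gap hh μ ν hg hg (le_max_left _ _) hgk).trans ?_
      calc _ = B / g * |p| := by rw [hB]; ring
        _ ≤ C * |p| + C * 0 := by
          rw [mul_zero, add_zero]; gcongr; rw [hC]; linarith
        _ ≤ _ := by gcongr
    · intro hp₀
      refine (norm_lindhard_le_of_gap hh μ ν hg (abs_pos.2 hp₀) (le_max_right _ _) hgk).trans ?_
      calc _ = B * |p| / |p₀| := by rw [hB]; ring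
        _ ≤ _ := by
          gcongr
          have : B * |p| ≤ C * |p| := by gcongr; rw [hC]; linarith
          nlinarith [mul_nonneg hC0 hsum0]
  · push Not at hfar
    obtain ⟨ω, hω⟩ := hfar
    obtain ⟨m, hm⟩ := exists_relPos_eq (A.kF ω) k
    have hother : ∀ ω', ω' ≠ ω → r' / 2 ≤ |relPos (A.kF ω') k| := by
      intro ω' hne
      by_contra! hlt
      obtain ⟨m', hm'⟩ := exists_relPos_eq (A.kF ω') k
      rw [hm] at hω
      rw [hm'] at hlt
      have h1 := ((hA ω).2 _ (hω.trans (half_lt_self hr'0))).1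
      have h2 := ((hA ω').2 _ (hlt.trans (half_lt_self hr'0))).1
      refine A.disjoint ω ω' hne.symm _ h1 _ h2 (m' - m) ?_
      push_cast; ring
    have hsum : ∑ ω', chiralTerm ν (A.v ω') p₀ p (relPos (A.kF ω') k) =
        chiralTerm ν (A.v ω) p₀ p (relPos (A.kF ω) k) := by
      refine Finset.sum_eq_single ω (fun ω' _ hne => ?_) (by simp)
      exact chiralTerm_eq_zero (hpr.trans_le (hother ω' hne))
    have hind1 : nearInd A ω p k ≤ ∑ ω, nearInd A ω p k :=
      Finset.single_le_sum (fun ω _ => hind ω) (Finset.mem_univ ω)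
    -- Move k into the arc itself, where the band function is defined; the integrand is periodic.
    have hperr := lindhard_add_two_pi hh μ ν p₀ p k m
    set k' := k + 2 * Real.pi * m with hk'
    have hω' := hω
    rw [hm] at hω'
    obtain ⟨a₀, b₀, ha, hb, hzero, hdiff⟩ :=
      A.norm_pair_sub_chiral_le hh hC₀ ω (hA ω).1 (hA ω).2 ν p₀ hp hp1 hpr hω'
    have hEω : chiralErr M (hopMoment h) A.Δ C₀ (A.v ω) ≤ E :=
      Finset.single_le_sum (f := fun ω => chiralErr M (hopMoment h) A.Δ C₀ (A.v ω))
        (fun ω _ => chiralErr_nonneg hC₀) (Finset.mem_univ ω)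
    rw [hsum, ← hperr, hm]
    have hdiff' : ‖lindhardPair hh μ ν p₀ p k' a₀ b₀ - chiralTerm ν (A.v ω) p₀ p (k' - A.kF ω)‖ ≤
        E * nearInd A ω p k := by
      rw [nearInd, hm]
      split_ifs with hle
      · rw [mul_one]; exact hdiff.trans hEω
      · rw [hzero (not_le.1 hle), chiralTerm_eq_zero (not_le.1 hle)]; simp
    have hpair' : p₀ ≠ 0 → ‖lindhardPair hh μ ν p₀ p k' a₀ b₀‖ ≤
        vertexBound h * nearInd A ω p k / |p₀| := by
      intro hp₀
      rw [nearInd, hm]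
      split_ifs with hle
      · rw [mul_one]; exact norm_lindhardPair_le' hh μ ν hp₀ a₀ b₀
      · rw [hzero (not_le.1 hle)]; simp
    have hga : ∀ a, a ≠ a₀ → g ≤ |ev hh μ k' a| := fun a h1 => hgΔ.trans (ha a h1)
    have hgb : ∀ b, b ≠ b₀ → g ≤ |ev hh μ (k' + p) b| := fun b h1 => hgΔ.trans (hb b h1)
    constructor
    · have h1 := norm_lindhard_sub_pair_le hh μ ν (p₀ := p₀) hg hg (le_max_left _ _) hga hgb
      have h2 := norm_sub_le_norm_sub_add_norm_sub (lindhard hh μ ν p₀ p k')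
        (lindhardPair hh μ ν p₀ p k' a₀ b₀) (chiralTerm ν (A.v ω) p₀ p (k' - A.kF ω))
      have h3 : (M : ℝ) ^ 2 * (hopMoment h * vertexBound h / g * |p| / g) ≤ C * |p| := by
        calc _ = B / g * |p| := by rw [hB]; ring
          _ ≤ _ := by gcongr; rw [hC]; linarith
      have h4 : E * nearInd A ω p k ≤ C * ∑ ω, nearInd A ω p k := by
        have := hind ω
        gcongr
        rw [hC]; linarith
      exact h2.trans (add_le_add (h1.trans h3) (hdiff'.trans h4))
    · intro hp₀
      have h1 := norm_lindhard_sub_pair_le hh μ ν hg (abs_pos.2 hp₀) (le_max_right g _) hga hgb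
      have h2 := norm_le_norm_sub_add (lindhard hh μ ν p₀ p k')
        (lindhardPair hh μ ν p₀ p k' a₀ b₀)
      have h3 : (M : ℝ) ^ 2 * (hopMoment h * vertexBound h / g * |p| / |p₀|) ≤ C * |p| / |p₀| := by
        calc _ = B * |p| / |p₀| := by rw [hB]; ring
          _ ≤ _ := by gcongr; rw [hC]; linarith
      have h4 : vertexBound h * nearInd A ω p k / |p₀| ≤ C * (∑ ω, nearInd A ω p k) / |p₀| := by
        have := hind ω
        gcongr
        rw [hC]; linarith
      rw [add_div]
      exact h2.trans (add_le_add (h1.trans h3) ((hpair' hp₀).trans h4))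

end
end LinearResponse
end

noncomputable section
namespace LinearResponse

open MeasureTheory

/-! ### Estimates of the correlation -/

section
variable {M N : ℕ} {h : Hopping M} {μ : ℝ}

/-- For small p the points k and k + p cannot both be within |p|/2 of Fermi points: two different
ones are too far apart, and a common one would give |p| < |p|. So the gap applies to one of the two.
This covers the static case p₀ = 0. -/
lemma LowEnergySpectrum.exists_sum_lower_bound (hh : h.SelfAdjoint) (A : LowEnergySpectrum h μ N) :
    ∃ r > 0, ∀ p : ℝ, p ≠ 0 → |p| < r →
      ∃ c > 0, ∀ k a b, c ≤ |ev hh μ k a| + |ev hh μ (k + p) b| := by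
  obtain ⟨C₀, hC₀, r, hr, hA⟩ := A.exists_radius
  refine ⟨min r Real.pi / 2, half_pos (lt_min hr Real.pi_pos), fun p hp hpr => ?_⟩
  have hp' := abs_pos.2 hp
  have hr1 : min r Real.pi ≤ r := min_le_left _ _
  have hr2 : min r Real.pi ≤ Real.pi := min_le_right _ _
  obtain ⟨g, hg, hgap⟩ := A.exists_gap hh (half_pos hp')
  refine ⟨g, hg, fun k a b => ?_⟩
  by_cases h1 : ∀ ω, ∀ n : ℤ, |p| / 2 ≤ |k + 2 * Real.pi * n - A.kF ω|
  · linarith [hgap k h1 a, abs_nonneg (ev hh μ (k + p) b)]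
  by_cases h2 : ∀ ω, ∀ n : ℤ, |p| / 2 ≤ |k + p + 2 * Real.pi * n - A.kF ω|
  · linarith [hgap (k + p) h2 b, abs_nonneg (ev hh μ k a)]
  exfalso
  push Not at h1 h2
  obtain ⟨ω, n, hn⟩ := h1
  obtain ⟨ω', n', hn'⟩ := h2
  have hn'' : |k + 2 * Real.pi * n' - A.kF ω'| < 3 * |p| / 2 := by
    have := abs_sub (k + p + 2 * Real.pi * n' - A.kF ω') p
    rw [show k + p + 2 * Real.pi * n' - A.kF ω' - p = k + 2 * Real.pi * n' - A.kF ω' by ring] at this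
    linarith
  have hI := ((hA ω).2 _ (show |k + 2 * Real.pi * n - A.kF ω| < r by linarith)).1
  have hI' := ((hA ω').2 _ (show |k + 2 * Real.pi * n' - A.kF ω'| < r by linarith)).1
  have hω : ω = ω' := by
    by_contra hne
    refine A.disjoint ω ω' hne _ hI _ hI' (n' - n) ?_
    push_cast; ring
  subst hω
  have hnn : n = n' := by
    by_contra hne
    have h1 : (1 : ℝ) ≤ |((n - n' : ℤ) : ℝ)| := by
      rw [← Int.cast_abs]
      exact_mod_cast Int.one_le_abs (sub_ne_zero.2 hne)
    have h3 := abs_sub (k + 2 * Real.pi * n - A.kF ω) (k + 2 * Real.pi * n' - A.kF ω)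
    rw [show k + 2 * Real.pi * n - A.kF ω - (k + 2 * Real.pi * n' - A.kF ω) =
      2 * Real.pi * ((n - n' : ℤ) : ℝ) by push_cast; ring, abs_mul,
      abs_of_pos Real.two_pi_pos] at h3
    nlinarith [Real.pi_pos]
  subst hnn
  have h3 := abs_sub (k + p + 2 * Real.pi * n - A.kF ω) (k + 2 * Real.pi * n - A.kF ω)
  rw [show k + p + 2 * Real.pi * n - A.kF ω - (k + 2 * Real.pi * n - A.kF ω) = p by ring] at h3
  linarith

/-- A perturbation at zero momentum is a multiple of the conserved particle number: the overlap of
distinct eigenvectors vanishes, and a level has the same occupation as itself. -/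
lemma lindhard_zero (hh : h.SelfAdjoint) (ν : Fin 2) (p₀ k : ℝ) : lindhard hh μ ν p₀ 0 k = 0 := by
  have h1 : lindhard hh μ ν p₀ 0 k = pairSum (shifted_isHermitian hh μ k)
      (shifted_isHermitian hh μ k)
      (fun x y => ((occ x - occ y : ℝ) : ℂ) / (x - y - Complex.I * p₀)) (vertex h ν k (-0)) :=
    pairSum_eq_of_eq _ _ _ _ rfl (by rw [add_zero]) _ _
  rw [h1, pairSum]
  refine Finset.sum_eq_zero fun a _ => Finset.sum_eq_zero fun b _ => ?_
  by_cases hab : a = b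
  · subst hab; simp
  · have : overlap (shifted_isHermitian hh μ k) (shifted_isHermitian hh μ k) a b = 0 := by
      rw [overlap, eigU_star_mul, Matrix.one_apply_ne hab]
    rw [this]; simp

lemma setIntegral_nearInd_le (A : LowEnergySpectrum h μ N) (ω : Fin N) (p : ℝ) :
    IntegrableOn (nearInd A ω p) (Set.Ioc (-Real.pi) Real.pi) ∧
    ∫ k in Set.Ioc (-Real.pi) Real.pi, nearInd A ω p k ≤ 2 * |p| := by
  have hi : IntegrableOn (fun q : ℝ => if |q| ≤ |p| then (1 : ℝ) else 0)
      (Set.Ioc (-Real.pi) Real.pi) := by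
    refine Measure.integrableOn_of_bounded (M := 1) (by simp) ?_
      (Filter.Eventually.of_forall fun q => ?_)
    · exact (Measurable.ite (measurableSet_le (by fun_prop) measurable_const) measurable_const
        measurable_const).aestronglyMeasurable
    · split_ifs <;> simp
  obtain ⟨h1, h2⟩ := integral_comp_relPos (A.kF ω) _ hi
  refine ⟨h1, ?_⟩
  unfold nearInd
  rw [h2]
  have h3 : (fun q : ℝ => if |q| ≤ |p| then (1 : ℝ) else 0) =
      (Set.Icc (-|p|) |p|).indicator fun _ => (1 : ℝ) := by
    ext q
    simp only [Set.indicator, Set.mem_Icc, abs_le]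
  rw [h3, setIntegral_indicator measurableSet_Icc, setIntegral_const, smul_eq_mul, mul_one]
  calc volume.real (Set.Ioc (-Real.pi) Real.pi ∩ Set.Icc (-|p|) |p|)
      ≤ volume.real (Set.Icc (-|p|) |p|) := measureReal_mono Set.inter_subset_right (by simp)
    _ = 2 * |p| := by
      rw [Measure.real, Real.volume_Icc, ENNReal.toReal_ofReal (by linarith [abs_nonneg p])]; ring

lemma setIntegral_bound (A : LowEnergySpectrum h μ N) {C X : ℝ} (hC : 0 ≤ C) {p : ℝ} (F : ℝ → ℂ) (hX : 0 ≤ X)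
    (hF : ∀ k, ‖F k‖ ≤ (C * |p| + C * ∑ ω, nearInd A ω p k) * X) :
    ‖∫ k in Set.Ioc (-Real.pi) Real.pi, F k‖ ≤ (2 * Real.pi + 2 * N) * C * |p| * X := by
  have hi : IntegrableOn (fun k => ∑ ω, nearInd A ω p k) (Set.Ioc (-Real.pi) Real.pi) :=
    integrable_finsetSum _ fun ω _ => (setIntegral_nearInd_le A ω p).1
  have h1 := norm_integral_le_of_norm_le (μ := volume.restrict (Set.Ioc (-Real.pi) Real.pi))
    (((integrable_const (C * |p|)).add (hi.const_mul C)).mul_const X)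
    (Filter.Eventually.of_forall hF)
  refine h1.trans ?_
  have h3 : ∫ k in Set.Ioc (-Real.pi) Real.pi, (C * |p| + C * ∑ ω, nearInd A ω p k) * X =
      ((∫ k in Set.Ioc (-Real.pi) Real.pi, C * |p|) +
        C * ∫ k in Set.Ioc (-Real.pi) Real.pi, ∑ ω, nearInd A ω p k) * X := by
    rw [integral_mul_const, integral_add (integrable_const _) (hi.const_mul C)]
    congr 2
    exact integral_const_mul _ _
  refine (le_of_eq h3).trans ?_
  rw [integral_finsetSum _ fun ω _ => (setIntegral_nearInd_le A ω p).1, setIntegral_const,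
    Measure.real, Real.volume_Ioc, ENNReal.toReal_ofReal (by linarith [Real.pi_pos])]
  have h2 : ∑ ω, ∫ k in Set.Ioc (-Real.pi) Real.pi, nearInd A ω p k ≤ N * (2 * |p|) := by
    refine (Finset.sum_le_sum fun ω _ => (setIntegral_nearInd_le A ω p).2).trans (le_of_eq ?_)
    simp
  calc _ ≤ ((Real.pi - -Real.pi) * (C * |p|) + C * (N * (2 * |p|))) * X := by
        rw [smul_eq_mul]; gcongr
    _ = _ := by ring

/-- The leading behaviour of the correlation at small momenta. -/
def leading (A : LowEnergySpectrum h μ N) (ν : Fin 2) (p₀ p : ℝ) : ℂ :=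
  ∑ ω, (A.coeff ν ω : ℂ) * ((A.v ω * p : ℂ) / (A.v ω * p + Complex.I * p₀))

lemma norm_ratio_le (v p p₀ : ℝ) : ‖(v * p : ℂ) / (v * p + Complex.I * p₀)‖ ≤ 1 := by
  rw [norm_div]
  refine div_le_one_of_le₀ ?_ (norm_nonneg _)
  have h1 := Complex.abs_re_le_norm ((v * p : ℂ) + Complex.I * p₀)
  rw [← Complex.ofReal_mul] at h1 ⊢
  rw [Complex.norm_real, Real.norm_eq_abs]
  simpa using h1

lemma norm_leading_le (A : LowEnergySpectrum h μ N) (ν : Fin 2) (p₀ p : ℝ) : ‖leading A ν p₀ p‖ ≤ ∑ ω, |A.coeff ν ω| := by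
  refine (norm_sum_le _ _).trans (Finset.sum_le_sum fun ω _ => ?_)
  rw [norm_mul, Complex.norm_real, Real.norm_eq_abs]
  exact mul_le_of_le_one_right (abs_nonneg _) (norm_ratio_le _ _ _)

lemma correlation_zero (hh : h.SelfAdjoint) (A : LowEnergySpectrum h μ N) (ν : Fin 2) {p₀ : ℝ} (hp₀ : p₀ ≠ 0) : correlation h μ ν p₀ 0 = 0 := by
  rw [(correlation_eq hh μ A ν (abs_pos.2 hp₀) (fun k a b => by
    linarith [abs_nonneg (ev hh μ k a), abs_nonneg (ev hh μ (k + 0) b)])).2]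
  simp [lindhard_zero]

/-- The central estimate. The pointwise bounds are integrated over k, and the chiral terms integrate
exactly to `leading`. The constant does not depend on p₀, which is what permits every ratio of p to
p₀ later. -/
lemma LowEnergySpectrum.exists_correlation_bounds (hh : h.SelfAdjoint) (A : LowEnergySpectrum h μ N) :
    ∃ C ≥ 0, ∃ r > 0, ∀ (ν : Fin 2) (p₀ p : ℝ), (p₀, p) ≠ (0, 0) → |p| < r →
      ‖correlation h μ ν p₀ p - leading A ν p₀ p‖ ≤ C * |p| ∧
      (p₀ ≠ 0 → ‖correlation h μ ν p₀ p‖ ≤ C * |p| / |p₀|) := by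
  obtain ⟨C, hC, r₁, hr₁, hr₁', hpw⟩ := A.exists_pointwise_bound hh
  obtain ⟨r₂, hr₂, hlow⟩ := A.exists_sum_lower_bound hh
  refine ⟨(2 * Real.pi + 2 * N) * C, by positivity, min r₁ r₂, lt_min hr₁ hr₂, ?_⟩
  intro ν p₀ p hne hpr
  have hpr₁ := hpr.trans_le (min_le_left _ _)
  have hpr₂ := hpr.trans_le (min_le_right _ _)
  have hpi3 := Real.pi_gt_three
  have hpπ : |p| ≤ Real.pi := by linarith
  by_cases hp : p = 0
  · subst hp
    have hp₀ : p₀ ≠ 0 := by rintro rfl; exact hne rfl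
    rw [correlation_zero hh A ν hp₀]
    simp [leading]
  obtain ⟨c, hc, hsum⟩ : ∃ c > 0, ∀ k a b, c ≤ |p₀| + |ev hh μ k a| + |ev hh μ (k + p) b| := by
    obtain ⟨c, hc, h1⟩ := hlow p hp hpr₂
    exact ⟨c, hc, fun k a b => by linarith [h1 k a b, abs_nonneg p₀]⟩
  obtain ⟨hint, heq⟩ := correlation_eq hh μ A ν hc hsum
  have hnorm : ‖(2 * Real.pi : ℂ)‖ = 2 * Real.pi := by
    rw [norm_mul, Complex.norm_real, Real.norm_of_nonneg Real.pi_pos.le]; norm_num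
  have hone : ∀ x : ℝ, 0 ≤ x → x / (2 * Real.pi) ≤ x := fun x hx =>
    div_le_self hx (by linarith)
  constructor
  · have hci : ∀ ω, IntegrableOn (fun k => chiralTerm ν (A.v ω) p₀ p (relPos (A.kF ω) k))
        (Set.Ioc (-Real.pi) Real.pi) ∧ _ := fun ω =>
      integral_comp_relPos (A.kF ω) _ (setIntegral_chiralTerm ν (A.velocity_ne_zero ω) hpπ).1
    have hlead : leading A ν p₀ p = -(∫ k in Set.Ioc (-Real.pi) Real.pi,
        ∑ ω, chiralTerm ν (A.v ω) p₀ p (relPos (A.kF ω) k)) / (2 * Real.pi) := by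
      rw [integral_finsetSum _ fun ω _ => (hci ω).1, leading, ← Finset.sum_neg_distrib,
        Finset.sum_div]
      refine Finset.sum_congr rfl fun ω _ => ?_
      have e1 := (hci ω).2
      have e2 := (setIntegral_chiralTerm (p₀ := p₀) ν (A.velocity_ne_zero ω) hpπ).2
      have e3 := e1.trans e2
      rw [e3, neg_neg, LowEnergySpectrum.coeff, ← LowEnergySpectrum.v]
      push_cast
      ring
    rw [heq, hlead, ← sub_div, neg_sub_neg, norm_div, hnorm, norm_sub_rev,
      ← integral_sub hint (integrable_finsetSum _ fun ω _ => (hci ω).1)]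
    refine (hone _ (norm_nonneg _)).trans ?_
    have := setIntegral_bound A hC
      (fun k => lindhard hh μ ν p₀ p k - ∑ ω, chiralTerm ν (A.v ω) p₀ p (relPos (A.kF ω) k))
      zero_le_one (fun k => by rw [mul_one]; exact (hpw ν p₀ p k hp hpr₁).1)
    rwa [mul_one] at this
  · intro hp₀
    rw [heq, norm_div, hnorm, norm_neg]
    refine (hone _ (norm_nonneg _)).trans ?_
    have := setIntegral_bound A hC (lindhard hh μ ν p₀ p)
      (X := |p₀|⁻¹) (by positivity)
      (fun k => by rw [← div_eq_mul_inv]; exact (hpw ν p₀ p k hp hpr₁).2 hp₀)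
    rwa [← div_eq_mul_inv] at this

/-- For |p| ≥ r the trivial bound 1/|p₀| is already of the form |p|/(r|p₀|), so the restriction to
small p can be dropped. -/
lemma LowEnergySpectrum.exists_correlation_bound (hh : h.SelfAdjoint) (A : LowEnergySpectrum h μ N) :
    ∃ C ≥ 0, ∀ (ν : Fin 2) (p₀ p : ℝ), p₀ ≠ 0 → ‖correlation h μ ν p₀ p‖ ≤ C * |p| / |p₀| := by
  obtain ⟨C, hC, r, hr, hb⟩ := A.exists_correlation_bounds hh
  have hVB := vertexBound_nonneg h
  refine ⟨C + (M : ℝ) ^ 2 * vertexBound h / r, by positivity, fun ν p₀ p hp₀ => ?_⟩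
  have hp₀' := abs_pos.2 hp₀
  rcases lt_or_ge |p| r with hpr | hpr
  · refine ((hb ν p₀ p (by simp [hp₀]) hpr).2 hp₀).trans ?_
    gcongr
    exact le_add_of_nonneg_right (by positivity)
  · obtain ⟨hint, heq⟩ := correlation_eq hh μ A ν hp₀' (p₀ := p₀) (p := p) (fun k a b => by
      linarith [abs_nonneg (ev hh μ k a), abs_nonneg (ev hh μ (k + p) b)])
    have h1 : ∀ k, ‖lindhard hh μ ν p₀ p k‖ ≤ (M : ℝ) ^ 2 * vertexBound h / |p₀| := by
      intro k
      rw [lindhard_eq_sum]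
      refine (norm_sum_le _ _).trans ((Finset.sum_le_sum fun a _ => (norm_sum_le _ _).trans
        (Finset.sum_le_sum fun b _ => norm_lindhardPair_le' hh μ ν hp₀ a b)).trans (le_of_eq ?_))
      simp only [Finset.sum_const, Finset.card_univ, Fintype.card_fin, nsmul_eq_mul]
      ring
    have h2 := norm_setIntegral_le_of_norm_le_const (μ := volume)
      (s := Set.Ioc (-Real.pi) Real.pi) (by simp) (fun k _ => h1 k)
    rw [Measure.real, Real.volume_Ioc, ENNReal.toReal_ofReal (by linarith [Real.pi_pos])] at h2
    rw [heq, norm_div, norm_neg]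
    have hnorm : ‖(2 * Real.pi : ℂ)‖ = 2 * Real.pi := by
      rw [norm_mul, Complex.norm_real, Real.norm_of_nonneg Real.pi_pos.le]; norm_num
    rw [hnorm, div_le_iff₀ (by positivity)]
    refine h2.trans ?_
    have h3 : (M : ℝ) ^ 2 * vertexBound h ≤ (C + (M : ℝ) ^ 2 * vertexBound h / r) * |p| := by
      have : (M : ℝ) ^ 2 * vertexBound h / r * r ≤ (M : ℝ) ^ 2 * vertexBound h / r * |p| := by gcongr
      rw [div_mul_cancel₀ _ hr.ne'] at this
      nlinarith [abs_nonneg p]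
    calc _ = ((M : ℝ) ^ 2 * vertexBound h) / |p₀| * (2 * Real.pi) := by ring
      _ ≤ _ := by gcongr

end
end LinearResponse
end

noncomputable section
namespace LinearResponse

open MeasureTheory

/-! ### The relativistic bubble and the constant remainder -/

/-- The map (k₀, k) ↦ vk + ik₀ onto the complex plane has Jacobian |v|. It makes the bubble
rotationally symmetric, apart from the prefactor 1/|v|. -/
lemma integral_comp_velocity {E : Type*} [NormedAddCommGroup E] [NormedSpace ℝ E]
    {v : ℝ} (hv : v ≠ 0) (f : ℂ → E) :
    ∫ κ : ℝ × ℝ, f (v * κ.2 + Complex.I * κ.1) = |v|⁻¹ • ∫ z : ℂ, f z := by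
  have e0 : ∫ κ : ℝ × ℝ, f (v * κ.2 + Complex.I * κ.1) =
      ∫ κ : ℝ × ℝ, f (v * κ.1 + Complex.I * κ.2) :=
    integral_prod_swap (μ := volume) (ν := volume)
      (fun κ : ℝ × ℝ => f (v * κ.1 + Complex.I * κ.2))
  have e1 : Measure.map ((MeasurableEquiv.mulLeft₀ v hv).prodCongr (MeasurableEquiv.refl ℝ))
      (volume : Measure (ℝ × ℝ)) = ENNReal.ofReal |v⁻¹| • volume := by
    have := Measure.map_prod_map (volume : Measure ℝ) (volume : Measure ℝ)
      (measurable_const_mul v) measurable_id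
    rw [Real.map_volume_mul_left hv, Measure.map_id, Measure.prod_smul_left] at this
    exact this.symm
  have e2 := integral_map_equiv (μ := (volume : Measure (ℝ × ℝ)))
    ((MeasurableEquiv.mulLeft₀ v hv).prodCongr (MeasurableEquiv.refl ℝ))
    (fun κ : ℝ × ℝ => f (κ.1 + Complex.I * κ.2))
  rw [e1, integral_smul_measure, ENNReal.toReal_ofReal (abs_nonneg _), abs_inv] at e2
  have e3 := Complex.volume_preserving_equiv_real_prod.symm.integral_comp' f
  rw [e0, ← e3]
  refine Eq.trans ?_ (e2.symm.trans ?_)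
  · refine integral_congr_ae (Filter.Eventually.of_forall fun κ => ?_)
    simp [MeasurableEquiv.prodCongr]
  · congr 1
    refine integral_congr_ae (Filter.Eventually.of_forall fun κ => ?_)
    simp only [Complex.measurableEquivRealProd_symm_apply]
    rw [Complex.mk_eq_add_mul_I, mul_comm Complex.I]

/-- The radial cutoff `χ(|z|/δ)` on the complex plane. -/
def radialCutoff (χ : ℝ → ℝ) (δ : ℝ) (z : ℂ) : ℂ := (χ (‖z‖ / δ) : ℂ)

/-! ### The cutoff integral of the bubble and its derivative at zero -/

section
variable {χ : ℝ → ℝ} (hχ : IsCutoff χ) {δ : ℝ} (hδ : 0 < δ)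

lemma radialCutoff_neg (z : ℂ) : radialCutoff χ δ (-z) = radialCutoff χ δ z := by
  simp [radialCutoff]

lemma hasFDerivAt_norm_complex {z : ℂ} (hz : z ≠ 0) :
    HasFDerivAt (fun z : ℂ => ‖z‖) (‖z‖⁻¹ • innerSL ℝ z) z := by
  have h1 := (hasStrictFDerivAt_norm_sq z).hasFDerivAt.sqrt (by positivity)
  simp only [Real.sqrt_sq (norm_nonneg _)] at h1
  refine h1.congr_fderiv ?_
  ext w
  have := norm_ne_zero_iff.2 hz
  simp
  field_simp

/-- The norm is not differentiable at the origin, but there the cutoff is locally constant. -/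
lemma contDiff_radialCutoff (hχ : IsCutoff χ) (hδ : 0 < δ) : ContDiff ℝ 1 (radialCutoff χ δ) := by
  refine Complex.ofRealCLM.contDiff.comp (?_ : ContDiff ℝ 1 fun z : ℂ => χ (‖z‖ / δ))
  refine contDiff_iff_contDiffAt.2 fun z => ?_
  by_cases hz : z = 0
  · refine (contDiffAt_const (c := (1 : ℝ))).congr_of_eventuallyEq ?_
    have : ∀ᶠ w in 𝓝 z, ‖w‖ < δ := by
      subst hz
      filter_upwards [Metric.ball_mem_nhds (0 : ℂ) hδ] with w hw
      simpa using hw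
    filter_upwards [this] with w hw
    exact hχ.eq_one _ ((div_le_one hδ).2 hw.le)
  · exact ((hχ.smooth.of_le (by exact_mod_cast le_top)).contDiffAt).comp z
      ((contDiffAt_norm ℝ hz).div_const δ)

lemma hasCompactSupport_radialCutoff (hχ : IsCutoff χ) (hδ : 0 < δ) :
    HasCompactSupport (radialCutoff χ δ) := by
  refine HasCompactSupport.intro (isCompact_closedBall (0 : ℂ) (2 * δ)) fun z hz => ?_
  have : 2 * δ < ‖z‖ := by simpa using hz
  rw [radialCutoff, hχ.eq_zero _ ((le_div_iff₀ hδ).2 this.le), Complex.ofReal_zero]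

lemma fderiv_radialCutoff (hχ : IsCutoff χ) {z : ℂ} (hz : z ≠ 0) (w : ℂ) :
    fderiv ℝ (radialCutoff χ δ) z w =
      ((deriv χ (‖z‖ / δ) * (‖z‖⁻¹ * inner ℝ z w / δ) : ℝ) : ℂ) := by
  have h1 : HasFDerivAt (fun z : ℂ => ‖z‖ / δ) (δ⁻¹ • (‖z‖⁻¹ • innerSL ℝ z)) z := by
    simpa [div_eq_mul_inv, mul_comm] using (hasFDerivAt_norm_complex hz).mul_const δ⁻¹
  have h2 := (hχ.smooth.differentiable (by simp) (‖z‖ / δ)).hasDerivAt.comp_hasFDerivAt z h1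
  have h3 := Complex.ofRealCLM.hasFDerivAt.comp z h2
  have h4 : HasFDerivAt (radialCutoff χ δ) _ z := h3
  rw [h4.fderiv]
  simp
  ring

lemma locallyIntegrable_inv_complex : LocallyIntegrable (fun z : ℂ => z⁻¹) := by
  refine locallyIntegrable_of_norm_le_rpow (C := 1) (α := 1) ?_ ?_
    (Filter.Eventually.of_forall fun z => ?_) measurable_inv.aestronglyMeasurable
  · simp
  · simp
  · rw [norm_inv, Real.rpow_neg_one, one_mul]

lemma integrable_radialCutoff_mul_inv (hχ : IsCutoff χ) (hδ : 0 < δ) :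
    Integrable fun z : ℂ => radialCutoff χ δ z * z⁻¹ :=
  locallyIntegrable_inv_complex.integrable_smul_left_of_hasCompactSupport
    (contDiff_radialCutoff hχ hδ).continuous (hasCompactSupport_radialCutoff hχ hδ)

lemma norm_radialCutoff_le (hχ : IsCutoff χ) (z : ℂ) : ‖radialCutoff χ δ z‖ ≤ 1 := by
  rw [radialCutoff, Complex.norm_real, Real.norm_of_nonneg (hχ.nonneg _)]
  exact hχ.le_one _

/-- The integral `∫ χ(|z|/δ) χ(|z+w|/δ) / z`. -/
def cutoffIntegral (χ : ℝ → ℝ) (δ : ℝ) (w : ℂ) : ℂ :=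
  ∫ z : ℂ, radialCutoff χ δ z * z⁻¹ * radialCutoff χ δ (z + w)

lemma integrable_cutoffIntegral (hχ : IsCutoff χ) (hδ : 0 < δ) (w : ℂ) :
    Integrable fun z : ℂ => radialCutoff χ δ z * z⁻¹ * radialCutoff χ δ (z + w) := by
  refine (integrable_radialCutoff_mul_inv hχ hδ).mul_bdd (c := 1)
    ((contDiff_radialCutoff hχ hδ).continuous.comp
      (continuous_id.add continuous_const)).aestronglyMeasurable
    (Filter.Eventually.of_forall fun z => norm_radialCutoff_le hχ _)

/-- At w = 0 the integrand is odd. -/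
lemma cutoffIntegral_zero : cutoffIntegral χ δ 0 = 0 := by
  have h1 := integral_neg_eq_self
    (fun z : ℂ => radialCutoff χ δ z * z⁻¹ * radialCutoff χ δ (z + 0)) volume
  have h2 : ∫ z : ℂ, radialCutoff χ δ (-z) * (-z)⁻¹ * radialCutoff χ δ (-z + 0) =
      -cutoffIntegral χ δ 0 := by
    rw [cutoffIntegral, ← integral_neg]
    refine integral_congr_ae (Filter.Eventually.of_forall fun z => ?_)
    simp only [add_zero, radialCutoff_neg, inv_neg]
    ring
  have h3 : -cutoffIntegral χ δ 0 = cutoffIntegral χ δ 0 := h2.symm.trans h1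
  exact self_eq_neg.1 h3.symm

/-- Use 1/(z(z+w)) = (1/z - 1/(z+w))/w. The reflection z ↦ -w - z maps the second integral to minus
the first, which produces the factor 2. -/
lemma integral_mul_inv_mul (hχ : IsCutoff χ) (hδ : 0 < δ) {w : ℂ} (hw : w ≠ 0) :
    ∫ z : ℂ, radialCutoff χ δ z / z * (radialCutoff χ δ (z + w) / (z + w)) =
      2 / w * cutoffIntegral χ δ w := by
  have h1 : ∫ z : ℂ, radialCutoff χ δ z * (z + w)⁻¹ * radialCutoff χ δ (z + w) =
      -cutoffIntegral χ δ w := by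
    rw [← integral_sub_left_eq_self _ volume (-w), cutoffIntegral, ← integral_neg]
    refine integral_congr_ae (Filter.Eventually.of_forall fun z => ?_)
    simp only
    rw [show -w - z = -(z + w) by ring, show -(z + w) + w = -z by ring, radialCutoff_neg,
      radialCutoff_neg, inv_neg]
    ring
  have h2 : Integrable fun z : ℂ => radialCutoff χ δ z * (z + w)⁻¹ * radialCutoff χ δ (z + w) := by
    have := (integrable_cutoffIntegral hχ hδ (-w)).comp_add_right w
    refine this.congr (Filter.Eventually.of_forall fun z => ?_)
    simp only [add_neg_cancel_right]
    ring
  have h3 : ∀ᵐ z : ℂ, radialCutoff χ δ z / z * (radialCutoff χ δ (z + w) / (z + w)) =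
      w⁻¹ * (radialCutoff χ δ z * z⁻¹ * radialCutoff χ δ (z + w) -
        radialCutoff χ δ z * (z + w)⁻¹ * radialCutoff χ δ (z + w)) := by
    have ha : ∀ᵐ z : ℂ, z ≠ 0 := by simp [ae_iff]
    have hb : ∀ᵐ z : ℂ, z ≠ -w := by simp [ae_iff]
    filter_upwards [ha, hb] with z hz hz'
    have hz'' : z + w ≠ 0 := fun h => hz' (eq_neg_of_add_eq_zero_left h)
    field_simp
    ring
  rw [integral_congr_ae h3, integral_const_mul,
    integral_sub (integrable_cutoffIntegral hχ hδ w) h2, h1, cutoffIntegral]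
  ring

/-- Splitting the real part gives the mode e^{-2iφ}, with mean zero, and a constant multiple of w̄.
This is why the bubble depends on w̄ to first order. -/
lemma integral_exp_mul_re (w : ℂ) :
    ∫ φ in Set.Ioo (-Real.pi) Real.pi,
      ((Complex.exp (-(φ * Complex.I)) * w).re : ℂ) * Complex.exp (-(φ * Complex.I)) =
        Real.pi * star w := by
  have h1 : ∀ φ : ℝ, ((Complex.exp (-(φ * Complex.I)) * w).re : ℂ) *
      Complex.exp (-(φ * Complex.I)) =
        w / 2 * Complex.exp (-2 * Complex.I * φ) + star w / 2 := by
    intro φ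
    have hc : (starRingEnd ℂ) (Complex.exp (-(φ * Complex.I))) = Complex.exp (φ * Complex.I) := by
      rw [← Complex.exp_conj]; simp
    rw [Complex.re_eq_add_conj, map_mul, hc, ← Complex.star_def]
    have e1 : Complex.exp (φ * Complex.I) * Complex.exp (-(φ * Complex.I)) = 1 := by
      rw [← Complex.exp_add]; simp
    have e2 : Complex.exp (-(φ * Complex.I)) * Complex.exp (-(φ * Complex.I)) =
        Complex.exp (-2 * Complex.I * φ) := by
      rw [← Complex.exp_add]; ring_nf
    linear_combination (w / 2) * e2 + (star w / 2) * e1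
  have hI : (-2 * Complex.I : ℂ) ≠ 0 := by simp
  rw [← integral_Ioc_eq_integral_Ioo,
    ← intervalIntegral.integral_of_le (by linarith [Real.pi_pos])]
  simp only [h1]
  rw [intervalIntegral.integral_add (Continuous.intervalIntegrable (by fun_prop) _ _)
    (by simp), intervalIntegral.integral_const_mul, integral_exp_mul_complex hI,
    intervalIntegral.integral_const]
  have e3 : Complex.exp (-2 * Complex.I * (Real.pi : ℝ)) = 1 := by
    rw [show -2 * Complex.I * (Real.pi : ℝ) = -(2 * Real.pi * Complex.I) by ring, Complex.exp_neg,
      Complex.exp_two_pi_mul_I, inv_one]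
  have e4 : Complex.exp (-2 * Complex.I * (-Real.pi : ℝ)) = 1 := by
    rw [show -2 * Complex.I * (-Real.pi : ℝ) = 2 * Real.pi * Complex.I by push_cast; ring,
      Complex.exp_two_pi_mul_I]
  rw [e3, e4, sub_self, zero_div, mul_zero, zero_add, Complex.real_smul]
  push_cast
  ring

/-- The integrand is the derivative of χ²/2, which falls from 1/2 to 0. Hence the limit of the
remainder depends neither on δ nor on the shape of χ. -/
lemma integral_cutoff_mul_deriv (hχ : IsCutoff χ) (hδ : 0 < δ) :
    ∫ r in Set.Ioi (0 : ℝ), χ (r / δ) * (deriv χ (r / δ) / δ) = -(1 / 2) := by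
  have hd : ∀ r : ℝ, HasDerivAt (fun r => χ (r / δ) ^ 2 / 2) (χ (r / δ) * (deriv χ (r / δ) / δ)) r := by
    intro r
    have h1 := (hχ.smooth.differentiable (by simp) (r / δ)).hasDerivAt.comp r
      ((hasDerivAt_id r).div_const δ)
    refine ((h1.pow 2).div_const 2).congr_deriv ?_
    simp [Function.comp]
    ring
  have hzero : ∀ r, 2 * δ ≤ r → χ (r / δ) = 0 := fun r hr => hχ.eq_zero _ ((le_div_iff₀ hδ).2 hr)
  have hcont : Continuous fun r => χ (r / δ) * (deriv χ (r / δ) / δ) := by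
    have h1 := hχ.smooth.continuous
    have h2 := hχ.smooth.continuous_deriv (by simp)
    fun_prop
  have hint : IntegrableOn (fun r => χ (r / δ) * (deriv χ (r / δ) / δ)) (Set.Ioi 0) := by
    have h1 : IntegrableOn (fun r => χ (r / δ) * (deriv χ (r / δ) / δ)) (Set.Icc 0 (2 * δ)) :=
      hcont.continuousOn.integrableOn_Icc
    refine h1.of_forall_sdiff_eq_zero measurableSet_Ioi fun r hr => ?_
    have : 2 * δ ≤ r := by
      by_contra hlt
      exact hr.2 ⟨(Set.mem_Ioi.1 hr.1).le, (not_le.1 hlt).le⟩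
    rw [hzero r this, zero_mul]
  rw [integral_Ioi_of_hasDerivAt_of_tendsto (hd 0).continuousAt.continuousWithinAt
    (fun r _ => hd r) hint (m := 0)]
  · rw [zero_div, hχ.eq_one 0 zero_le_one]; norm_num
  · refine tendsto_const_nhds.congr' ?_
    filter_upwards [Filter.eventually_ge_atTop (2 * δ)] with r hr
    simp [hzero r hr]

/-- Up to sign the integral is the convolution of the locally integrable χ/z with the C¹ cutoff, so
the derivative may fall on the cutoff. In polar coordinates at 0 the result factors into the radial
integral -1/2 and the angular integral π w̄. -/
lemma hasFDerivAt_cutoffIntegral (hχ : IsCutoff χ) (hδ : 0 < δ) :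
    ∃ D : ℂ →L[ℝ] ℂ, HasFDerivAt (cutoffIntegral χ δ) D 0 ∧ ∀ w, D w = -(Real.pi / 2) * star w := by
  have hloc : LocallyIntegrable fun t : ℂ => -(radialCutoff χ δ t * t⁻¹) :=
    (integrable_radialCutoff_mul_inv hχ hδ).neg.locallyIntegrable
  have hX := contDiff_radialCutoff hχ hδ
  have hXc := hasCompactSupport_radialCutoff hχ hδ
  have h1 := hXc.hasFDerivAt_convolution_right (ContinuousLinearMap.mul ℝ ℂ) hloc hX 0
  have h2 : convolution (fun t : ℂ => -(radialCutoff χ δ t * t⁻¹)) (radialCutoff χ δ)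
      (ContinuousLinearMap.mul ℝ ℂ) volume = cutoffIntegral χ δ := by
    ext w
    rw [convolution_def, cutoffIntegral, ← integral_neg_eq_self]
    refine integral_congr_ae (Filter.Eventually.of_forall fun t => ?_)
    simp only [ContinuousLinearMap.mul_apply', radialCutoff_neg, inv_neg, sub_neg_eq_add]
    rw [add_comm w t]; ring
  rw [h2] at h1
  refine ⟨_, h1, fun w => ?_⟩
  rw [convolution_precompR_apply _ hloc (hXc.fderiv (𝕜 := ℝ)) (hX.continuous_fderiv (by simp)),
    convolution_def, ← Complex.integral_comp_polarCoord_symm]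
  -- The Jacobian r cancels the modulus of 1/z, and the radial and angular variables separate.
  have h3 : ∀ p ∈ polarCoord.target, p.1 • (ContinuousLinearMap.mul ℝ ℂ)
      (-(radialCutoff χ δ (Complex.polarCoord.symm p) * (Complex.polarCoord.symm p)⁻¹))
      (fderiv ℝ (radialCutoff χ δ) (0 - Complex.polarCoord.symm p) w) =
      ((χ (p.1 / δ) * (deriv χ (p.1 / δ) / δ) : ℝ) : ℂ) *
        (((Complex.exp (-(p.2 * Complex.I)) * w).re : ℂ) * Complex.exp (-(p.2 * Complex.I))) := by
    rintro ⟨r, φ⟩ hp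
    have hr : 0 < r := by
      rw [polarCoord_target] at hp; exact hp.1
    have hz : (Complex.polarCoord.symm (r, φ) : ℂ) = r * Complex.exp (φ * Complex.I) := by
      rw [Complex.polarCoord_symm_apply, Complex.exp_mul_I]
      push_cast; ring
    have hnorm : ‖(r * Complex.exp (φ * Complex.I) : ℂ)‖ = r := by
      rw [norm_mul, Complex.norm_exp_ofReal_mul_I, Complex.norm_real, Real.norm_of_nonneg hr.le,
        mul_one]
    have hne : (-(r * Complex.exp (φ * Complex.I)) : ℂ) ≠ 0 := by
      simp [hr.ne', Complex.exp_ne_zero]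
    have hinner : inner ℝ (r * Complex.exp (φ * Complex.I) : ℂ) w =
        r * (Complex.exp (-(φ * Complex.I)) * w).re := by
      have hc : (starRingEnd ℂ) (Complex.exp (φ * Complex.I)) = Complex.exp (-(φ * Complex.I)) := by
        rw [← Complex.exp_conj]; simp
      rw [Complex.inner, map_mul, hc, Complex.conj_ofReal, mul_comm w, mul_assoc, Complex.re_ofReal_mul]
    rw [zero_sub, hz, fderiv_radialCutoff hχ hne, norm_neg, radialCutoff, hnorm, inner_neg_left,
      hinner, Complex.exp_neg, ContinuousLinearMap.mul_apply', Complex.real_smul]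
    have hr' : (r : ℂ) ≠ 0 := by exact_mod_cast hr.ne'
    have hδ' : (δ : ℂ) ≠ 0 := by exact_mod_cast hδ.ne'
    have he := Complex.exp_ne_zero (φ * Complex.I)
    push_cast
    field_simp
  rw [setIntegral_congr_fun polarCoord.open_target.measurableSet h3, polarCoord_target,
    Measure.volume_eq_prod, setIntegral_prod_mul
      (fun r : ℝ => ((χ (r / δ) * (deriv χ (r / δ) / δ) : ℝ) : ℂ))
      (fun φ : ℝ => ((Complex.exp (-(φ * Complex.I)) * w).re : ℂ) * Complex.exp (-(φ * Complex.I))),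
    integral_exp_mul_re, integral_complex_ofReal, integral_cutoff_mul_deriv hχ hδ]
  push_cast
  ring

lemma bubble_eq (hχ : IsCutoff χ) (hδ : 0 < δ) {v : ℝ} (hv : v ≠ 0) {p₀ p : ℝ}
    (hp : (p₀, p) ≠ (0, 0)) :
    bubble χ δ v p₀ p = -(1 / (2 * Real.pi ^ 2 * |v|) : ℝ) *
      (cutoffIntegral χ δ (v * p + Complex.I * p₀) / (v * p + Complex.I * p₀)) := by
  have hw : (v * p + Complex.I * p₀ : ℂ) ≠ 0 := by
    intro h0
    have h1 := congrArg Complex.re h0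
    have h2 := congrArg Complex.im h0
    simp [hv] at h1 h2
    exact hp (by rw [h1, h2])
  have hg : ∀ q₀ q : ℝ, chiralPropagator χ δ v q₀ q =
      radialCutoff χ δ (v * q + Complex.I * q₀) / (v * q + Complex.I * q₀) := by
    intro q₀ q
    have : ‖(v * q + Complex.I * q₀ : ℂ)‖ = √(q₀ ^ 2 + v ^ 2 * q ^ 2) := by
      rw [Complex.norm_eq_sqrt_sq_add_sq]
      congr 1
      simp; ring
    rw [chiralPropagator, radialCutoff, this, add_comm (Complex.I * (q₀ : ℂ))]
  have h1 := integral_comp_velocity hv fun z => radialCutoff χ δ z / z *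
    (radialCutoff χ δ (z + (v * p + Complex.I * p₀)) / (z + (v * p + Complex.I * p₀)))
  rw [integral_mul_inv_mul hχ hδ hw] at h1
  rw [bubble, integral_div]
  have h2 : ∫ κ : ℝ × ℝ, chiralPropagator χ δ v κ.1 κ.2 *
      chiralPropagator χ δ v (κ.1 + p₀) (κ.2 + p) =
      |v|⁻¹ • (2 / (v * p + Complex.I * p₀) * cutoffIntegral χ δ (v * p + Complex.I * p₀)) := by
    rw [← h1]
    refine integral_congr_ae (Filter.Eventually.of_forall fun κ => ?_)
    simp only [hg]
    have : (v * ((κ.2 + p : ℝ) : ℂ) + Complex.I * ((κ.1 + p₀ : ℝ) : ℂ)) =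
      v * κ.2 + Complex.I * κ.1 + (v * p + Complex.I * p₀) := by push_cast; ring
    rw [this]
  rw [h2, Complex.real_smul]
  have hv' : ((|v| : ℝ) : ℂ) ≠ 0 := by exact_mod_cast abs_ne_zero.2 hv
  have hπ : (Real.pi : ℂ) ≠ 0 := by exact_mod_cast Real.pi_ne_zero
  push_cast
  field_simp

/-- The bubble has no limit by itself: to leading order it is w̄/(4π|v|w), which depends on the
direction of w. Writing w̄ = 2vp - w isolates the direction-dependent ratio vp/w and leaves a
constant. -/
lemma tendsto_bubble (hχ : IsCutoff χ) (hδ : 0 < δ) {v : ℝ} (hv : v ≠ 0) :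
    Filter.Tendsto (fun p : ℝ × ℝ => (v * p.2 : ℂ) / (v * p.2 + Complex.I * p.1) *
      (1 / (2 * Real.pi * |v|) : ℝ) - bubble χ δ v p.1 p.2) (𝓝[≠] 0)
      (𝓝 ((1 / (4 * Real.pi * |v|) : ℝ) : ℂ)) := by
  obtain ⟨D, hD, hDw⟩ := hasFDerivAt_cutoffIntegral hχ hδ
  have h1 := hD.isLittleO
  simp only [cutoffIntegral_zero, sub_zero] at h1
  have h2 := h1.tendsto_div_nhds_zero
  have h3 : Filter.Tendsto (fun p : ℝ × ℝ => (v * p.2 + Complex.I * p.1 : ℂ)) (𝓝[≠] 0) (𝓝 0) := by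
    have : Continuous fun p : ℝ × ℝ => (v * p.2 + Complex.I * p.1 : ℂ) := by fun_prop
    have h := (this.tendsto 0).mono_left (nhdsWithin_le_nhds (s := {0}ᶜ))
    simpa using h
  have h4 := ((h2.comp h3).const_mul ((1 / (2 * Real.pi ^ 2 * |v|) : ℝ) : ℂ)).add_const
    ((1 / (4 * Real.pi * |v|) : ℝ) : ℂ)
  rw [mul_zero, zero_add] at h4
  refine h4.congr' ?_
  filter_upwards [self_mem_nhdsWithin] with p hp
  have hp' : (p.1, p.2) ≠ (0, 0) := hp
  have hw : (v * p.2 + Complex.I * p.1 : ℂ) ≠ 0 := by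
    intro h0
    have h1 := congrArg Complex.re h0
    have h2 := congrArg Complex.im h0
    simp [hv] at h1 h2
    exact hp' (by rw [h1, h2])
  rw [bubble_eq hχ hδ hv hp']
  simp only [Function.comp, hDw]
  have hstar : star (v * p.2 + Complex.I * p.1 : ℂ) = 2 * (v * p.2) - (v * p.2 + Complex.I * p.1) := by
    simp; ring
  rw [hstar]
  have hv' : ((|v| : ℝ) : ℂ) ≠ 0 := by exact_mod_cast abs_ne_zero.2 hv
  have hπ : (Real.pi : ℂ) ≠ 0 := by exact_mod_cast Real.pi_ne_zero
  push_cast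
  field_simp
  ring

end

lemma LowEnergySpectrum.tendsto_remainder {M N : ℕ} {h : Hopping M} {μ : ℝ}
    (A : LowEnergySpectrum h μ N) (hh : h.SelfAdjoint) {χ : ℝ → ℝ} (hχ : IsCutoff χ)
    (ν : Fin 2) {δ : ℝ} (hδ : 0 < δ) :
    Filter.Tendsto (fun p : ℝ × ℝ => remainder A χ δ ν p.1 p.2) (𝓝[≠] 0)
      (𝓝 ((∑ ω, A.v ω ^ (ν : ℕ) / (4 * Real.pi * |A.v ω|) : ℝ) : ℂ)) := by
  obtain ⟨C, hC, r, hr, hb⟩ := A.exists_correlation_bounds hh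
  have h1 : Filter.Tendsto (fun p : ℝ × ℝ => correlation h μ ν p.1 p.2 - leading A ν p.1 p.2)
      (𝓝[≠] 0) (𝓝 0) := by
    have h0 : Filter.Tendsto (fun p : ℝ × ℝ => |p.2|) (𝓝[≠] 0) (𝓝 0) := by
      have : Continuous fun p : ℝ × ℝ => |p.2| := by fun_prop
      have h := (this.tendsto 0).mono_left (nhdsWithin_le_nhds (s := {0}ᶜ))
      simpa using h
    refine squeeze_zero_norm' ?_ (by simpa using h0.const_mul C)
    filter_upwards [self_mem_nhdsWithin, h0.eventually (gt_mem_nhds hr)] with p hp hpr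
    exact (hb ν p.1 p.2 hp hpr).1
  have h2 : Filter.Tendsto (fun p : ℝ × ℝ => ∑ ω, ((A.v ω ^ (ν : ℕ) : ℝ) : ℂ) *
      ((A.v ω * p.2 : ℂ) / (A.v ω * p.2 + Complex.I * p.1) *
      (1 / (2 * Real.pi * |A.v ω|) : ℝ) - bubble χ δ (A.v ω) p.1 p.2)) (𝓝[≠] 0)
      (𝓝 (∑ ω, ((A.v ω ^ (ν : ℕ) : ℝ) : ℂ) * ((1 / (4 * Real.pi * |A.v ω|) : ℝ) : ℂ))) :=
    tendsto_finsetSum _ fun ω _ => (tendsto_bubble hχ hδ (A.velocity_ne_zero ω)).const_mul _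
  have h3 := h1.add h2
  rw [zero_add] at h3
  convert h3 using 1
  · ext p
    rw [remainder, singularPart, leading]
    simp only [mul_sub, Finset.sum_sub_distrib]
    have : ∀ ω, (A.coeff ν ω : ℂ) * ((A.v ω * p.2 : ℂ) / (A.v ω * p.2 + Complex.I * p.1)) =
        ((A.v ω ^ (ν : ℕ) : ℝ) : ℂ) * ((A.v ω * p.2 : ℂ) / (A.v ω * p.2 + Complex.I * p.1) *
      (1 / (2 * Real.pi * |A.v ω|) : ℝ)) := by
      intro ω
      rw [LowEnergySpectrum.coeff]
      push_cast
      ring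
    simp only [this]
    ring
  · push_cast
    congr 1
    exact Finset.sum_congr rfl fun ω _ => by ring

end LinearResponse
end

noncomputable section
namespace LinearResponse

open MeasureTheory

/-! ### The Fourier transform of the potential -/

section
variable {f : ℝ → ℝ}

/-- A smooth compactly supported function as a complex Schwartz function. -/
def toSchwartz (hf : ContDiff ℝ (⊤ : ℕ∞) f) (hc : HasCompactSupport f) : SchwartzMap ℝ ℂ :=
  HasCompactSupport.toSchwartzMap (f := fun y => (f y : ℂ)) (hc.comp_left Complex.ofReal_zero)
    (Complex.ofRealCLM.contDiff.comp hf)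

lemma fourier_eq_fourierTransform (hf : ContDiff ℝ (⊤ : ℕ∞) f) (hc : HasCompactSupport f) (q : ℝ) :
    fourier f q = FourierTransform.fourier (toSchwartz hf hc) (q / (2 * Real.pi)) := by
  rw [SchwartzMap.fourier_coe, Real.fourier_eq', fourier]
  refine integral_congr_ae (Filter.Eventually.of_forall fun y => ?_)
  simp only [phase, smul_eq_mul]
  congr 2
  have : -2 * Real.pi * inner ℝ y (q / (2 * Real.pi)) = -(q * y) := by
    rw [real_inner_eq_re_inner]
    simp
    field_simp
  rw [this, mul_comm]

lemma continuous_fourier (hf : ContDiff ℝ (⊤ : ℕ∞) f) (hc : HasCompactSupport f) :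
    Continuous (fourier f) := by
  rw [funext (fourier_eq_fourierTransform hf hc)]
  exact (FourierTransform.fourier (toSchwartz hf hc)).continuous.comp (continuous_id.div_const _)

lemma integrable_pow_mul_fourier (hf : ContDiff ℝ (⊤ : ℕ∞) f) (hc : HasCompactSupport f) (k : ℕ) :
    Integrable fun q => |q| ^ k * ‖fourier f q‖ := by
  have h1 := (SchwartzMap.integrable_pow_mul volume
    (FourierTransform.fourier (toSchwartz hf hc)) k).comp_div Real.two_pi_pos.ne'
  refine (h1.const_mul ((2 * Real.pi) ^ k)).congr (Filter.Eventually.of_forall fun q => ?_)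
  simp only [fourier_eq_fourierTransform hf hc, norm_div, Real.norm_eq_abs,
    abs_of_pos Real.two_pi_pos, div_pow]
  have := (pow_pos Real.two_pi_pos k).ne'
  field_simp

lemma integrable_fourier (hf : ContDiff ℝ (⊤ : ℕ∞) f) (hc : HasCompactSupport f) :
    Integrable (fourier f) := by
  have := integrable_pow_mul_fourier hf hc 0
  simp only [pow_zero, one_mul] at this
  exact (integrable_norm_iff (continuous_fourier hf hc).aestronglyMeasurable).1 this

lemma exists_fourier_decay (hf : ContDiff ℝ (⊤ : ℕ∞) f) (hc : HasCompactSupport f) :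
    ∃ C ≥ 0, ∀ q, |q| ^ 2 * ‖fourier f q‖ ≤ C := by
  obtain ⟨C, hC, hd⟩ := (FourierTransform.fourier (toSchwartz hf hc)).decay 2 0
  refine ⟨(2 * Real.pi) ^ 2 * C, by positivity, fun q => ?_⟩
  have := hd (q / (2 * Real.pi))
  rw [norm_iteratedFDeriv_zero, norm_div, Real.norm_eq_abs, Real.norm_of_nonneg Real.two_pi_pos.le,
    div_pow, ← fourier_eq_fourierTransform, div_mul_eq_mul_div, div_le_iff₀ (by positivity)] at this
  linarith

lemma integral_fourier_mul_phase (hf : ContDiff ℝ (⊤ : ℕ∞) f) (hc : HasCompactSupport f) (X : ℝ) :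
    ∫ q, fourier f q * phase (q * X) / (2 * Real.pi) = f X := by
  have hF := FourierTransform.fourier (toSchwartz hf hc)
  have h1 : FourierTransformInv.fourierInv (FourierTransform.fourier ⇑(toSchwartz hf hc)) X =
      toSchwartz hf hc X := by
    rw [(toSchwartz hf hc).continuous.fourierInv_fourier_eq (toSchwartz hf hc).integrable]
    rw [← SchwartzMap.fourier_coe]
    exact (FourierTransform.fourier (toSchwartz hf hc)).integrable
  have h2 : toSchwartz hf hc X = f X := rfl
  rw [h2, Real.fourierInv_eq', ← SchwartzMap.fourier_coe] at h1
  rw [← h1]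
  have h3 := Measure.integral_comp_mul_left
    (fun q => fourier f q * phase (q * X) / (2 * Real.pi)) (2 * Real.pi)
  rw [abs_inv, abs_of_pos Real.two_pi_pos, eq_inv_smul_iff₀ Real.two_pi_pos.ne'] at h3
  rw [← h3, ← integral_smul]
  refine integral_congr_ae (Filter.Eventually.of_forall fun v => ?_)
  simp only [fourier_eq_fourierTransform hf hc]
  rw [mul_div_cancel_left₀ _ Real.two_pi_pos.ne', Complex.real_smul, smul_eq_mul, phase]
  have : (2 * Real.pi : ℂ) ≠ 0 := by exact_mod_cast Real.two_pi_pos.ne'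
  have e : (Complex.I * ((2 * Real.pi * v * X : ℝ) : ℂ)) =
      ((2 * Real.pi * inner ℝ v X : ℝ) : ℂ) * Complex.I := by
    rw [real_inner_eq_re_inner]
    simp
    ring
  rw [e]
  push_cast
  field_simp

/-- Poisson summation for the modulated function y ↦ f(θy) e^{-iqθy}. The right side is a finite sum
in disguise. -/
lemma torusFourier_eq (hf : ContDiff ℝ (⊤ : ℕ∞) f) (hc : HasCompactSupport f) {θ : ℝ} (hθ : 0 < θ)
    (q : ℝ) : torusFourier f θ q = θ * ∑' y : ℤ, (f (θ * y) : ℂ) * phase (-(q * (θ * y))) := by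
  have hgc : HasCompactSupport fun y : ℝ => (f (θ * y) : ℂ) * phase (-(q * (θ * y))) := by
    have h1 := hc.comp_homeomorph (Homeomorph.mulLeft₀ θ hθ.ne')
    refine HasCompactSupport.mul_right (f := fun y : ℝ => (f (θ * y) : ℂ)) ?_
    exact HasCompactSupport.comp_left (f := fun y : ℝ => f (θ * y)) h1 Complex.ofReal_zero
  have hgs : ContDiff ℝ (⊤ : ℕ∞) fun y : ℝ => (f (θ * y) : ℂ) * phase (-(q * (θ * y))) := by
    have h1 : ContDiff ℝ (⊤ : ℕ∞) fun y : ℝ => (f (θ * y) : ℂ) :=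
      Complex.ofRealCLM.contDiff.comp (hf.comp (contDiff_const.mul contDiff_id))
    refine h1.mul ?_
    unfold phase
    refine ContDiff.cexp (contDiff_const.mul ?_)
    exact Complex.ofRealCLM.contDiff.comp
      (contDiff_const.mul (contDiff_const.mul contDiff_id)).neg
  have hP := SchwartzMap.tsum_eq_tsum_fourier (hgc.toSchwartzMap hgs) 0
  have h1 : ∀ y : ℤ, hgc.toSchwartzMap hgs (0 + y) =
      (f (θ * y) : ℂ) * phase (-(q * (θ * y))) := fun y => by rw [zero_add]; rfl
  simp only [h1] at hP
  rw [hP, ← tsum_mul_left, torusFourier]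
  refine tsum_congr fun n => ?_
  have h2 : ((0 : ℝ) : UnitAddCircle) = 0 := rfl
  rw [h2, fourier_eval_zero, mul_one, SchwartzMap.fourier_coe, Real.fourier_eq']
  have h3 := Measure.integral_comp_mul_left
    (fun u => phase (-((q + 2 * Real.pi * n / θ) * u)) * (f u : ℂ)) θ
  rw [abs_inv, abs_of_pos hθ, eq_inv_smul_iff₀ hθ.ne', Complex.real_smul] at h3
  rw [fourier, ← h3]
  congr 1
  refine integral_congr_ae (Filter.Eventually.of_forall fun y => ?_)
  have e1 : hgc.toSchwartzMap hgs y = (f (θ * y) : ℂ) * phase (-(q * (θ * y))) := rfl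
  have e2 : Complex.exp (((-2 * Real.pi * inner ℝ y (n : ℝ) : ℝ) : ℂ) * Complex.I) =
      phase (-(2 * Real.pi * n * y)) := by
    rw [phase, real_inner_eq_re_inner, mul_comm]
    congr 3
    simp
    ring
  simp only
  rw [e1, e2, smul_eq_mul, show -((q + 2 * Real.pi * n / θ) * (θ * y)) =
    -(2 * Real.pi * n * y) + -(q * (θ * y)) by field_simp; ring, phase_add]
  ring

lemma exists_finset_eq_zero (hc : HasCompactSupport f) {θ : ℝ} (hθ : 0 < θ) :
    ∃ s : Finset ℤ, ∀ y ∉ s, f (θ * y) = 0 := by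
  obtain ⟨R, hR⟩ := hc.isCompact.isBounded.subset_closedBall 0
  refine ⟨Finset.Icc (-⌈R / θ⌉) ⌈R / θ⌉, fun y hy => ?_⟩
  by_contra hne
  apply hy
  have h1 := hR (subset_tsupport f (Function.mem_support.2 hne))
  rw [mem_closedBall_zero_iff, norm_mul, Real.norm_of_nonneg hθ.le, Real.norm_eq_abs,
    ← le_div_iff₀' hθ] at h1
  have h2 := h1.trans (Int.le_ceil _)
  rw [← Int.cast_abs, Int.cast_le, abs_le] at h2
  exact Finset.mem_Icc.2 h2

lemma continuous_torusFourier (hf : ContDiff ℝ (⊤ : ℕ∞) f) (hc : HasCompactSupport f) {θ : ℝ}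
    (hθ : 0 < θ) : Continuous (torusFourier f θ) := by
  obtain ⟨s, hs⟩ := exists_finset_eq_zero hc hθ
  have : torusFourier f θ = fun q => θ * ∑ y ∈ s, (f (θ * y) : ℂ) * phase (-(q * (θ * y))) := by
    ext q
    rw [torusFourier_eq hf hc hθ, tsum_eq_sum fun y hy => by rw [hs y hy]; simp]
  rw [this]
  refine continuous_const.mul (continuous_finsetSum _ fun y _ => continuous_const.mul ?_)
  exact Continuous.phase (by fun_prop)

/-- For |q| ≤ π/θ the n-th image has modulus at least |n|/θ, where quadratic decay of the transform
gives a term of order θ²/n². -/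
lemma exists_torusFourier_sub_le (hf : ContDiff ℝ (⊤ : ℕ∞) f) (hc : HasCompactSupport f) :
    ∃ C ≥ 0, ∀ θ > 0, ∀ q, |q| ≤ Real.pi / θ →
      ‖torusFourier f θ q - fourier f q‖ ≤ C * θ ^ 2 := by
  obtain ⟨C, hC, hd⟩ := exists_fourier_decay hf hc
  have hs : Summable fun n : ℤ => 1 / (n : ℝ) ^ 2 := Real.summable_one_div_int_pow.2 one_lt_two
  refine ⟨C * ∑' n : ℤ, 1 / (n : ℝ) ^ 2,
    mul_nonneg hC (tsum_nonneg fun n => by positivity), fun θ hθ q hq => ?_⟩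
  have hb : ∀ n : ℤ, n ≠ 0 → ‖fourier f (q + 2 * Real.pi * n / θ)‖ ≤
      C * θ ^ 2 * (1 / (n : ℝ) ^ 2) := by
    intro n hn
    have h1 : (1 : ℝ) ≤ |(n : ℝ)| := by
      rw [← Int.cast_abs]; exact_mod_cast Int.one_le_abs hn
    have h2 : |(n : ℝ)| / θ ≤ |q + 2 * Real.pi * n / θ| := by
      have h3 := abs_sub (q + 2 * Real.pi * n / θ) q
      rw [add_sub_cancel_left, abs_div, abs_mul, abs_of_pos Real.two_pi_pos, abs_of_pos hθ] at h3
      have h4 : Real.pi / θ + |(n : ℝ)| / θ ≤ 2 * Real.pi * |(n : ℝ)| / θ := by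
        rw [← add_div]
        gcongr
        nlinarith [Real.pi_gt_three]
      linarith
    have h5 := hd (q + 2 * Real.pi * n / θ)
    have h6 : (|(n : ℝ)| / θ) ^ 2 * ‖fourier f (q + 2 * Real.pi * n / θ)‖ ≤ C :=
      le_trans (by gcongr) h5
    have hn' : 0 < |(n : ℝ)| := by linarith
    rw [div_pow, sq_abs, div_mul_eq_mul_div, div_le_iff₀ (by positivity)] at h6
    have hn2 : 0 < (n : ℝ) ^ 2 := by positivity
    rw [mul_one_div, le_div_iff₀ hn2]
    linarith
  have hsum : Summable fun n : ℤ => C * θ ^ 2 * (1 / (n : ℝ) ^ 2) := hs.mul_left _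
  have hsF : Summable fun n : ℤ => fourier f (q + 2 * Real.pi * n / θ) := by
    refine Summable.of_norm_bounded_eventually hsum ?_
    refine (Set.finite_singleton (0 : ℤ)).subset fun n hn => ?_
    by_contra hn0
    exact hn (hb n hn0)
  have h0 : fourier f (q + 2 * Real.pi * (0 : ℤ) / θ) = fourier f q := by simp
  rw [torusFourier, hsF.tsum_eq_add_tsum_ite 0, h0, add_sub_cancel_left]
  have h1 : ∀ n : ℤ, ‖if n = 0 then (0 : ℂ) else fourier f (q + 2 * Real.pi * n / θ)‖ ≤
      C * θ ^ 2 * (1 / (n : ℝ) ^ 2) := by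
    intro n
    split_ifs with hn
    · rw [norm_zero]; positivity
    · exact hb n hn
  refine (tsum_of_norm_bounded hsum.hasSum h1).trans (le_of_eq ?_)
  rw [tsum_mul_left]; ring

/-- Insert 1/(1 + ibq) = ∫₀^∞ e^{-(1+ibq)t} dt, exchange the integrals, invert the Fourier transform
and substitute y = bt. The condition 0 < y/b selects the half-line on the correct side for either
sign of b. -/
lemma integral_fourier_mul_phase_div (hf : ContDiff ℝ (⊤ : ℕ∞) f) (hc : HasCompactSupport f)
    {b : ℝ} (hb : b ≠ 0) (X : ℝ) :
    ∫ q, fourier f q * phase (q * X) / (1 + Complex.I * (b * q)) / (2 * Real.pi) =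
      ((∫ y in {y : ℝ | 0 < y / b}, f (X - y) * (1 / |b| * Real.exp (-y / b)) : ℝ) : ℂ) := by
  have hexp : ∀ q : ℝ, ∫ t in Set.Ioi (0 : ℝ), Complex.exp (-(1 + Complex.I * (b * q)) * t) =
      1 / (1 + Complex.I * (b * q)) := by
    intro q
    rw [integral_exp_mul_complex_Ioi (by simp)]
    rw [Complex.ofReal_zero, mul_zero, Complex.exp_zero, neg_div_neg_eq]
  have h1 : ∀ q : ℝ, fourier f q * phase (q * X) / (1 + Complex.I * (b * q)) / (2 * Real.pi) =
      ∫ t in Set.Ioi (0 : ℝ), fourier f q * phase (q * (X - b * t)) / (2 * Real.pi) *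
        (Real.exp (-t) : ℂ) := by
    intro q
    have e : ∀ t : ℝ, fourier f q * phase (q * (X - b * t)) / (2 * Real.pi) * (Real.exp (-t) : ℂ) =
        fourier f q * phase (q * X) / (2 * Real.pi) *
          Complex.exp (-(1 + Complex.I * (b * q)) * t) := by
      intro t
      have : phase (q * (X - b * t)) * (Real.exp (-t) : ℂ) =
          phase (q * X) * Complex.exp (-(1 + Complex.I * (b * q)) * t) := by
        rw [phase, phase, Complex.ofReal_exp, ← Complex.exp_add, ← Complex.exp_add]
        push_cast; ring_nf
      linear_combination (fourier f q / (2 * Real.pi)) * this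
    simp only [e]
    rw [integral_const_mul, hexp]
    ring
  have hint : Integrable (Function.uncurry fun q t : ℝ =>
      fourier f q * phase (q * (X - b * t)) / (2 * Real.pi) * (Real.exp (-t) : ℂ))
      (volume.prod (volume.restrict (Set.Ioi 0))) := by
    have h2 : Integrable (fun z : ℝ × ℝ => fourier f z.1 * (Real.exp (-z.2) : ℂ))
        (volume.prod (volume.restrict (Set.Ioi 0))) :=
      (integrable_fourier hf hc).mul_prod (g := fun t : ℝ => ((Real.exp (-t) : ℝ) : ℂ))
        (integrableOn_exp_neg_Ioi 0).ofReal
    have h3 := h2.bdd_mul (c := 1 / (2 * Real.pi))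
      (f := fun z : ℝ × ℝ => phase (z.1 * (X - b * z.2)) / (2 * Real.pi))
      (Continuous.aestronglyMeasurable ((Continuous.phase (by fun_prop)).div_const _))
      (Filter.Eventually.of_forall fun z => by
        rw [norm_div, norm_phase, norm_mul, Complex.norm_real, Real.norm_of_nonneg Real.pi_pos.le]
        simp)
    refine h3.congr (Filter.Eventually.of_forall fun z => ?_)
    simp only [Function.uncurry]
    ring
  rw [integral_congr_ae (Filter.Eventually.of_forall h1), integral_integral_swap hint]
  have h4 : ∀ t : ℝ, ∫ q, fourier f q * phase (q * (X - b * t)) / (2 * Real.pi) *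
      (Real.exp (-t) : ℂ) = ((f (X - b * t) * Real.exp (-t) : ℝ) : ℂ) := by
    intro t
    rw [integral_mul_const, integral_fourier_mul_phase hf hc]
    push_cast; ring
  simp only [h4]
  rw [integral_complex_ofReal]
  congr 1
  have hm : MeasurableSet {y : ℝ | 0 < y / b} :=
    measurableSet_lt measurable_const (measurable_id.div_const b)
  rw [← integral_indicator measurableSet_Ioi, ← integral_indicator hm]
  have h5 := Measure.integral_comp_mul_left ({y : ℝ | 0 < y / b}.indicator
    fun y => f (X - y) * (1 / |b| * Real.exp (-y / b))) b
  rw [abs_inv, eq_inv_smul_iff₀ (abs_ne_zero.2 hb), smul_eq_mul, ← integral_const_mul] at h5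
  rw [← h5]
  refine integral_congr_ae (Filter.Eventually.of_forall fun t => ?_)
  have hb' := abs_ne_zero.2 hb
  by_cases ht : 0 < t
  · have : b * t ∈ {y : ℝ | 0 < y / b} := by
      simpa [mul_div_cancel_left₀ _ hb] using ht
    simp only [Set.indicator_of_mem (Set.mem_Ioi.2 ht), Set.indicator_of_mem this]
    rw [show -(b * t) / b = -t by field_simp]
    field_simp
  · have : b * t ∉ {y : ℝ | 0 < y / b} := by
      simpa [mul_div_cancel_left₀ _ hb] using ht
    have h0 : t ∉ Set.Ioi (0 : ℝ) := ht
    simp only [Set.indicator_of_notMem h0, Set.indicator_of_notMem this, mul_zero]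

lemma abs_setIntegral_convolution_le (hf : ContDiff ℝ (⊤ : ℕ∞) f) (hc : HasCompactSupport f)
    (b X : ℝ) :
    |∫ y in {y : ℝ | 0 < y / b}, f (X - y) * (1 / |b| * Real.exp (-y / b))| ≤
      1 / |b| * ∫ y, |f y| := by
  have hm : MeasurableSet {y : ℝ | 0 < y / b} :=
    measurableSet_lt measurable_const (measurable_id.div_const b)
  have hi : Integrable fun y => |f (X - y)| :=
    ((hf.continuous.integrable_of_hasCompactSupport hc).comp_sub_left X).abs
  have h1 := norm_integral_le_of_norm_le (μ := volume.restrict {y : ℝ | 0 < y / b})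
    (f := fun y => f (X - y) * (1 / |b| * Real.exp (-y / b)))
    (hi.const_mul (1 / |b|)).integrableOn ((ae_restrict_iff' hm).2
      (Filter.Eventually.of_forall fun y hy => by
        rw [Real.norm_eq_abs, abs_mul, abs_mul, Real.abs_exp, abs_of_nonneg (by positivity : 0 ≤ 1 / |b|)]
        have : Real.exp (-y / b) ≤ 1 := by
          rw [Real.exp_le_one_iff, neg_div]
          exact neg_nonpos.2 (le_of_lt hy)
        calc |f (X - y)| * (1 / |b| * Real.exp (-y / b)) ≤ |f (X - y)| * (1 / |b| * 1) := by gcongr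
          _ = _ := by ring))
  rw [Real.norm_eq_abs] at h1
  refine h1.trans ((setIntegral_le_integral (hi.const_mul _)
    (Filter.Eventually.of_forall fun y => by positivity)).trans (le_of_eq ?_))
  rw [integral_const_mul, integral_sub_left_eq_self (fun y => |f y|) volume X]

end

end LinearResponse
end

noncomputable section
namespace LinearResponse

open MeasureTheory

/-! ### Evaluation of the linear response -/

lemma measurable_correlation {M : ℕ} (h : Hopping M) (μ : ℝ) (ν : Fin 2) (p₀ : ℝ) :
    Measurable fun p => correlation h μ ν p₀ p :=
  ((measurable_correlation_integrand h μ ν p₀).stronglyMeasurable.integral_prod_right'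
    (ν := volume.restrict (Set.univ ×ˢ Set.Ioc (-Real.pi) Real.pi))).measurable.neg

/-- Removing the cutoff thus costs a moment of whatever order is convenient. -/
lemma IsCutoff.abs_one_sub_le {χ : ℝ → ℝ} (hχ : IsCutoff χ) {t : ℝ} (ht : 0 ≤ t) (j : ℕ) :
    |1 - χ t| ≤ t ^ j := by
  have h0 := hχ.nonneg t
  have h1 := hχ.le_one t
  rcases le_or_gt t 1 with h | h
  · rw [hχ.eq_one t h, sub_self, abs_zero]; positivity
  · rw [abs_of_nonneg (by linarith)]
    linarith [one_le_pow₀ h.le (n := j)]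

section
variable {M N : ℕ} {h : Hopping M} {μ : ℝ}

lemma measurable_leading (A : LowEnergySpectrum h μ N) (ν : Fin 2) (p₀ : ℝ) :
    Measurable fun p => leading A ν p₀ p := by
  unfold leading
  fun_prop

/-- On the support of the cutoff θ|q| ≤ 2θ^(1-α), so K_ν is only needed at small momenta, where it
is `leading` up to O(θ|q|). All errors are paid for by moments of the rapidly decaying transform of
f. -/
lemma LowEnergySpectrum.exists_linResp_sub_le (hh : h.SelfAdjoint) (A : LowEnergySpectrum h μ N)
    {α : ℝ} (hα : α ∈ Set.Ioo (0 : ℝ) 1) {χ : ℝ → ℝ} (hχ : IsCutoff χ)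
    {f : ℝ → ℝ} (hf : ContDiff ℝ (⊤ : ℕ∞) f) (hc : HasCompactSupport f) :
    ∃ C ≥ 0, ∃ θ₀ > 0, θ₀ ≤ 1 ∧ ∀ (ν : Fin 2) (x : ℤ) (η θ : ℝ), 0 < η → 0 < θ → θ < θ₀ →
      ‖linResp h μ χ α f ν x η θ -
        -∫ q, fourier f (-q) * phase (-(θ * q * x)) * leading A ν η (θ * q) / (2 * Real.pi)‖
        ≤ C * θ := by
  obtain ⟨C₁, hC₁, r, hr, hK⟩ := A.exists_correlation_bounds hh
  obtain ⟨C₂, hC₂, hT⟩ := exists_torusFourier_sub_le hf hc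
  obtain ⟨j, hj⟩ := exists_nat_ge (1 / α)
  -- The cutoff costs at most (θ^α |q|)^j, and this exponent turns that into θ|q|^j for θ ≤ 1.
  have hαj : 1 ≤ α * j := by
    rw [div_le_iff₀ hα.1] at hj; linarith
  set B : ℝ := ∑ ν, ∑ ω, |A.coeff ν ω| with hB
  have hB0 : 0 ≤ B := Finset.sum_nonneg fun ν _ => Finset.sum_nonneg fun ω _ => abs_nonneg _
  have hlead : ∀ ν p₀ p, ‖leading A ν p₀ p‖ ≤ B := fun ν p₀ p =>
    (norm_leading_le A ν p₀ p).trans (Finset.single_le_sum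
      (f := fun ν => ∑ ω, |A.coeff ν ω|) (fun ν _ => Finset.sum_nonneg fun ω _ => abs_nonneg _)
      (Finset.mem_univ ν))
  set g : ℝ → ℝ := fun q => C₁ * (|q| ^ 1 * ‖fourier f q‖) + B * (|q| ^ j * ‖fourier f q‖) +
    B * (|q| ^ 1 * ‖fourier f q‖) with hg
  have hgi : Integrable g := (((integrable_pow_mul_fourier hf hc 1).const_mul C₁).add
    ((integrable_pow_mul_fourier hf hc j).const_mul B)).add
    ((integrable_pow_mul_fourier hf hc 1).const_mul B)
  have hg0 : ∀ q, 0 ≤ g q := fun q => by simp only [hg]; positivity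
  -- below `θ₀` the support of the cutoff lies in the region of small momenta
  obtain ⟨θ₀, hθ₀, hθ₀1, hsmall⟩ : ∃ θ₀ > 0, θ₀ ≤ 1 ∧ ∀ θ, 0 < θ → θ < θ₀ →
      2 * θ ^ (1 - α) < r := by
    have h1 : Filter.Tendsto (fun θ : ℝ => 2 * θ ^ (1 - α)) (𝓝 0) (𝓝 0) := by
      have := (Real.continuousAt_rpow_const 0 (1 - α) (Or.inr (by linarith [hα.2]))).tendsto
      rw [Real.zero_rpow (by linarith [hα.2])] at this
      simpa using this.const_mul 2
    obtain ⟨ε, hε, hball⟩ := Metric.eventually_nhds_iff.1 (h1.eventually (gt_mem_nhds hr))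
    refine ⟨min ε 1, lt_min hε one_pos, min_le_right _ _, fun θ hθ hθε => hball ?_⟩
    rw [Real.dist_eq, sub_zero, abs_of_pos hθ]
    exact hθε.trans_le (min_le_left _ _)
  -- The error θ² of the periodized transform is integrated over an interval of length 2π/θ; the
  -- other errors are θ times the integrable function g.
  refine ⟨C₂ * (B + C₁ * r) * (2 * Real.pi) + ∫ q, g (-q), by
    have := integral_nonneg (μ := volume) (f := fun q => g (-q)) fun q => hg0 _
    positivity, θ₀, hθ₀, hθ₀1, fun ν x η θ hη hθ hθθ₀ => ?_⟩
  have hθ1 : θ ≤ 1 := (hθθ₀.trans_le hθ₀1).le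
  set S := Set.Ioc (-(Real.pi / θ)) (Real.pi / θ) with hS
  set F : ℝ → ℂ := S.indicator fun q => torusFourier f θ (-q) * (χ (θ ^ α * |q|) : ℂ) *
    phase (-(θ * q * x)) * correlation h μ ν η (θ * q) / (2 * Real.pi : ℂ) with hF
  set G : ℝ → ℂ := fun q => fourier f (-q) * phase (-(θ * q * x)) * leading A ν η (θ * q) /
    (2 * Real.pi) with hG
  set b : ℝ → ℝ := fun q => S.indicator (fun _ => C₂ * (B + C₁ * r) * θ ^ 2) q + θ * g (-q) with hb
  have hLF : linResp h μ χ α f ν x η θ = -∫ q, F q := by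
    rw [hF, integral_indicator measurableSet_Ioc, linResp]
  have hnπ : ∀ z : ℂ, ‖z / (2 * Real.pi)‖ ≤ ‖z‖ := fun z => by
    rw [norm_div]
    refine div_le_self (norm_nonneg _) ?_
    rw [norm_mul, Complex.norm_real, Real.norm_of_nonneg Real.pi_pos.le, Complex.norm_ofNat]
    linarith [Real.pi_gt_three]
  have hFm : AEStronglyMeasurable F := by
    refine Measurable.aestronglyMeasurable (Measurable.indicator ?_ measurableSet_Ioc)
    have m1 : Measurable fun q => torusFourier f θ (-q) :=
      ((continuous_torusFourier hf hc hθ).comp continuous_neg).measurable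
    have m2 : Measurable fun q : ℝ => (χ (θ ^ α * |q|) : ℂ) := by
      have := hχ.smooth.continuous
      exact (by fun_prop : Continuous fun q : ℝ => (χ (θ ^ α * |q|) : ℂ)).measurable
    have m3 : Measurable fun q : ℝ => phase (-(θ * q * x)) := Measurable.phase (by fun_prop)
    have m4 : Measurable fun q : ℝ => correlation h μ ν η (θ * q) :=
      (measurable_correlation h μ ν η).comp (measurable_const_mul θ)
    exact (((m1.mul m2).mul m3).mul m4).div_const _
  have hGi : Integrable G := by
    have h1 : Integrable fun q => fourier f (-q) := (integrable_fourier hf hc).comp_neg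
    have m3 : Measurable fun q : ℝ => phase (-(θ * q * x)) := Measurable.phase (by fun_prop)
    have m4 : Measurable fun q : ℝ => leading A ν η (θ * q) :=
      (measurable_leading A ν η).comp (measurable_const_mul θ)
    refine ((h1.mul_bdd (c := B) (m3.mul m4).aestronglyMeasurable
      (Filter.Eventually.of_forall fun q => ?_)).div_const (2 * Real.pi)).congr
      (Filter.Eventually.of_forall fun q => ?_)
    · simp only [Pi.mul_apply, norm_mul, norm_phase, one_mul]
      exact hlead _ _ _
    · simp only [hG, Pi.mul_apply]; ring
  have hpt : ∀ q, ‖F q - G q‖ ≤ b q := by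
    intro q
    have habs : |(-q)| = |q| := abs_neg q
    by_cases hq : q ∈ S
    · have hqπ : |q| ≤ Real.pi / θ := abs_le.2 ⟨hq.1.le, hq.2⟩
      have hθq : |θ * q| = θ * |q| := by rw [abs_mul, abs_of_pos hθ]
      have htf := hT θ hθ (-q) (by rwa [habs])
      have hGn := hlead ν η (θ * q)
      simp only [hF, hG, hb, Set.indicator_of_mem hq]
      rw [← sub_div]
      refine (hnπ _).trans ?_
      -- Three replacements, one per summand: the periodized transform, the correlation, and the
      -- cutoff.
      have hsplit : torusFourier f θ (-q) * (χ (θ ^ α * |q|) : ℂ) * phase (-(θ * q * x)) *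
          correlation h μ ν η (θ * q) - fourier f (-q) * phase (-(θ * q * x)) *
            leading A ν η (θ * q) = phase (-(θ * q * x)) *
          ((torusFourier f θ (-q) - fourier f (-q)) *
              ((χ (θ ^ α * |q|) : ℂ) * correlation h μ ν η (θ * q)) +
            fourier f (-q) * ((χ (θ ^ α * |q|) : ℂ) *
              (correlation h μ ν η (θ * q) - leading A ν η (θ * q))) -
            fourier f (-q) * ((1 - χ (θ ^ α * |q|) : ℝ) : ℂ) * leading A ν η (θ * q)) := by
        push_cast; ring
      rw [hsplit, norm_mul, norm_phase, one_mul]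
      have hχ1 : ‖((1 - χ (θ ^ α * |q|) : ℝ) : ℂ)‖ ≤ θ * |q| ^ j := by
        rw [Complex.norm_real, Real.norm_eq_abs]
        refine (hχ.abs_one_sub_le (by positivity) j).trans ?_
        rw [mul_pow, ← Real.rpow_mul_natCast hθ.le]
        gcongr
        simpa using Real.rpow_le_rpow_of_exponent_ge hθ hθ1 hαj
      have hχK : ‖(χ (θ ^ α * |q|) : ℂ) * correlation h μ ν η (θ * q)‖ ≤ B + C₁ * r ∧
          ‖(χ (θ ^ α * |q|) : ℂ) * (correlation h μ ν η (θ * q) - leading A ν η (θ * q))‖ ≤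
            C₁ * (θ * |q|) := by
        by_cases hz : 2 ≤ θ ^ α * |q|
        · rw [hχ.eq_zero _ hz]
          simp only [Complex.ofReal_zero, zero_mul, norm_zero]
          constructor <;> positivity
        · push Not at hz
          have hlt : |θ * q| < r := by
            rw [hθq]
            refine lt_trans ?_ (hsmall θ hθ hθθ₀)
            have : θ = θ ^ (1 - α) * θ ^ α := by
              rw [← Real.rpow_add hθ]; simp
            calc θ * |q| = θ ^ (1 - α) * (θ ^ α * |q|) := by rw [← mul_assoc, ← this]
              _ < θ ^ (1 - α) * 2 := by
                have := Real.rpow_pos_of_pos hθ (1 - α)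
                gcongr
              _ = _ := by ring
          have hk := (hK ν η (θ * q) (by simp [hη.ne']) hlt).1
          have hχn : ‖(χ (θ ^ α * |q|) : ℂ)‖ ≤ 1 := by
            rw [Complex.norm_real, Real.norm_of_nonneg (hχ.nonneg _)]; exact hχ.le_one _
          constructor
          · rw [norm_mul]
            refine (mul_le_of_le_one_left (norm_nonneg _) hχn).trans ?_
            have h1 := norm_le_norm_add_norm_sub' (correlation h μ ν η (θ * q))
              (leading A ν η (θ * q))
            have h2 : C₁ * |θ * q| ≤ C₁ * r := by gcongr
            linarith
          · rw [norm_mul, ← hθq]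
            exact (mul_le_of_le_one_left (norm_nonneg _) hχn).trans hk
      refine (norm_sub_le _ _).trans ((add_le_add_left (norm_add_le _ _) _).trans ?_)
      rw [norm_mul, norm_mul (fourier f (-q)), norm_mul (_ * _), norm_mul (fourier f (-q))]
      have t1 : ‖torusFourier f θ (-q) - fourier f (-q)‖ *
          ‖(χ (θ ^ α * |q|) : ℂ) * correlation h μ ν η (θ * q)‖ ≤ C₂ * θ ^ 2 * (B + C₁ * r) :=
        mul_le_mul htf hχK.1 (norm_nonneg _) (by positivity)
      have t2 := mul_le_mul_of_nonneg_left hχK.2 (norm_nonneg (fourier f (-q)))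
      have t3 : ‖fourier f (-q)‖ * ‖((1 - χ (θ ^ α * |q|) : ℝ) : ℂ)‖ * ‖leading A ν η (θ * q)‖ ≤
          ‖fourier f (-q)‖ * (θ * |q| ^ j) * B := by gcongr
      have t4 : 0 ≤ θ * (B * (|q| ^ 1 * ‖fourier f (-q)‖)) := by positivity
      simp only [hg, habs, pow_one] at t4 ⊢
      linarith
    · simp only [hF, hG, hb, Set.indicator_of_notMem hq, zero_sub, norm_neg, zero_add]
      refine (hnπ _).trans ?_
      rw [norm_mul, norm_mul, norm_phase, mul_one]
      -- Outside the Brillouin zone θ|q| ≥ π, so one extra factor θ|q| makes the tail of the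
      -- limiting integral O(θ).
      have hq1 : 1 ≤ θ * |q| := by
        have : Real.pi / θ ≤ |q| := by
          rw [hS, Set.mem_Ioc, not_and_or, not_lt, not_le] at hq
          rcases hq with hq | hq
          · exact (le_neg_of_le_neg hq).trans (neg_le_abs q)
          · exact hq.le.trans (le_abs_self q)
        rw [div_le_iff₀ hθ] at this
        linarith [Real.pi_gt_three]
      have t1 : ‖fourier f (-q)‖ * ‖leading A ν η (θ * q)‖ ≤ ‖fourier f (-q)‖ * B := by
        gcongr; exact hlead _ _ _
      have t2 : ‖fourier f (-q)‖ * B ≤ ‖fourier f (-q)‖ * B * (θ * |q|) :=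
        le_mul_of_one_le_right (by positivity) hq1
      have t3 : 0 ≤ θ * (C₁ * (|q| ^ 1 * ‖fourier f (-q)‖) + B * (|q| ^ j * ‖fourier f (-q)‖)) := by
        positivity
      simp only [hg, habs, pow_one] at t3 ⊢
      linarith
  have hbS : Integrable (S.indicator fun _ : ℝ => C₂ * (B + C₁ * r) * θ ^ 2) :=
    (integrable_indicator_iff measurableSet_Ioc).2 (integrableOn_const (by simp))
  have hbi : Integrable b := hbS.add (hgi.comp_neg.const_mul θ)
  have hFGi : Integrable fun q => F q - G q :=
    hbi.mono' (hFm.sub hGi.aestronglyMeasurable) (Filter.Eventually.of_forall hpt)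
  have hFi : Integrable F := by
    refine (hFGi.add hGi).congr (Filter.Eventually.of_forall fun q => ?_)
    simp
  rw [hLF, neg_sub_neg, norm_sub_rev, ← integral_sub hFi hGi]
  refine (norm_integral_le_of_norm_le hbi (Filter.Eventually.of_forall hpt)).trans (le_of_eq ?_)
  have e1 : ∫ q, b q = (∫ q, S.indicator (fun _ : ℝ => C₂ * (B + C₁ * r) * θ ^ 2) q) +
      ∫ q, θ * g (-q) := integral_add hbS (hgi.comp_neg.const_mul θ)
  rw [e1, integral_const_mul, integral_indicator measurableSet_Ioc, setIntegral_const,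
    Measure.real, Real.volume_Ioc, ENNReal.toReal_ofReal (by
      have := div_pos Real.pi_pos hθ; linarith), smul_eq_mul]
  field_simp
  ring

/-- The bound |K_ν| ≤ C|p|/|p₀| at (η, θq) supplies the factor θ/η for every θ and η. The correction
θ² to the transform, weighted by |q| ≤ π/θ over length 2π/θ, contributes a constant. -/
lemma LowEnergySpectrum.exists_linResp_le (hh : h.SelfAdjoint) (A : LowEnergySpectrum h μ N)
    (α : ℝ) {χ : ℝ → ℝ} (hχ : IsCutoff χ)
    {f : ℝ → ℝ} (hf : ContDiff ℝ (⊤ : ℕ∞) f) (hc : HasCompactSupport f) :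
    ∃ C, ∀ (ν : Fin 2) (x : ℤ) (η θ : ℝ), 0 < η → 0 < θ →
      ‖linResp h μ χ α f ν x η θ‖ ≤ C * (θ / η) := by
  obtain ⟨C₁, hC₁, hK⟩ := A.exists_correlation_bound hh
  obtain ⟨C₂, hC₂, hT⟩ := exists_torusFourier_sub_le hf hc
  have hgi : Integrable fun q => |(-q)| ^ 1 * ‖fourier f (-q)‖ :=
    (integrable_pow_mul_fourier hf hc 1).comp_neg
  refine ⟨C₁ * ((∫ q, |(-q)| ^ 1 * ‖fourier f (-q)‖) + 2 * Real.pi ^ 2 * C₂),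
    fun ν x η θ hη hθ => ?_⟩
  have hπθ : 0 < Real.pi / θ := div_pos Real.pi_pos hθ
  rw [linResp, norm_neg]
  have hbi : Integrable (fun q => C₁ * (θ / η) * (|(-q)| ^ 1 * ‖fourier f (-q)‖) +
      C₁ * (θ / η) * (Real.pi / θ * (C₂ * θ ^ 2)))
      (volume.restrict (Set.Ioc (-(Real.pi / θ)) (Real.pi / θ))) :=
    (hgi.const_mul _).integrableOn.add (integrable_const _)
  refine (norm_integral_le_of_norm_le hbi ((ae_restrict_iff' measurableSet_Ioc).2
    (Filter.Eventually.of_forall fun q hq => ?_))).trans ?_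
  · have hqπ : |q| ≤ Real.pi / θ := abs_le.2 ⟨hq.1.le, hq.2⟩
    have hnπ : ∀ z : ℂ, ‖z / (2 * Real.pi)‖ ≤ ‖z‖ := fun z => by
      rw [norm_div]
      refine div_le_self (norm_nonneg _) ?_
      rw [norm_mul, Complex.norm_real, Real.norm_of_nonneg Real.pi_pos.le, Complex.norm_ofNat]
      linarith [Real.pi_gt_three]
    have htf := hT θ hθ (-q) (by rwa [abs_neg])
    have hk := hK ν η (θ * q) hη.ne'
    rw [abs_mul, abs_of_pos hθ, abs_of_pos hη] at hk
    refine (hnπ _).trans ?_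
    rw [norm_mul, norm_mul, norm_mul, norm_phase, mul_one, abs_neg, pow_one, Complex.norm_real,
      Real.norm_of_nonneg (hχ.nonneg _)]
    have h1 : ‖torusFourier f θ (-q)‖ ≤ ‖fourier f (-q)‖ + C₂ * θ ^ 2 :=
      (norm_le_norm_add_norm_sub' _ _).trans (by gcongr)
    calc _ ≤ (‖fourier f (-q)‖ + C₂ * θ ^ 2) * 1 * (C₁ * (θ * |q|) / η) := by
          have := hχ.le_one (θ ^ α * |q|)
          have := hχ.nonneg (θ ^ α * |q|)
          gcongr
      _ = C₁ * (θ / η) * (|q| * ‖fourier f (-q)‖) + C₁ * (θ / η) * (|q| * (C₂ * θ ^ 2)) := by ring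
      _ ≤ _ := by gcongr
  · rw [integral_add (hgi.const_mul _).integrableOn (integrable_const _), setIntegral_const,
      Measure.real, Real.volume_Ioc, ENNReal.toReal_ofReal (by linarith), smul_eq_mul,
      integral_const_mul]
    have h1 := setIntegral_le_integral (s := Set.Ioc (-(Real.pi / θ)) (Real.pi / θ)) hgi
      (Filter.Eventually.of_forall fun q => by positivity)
    calc _ ≤ C₁ * (θ / η) * (∫ q, |(-q)| ^ 1 * ‖fourier f (-q)‖) +
          (Real.pi / θ - -(Real.pi / θ)) * (C₁ * (θ / η) * (Real.pi / θ * (C₂ * θ ^ 2))) := by gcongr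
      _ = _ := by field_simp; ring

lemma integral_leading_eq (A : LowEnergySpectrum h μ N)
    {f : ℝ → ℝ} (hf : ContDiff ℝ (⊤ : ℕ∞) f) (hc : HasCompactSupport f) (ν : Fin 2) (x : ℤ)
    {η a : ℝ} (hη : 0 < η) (ha : 0 < a) :
    ∫ q, fourier f (-q) * phase (-(a * η * q * x)) * leading A ν η (a * η * q) / (2 * Real.pi) =
      ∑ ω, (A.coeff ν ω : ℂ) * ∫ q : ℝ, fourier f q * phase (q * (a * η) * x) *
          (((A.v ω * q : ℝ) : ℂ) / (-(Complex.I / (a : ℂ)) + ((A.v ω * q : ℝ) : ℂ))) /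
          (2 * Real.pi : ℂ) := by
  have ha' : (a : ℂ) ≠ 0 := by exact_mod_cast ha.ne'
  have hη' : (η : ℂ) ≠ 0 := by exact_mod_cast hη.ne'
  -- Reflecting q turns f̂(-q) into f̂(q); a common factor -aη then cancels from the ratio.
  rw [← integral_neg_eq_self]
  simp only [← integral_const_mul]
  rw [← integral_finsetSum]
  · refine integral_congr_ae (Filter.Eventually.of_forall fun q => ?_)
    simp only [neg_neg, leading]
    rw [show -(a * η * -q * x) = q * (a * η) * x by ring, Finset.mul_sum, Finset.sum_div]
    refine Finset.sum_congr rfl fun ω _ => ?_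
    have : (A.v ω * ((a * η * -q : ℝ) : ℂ)) / (A.v ω * ((a * η * -q : ℝ) : ℂ) + Complex.I * η) =
        ((A.v ω * q : ℝ) : ℂ) / (-(Complex.I / (a : ℂ)) + ((A.v ω * q : ℝ) : ℂ)) := by
      have e1 : (A.v ω * ((a * η * -q : ℝ) : ℂ)) = -(a * η) * ((A.v ω * q : ℝ) : ℂ) := by
        push_cast; ring
      have e2 : -(a * η) * ((A.v ω * q : ℝ) : ℂ) + Complex.I * η =
          -(a * η) * (-(Complex.I / (a : ℂ)) + ((A.v ω * q : ℝ) : ℂ)) := by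
        field_simp; ring
      rw [e1, e2, mul_div_mul_left _ _ (neg_ne_zero.2 (mul_ne_zero ha' hη'))]
    rw [this]
    ring
  · intro ω _
    have m1 : Measurable fun q : ℝ => phase (q * (a * η) * x) := Measurable.phase (by fun_prop)
    have m2 : Measurable fun q : ℝ =>
        ((A.v ω * q : ℝ) : ℂ) / (-(Complex.I / (a : ℂ)) + ((A.v ω * q : ℝ) : ℂ)) := by fun_prop
    refine ((((integrable_fourier hf hc).mul_bdd (c := 1) (m1.mul m2).aestronglyMeasurable
      (Filter.Eventually.of_forall fun q => ?_)).div_const (2 * Real.pi)).const_mul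
        (A.coeff ν ω : ℂ)).congr (Filter.Eventually.of_forall fun q => ?_)
    · rw [Pi.mul_apply, norm_mul, norm_phase, one_mul]
      have := norm_ratio_le (A.v ω) q (-(1 / a))
      rwa [show (A.v ω * q + Complex.I * ((-(1 / a) : ℝ) : ℂ) : ℂ) =
        -(Complex.I / (a : ℂ)) + ((A.v ω * q : ℝ) : ℂ) by push_cast; ring,
        ← Complex.ofReal_mul] at this
    · simp only [Pi.mul_apply]
      ring

/-- The multiplier vq/(-i/a + vq) equals 1 - 1/(1 + iavq): Fourier inversion for the first term, the
one-sided exponential for the second. -/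
lemma integral_ratio_eq {f : ℝ → ℝ} (hf : ContDiff ℝ (⊤ : ℕ∞) f) (hc : HasCompactSupport f)
    {a v : ℝ} (ha : 0 < a) (hv : v ≠ 0) (X : ℝ) :
    ∫ q : ℝ, fourier f q * phase (q * X) *
        (((v * q : ℝ) : ℂ) / (-(Complex.I / (a : ℂ)) + ((v * q : ℝ) : ℂ))) / (2 * Real.pi : ℂ) =
      ((f X - ∫ y in {y : ℝ | 0 < y / v}, f (X - y) *
        (1 / (a * |v|) * Real.exp (-y / (a * v))) : ℝ) : ℂ) := by
  have hav : a * v ≠ 0 := mul_ne_zero ha.ne' hv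
  have ha' : (a : ℂ) ≠ 0 := by exact_mod_cast ha.ne'
  have h1 := integral_fourier_mul_phase_div hf hc hav X
  have hset : {y : ℝ | 0 < y / (a * v)} = {y : ℝ | 0 < y / v} := by
    ext y
    have : y / (a * v) = y / v / a := by field_simp
    simp only [Set.mem_ofPred_eq, this]
    exact div_pos_iff_of_pos_right ha
  rw [hset, abs_mul, abs_of_pos ha] at h1
  have hone : ∀ q : ℝ, (1 + Complex.I * (((a * v : ℝ) : ℂ) * q)) ≠ 0 := by
    intro q h0
    have := congrArg Complex.re h0
    simp at this
  have hb : ∀ q : ℝ, ‖(1 + Complex.I * (((a * v : ℝ) : ℂ) * q))⁻¹‖ ≤ 1 := by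
    intro q
    rw [norm_inv]
    refine inv_le_one_of_one_le₀ ?_
    have := Complex.abs_re_le_norm (1 + Complex.I * (((a * v : ℝ) : ℂ) * q))
    simpa using this
  have i1 : Integrable fun q : ℝ => fourier f q * phase (q * X) / (2 * Real.pi) := by
    refine ((integrable_fourier hf hc).mul_bdd (c := 1)
      (Measurable.phase (f := fun q : ℝ => q * X) (by fun_prop)).aestronglyMeasurable
      (Filter.Eventually.of_forall fun q => by rw [norm_phase])).div_const _
  have i2 : Integrable fun q : ℝ => fourier f q * phase (q * X) /
      (1 + Complex.I * (((a * v : ℝ) : ℂ) * q)) / (2 * Real.pi) := by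
    have m : Measurable fun q : ℝ => (1 + Complex.I * (((a * v : ℝ) : ℂ) * q))⁻¹ := by fun_prop
    refine (i1.mul_bdd (c := 1) m.aestronglyMeasurable
      (Filter.Eventually.of_forall hb)).congr (Filter.Eventually.of_forall fun q => ?_)
    simp only
    ring
  rw [Complex.ofReal_sub, ← h1, ← integral_fourier_mul_phase hf hc X, ← integral_sub i1 i2]
  refine integral_congr_ae (Filter.Eventually.of_forall fun q => ?_)
  have e : ((v * q : ℝ) : ℂ) / (-(Complex.I / (a : ℂ)) + ((v * q : ℝ) : ℂ)) =
      1 - 1 / (1 + Complex.I * (((a * v : ℝ) : ℂ) * q)) := by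
    have e1 : -(Complex.I / (a : ℂ)) + ((v * q : ℝ) : ℂ) =
        -(Complex.I / a) * (1 + Complex.I * (((a * v : ℝ) : ℂ) * q)) := by
      push_cast
      field_simp
      linear_combination (a * v * q : ℂ) * Complex.I_sq
    have hIa : -(Complex.I / (a : ℂ)) ≠ 0 := neg_ne_zero.2 (div_ne_zero Complex.I_ne_zero ha')
    rw [e1, eq_sub_iff_add_eq, ← mul_div_mul_left 1 _ hIa, ← add_div,
      div_eq_one_iff_eq (mul_ne_zero hIa (hone q)), ← e1]
    ring
  simp only
  rw [e]
  ring

lemma LowEnergySpectrum.exists_linResp_formula (hh : h.SelfAdjoint) (A : LowEnergySpectrum h μ N)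
    {α : ℝ} (hα : α ∈ Set.Ioo (0 : ℝ) 1) {χ : ℝ → ℝ} (hχ : IsCutoff χ)
    {f : ℝ → ℝ} (hf : ContDiff ℝ (⊤ : ℕ∞) f) (hc : HasCompactSupport f) :
    ∃ C ≥ 0, ∃ θ₀ > 0, ∀ (ν : Fin 2) (x : ℤ) (η a : ℝ), 0 < η → 0 < a → a * η < θ₀ →
      ‖linResp h μ χ α f ν x η (a * η) -
        -∑ ω, (A.coeff ν ω : ℂ) * ∫ q : ℝ, fourier f q * phase (q * (a * η) * x) *
          (((A.v ω * q : ℝ) : ℂ) / (-(Complex.I / (a : ℂ)) + ((A.v ω * q : ℝ) : ℂ))) /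
          (2 * Real.pi : ℂ)‖ ≤ C * (a * η) ^ (1 - α) := by
  obtain ⟨C, hC, θ₀, hθ₀, hθ₀1, hb⟩ := A.exists_linResp_sub_le hh hα hχ hf hc
  refine ⟨C, hC, θ₀, hθ₀, fun ν x η a hη ha hθ => ?_⟩
  have hθ0 : 0 < a * η := mul_pos ha hη
  rw [← integral_leading_eq A hf hc ν x hη ha]
  refine (hb ν x η (a * η) hη hθ0 hθ).trans (mul_le_mul_of_nonneg_left ?_ hC)
  -- The error obtained is O(θ), and θ ≤ θ^(1-α) because θ ≤ 1.
  simpa using Real.rpow_le_rpow_of_exponent_ge hθ0 (hθ.trans_le hθ₀1).le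
    (show 1 - α ≤ 1 by linarith [hα.1])

lemma LowEnergySpectrum.exists_linResp_explicit (hh : h.SelfAdjoint) (A : LowEnergySpectrum h μ N)
    {α : ℝ} (hα : α ∈ Set.Ioo (0 : ℝ) 1) {χ : ℝ → ℝ} (hχ : IsCutoff χ)
    {f : ℝ → ℝ} (hf : ContDiff ℝ (⊤ : ℕ∞) f) (hc : HasCompactSupport f) :
    ∃ C ≥ 0, ∃ θ₀ > 0, ∀ (ν : Fin 2) (x : ℤ) (η a : ℝ), 0 < η → 0 < a → a * η < θ₀ →
      ‖linResp h μ χ α f ν x η (a * η) -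
        ((-∑ ω, A.coeff ν ω * (f (a * η * x) -
            ∫ y in {y : ℝ | 0 < y / A.v ω}, f (a * η * x - y) *
              (1 / (a * |A.v ω|) * Real.exp (-y / (a * A.v ω)))) : ℝ) : ℂ)‖
        ≤ C * (a * η) ^ (1 - α) := by
  obtain ⟨C, hC, θ₀, hθ₀, hb⟩ := A.exists_linResp_formula hh hα hχ hf hc
  refine ⟨C, hC, θ₀, hθ₀, fun ν x η a hη ha hθ => ?_⟩
  convert hb ν x η a hη ha hθ using 3
  push_cast
  congr 1
  refine Finset.sum_congr rfl fun ω _ => ?_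
  have := integral_ratio_eq hf hc ha (A.velocity_ne_zero ω) (a * η * x)
  rw [← LowEnergySpectrum.v] at this
  simp only [mul_assoc] at this ⊢
  push_cast at this ⊢
  rw [this]

lemma LowEnergySpectrum.linResp_fast (hh : h.SelfAdjoint) (A : LowEnergySpectrum h μ N)
    {α : ℝ} {χ : ℝ → ℝ} (hχ : IsCutoff χ)
    {f : ℝ → ℝ} (hf : ContDiff ℝ (⊤ : ℕ∞) f) (hc : HasCompactSupport f) :
    ∃ C : ℝ, ∀ a : ℝ → ℝ, (∀ η, 0 < η → 0 < a η) → Filter.Tendsto a (𝓝[>] 0) (𝓝 0) →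
      ∀ᶠ η in 𝓝[>] (0 : ℝ), ∀ (ν : Fin 2) (x : ℤ),
        ‖linResp h μ χ α f ν x η (a η * η)‖ ≤ C * a η := by
  obtain ⟨C, hC⟩ := A.exists_linResp_le hh α hχ hf hc
  refine ⟨C, fun a ha _ => ?_⟩
  filter_upwards [self_mem_nhdsWithin] with η hη ν x
  have hη' : 0 < η := hη
  have := hC ν x η (a η * η) hη (mul_pos (ha η hη) hη)
  rwa [mul_div_cancel_right₀ _ hη'.ne'] at this

lemma LowEnergySpectrum.linResp_balanced (hh : h.SelfAdjoint) (A : LowEnergySpectrum h μ N)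
    {α : ℝ} (hα : α ∈ Set.Ioo (0 : ℝ) 1) {χ : ℝ → ℝ} (hχ : IsCutoff χ)
    {f : ℝ → ℝ} (hf : ContDiff ℝ (⊤ : ℕ∞) f) (hc : HasCompactSupport f) {a : ℝ} (ha : 0 < a) :
    ∃ C : ℝ, ∀ᶠ η in 𝓝[>] (0 : ℝ), ∀ (ν : Fin 2) (x : ℤ),
        ‖linResp h μ χ α f ν x η (a * η) -
          ((-∑ ω, A.coeff ν ω * (f (a * η * x) -
            ∫ y in {y : ℝ | 0 < y / A.v ω}, f (a * η * x - y) *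
              (1 / (a * |A.v ω|) * Real.exp (-y / (a * A.v ω)))) : ℝ) : ℂ)‖
          ≤ C * η ^ (1 - α) := by
  obtain ⟨C, hC, θ₀, hθ₀, hb⟩ := A.exists_linResp_explicit hh hα hχ hf hc
  refine ⟨C * a ^ (1 - α), ?_⟩
  have h1 : ∀ᶠ η in 𝓝[>] (0 : ℝ), η < θ₀ / a :=
    nhdsWithin_le_nhds (gt_mem_nhds (div_pos hθ₀ ha))
  filter_upwards [self_mem_nhdsWithin, h1] with η hη hηθ ν x
  have hη' : 0 < η := hη
  rw [mul_assoc C, ← Real.mul_rpow ha.le hη'.le]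
  exact hb ν x η a hη ha (by rwa [lt_div_iff₀' ha] at hηθ)

/-- The kernel of the exponential average is at most 1/(a|v|), so that term is bounded by
‖f‖₁/(a|v|), uniformly in x. What is left of the explicit formula is local. -/
lemma LowEnergySpectrum.linResp_slow (hh : h.SelfAdjoint) (A : LowEnergySpectrum h μ N)
    {α : ℝ} (hα : α ∈ Set.Ioo (0 : ℝ) 1) {χ : ℝ → ℝ} (hχ : IsCutoff χ)
    {f : ℝ → ℝ} (hf : ContDiff ℝ (⊤ : ℕ∞) f) (hc : HasCompactSupport f) :
    ∃ C : ℝ, ∀ a : ℝ → ℝ, (∀ η, 0 < η → 0 < a η) →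
      Filter.Tendsto a (𝓝[>] 0) Filter.atTop →
      Filter.Tendsto (fun η => a η * η) (𝓝[>] 0) (𝓝 0) →
      ∀ᶠ η in 𝓝[>] (0 : ℝ), ∀ (ν : Fin 2) (x : ℤ),
        ‖linResp h μ χ α f ν x η (a η * η) -
          ((-(f (a η * η * x) * ∑ ω, A.coeff ν ω) : ℝ) : ℂ)‖
          ≤ C * (1 / a η + (a η * η) ^ (1 - α)) := by
  obtain ⟨C, hC, θ₀, hθ₀, hb⟩ := A.exists_linResp_explicit hh hα hχ hf hc
  set D : ℝ := ∑ ν, ∑ ω, |A.coeff ν ω| * (1 / |A.v ω| * ∫ y, |f y|) with hD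
  have hI : 0 ≤ ∫ y, |f y| := integral_nonneg fun y => abs_nonneg _
  have hD0 : 0 ≤ D := Finset.sum_nonneg fun ν _ => Finset.sum_nonneg fun ω _ => by positivity
  refine ⟨C + D, fun a ha _ hθ => ?_⟩
  filter_upwards [self_mem_nhdsWithin, hθ.eventually (gt_mem_nhds hθ₀)] with η hη hηθ ν x
  have hη' : 0 < η := hη
  have haη := ha η hη
  set J : Fin N → ℝ := fun ω => ∫ y in {y : ℝ | 0 < y / A.v ω}, f (a η * η * x - y) *
              (1 / (a η * |A.v ω|) * Real.exp (-y / (a η * A.v ω))) with hJ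
  have hJb : ∀ ω, |J ω| ≤ 1 / a η * (1 / |A.v ω| * ∫ y, |f y|) := by
    intro ω
    have h1 := abs_setIntegral_convolution_le hf hc (a η * A.v ω) (a η * η * x)
    have hset : {y : ℝ | 0 < y / (a η * A.v ω)} = {y : ℝ | 0 < y / A.v ω} := by
      ext y
      have : y / (a η * A.v ω) = y / A.v ω / a η := by rw [div_div, mul_comm]
      simp only [Set.mem_ofPred_eq, this]
      exact div_pos_iff_of_pos_right haη
    rw [hset, abs_mul, abs_of_pos haη] at h1
    refine h1.trans (le_of_eq ?_)
    ring
  have hsum : |∑ ω, A.coeff ν ω * J ω| ≤ D * (1 / a η) := by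
    refine (Finset.abs_sum_le_sum_abs _ _).trans ?_
    calc ∑ ω, |A.coeff ν ω * J ω| ≤ ∑ ω, |A.coeff ν ω| * (1 / |A.v ω| * ∫ y, |f y|) * (1 / a η) := by
          refine Finset.sum_le_sum fun ω _ => ?_
          rw [abs_mul]
          calc _ ≤ |A.coeff ν ω| * (1 / a η * (1 / |A.v ω| * ∫ y, |f y|)) := by
                gcongr; exact hJb ω
            _ = _ := by ring
      _ = (∑ ω, |A.coeff ν ω| * (1 / |A.v ω| * ∫ y, |f y|)) * (1 / a η) := by
          rw [Finset.sum_mul]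
      _ ≤ _ := by
          gcongr
          exact Finset.single_le_sum (f := fun ν => ∑ ω, |A.coeff ν ω| * (1 / |A.v ω| * ∫ y, |f y|))
            (fun ν _ => Finset.sum_nonneg fun ω _ => by positivity) (Finset.mem_univ ν)
  have hmain := hb ν x η (a η) hη haη hηθ
  have hsplit : ((-(f (a η * η * x) * ∑ ω, A.coeff ν ω) : ℝ) : ℂ) =
      ((-∑ ω, A.coeff ν ω * (f (a η * η * x) - J ω) : ℝ) : ℂ) -
        ((∑ ω, A.coeff ν ω * J ω : ℝ) : ℂ) := by
    rw [← Complex.ofReal_sub]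
    congr 1
    simp only [mul_sub, Finset.sum_sub_distrib, ← Finset.sum_mul]
    ring
  rw [hsplit, ← sub_add]
  refine (norm_add_le _ _).trans ((add_le_add hmain (le_of_eq (Complex.norm_real _))).trans ?_)
  rw [Real.norm_eq_abs]
  have h1 : 0 ≤ C * (1 / a η) := by positivity
  have h2 : 0 ≤ D * (a η * η) ^ (1 - α) := by positivity
  linarith

end
end LinearResponse
end

noncomputable section
namespace LinearResponse

open MeasureTheory

/-! ### Canonical anticommutation relations -/

section
variable {ℓ M : ℕ}

/-- The sign of the mode `m` in the occupation number state `T`. -/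
def fermiSign (m : Mode ℓ M) (T : Finset (Mode ℓ M)) : ℂ := (-1) ^ (T.filter (· < m)).card

lemma fermiSign_mul_self (m : Mode ℓ M) (T : Finset (Mode ℓ M)) :
    fermiSign m T * fermiSign m T = 1 := by
  rw [fermiSign, ← pow_add, ← two_mul, pow_mul]; norm_num

lemma fermiSign_erase {m n : Mode ℓ M} {T : Finset (Mode ℓ M)} (hm : m ∈ T) :
    fermiSign n (T.erase m) = if m < n then -fermiSign n T else fermiSign n T := by
  rw [fermiSign, fermiSign, Finset.filter_erase]
  split_ifs with h
  · have hmem : m ∈ T.filter (· < n) := Finset.mem_filter.2 ⟨hm, h⟩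
    rw [← Finset.card_erase_add_one hmem, pow_succ]; ring
  · rw [Finset.erase_eq_of_notMem (a := m) (s := T.filter (· < n))
      fun h' => h (Finset.mem_filter.1 h').2]

lemma fermiSign_insert {m n : Mode ℓ M} {T : Finset (Mode ℓ M)} (hm : m ∉ T) :
    fermiSign n (insert m T) = if m < n then -fermiSign n T else fermiSign n T := by
  rw [fermiSign, fermiSign, Finset.filter_insert]
  split_ifs with h
  · rw [Finset.card_insert_of_notMem fun h' => hm (Finset.mem_filter.1 h').1, pow_succ]; ring
  · rfl

lemma annihil_apply (m : Mode ℓ M) (S T : Finset (Mode ℓ M)) :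
    annihil m S T = if m ∈ T ∧ S = T.erase m then fermiSign m T else 0 := rfl

lemma creat_apply (m : Mode ℓ M) (S T : Finset (Mode ℓ M)) :
    creat m S T = if m ∉ T ∧ S = insert m T then fermiSign m T else 0 := by
  rw [creat, Matrix.conjTranspose_apply, annihil_apply]
  have hiff : (m ∈ S ∧ T = S.erase m) ↔ (m ∉ T ∧ S = insert m T) := by
    constructor
    · rintro ⟨h, rfl⟩
      exact ⟨Finset.notMem_erase _ _, (Finset.insert_erase h).symm⟩
    · rintro ⟨h, rfl⟩
      exact ⟨Finset.mem_insert_self _ _, (Finset.erase_insert h).symm⟩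
  by_cases h : m ∉ T ∧ S = insert m T
  · rw [if_pos h, if_pos (hiff.2 h), h.2, fermiSign_insert h.1, if_neg (lt_irrefl m), fermiSign]
    simp
  · rw [if_neg h, if_neg fun h' => h (hiff.1 h'), star_zero]

lemma mul_annihil_apply (X : FockOp ℓ M) (m : Mode ℓ M) (S T : Finset (Mode ℓ M)) :
    (X * annihil m) S T = if m ∈ T then X S (T.erase m) * fermiSign m T else 0 := by
  rw [Matrix.mul_apply]
  simp only [annihil_apply]
  by_cases h : m ∈ T <;> simp [h]

lemma mul_creat_apply (X : FockOp ℓ M) (m : Mode ℓ M) (S T : Finset (Mode ℓ M)) :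
    (X * creat m) S T = if m ∉ T then X S (insert m T) * fermiSign m T else 0 := by
  rw [Matrix.mul_apply]
  simp only [creat_apply]
  by_cases h : m ∈ T <;> simp [h]

/-- Both orders empty the same modes. Removing the smaller mode first flips the sign of the larger
one and not conversely, so the two products are opposite. -/
lemma annihil_mul_annihil_add (m n : Mode ℓ M) :
    annihil m * annihil n + annihil n * annihil m = 0 := by
  ext S T
  rw [Matrix.add_apply, mul_annihil_apply, mul_annihil_apply, annihil_apply, annihil_apply,
    Matrix.zero_apply]
  by_cases hmn : m = n
  · subst hmn; simp
  by_cases hm : m ∈ T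
  · by_cases hn : n ∈ T
    · rw [if_pos hm, if_pos hn, fermiSign_erase hm, fermiSign_erase hn, Finset.erase_right_comm]
      have h1 : m ∈ T.erase n := Finset.mem_erase.2 ⟨hmn, hm⟩
      have h2 : n ∈ T.erase m := Finset.mem_erase.2 ⟨Ne.symm hmn, hn⟩
      by_cases hS : S = (T.erase m).erase n
      · rcases lt_or_gt_of_ne hmn with hlt | hlt
        · simp only [h1, h2, hS, hlt, not_lt_of_gt hlt, and_self, if_true, if_false]; ring
        · simp only [h1, h2, hS, hlt, not_lt_of_gt hlt, and_self, if_true, if_false]; ring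
      · simp [hS]
    · simp [hn]
  · simp [hm]

lemma annihil_mul_creat_add (m n : Mode ℓ M) :
    annihil m * creat n + creat n * annihil m = if m = n then 1 else 0 := by
  ext S T
  rw [Matrix.add_apply, mul_annihil_apply, mul_creat_apply, annihil_apply, creat_apply]
  by_cases hmn : m = n
  · subst hmn
    rw [if_pos rfl, Matrix.one_apply]
    by_cases hm : m ∈ T
    · simp only [hm, not_true, if_false, if_true, zero_add, Finset.mem_erase, ne_eq, not_true,
        false_and, not_false_iff, true_and, Finset.insert_erase hm, fermiSign_erase hm,
        lt_irrefl, ite_mul, zero_mul, fermiSign_mul_self]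
    · simp only [hm, not_false_iff, if_true, if_false, add_zero, Finset.mem_insert, true_or,
        true_and, Finset.erase_insert hm, fermiSign_insert hm, lt_irrefl, ite_mul, zero_mul,
        fermiSign_mul_self]
  · rw [if_neg hmn, Matrix.zero_apply]
    by_cases hm : m ∈ T
    · by_cases hn : n ∈ T
      · have : n ∈ T.erase m := Finset.mem_erase.2 ⟨Ne.symm hmn, hn⟩
        simp [hn, this]
      · have h1 : m ∈ insert n T := Finset.mem_insert_of_mem hm
        have h2 : n ∉ T.erase m := fun h => hn (Finset.mem_of_mem_erase h)
        have h3 : (insert n T).erase m = insert n (T.erase m) :=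
          Finset.erase_insert_of_ne (Ne.symm hmn)
        rw [if_pos hm, if_pos hn, fermiSign_erase hm, fermiSign_insert hn, h3]
        by_cases hS : S = insert n (T.erase m)
        · rcases lt_or_gt_of_ne hmn with hlt | hlt
          · simp only [h1, h2, hS, hlt, not_lt_of_gt hlt, and_self, if_true, if_false,
              not_false_iff]; ring
          · simp only [h1, h2, hS, hlt, not_lt_of_gt hlt, and_self, if_true, if_false,
              not_false_iff]; ring
        · simp [hS]
    · simp [hm, hmn]

end

/-! ### Quasi-free Gibbs states -/

section
variable {Φ I : Type*} [Fintype Φ] [DecidableEq Φ] [Fintype I] [DecidableEq I]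

/-- The canonical anticommutation relations for a family of annihilation operators. -/
structure IsCAR (c : I → Matrix Φ Φ ℂ) : Prop where
  anti : ∀ i j, c i * c j + c j * c i = 0
  mixed : ∀ i j, c i * (c j)ᴴ + (c j)ᴴ * c i = if i = j then 1 else 0

/-- The free Hamiltonian with energies `e`. -/
def freeHam (c : I → Matrix Φ Φ ℂ) (e : I → ℝ) : Matrix Φ Φ ℂ :=
  ∑ i, (e i : ℂ) • ((c i)ᴴ * c i)

/-- The normalized thermal expectation value. -/
def thermal (G : Matrix Φ Φ ℂ) (β : ℝ) (O : Matrix Φ Φ ℂ) : ℂ :=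
  (O * NormedSpace.exp (-((β : ℂ) • G))).trace / (NormedSpace.exp (-((β : ℂ) • G))).trace

/-- The Fermi function. -/
def fermi (β x : ℝ) : ℝ := (1 + Real.exp (β * x))⁻¹

/-- An intertwiner of two matrices intertwines their exponentials; the norms are only local
instances for the power series. -/
lemma exp_mul_of_mul_eq {A B X : Matrix Φ Φ ℂ} (h : A * X = X * B) :
    NormedSpace.exp A * X = X * NormedSpace.exp B := by
  let _ : NormedRing (Matrix Φ Φ ℂ) := Matrix.linftyOpNormedRing
  let _ : NormedAlgebra ℂ (Matrix Φ Φ ℂ) := Matrix.linftyOpNormedAlgebra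
  let _ : NormedAlgebra ℚ (Matrix Φ Φ ℂ) := .restrictScalars ℚ ℂ _
  have h' : SemiconjBy X B A := h.symm
  exact h'.exp_right.symm

lemma exp_add_smul_one (A : Matrix Φ Φ ℂ) (z : ℂ) :
    NormedSpace.exp (A + z • (1 : Matrix Φ Φ ℂ)) = Complex.exp z • NormedSpace.exp A := by
  rw [Matrix.exp_add_of_commute _ _ ((Commute.one_right A).smul_right z)]
  have h1 : z • (1 : Matrix Φ Φ ℂ) = Matrix.diagonal fun _ => z := by
    rw [← Matrix.diagonal_one, ← Matrix.diagonal_smul]; congr 1; ext; simp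
  have h2 : NormedSpace.exp (fun _ : Φ => z) = fun _ => Complex.exp z := by
    ext i
    rw [Pi.coe_exp, Complex.exp_eq_exp_ℂ]
  have h3 : Matrix.diagonal (fun _ : Φ => Complex.exp z) = Complex.exp z • 1 := by
    rw [← Matrix.diagonal_one, ← Matrix.diagonal_smul]; congr 1; ext; simp
  rw [h1, Matrix.exp_diagonal, h2, h3, mul_smul_comm, mul_one]

lemma exp_mul_exp_neg (A : Matrix Φ Φ ℂ) : NormedSpace.exp A * NormedSpace.exp (-A) = 1 := by
  rw [← Matrix.exp_add_of_commute _ _ (Commute.neg_right (Commute.refl A)), add_neg_cancel,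
    NormedSpace.exp_zero]

open scoped ComplexOrder in
-- With B = e^{A/2} the trace is that of BB*; it vanishes only for B = 0, but B is invertible.
lemma trace_exp_ne_zero [Nonempty Φ] {A : Matrix Φ Φ ℂ} (hA : A.IsHermitian) :
    (NormedSpace.exp A).trace ≠ 0 := by
  intro h0
  have hhalf : ((1 / 2 : ℂ) • A).IsHermitian := by
    rw [Matrix.IsHermitian, Matrix.conjTranspose_smul, hA.eq]
    simp
  have h1 : NormedSpace.exp A = NormedSpace.exp ((1 / 2 : ℂ) • A) *
      (NormedSpace.exp ((1 / 2 : ℂ) • A))ᴴ := by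
    rw [hhalf.exp.eq, ← Matrix.exp_add_of_commute _ _ (Commute.refl _), ← add_smul]
    norm_num
  rw [h1, Matrix.trace_mul_conjTranspose_self_eq_zero_iff] at h0
  have h2 := exp_mul_exp_neg ((1 / 2 : ℂ) • A)
  rw [h0, zero_mul] at h2
  exact zero_ne_one h2

variable {c : I → Matrix Φ Φ ℂ} (e : I → ℝ)

lemma freeHam_isHermitian (c : I → Matrix Φ Φ ℂ) (e : I → ℝ) : (freeHam c e).IsHermitian := by
  rw [Matrix.IsHermitian, freeHam, Matrix.conjTranspose_sum]
  refine Finset.sum_congr rfl fun i _ => ?_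
  rw [Matrix.conjTranspose_smul, Matrix.conjTranspose_mul, Matrix.conjTranspose_conjTranspose]
  simp

lemma IsCAR.anti_star (hc : IsCAR c) (i j : I) : (c i)ᴴ * (c j)ᴴ = -((c j)ᴴ * (c i)ᴴ) := by
  have := congrArg Matrix.conjTranspose (hc.anti j i)
  rw [Matrix.conjTranspose_add, Matrix.conjTranspose_mul, Matrix.conjTranspose_mul,
    Matrix.conjTranspose_zero] at this
  exact eq_neg_of_add_eq_zero_left this

lemma IsCAR.mul_star (hc : IsCAR c) (i j : I) :
    c i * (c j)ᴴ = (if i = j then 1 else 0) - (c j)ᴴ * c i :=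
  eq_sub_of_add_eq (hc.mixed i j)

/-- A creation operator raises the energy by e_i. In this intertwining form the relation passes
directly to exponentials. -/
lemma IsCAR.freeHam_mul_star (hc : IsCAR c) (i : I) :
    freeHam c e * (c i)ᴴ = (c i)ᴴ * (freeHam c e + (e i : ℂ) • 1) := by
  rw [mul_add, mul_smul_comm, mul_one, freeHam, Finset.sum_mul, Finset.mul_sum]
  have : ∀ k, (e k : ℂ) • ((c k)ᴴ * c k) * (c i)ᴴ =
      (c i)ᴴ * ((e k : ℂ) • ((c k)ᴴ * c k)) + if k = i then (e i : ℂ) • (c i)ᴴ else 0 := by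
    intro k
    rw [smul_mul_assoc, mul_assoc, hc.mul_star, mul_sub, ← mul_assoc, hc.anti_star k i,
      mul_smul_comm]
    by_cases hk : k = i
    · subst hk
      simp only [if_true, mul_one, neg_mul, sub_neg_eq_add, smul_add, mul_assoc]
      rw [add_comm]
    · simp only [hk, if_false, mul_zero, neg_mul, sub_neg_eq_add, zero_add, add_zero, mul_assoc]
  simp only [this, Finset.sum_add_distrib]
  simp

lemma IsCAR.exp_mul_star (hc : IsCAR c) (z : ℂ) (i : I) :
    NormedSpace.exp (z • freeHam c e) * (c i)ᴴ =
      Complex.exp (z * e i) • ((c i)ᴴ * NormedSpace.exp (z • freeHam c e)) := by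
  have h1 : (z • freeHam c e) * (c i)ᴴ =
      (c i)ᴴ * (z • freeHam c e + (z * e i) • (1 : Matrix Φ Φ ℂ)) := by
    rw [smul_mul_assoc, hc.freeHam_mul_star, ← mul_smul_comm, smul_add, smul_smul]
  rw [exp_mul_of_mul_eq h1, exp_add_smul_one, mul_smul_comm]

lemma IsCAR.freeHam_mul (hc : IsCAR c) (i : I) :
    freeHam c e * c i = c i * (freeHam c e + (-(e i : ℂ)) • 1) := by
  have := congrArg Matrix.conjTranspose (hc.freeHam_mul_star e i)
  rw [Matrix.conjTranspose_mul, Matrix.conjTranspose_mul, Matrix.conjTranspose_conjTranspose,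
    (freeHam_isHermitian c e).eq, Matrix.conjTranspose_add, (freeHam_isHermitian c e).eq,
    Matrix.conjTranspose_smul, Matrix.conjTranspose_one, add_mul] at this
  rw [mul_add, this]
  simp

lemma IsCAR.exp_mul (hc : IsCAR c) (z : ℂ) (i : I) :
    NormedSpace.exp (z • freeHam c e) * c i =
      Complex.exp (-(z * e i)) • (c i * NormedSpace.exp (z • freeHam c e)) := by
  have h1 : (z • freeHam c e) * c i =
      c i * (z • freeHam c e + (-(z * e i)) • (1 : Matrix Φ Φ ℂ)) := by
    rw [smul_mul_assoc, hc.freeHam_mul, ← mul_smul_comm, smul_add, smul_smul, mul_neg]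
  rw [exp_mul_of_mul_eq h1, exp_add_smul_one, mul_smul_comm]

lemma IsCAR.evolve (hc : IsCAR c) (s : ℂ) (i j : I) :
    NormedSpace.exp (s • freeHam c e) * ((c i)ᴴ * c j) * NormedSpace.exp (-(s • freeHam c e)) =
      Complex.exp (s * (e i - e j)) • ((c i)ᴴ * c j) := by
  rw [← mul_assoc, hc.exp_mul_star, smul_mul_assoc, smul_mul_assoc, mul_assoc (c i)ᴴ,
    hc.exp_mul, mul_smul_comm, smul_mul_assoc, smul_smul, mul_assoc, mul_assoc, exp_mul_exp_neg,
    mul_one, ← Complex.exp_add]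
  congr 2; ring

lemma thermal_add (G : Matrix Φ Φ ℂ) (β : ℝ) (X Y : Matrix Φ Φ ℂ) :
    thermal G β (X + Y) = thermal G β X + thermal G β Y := by
  rw [thermal, thermal, thermal, add_mul, Matrix.trace_add, add_div]

lemma thermal_sub (G : Matrix Φ Φ ℂ) (β : ℝ) (X Y : Matrix Φ Φ ℂ) :
    thermal G β (X - Y) = thermal G β X - thermal G β Y := by
  rw [thermal, thermal, thermal, sub_mul, Matrix.trace_sub, sub_div]

lemma thermal_smul (G : Matrix Φ Φ ℂ) (β : ℝ) (z : ℂ) (X : Matrix Φ Φ ℂ) :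
    thermal G β (z • X) = z * thermal G β X := by
  rw [thermal, thermal, smul_mul_assoc, Matrix.trace_smul, smul_eq_mul, mul_div_assoc]

lemma thermal_zero (G : Matrix Φ Φ ℂ) (β : ℝ) : thermal G β 0 = 0 := by
  simp [thermal]

lemma thermal_sum {ι : Type*} (s : Finset ι) (G : Matrix Φ Φ ℂ) (β : ℝ)
    (X : ι → Matrix Φ Φ ℂ) : thermal G β (∑ i ∈ s, X i) = ∑ i ∈ s, thermal G β (X i) := by
  classical
  induction s using Finset.induction_on with
  | empty => simp [thermal_zero]
  | insert a s ha ih => rw [Finset.sum_insert ha, Finset.sum_insert ha, thermal_add, ih]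

lemma thermal_one [Nonempty Φ] {G : Matrix Φ Φ ℂ} (hG : G.IsHermitian) (β : ℝ) :
    thermal G β 1 = 1 := by
  rw [thermal, one_mul]
  refine div_self (trace_exp_ne_zero ?_)
  rw [Matrix.IsHermitian, Matrix.conjTranspose_neg, Matrix.conjTranspose_smul, hG.eq]
  simp

/-- The Kubo-Martin-Schwinger condition. -/
lemma IsCAR.thermal_star_mul (hc : IsCAR c) (β : ℝ) (i : I) (X : Matrix Φ Φ ℂ) :
    thermal (freeHam c e) β ((c i)ᴴ * X) =
      Complex.exp (-(β * e i)) * thermal (freeHam c e) β (X * (c i)ᴴ) := by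
  rw [thermal, thermal, ← mul_div_assoc]
  congr 1
  have h1 := hc.exp_mul_star e (-(β : ℂ)) i
  rw [neg_smul] at h1
  rw [mul_assoc, Matrix.trace_mul_comm, mul_assoc, h1, mul_smul_comm, Matrix.trace_smul, smul_eq_mul,
    neg_mul, mul_assoc]

/-- Solves the relation that arises when the KMS condition moves a creation operator cyclically and
the anticommutation relations bring it back. -/
lemma exp_ratio_eq_fermi (β x : ℝ) {z w : ℂ}
    (h : z = Complex.exp (-(β * x)) * (w - z)) : z = fermi β x * w := by
  have h1 : (1 + Complex.exp (β * x)) ≠ 0 := by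
    have : (0 : ℝ) < 1 + Real.exp (β * x) := by positivity
    exact_mod_cast this.ne'
  have h2 : Complex.exp (β * x) * Complex.exp (-(β * x)) = 1 := by
    rw [← Complex.exp_add]; simp
  rw [fermi]
  push_cast
  rw [inv_mul_eq_div, eq_div_iff h1]
  linear_combination (Complex.exp (β * x)) * h + (w - z) * h2

lemma IsCAR.thermal_two (hc : IsCAR c) [Nonempty Φ] (β : ℝ) (i j : I) :
    thermal (freeHam c e) β ((c i)ᴴ * c j) = if i = j then (fermi β (e i) : ℂ) else 0 := by
  have h1 := hc.thermal_star_mul e β i (c j)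
  rw [hc.mul_star, thermal_sub] at h1
  rw [exp_ratio_eq_fermi β (e i) h1]
  by_cases hij : i = j
  · subst hij; simp [thermal_one (freeHam_isHermitian c e)]
  · simp [hij, Ne.symm hij, thermal_zero]

/-- The needed case of Wick's theorem, from one cyclic move of c_i*. The contraction of i with j
reproduces the product of two-point functions, leaving the exchange term. -/
lemma IsCAR.thermal_four (hc : IsCAR c) [Nonempty Φ] (β : ℝ) (i j k l : I) :
    thermal (freeHam c e) β ((c i)ᴴ * c j * ((c k)ᴴ * c l)) -
      thermal (freeHam c e) β ((c i)ᴴ * c j) * thermal (freeHam c e) β ((c k)ᴴ * c l) =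
      if i = l ∧ j = k then (fermi β (e i) * (1 - fermi β (e j)) : ℂ) else 0 := by
  have h1 := hc.thermal_star_mul e β i (c j * ((c k)ᴴ * c l))
  -- Bringing c_i* back to the left crosses three operators, hence the minus sign, and leaves one
  -- contraction with c_l and one with c_j.
  have h2 : c j * ((c k)ᴴ * c l) * (c i)ᴴ = (if l = i then c j * (c k)ᴴ else 0) +
      (if j = i then (c k)ᴴ * c l else 0) - (c i)ᴴ * c j * ((c k)ᴴ * c l) := by
    have e1 : c j * ((c k)ᴴ * c l) * (c i)ᴴ = c j * (c k)ᴴ * (c l * (c i)ᴴ) := by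
      simp only [mul_assoc]
    have e2 : c j * (c k)ᴴ * ((c i)ᴴ * c l) = -(c j * (c i)ᴴ * ((c k)ᴴ * c l)) := by
      rw [mul_assoc, ← mul_assoc (c k)ᴴ, hc.anti_star k i]
      simp only [neg_mul, mul_neg, mul_assoc]
    rw [e1, hc.mul_star l i, mul_sub, e2, hc.mul_star j i, sub_mul]
    by_cases hl : l = i <;> by_cases hj : j = i <;> simp [hl, hj, mul_assoc] <;> abel
  rw [h2, thermal_sub, ← mul_assoc] at h1
  rw [exp_ratio_eq_fermi β (e i) h1, thermal_add, hc.thermal_two, hc.thermal_two]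
  have h3 : thermal (freeHam c e) β (c j * (c k)ᴴ) =
      if j = k then (1 - fermi β (e j) : ℂ) else 0 := by
    rw [hc.mul_star, thermal_sub, hc.thermal_two]
    by_cases hjk : j = k
    · subst hjk; simp [thermal_one (freeHam_isHermitian c e)]
    · simp [hjk, Ne.symm hjk, thermal_zero]
  have h4 : thermal (freeHam c e) β (if l = i then c j * (c k)ᴴ else 0) =
      if i = l then (if j = k then (1 - fermi β (e j) : ℂ) else 0) else 0 := by
    by_cases hl : i = l
    · rw [if_pos hl.symm, if_pos hl, h3]
    · rw [if_neg (Ne.symm hl), if_neg hl, thermal_zero]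
  have h5 : thermal (freeHam c e) β (if j = i then (c k)ᴴ * c l else 0) =
      if i = j then (if k = l then (fermi β (e k) : ℂ) else 0) else 0 := by
    by_cases hj : i = j
    · rw [if_pos hj.symm, if_pos hj, hc.thermal_two]
    · rw [if_neg (Ne.symm hj), if_neg hj, thermal_zero]
  rw [h4, h5]
  by_cases hl : i = l
  · subst hl
    by_cases hj : i = j
    · subst hj
      by_cases hk : i = k
      · subst hk; simp; ring
      · simp [hk, Ne.symm hk]
    · simp [hj]
  · by_cases hj : i = j
    · subst hj
      by_cases hk : k = l
      · subst hk; simp [hl]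
      · simp [hl, hk]
    · simp [hl, hj]

/-- The cumulant of two quadratic operators in a quasi-free state. -/
lemma IsCAR.thermal_cumulant (hc : IsCAR c) [Nonempty Φ] (β : ℝ) (s : ℂ) (a b : I → I → ℂ) :
    thermal (freeHam c e) β (NormedSpace.exp (s • freeHam c e) *
        (∑ i, ∑ j, a i j • ((c i)ᴴ * c j)) * NormedSpace.exp (-(s • freeHam c e)) *
          (∑ k, ∑ l, b k l • ((c k)ᴴ * c l))) -
      thermal (freeHam c e) β (∑ i, ∑ j, a i j • ((c i)ᴴ * c j)) *
        thermal (freeHam c e) β (∑ k, ∑ l, b k l • ((c k)ᴴ * c l)) =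
      ∑ i, ∑ j, Complex.exp (s * (e i - e j)) * (fermi β (e i) * (1 - fermi β (e j))) *
        (a i j * b j i) := by
  -- The two-point function vanishes off the diagonal, where alone the evolution factor differs from
  -- 1. So the disconnected part may carry the same factor and cancels.
  have hstat : ∀ i j, Complex.exp (s * (e i - e j)) * thermal (freeHam c e) β ((c i)ᴴ * c j) =
      thermal (freeHam c e) β ((c i)ᴴ * c j) := by
    intro i j
    rw [hc.thermal_two]
    by_cases hij : i = j
    · subst hij; simp
    · simp [hij]
  simp only [Finset.mul_sum, Finset.sum_mul, mul_smul_comm, smul_mul_assoc, hc.evolve e,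
    thermal_sum, thermal_smul, ← Finset.sum_sub_distrib]
  have hterm : ∀ k l i j, b k l * (a i j * (Complex.exp (s * (e i - e j)) *
      thermal (freeHam c e) β ((c i)ᴴ * c j * ((c k)ᴴ * c l)))) -
      a i j * thermal (freeHam c e) β ((c i)ᴴ * c j) *
        (b k l * thermal (freeHam c e) β ((c k)ᴴ * c l)) =
      a i j * b k l * Complex.exp (s * (e i - e j)) *
        (if i = l ∧ j = k then (fermi β (e i) * (1 - fermi β (e j)) : ℂ) else 0) := by
    intro k l i j
    rw [← hc.thermal_four e β i j k l]
    linear_combination (a i j * b k l * thermal (freeHam c e) β ((c k)ᴴ * c l)) * hstat i j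
  simp only [hterm]
  rw [Finset.sum_comm]
  refine Finset.sum_congr rfl fun l _ => Finset.sum_congr rfl fun k _ => ?_
  rw [Finset.sum_eq_single l (fun i _ hi => Finset.sum_eq_zero fun j _ => by simp [hi])
    (by simp), Finset.sum_eq_single k (fun j _ hj => by simp [hj]) (by simp)]
  simp only [and_self, if_true]
  ring

end
end LinearResponse
end

noncomputable section
namespace LinearResponse

open MeasureTheory

/-! ### Lattice Fourier analysis -/

lemma phase_nat_mul (t : ℝ) (n : ℕ) : phase (t * n) = phase t ^ n := by
  rw [phase, phase, ← Complex.exp_nat_mul]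
  push_cast; ring_nf

lemma sum_range_phase {L : ℕ} (hL : 0 < L) (m : ℤ) :
    ∑ j ∈ Finset.range L, phase (2 * Real.pi * m / L * j) = if (L : ℤ) ∣ m then (L : ℂ) else 0 := by
  have hL' : (L : ℝ) ≠ 0 := by exact_mod_cast hL.ne'
  simp only [phase_nat_mul]
  by_cases h : (L : ℤ) ∣ m
  · obtain ⟨c, rfl⟩ := h
    have : phase (2 * Real.pi * ((L * c : ℤ) : ℝ) / L) = 1 := by
      rw [← phase_two_pi_int c]
      congr 1
      push_cast
      field_simp
    rw [if_pos (dvd_mul_right _ _)]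
    simp only [this]
    simp
  · rw [if_neg h, geom_sum_eq]
    · rw [← phase_nat_mul, div_mul_cancel₀ _ hL', phase_two_pi_int, sub_self, zero_div]
    · intro h1
      obtain ⟨n, hn⟩ := (phase_eq_one_iff _).1 h1
      apply h
      refine ⟨n, ?_⟩
      have h2 : (m : ℝ) = L * n := by
        have := Real.pi_pos
        field_simp at hn
        linarith
      exact_mod_cast h2

section
variable (ℓ : ℕ)

lemma sum_momentum_phase (z : ℤ) :
    ∑ n, phase (momentum ℓ n * z) = if ((2 * ℓ + 1 : ℕ) : ℤ) ∣ z then (2 * ℓ + 1 : ℂ) else 0 := by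
  have h1 := sum_range_phase (Nat.succ_pos (2 * ℓ)) z
  rw [← Fin.sum_univ_eq_sum_range (fun j : ℕ => phase (2 * Real.pi * z / (2 * ℓ + 1 : ℕ) * j))] at h1
  refine Eq.trans (Finset.sum_congr rfl fun n _ => ?_) (h1.trans ?_)
  · rw [momentum]; congr 1; push_cast; ring
  · push_cast; rfl

lemma sum_site_eq_range {E : Type*} [AddCommMonoid E] (g : ℤ → E) :
    ∑ x : Site ℓ, g x.1 = ∑ j ∈ Finset.range (2 * ℓ + 1), g (j - ℓ) := by
  rw [Finset.sum_coe_sort (Finset.Icc (-(ℓ : ℤ)) ℓ) g]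
  symm
  refine Finset.sum_bij (fun (j : ℕ) _ => (j - ℓ : ℤ)) ?_ ?_ ?_ ?_
  · intro j hj; simp at hj ⊢; omega
  · intro i _ j _ h; simpa using h
  · intro b hb
    simp at hb
    refine ⟨(b + ℓ).toNat, ?_, ?_⟩
    · simp; omega
    · rw [Int.toNat_of_nonneg (by omega)]; ring
  · intro j _; rfl

lemma sum_site_phase (m : ℤ) :
    ∑ x : Site ℓ, phase (2 * Real.pi * m / (2 * ℓ + 1) * x.1) =
      if ((2 * ℓ + 1 : ℕ) : ℤ) ∣ m then (2 * ℓ + 1 : ℂ) else 0 := by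
  rw [sum_site_eq_range ℓ (fun z : ℤ => phase (2 * Real.pi * m / (2 * ℓ + 1) * z))]
  have h1 := sum_range_phase (Nat.succ_pos (2 * ℓ)) m
  have h2 : ∀ j : ℕ, phase (2 * Real.pi * m / (2 * ℓ + 1) * ((j - ℓ : ℤ) : ℝ)) =
      phase (-(2 * Real.pi * m / (2 * ℓ + 1) * ℓ)) *
        phase (2 * Real.pi * m / ((2 * ℓ).succ : ℕ) * j) := by
    intro j
    rw [← phase_add]; congr 1; rw [Nat.succ_eq_add_one]; push_cast; ring
  simp only [h2]
  rw [← Finset.mul_sum, h1]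
  by_cases h : ((2 * ℓ + 1 : ℕ) : ℤ) ∣ m
  · rw [if_pos h, if_pos h]
    obtain ⟨c, rfl⟩ := h
    have : phase (-(2 * Real.pi * (((2 * ℓ + 1 : ℕ) * c : ℤ) : ℝ) / (2 * ℓ + 1) * ℓ)) = 1 := by
      rw [← phase_two_pi_int (-(c * ℓ))]
      congr 1
      push_cast
      have : (2 * ℓ + 1 : ℝ) ≠ 0 := by positivity
      field_simp
    rw [this]
    push_cast; ring
  · rw [if_neg h, if_neg h, mul_zero]

/-- Subtraction in `Fin` is modulo L, hence agrees with subtraction of momenta only up to 2πℤ. -/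
lemma exists_momentum_sub (n r : Fin (2 * ℓ + 1)) :
    ∃ z : ℤ, momentum ℓ (n - r) = momentum ℓ n - momentum ℓ r + 2 * Real.pi * z := by
  obtain ⟨q, hq⟩ : ∃ q, q = (2 * ℓ + 1 - (r : ℕ) + n) / (2 * ℓ + 1) := ⟨_, rfl⟩
  have h1 : (2 * ℓ + 1 - (r : ℕ) + n) % (2 * ℓ + 1) + (2 * ℓ + 1) * q = 2 * ℓ + 1 - (r : ℕ) + n := by
    rw [hq]; exact Nat.mod_add_div _ _
  refine ⟨1 - q, ?_⟩
  have h2 : ((n - r : Fin (2 * ℓ + 1)) : ℕ) = (2 * ℓ + 1 - (r : ℕ) + n) % (2 * ℓ + 1) :=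
    Fin.val_sub n r
  have h3 : (r : ℕ) ≤ 2 * ℓ + 1 := r.2.le
  rw [momentum, momentum, momentum, h2]
  have h4 : (((2 * ℓ + 1 - (r : ℕ) + n) % (2 * ℓ + 1) : ℕ) : ℝ) =
      (2 * ℓ + 1) - r + n - (2 * ℓ + 1) * q := by
    have := congrArg (Nat.cast (R := ℝ)) h1
    rw [Nat.cast_add, Nat.cast_mul, Nat.cast_add (2 * ℓ + 1 - (r : ℕ)), Nat.cast_sub h3] at this
    push_cast at this ⊢
    linarith
  rw [h4]
  have : (2 * ℓ + 1 : ℝ) ≠ 0 := by positivity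
  push_cast
  field_simp
  ring

lemma sum_site_tsum (g : ℤ → ℂ) (hg : (Function.support g).Finite) :
    ∑ x : Site ℓ, ∑' a : ℤ, g (x.1 + a * (2 * ℓ + 1)) = ∑' y : ℤ, g y := by
  have hbij : Function.Bijective fun z : Site ℓ × ℤ => z.1.1 + z.2 * (2 * ℓ + 1) := by
    constructor
    · rintro ⟨⟨x, hx⟩, a⟩ ⟨⟨x', hx'⟩, a'⟩ h
      simp only [Finset.mem_Icc] at hx hx' h
      have h1 : x - x' = (a' - a) * (2 * ℓ + 1) := by linarith
      have h2 : x - x' = 0 := by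
        refine Int.eq_zero_of_abs_lt_dvd (m := 2 * ℓ + 1) ⟨a' - a, by rw [h1]; ring⟩ ?_
        rw [abs_lt]; constructor <;> omega
      have h3 : a' - a = 0 := by
        rw [h2] at h1
        rcases mul_eq_zero.1 h1.symm with h | h
        · exact h
        · omega
      have h4 : x = x' := by omega
      have h5 : a = a' := by omega
      subst h4 h5; rfl
    · intro y
      have h1 := Int.emod_nonneg (y + ℓ) (show (2 * ℓ + 1 : ℤ) ≠ 0 by omega)
      have h2 := Int.emod_lt_of_pos (y + ℓ) (show (0 : ℤ) < 2 * ℓ + 1 by omega)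
      have h3 := Int.emod_add_mul_ediv (y + ℓ) (2 * ℓ + 1)
      refine ⟨(⟨(y + ℓ) % (2 * ℓ + 1) - ℓ, ?_⟩, (y + ℓ) / (2 * ℓ + 1)), ?_⟩
      · simp only [Finset.mem_Icc]; constructor <;> omega
      · simp only; linarith
  have hs : Summable g := summable_of_hasFiniteSupport hg
  have e := Equiv.ofBijective _ hbij
  have h1 := (Equiv.ofBijective _ hbij).tsum_eq g
  have h2 : Summable fun z : Site ℓ × ℤ => g ((Equiv.ofBijective _ hbij) z) :=
    (Equiv.summable_iff (Equiv.ofBijective _ hbij)).2 hs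
  rw [← h1, h2.tsum_prod, tsum_fintype]
  rfl

end

/-! ### Bloch transforms of the lattice fermions -/

section
variable {M : ℕ}

lemma sum_anticomm {ι κ : Type*} [Fintype ι] [Fintype κ] {R : Type*} [Ring R] [Algebra ℂ R]
    (u : ι → ℂ) (w : κ → ℂ) (X : ι → R) (Y : κ → R) :
    (∑ i, u i • X i) * (∑ j, w j • Y j) + (∑ j, w j • Y j) * (∑ i, u i • X i) =
      ∑ i, ∑ j, (u i * w j) • (X i * Y j + Y j * X i) := by
  rw [Finset.sum_mul_sum, Finset.sum_mul_sum, Finset.sum_comm (s := (Finset.univ : Finset κ)),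
    ← Finset.sum_add_distrib]
  refine Finset.sum_congr rfl fun i _ => ?_
  rw [← Finset.sum_add_distrib]
  refine Finset.sum_congr rfl fun j _ => ?_
  rw [smul_mul_smul_comm, smul_mul_smul_comm, mul_comm (w j), smul_add]

variable (ℓ : ℕ)

lemma annihilHat_add_two_pi (k : ℝ) (z : ℤ) (ρ : Fin M) :
    annihilHat ℓ (k + 2 * Real.pi * z) ρ = annihilHat ℓ k ρ := by
  simp only [annihilHat, phase_add_two_pi_mul_int]

lemma annihilHat_star (k : ℝ) (ρ : Fin M) :
    (annihilHat ℓ k ρ)ᴴ = ∑ x : Site ℓ, phase (k * x.1) • creat (mode x ρ) := by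
  rw [annihilHat, Matrix.conjTranspose_sum]
  refine Finset.sum_congr rfl fun x _ => ?_
  rw [Matrix.conjTranspose_smul, star_phase, neg_neg, creat]

lemma annihilHat_anti (k k' : ℝ) (ρ ρ' : Fin M) :
    annihilHat ℓ k ρ * annihilHat ℓ k' ρ' + annihilHat ℓ k' ρ' * annihilHat ℓ k ρ = 0 := by
  rw [annihilHat, annihilHat, sum_anticomm]
  simp [annihil_mul_annihil_add]

lemma annihilHat_mixed (n n' : Fin (2 * ℓ + 1)) (ρ ρ' : Fin M) :
    annihilHat ℓ (momentum ℓ n) ρ * (annihilHat ℓ (momentum ℓ n') ρ')ᴴ +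
      (annihilHat ℓ (momentum ℓ n') ρ')ᴴ * annihilHat ℓ (momentum ℓ n) ρ =
      if n = n' ∧ ρ = ρ' then (2 * ℓ + 1 : ℂ) • 1 else 0 := by
  rw [annihilHat_star, annihilHat, sum_anticomm]
  have hmode : ∀ x y : Site ℓ, mode x ρ = mode y ρ' ↔ x = y ∧ ρ = ρ' := by
    intro x y; simp [mode, Prod.ext_iff]
  simp only [annihil_mul_creat_add, hmode]
  by_cases hρ : ρ = ρ'
  · simp only [hρ, and_true, smul_ite, smul_zero, Finset.sum_ite_eq, Finset.mem_univ, if_true]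
    rw [← Finset.sum_smul]
    have h1 : ∀ x : Site ℓ, phase (-(momentum ℓ n * x.1)) * phase (momentum ℓ n' * x.1) =
        phase (2 * Real.pi * ((n' - n : ℤ) : ℝ) / (2 * ℓ + 1) * x.1) := by
      intro x
      rw [← phase_add, momentum, momentum]
      congr 1
      push_cast
      ring
    simp only [h1]
    rw [sum_site_phase]
    have h2 : ((2 * ℓ + 1 : ℕ) : ℤ) ∣ ((n' : ℤ) - n) ↔ n = n' := by
      constructor
      · intro h
        have h3 : ((n' : ℤ) - n) = 0 := by
          refine Int.eq_zero_of_abs_lt_dvd h ?_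
          have := n.2; have := n'.2
          rw [abs_lt]; constructor <;> omega
        ext; omega
      · rintro rfl; simp
    simp only [h2]
    split_ifs <;> simp
  · simp [hρ]

lemma annihil_eq_sum (x : Site ℓ) (ρ : Fin M) :
    annihil (mode x ρ) =
      (1 / (2 * ℓ + 1) : ℂ) • ∑ n, phase (momentum ℓ n * x.1) • annihilHat ℓ (momentum ℓ n) ρ := by
  have hL : (2 * ℓ + 1 : ℂ) ≠ 0 := by exact_mod_cast Nat.succ_ne_zero (2 * ℓ)
  simp only [annihilHat, Finset.smul_sum, smul_smul]
  rw [Finset.sum_comm]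
  have h1 : ∀ y : Site ℓ, ∑ n, (1 / (2 * ℓ + 1) * (phase (momentum ℓ n * x.1) *
      phase (-(momentum ℓ n * y.1)))) • annihil (mode y ρ) =
      if y = x then annihil (mode y ρ) else 0 := by
    intro y
    rw [← Finset.sum_smul, ← Finset.mul_sum]
    have h2 : ∀ n, phase (momentum ℓ n * x.1) * phase (-(momentum ℓ n * y.1)) =
        phase (momentum ℓ n * ((x.1 - y.1 : ℤ) : ℝ)) := by
      intro n; rw [← phase_add]; congr 1; push_cast; ring
    simp only [h2]
    rw [sum_momentum_phase]
    have h3 : ((2 * ℓ + 1 : ℕ) : ℤ) ∣ (x.1 - y.1) ↔ y = x := by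
      constructor
      · intro h
        have hx := Finset.mem_Icc.1 x.2
        have hy := Finset.mem_Icc.1 y.2
        have h3 : x.1 - y.1 = 0 := by
          refine Int.eq_zero_of_abs_lt_dvd h ?_
          rw [abs_lt]; constructor <;> omega
        ext; omega
      · rintro rfl; simp
    simp only [h3]
    split_ifs
    · rw [one_div_mul_cancel hL, one_smul]
    · rw [mul_zero, zero_smul]
  rw [Finset.sum_congr rfl fun y _ => h1 y]
  simp

lemma creat_eq_sum (x : Site ℓ) (ρ : Fin M) :
    creat (mode x ρ) = (1 / (2 * ℓ + 1) : ℂ) •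
      ∑ n, phase (-(momentum ℓ n * x.1)) • (annihilHat ℓ (momentum ℓ n) ρ)ᴴ := by
  rw [creat, annihil_eq_sum, Matrix.conjTranspose_smul, Matrix.conjTranspose_sum]
  simp only [Matrix.conjTranspose_smul, star_phase]
  congr 1
  simp

/-- The quadratic form `∑_{ρρ'} V_{ρρ'} â*_{k,ρ} â_{k',ρ'}`. -/
def blochForm (k k' : ℝ) (V : Matrix (Fin M) (Fin M) ℂ) : FockOp ℓ M :=
  ∑ ρ, ∑ ρ', V ρ ρ' • ((annihilHat ℓ k ρ)ᴴ * annihilHat ℓ k' ρ')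

lemma sum_phase_density (p : ℝ) :
    ∑ x : Site ℓ, phase (p * x.1) • density M x =
      (1 / (2 * ℓ + 1) : ℂ) • ∑ n, blochForm (M := M) ℓ (momentum ℓ n) (momentum ℓ n - p) 1 := by
  simp only [density, blochForm, Matrix.one_apply, ite_smul, zero_smul, one_smul,
    Finset.sum_ite_eq, Finset.mem_univ, if_true]
  simp only [Finset.smul_sum]
  rw [Finset.sum_comm]
  rw [Finset.sum_comm (s := (Finset.univ : Finset (Fin (2 * ℓ + 1))))]
  refine Finset.sum_congr rfl fun ρ _ => ?_
  have hexp : ∀ n, annihilHat ℓ (momentum ℓ n - p) ρ =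
    ∑ x : Site ℓ, phase (-((momentum ℓ n - p) * x.1)) • annihil (mode x ρ) := fun n => rfl
  simp only [creat_eq_sum, hexp]
  simp only [smul_mul_assoc, Finset.sum_mul, Finset.mul_sum, Finset.smul_sum, smul_smul,
    mul_smul_comm]
  rw [Finset.sum_comm]
  refine Finset.sum_congr rfl fun n _ => Finset.sum_congr rfl fun x _ => ?_
  congr 1
  rw [show -((momentum ℓ n - p) * (x.1 : ℝ)) = p * x.1 + -(momentum ℓ n * x.1) by ring, phase_add]
  ring

lemma phase_momentum_mul_add (n : Fin (2 * ℓ + 1)) (x a : ℤ) :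
    phase (-(momentum ℓ n * ((x + a * (2 * ℓ + 1) : ℤ) : ℝ))) = phase (-(momentum ℓ n * x)) := by
  have : -(momentum ℓ n * ((x + a * (2 * ℓ + 1) : ℤ) : ℝ)) =
      -(momentum ℓ n * x) + 2 * Real.pi * ((-(n * a) : ℤ) : ℝ) := by
    have : (2 * ℓ + 1 : ℝ) ≠ 0 := by positivity
    rw [momentum]
    push_cast
    field_simp
    ring
  rw [this, phase_add_two_pi]

/-- At allowed momenta the phase is L-periodic, so the sum over images and sites unfolds to a sum
over ℤ. Periodization is therefore exact: it samples Ĥ with no error in L. -/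
lemma sum_phase_hopL (h : Hopping M) (n : Fin (2 * ℓ + 1)) (y : Site ℓ) (ρ ρ' : Fin M) :
    ∑ x : Site ℓ, phase (-(momentum ℓ n * x.1)) * hopL h ℓ x y ρ ρ' =
      phase (-(momentum ℓ n * y.1)) * bloch h (momentum ℓ n) ρ ρ' := by
  have hz : ∀ z ∉ h.support, h z ρ ρ' = 0 := by
    intro z hz
    rw [Finsupp.notMem_support_iff.1 hz, Matrix.zero_apply]
  have hfin : ∀ x : Site ℓ,
      (Function.support fun a : ℤ => h (x.1 + a * (2 * ℓ + 1) - y.1)).Finite := by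
    intro x
    refine (h.support.finite_toSet.preimage (f := fun a : ℤ => x.1 + a * (2 * ℓ + 1) - y.1)
      ?_).subset fun a ha => ?_
    · intro a _ b _ hab
      have h1 : (a - b) * (2 * ℓ + 1) = 0 := by simp only at hab; linarith
      rcases mul_eq_zero.1 h1 with h2 | h2 <;> omega
    · exact Finsupp.mem_support_iff.2 ha
  have h1 : ∀ x : Site ℓ, phase (-(momentum ℓ n * x.1)) * hopL h ℓ x y ρ ρ' =
      ∑' a : ℤ, phase (-(momentum ℓ n * ((x.1 + a * (2 * ℓ + 1) : ℤ) : ℝ))) *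
        h (x.1 + a * (2 * ℓ + 1) - y.1) ρ ρ' := by
    intro x
    simp only [phase_momentum_mul_add]
    rw [tsum_mul_left]
    congr 1
    have e1 : hopL h ℓ x y ρ ρ' = ∑ᶠ a : ℤ, h (x.1 + a * (2 * ℓ + 1) - y.1) ρ ρ' := by
      rw [hopL]
      exact (Matrix.entryAddMonoidHom ℂ ρ ρ').map_finsum (hfin x)
    rw [e1, tsum_eq_finsum]
    refine (hfin x).subset fun a ha => ?_
    intro h0
    apply ha
    simp only at h0 ⊢
    rw [h0, Matrix.zero_apply]
  simp only [h1]
  rw [sum_site_tsum ℓ (fun z : ℤ => phase (-(momentum ℓ n * z)) * h (z - y.1) ρ ρ'),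
    ← (Equiv.addRight y.1).tsum_eq, tsum_eq_sum (s := h.support), bloch_apply, Finset.mul_sum]
  · refine Finset.sum_congr rfl fun z _ => ?_
    rw [Equiv.coe_addRight, add_sub_cancel_right, ← mul_assoc, ← phase_add]
    congr 2
    push_cast; ring
  · intro z hzs
    rw [Equiv.coe_addRight, add_sub_cancel_right, hz z hzs, mul_zero]
  · refine (h.support.finite_toSet.preimage (f := fun z : ℤ => z - y.1)
      (sub_left_injective.injOn)).subset fun z hzs => ?_
    by_contra hn
    exact hzs (by simp only; rw [hz _ hn, mul_zero])

/-- Only the creation operators are expanded in Bloch modes. The sum over x then produces Ĥ, and the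
phase it leaves behind reassembles the annihilation operators into Bloch modes. -/
lemma hamiltonian_eq (h : Hopping M) :
    hamiltonian h ℓ = (1 / (2 * ℓ + 1) : ℂ) •
      ∑ n, blochForm ℓ (momentum ℓ n) (momentum ℓ n) (bloch h (momentum ℓ n)) := by
  have h1 : hamiltonian h ℓ = ∑ n, ∑ ρ, ∑ ρ', ∑ y : Site ℓ, ∑ x : Site ℓ,
      (1 / (2 * ℓ + 1) * (phase (-(momentum ℓ n * x.1)) * hopL h ℓ x y ρ ρ') : ℂ) •
        ((annihilHat ℓ (momentum ℓ n) ρ)ᴴ * annihil (mode y ρ')) := by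
    rw [hamiltonian]
    simp only [creat_eq_sum, smul_mul_assoc, Finset.sum_mul, Finset.smul_sum, smul_smul]
    calc _ = ∑ x : Site ℓ, ∑ ρ : Fin M, ∑ y : Site ℓ, ∑ n, ∑ ρ' : Fin M,
        (hopL h ℓ x y ρ ρ' * (1 / (2 * ℓ + 1) * phase (-(momentum ℓ n * x.1)))) •
          ((annihilHat ℓ (momentum ℓ n) ρ)ᴴ * annihil (mode y ρ')) :=
          Finset.sum_congr rfl fun x _ => Finset.sum_congr rfl fun ρ _ =>
            Finset.sum_congr rfl fun y _ => Finset.sum_comm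
      _ = ∑ x : Site ℓ, ∑ n, ∑ ρ : Fin M, ∑ ρ' : Fin M, ∑ y : Site ℓ,
        (hopL h ℓ x y ρ ρ' * (1 / (2 * ℓ + 1) * phase (-(momentum ℓ n * x.1)))) •
          ((annihilHat ℓ (momentum ℓ n) ρ)ᴴ * annihil (mode y ρ')) := by
          refine Finset.sum_congr rfl fun x _ => ?_
          calc _ = ∑ ρ : Fin M, ∑ n, ∑ ρ' : Fin M, ∑ y : Site ℓ, _ :=
                Finset.sum_congr rfl fun ρ _ => Finset.sum_comm.trans
                  (Finset.sum_congr rfl fun n _ => Finset.sum_comm)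
            _ = _ := Finset.sum_comm
      _ = ∑ n, ∑ ρ : Fin M, ∑ ρ' : Fin M, ∑ y : Site ℓ, ∑ x : Site ℓ,
        (hopL h ℓ x y ρ ρ' * (1 / (2 * ℓ + 1) * phase (-(momentum ℓ n * x.1)))) •
          ((annihilHat ℓ (momentum ℓ n) ρ)ᴴ * annihil (mode y ρ')) := by
          rw [Finset.sum_comm]
          refine Finset.sum_congr rfl fun n _ => ?_
          rw [Finset.sum_comm]
          refine Finset.sum_congr rfl fun ρ _ => ?_
          rw [Finset.sum_comm]
          refine Finset.sum_congr rfl fun ρ' _ => ?_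
          rw [Finset.sum_comm]
      _ = _ := by
          refine Finset.sum_congr rfl fun n _ => Finset.sum_congr rfl fun ρ _ =>
            Finset.sum_congr rfl fun ρ' _ => Finset.sum_congr rfl fun y _ =>
            Finset.sum_congr rfl fun x _ => ?_
          congr 1; ring
  rw [h1, Finset.smul_sum]
  refine Finset.sum_congr rfl fun n _ => ?_
  rw [blochForm, Finset.smul_sum]
  refine Finset.sum_congr rfl fun ρ _ => ?_
  rw [Finset.smul_sum]
  refine Finset.sum_congr rfl fun ρ' _ => ?_
  have hexp : annihilHat ℓ (momentum ℓ n) ρ' =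
    ∑ x : Site ℓ, phase (-(momentum ℓ n * x.1)) • annihil (mode x ρ') := rfl
  rw [hexp, Finset.mul_sum, Finset.smul_sum, Finset.smul_sum]
  refine Finset.sum_congr rfl fun y _ => ?_
  rw [← Finset.sum_smul, ← Finset.mul_sum, sum_phase_hopL, mul_smul_comm, smul_smul, smul_smul]
  congr 1; ring

lemma number_eq :
    number ℓ M = (1 / (2 * ℓ + 1) : ℂ) •
      ∑ n, blochForm (M := M) ℓ (momentum ℓ n) (momentum ℓ n) 1 := by
  have := sum_phase_density (M := M) ℓ 0
  simpa [phase_zero, number] using this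

lemma grandHam_eq (h : Hopping M) (μ : ℝ) :
    grandHam h μ ℓ = (1 / (2 * ℓ + 1) : ℂ) •
      ∑ n, blochForm ℓ (momentum ℓ n) (momentum ℓ n) (shifted h μ (momentum ℓ n)) := by
  rw [grandHam, hamiltonian_eq, number_eq, smul_comm, ← smul_sub, Finset.smul_sum,
    ← Finset.sum_sub_distrib]
  congr 1
  refine Finset.sum_congr rfl fun n _ => ?_
  simp only [blochForm, shifted, Finset.smul_sum, ← Finset.sum_sub_distrib, smul_smul, ← sub_smul,
    Matrix.sub_apply, Matrix.smul_apply, smul_eq_mul]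

end
end LinearResponse
end

noncomputable section
namespace LinearResponse

open MeasureTheory

/-! ### Eigenmodes and the first-order response in finite volume -/

section
variable {M : ℕ} {h : Hopping M} (hh : h.SelfAdjoint) (μ : ℝ) (ℓ : ℕ)

/-- The annihilation operators of the Bloch eigenstates. -/
def eigenmode (i : Fin (2 * ℓ + 1) × Fin M) : FockOp ℓ M :=
  ((√(2 * ℓ + 1) : ℝ) : ℂ)⁻¹ • ∑ ρ, star (eigU (shifted_isHermitian hh μ (momentum ℓ i.1)) ρ i.2) •
    annihilHat ℓ (momentum ℓ i.1) ρ

lemma sqrt_volume_mul_self : ((√(2 * ℓ + 1) : ℝ) : ℂ) * ((√(2 * ℓ + 1) : ℝ) : ℂ) = 2 * ℓ + 1 := by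
  rw [← Complex.ofReal_mul, Real.mul_self_sqrt (by positivity)]
  push_cast; rfl

lemma sqrt_volume_ne_zero : ((√(2 * ℓ + 1) : ℝ) : ℂ) ≠ 0 := by
  have : (0 : ℝ) < √(2 * ℓ + 1) := Real.sqrt_pos.2 (by positivity)
  exact_mod_cast this.ne'

lemma eigenmode_star (i : Fin (2 * ℓ + 1) × Fin M) :
    (eigenmode hh μ ℓ i)ᴴ = ((√(2 * ℓ + 1) : ℝ) : ℂ)⁻¹ •
      ∑ ρ, eigU (shifted_isHermitian hh μ (momentum ℓ i.1)) ρ i.2 •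
        (annihilHat ℓ (momentum ℓ i.1) ρ)ᴴ := by
  rw [eigenmode, Matrix.conjTranspose_smul, Matrix.conjTranspose_sum]
  have h1 : star ((√(2 * ℓ + 1) : ℝ) : ℂ)⁻¹ = ((√(2 * ℓ + 1) : ℝ) : ℂ)⁻¹ := by
    rw [star_inv₀, RCLike.star_def, Complex.conj_ofReal]
  simp only [Matrix.conjTranspose_smul, star_star, h1]

/-- Unitarity of the eigenvector matrix preserves the relations, and 1/√L removes the factor L from
the Bloch transform. -/
lemma isCAR_eigenmode : IsCAR (eigenmode hh μ ℓ) := by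
  constructor
  · intro i j
    rw [eigenmode, eigenmode, smul_mul_smul_comm, smul_mul_smul_comm, ← smul_add, sum_anticomm]
    simp [annihilHat_anti]
  · rintro ⟨n, a⟩ ⟨n', a'⟩
    rw [eigenmode_star, eigenmode, smul_mul_smul_comm, smul_mul_smul_comm, ← smul_add,
      sum_anticomm]
    simp only [annihilHat_mixed]
    by_cases hn : n = n'
    · subst hn
      simp only [true_and, smul_ite, smul_zero, Finset.sum_ite_eq, Finset.mem_univ, if_true,
        smul_smul]
      rw [← Finset.sum_smul, ← Finset.sum_mul, smul_smul]
      have h1 := congrFun (congrFun (eigU_star_mul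
        (shifted_isHermitian hh μ (momentum ℓ n))) a) a'
      simp only [Matrix.mul_apply, Matrix.conjTranspose_apply, Matrix.one_apply] at h1
      rw [h1, ← sqrt_volume_mul_self]
      have h2 := sqrt_volume_ne_zero ℓ
      by_cases ha : a = a'
      · simp only [ha, if_true]
        rw [one_mul, ← mul_inv, inv_mul_cancel₀ (mul_ne_zero h2 h2), one_smul]
      · simp [ha]
    · simp [hn]

lemma annihilHat_eq_sum (n : Fin (2 * ℓ + 1)) (ρ : Fin M) :
    annihilHat ℓ (momentum ℓ n) ρ = ((√(2 * ℓ + 1) : ℝ) : ℂ) •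
      ∑ a, eigU (shifted_isHermitian hh μ (momentum ℓ n)) ρ a • eigenmode hh μ ℓ (n, a) := by
  simp only [eigenmode, smul_comm _ ((√(2 * ℓ + 1) : ℝ) : ℂ)⁻¹]
  rw [← Finset.smul_sum, smul_inv_smul₀ (sqrt_volume_ne_zero ℓ)]
  simp only [Finset.smul_sum, smul_smul]
  rw [Finset.sum_comm]
  have h1 : ∀ ρ', ∑ a, (eigU (shifted_isHermitian hh μ (momentum ℓ n)) ρ a *
      star (eigU (shifted_isHermitian hh μ (momentum ℓ n)) ρ' a)) •
        annihilHat ℓ (momentum ℓ n) ρ' = if ρ = ρ' then annihilHat ℓ (momentum ℓ n) ρ' else 0 := by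
    intro ρ'
    have h2 := congrFun (congrFun (eigU_mul_star
      (shifted_isHermitian hh μ (momentum ℓ n))) ρ) ρ'
    simp only [Matrix.mul_apply, Matrix.conjTranspose_apply, Matrix.one_apply] at h2
    rw [← Finset.sum_smul, h2]
    split_ifs <;> simp
  rw [Finset.sum_congr rfl fun ρ' _ => h1 ρ']
  simp

lemma blochForm_eq (n n' : Fin (2 * ℓ + 1)) (V : Matrix (Fin M) (Fin M) ℂ) :
    blochForm ℓ (momentum ℓ n) (momentum ℓ n') V = (2 * ℓ + 1 : ℂ) • ∑ a, ∑ b,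
      ((eigU (shifted_isHermitian hh μ (momentum ℓ n)))ᴴ * V *
        eigU (shifted_isHermitian hh μ (momentum ℓ n'))) a b •
        ((eigenmode hh μ ℓ (n, a))ᴴ * eigenmode hh μ ℓ (n', b)) := by
  have h1 : ∀ ρ ρ', V ρ ρ' • ((annihilHat ℓ (momentum ℓ n) ρ)ᴴ * annihilHat ℓ (momentum ℓ n') ρ') =
      ∑ a, ∑ b, ((2 * ℓ + 1 : ℂ) * (star (eigU (shifted_isHermitian hh μ (momentum ℓ n)) ρ a) *
        V ρ ρ' * eigU (shifted_isHermitian hh μ (momentum ℓ n')) ρ' b)) •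
        ((eigenmode hh μ ℓ (n, a))ᴴ * eigenmode hh μ ℓ (n', b)) := by
    intro ρ ρ'
    rw [annihilHat_eq_sum hh μ, annihilHat_eq_sum hh μ, Matrix.conjTranspose_smul,
      Matrix.conjTranspose_sum, smul_mul_smul_comm, Finset.sum_mul_sum]
    simp only [Finset.smul_sum, Matrix.conjTranspose_smul, smul_mul_smul_comm, smul_smul]
    refine Finset.sum_congr rfl fun a _ => Finset.sum_congr rfl fun b _ => ?_
    congr 1
    rw [RCLike.star_def, Complex.conj_ofReal, ← sqrt_volume_mul_self]
    ring
  rw [blochForm]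
  simp only [h1]
  calc _ = ∑ ρ : Fin M, ∑ a, ∑ b, ∑ ρ' : Fin M, _ :=
        Finset.sum_congr rfl fun ρ _ => Finset.sum_comm.trans
          (Finset.sum_congr rfl fun a _ => Finset.sum_comm)
    _ = ∑ a, ∑ b, ∑ ρ : Fin M, ∑ ρ' : Fin M, _ :=
        Finset.sum_comm.trans (Finset.sum_congr rfl fun a _ => Finset.sum_comm)
    _ = _ := by
        rw [Finset.smul_sum]
        refine Finset.sum_congr rfl fun a _ => ?_
        rw [Finset.smul_sum]
        refine Finset.sum_congr rfl fun b _ => ?_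
        rw [smul_smul, Finset.sum_comm]
        simp only [← Finset.sum_smul]
        congr 1
        simp only [Matrix.mul_apply, Matrix.conjTranspose_apply, Finset.sum_mul, Finset.mul_sum]

lemma grandHam_eq_freeHam :
    grandHam h μ ℓ = freeHam (eigenmode hh μ ℓ) fun i => ev hh μ (momentum ℓ i.1) i.2 := by
  have hL : (2 * ℓ + 1 : ℂ) ≠ 0 := by exact_mod_cast Nat.succ_ne_zero (2 * ℓ)
  rw [grandHam_eq, freeHam, Fintype.sum_prod_type, Finset.smul_sum]
  refine Finset.sum_congr rfl fun n _ => ?_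
  rw [blochForm_eq hh μ, smul_smul, one_div_mul_cancel hL, one_smul]
  refine Finset.sum_congr rfl fun a _ => ?_
  have h1 : (eigU (shifted_isHermitian hh μ (momentum ℓ n)))ᴴ * shifted h μ (momentum ℓ n) *
      eigU (shifted_isHermitian hh μ (momentum ℓ n)) =
      Matrix.diagonal fun a => (ev hh μ (momentum ℓ n) a : ℂ) := by
    rw [conjTranspose_mul_eigen, mul_assoc, eigU_star_mul, mul_one]
    rfl
  rw [h1, Finset.sum_eq_single a (fun b _ hb => by
    rw [Matrix.diagonal_apply_ne _ (Ne.symm hb), zero_smul]) (by simp), Matrix.diagonal_apply_eq]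

lemma sum_sub_reindex {E : Type*} [AddCommMonoid E]
    (g : Fin (2 * ℓ + 1) → Fin (2 * ℓ + 1) → Fin (2 * ℓ + 1) → E) :
    ∑ r, ∑ n, g r n (n - r) = ∑ n, ∑ n', g (n - n') n n' := by
  rw [Finset.sum_comm]
  refine Finset.sum_congr rfl fun n _ => ?_
  refine Fintype.sum_equiv (Equiv.subLeft n) _ _ fun r => ?_
  simp

lemma annihilHat_momentum_sub (n r : Fin (2 * ℓ + 1)) (ρ : Fin M) :
    annihilHat ℓ (momentum ℓ n - momentum ℓ r) ρ = annihilHat ℓ (momentum ℓ (n - r)) ρ := by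
  obtain ⟨z, hz⟩ := exists_momentum_sub ℓ n r
  rw [hz, annihilHat_add_two_pi]

lemma blochForm_sub_right (k : ℝ) (n r : Fin (2 * ℓ + 1)) (V : Matrix (Fin M) (Fin M) ℂ) :
    blochForm ℓ k (momentum ℓ n - momentum ℓ r) V = blochForm ℓ k (momentum ℓ (n - r)) V := by
  simp only [blochForm, annihilHat_momentum_sub]

lemma blochForm_sub_left (k : ℝ) (n r : Fin (2 * ℓ + 1)) (V : Matrix (Fin M) (Fin M) ℂ) :
    blochForm ℓ (momentum ℓ n - momentum ℓ r) k V = blochForm ℓ (momentum ℓ (n - r)) k V := by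
  simp only [blochForm, annihilHat_momentum_sub]

/-- The Fourier coefficients of the potential with large momenta cut off. -/
def potentialWeight (χ : ℝ → ℝ) (α : ℝ) (f : ℝ → ℝ) (θ : ℝ) (r : Fin (2 * ℓ + 1)) : ℂ :=
  potentialHat f θ ℓ (momentum ℓ r) *
    (χ (θ ^ (α - 1) * ‖(momentum ℓ r : AddCircle (2 * Real.pi))‖) : ℂ)

lemma perturbation_eq_density (χ : ℝ → ℝ) (α : ℝ) (f : ℝ → ℝ) (θ : ℝ) :
    perturbation M χ α f θ ℓ = ∑ r, (θ * (1 / (2 * ℓ + 1)) * potentialWeight ℓ χ α f θ r : ℂ) •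
      ∑ x : Site ℓ, phase (momentum ℓ r * x.1) • density M x := by
  rw [perturbation]
  simp only [Finset.smul_sum, smul_smul]
  rw [Finset.sum_comm]
  refine Finset.sum_congr rfl fun x _ => ?_
  rw [← Finset.sum_smul, potentialCut, Finset.mul_sum, Finset.mul_sum]
  refine congrArg (fun z : ℂ => z • density M x) (Finset.sum_congr rfl fun r _ => ?_)
  rw [potentialWeight]
  ring

lemma perturbation_eq_blochForm (χ : ℝ → ℝ) (α : ℝ) (f : ℝ → ℝ) (θ : ℝ) :
    perturbation M χ α f θ ℓ = ∑ n, ∑ n',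
      (θ * (1 / (2 * ℓ + 1)) ^ 2 * potentialWeight ℓ χ α f θ (n - n') : ℂ) •
        blochForm ℓ (momentum ℓ n) (momentum ℓ n') 1 := by
  rw [perturbation_eq_density, ← sum_sub_reindex ℓ (fun r n n' => (θ * (1 / (2 * ℓ + 1)) ^ 2 *
    potentialWeight ℓ χ α f θ r : ℂ) • blochForm ℓ (momentum ℓ n) (momentum ℓ n') 1)]
  refine Finset.sum_congr rfl fun r _ => ?_
  rw [sum_phase_density, smul_smul, Finset.smul_sum]
  refine Finset.sum_congr rfl fun n _ => ?_
  rw [blochForm_sub_right]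
  refine congrArg (fun z : ℂ => z • blochForm ℓ (momentum ℓ n) (momentum ℓ (n - r)) 1) ?_
  ring

lemma current_eq_blochForm (ν : Fin 2) (x : ℤ) :
    current h ℓ ν x = ∑ n, ∑ n',
      ((1 / (2 * ℓ + 1)) ^ 2 * phase (momentum ℓ (n - n') * x) : ℂ) •
        blochForm ℓ (momentum ℓ n') (momentum ℓ n)
          (vertex h ν (momentum ℓ n) (momentum ℓ (n - n'))) := by
  rw [← sum_sub_reindex ℓ (fun r n n' => ((1 / (2 * ℓ + 1)) ^ 2 * phase (momentum ℓ r * x) : ℂ) •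
    blochForm ℓ (momentum ℓ n') (momentum ℓ n) (vertex h ν (momentum ℓ n) (momentum ℓ r))), current,
    Finset.smul_sum]
  refine Finset.sum_congr rfl fun r _ => ?_
  have h1 : currentHat h ℓ ν (momentum ℓ r) = (1 / (2 * ℓ + 1) : ℂ) •
      ∑ n, blochForm ℓ (momentum ℓ n - momentum ℓ r) (momentum ℓ n)
        (vertex h ν (momentum ℓ n) (momentum ℓ r)) := rfl
  rw [h1, smul_smul, smul_smul, Finset.smul_sum]
  refine Finset.sum_congr rfl fun n _ => ?_
  rw [blochForm_sub_left]
  refine congrArg (fun z : ℂ => z • blochForm ℓ (momentum ℓ (n - r)) (momentum ℓ n)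
    (vertex h ν (momentum ℓ n) (momentum ℓ r))) ?_
  ring

lemma sum_modes {E : Type*} [AddCommMonoid E]
    (F : Fin (2 * ℓ + 1) → Fin M → Fin (2 * ℓ + 1) → Fin M → E) :
    ∑ i : Fin (2 * ℓ + 1) × Fin M, ∑ j : Fin (2 * ℓ + 1) × Fin M, F i.1 i.2 j.1 j.2 =
      ∑ n, ∑ n', ∑ a, ∑ b, F n a n' b := by
  simp only [Fintype.sum_prod_type]
  exact Finset.sum_congr rfl fun n _ => Finset.sum_comm

lemma smul_blochForm_eq (z : ℂ) (n n' : Fin (2 * ℓ + 1)) (V : Matrix (Fin M) (Fin M) ℂ) :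
    (z * (1 / (2 * ℓ + 1))) • blochForm ℓ (momentum ℓ n) (momentum ℓ n') V = ∑ a, ∑ b,
      (z * ((eigU (shifted_isHermitian hh μ (momentum ℓ n)))ᴴ * V *
        eigU (shifted_isHermitian hh μ (momentum ℓ n'))) a b) •
        ((eigenmode hh μ ℓ (n, a))ᴴ * eigenmode hh μ ℓ (n', b)) := by
  have hL : (2 * ℓ + 1 : ℂ) ≠ 0 := by exact_mod_cast Nat.succ_ne_zero (2 * ℓ)
  rw [blochForm_eq hh μ, smul_smul, mul_assoc, one_div_mul_cancel hL, mul_one]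
  simp only [Finset.smul_sum, smul_smul]

/-- The matrix elements of the perturbation between Bloch eigenstates. -/
def perturbationCoeff (χ : ℝ → ℝ) (α : ℝ) (f : ℝ → ℝ) (θ : ℝ)
    (i j : Fin (2 * ℓ + 1) × Fin M) : ℂ :=
  θ * (1 / (2 * ℓ + 1)) * potentialWeight ℓ χ α f θ (i.1 - j.1) *
    ((eigU (shifted_isHermitian hh μ (momentum ℓ i.1)))ᴴ * (1 : Matrix (Fin M) (Fin M) ℂ) *
      eigU (shifted_isHermitian hh μ (momentum ℓ j.1))) i.2 j.2

/-- The matrix elements of the current between Bloch eigenstates. -/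
def currentCoeff (ν : Fin 2) (x : ℤ) (j i : Fin (2 * ℓ + 1) × Fin M) : ℂ :=
  1 / (2 * ℓ + 1) * phase (momentum ℓ (i.1 - j.1) * x) *
    ((eigU (shifted_isHermitian hh μ (momentum ℓ j.1)))ᴴ *
      vertex h ν (momentum ℓ i.1) (momentum ℓ (i.1 - j.1)) *
        eigU (shifted_isHermitian hh μ (momentum ℓ i.1))) j.2 i.2

lemma perturbation_eq (χ : ℝ → ℝ) (α : ℝ) (f : ℝ → ℝ) (θ : ℝ) :
    perturbation M χ α f θ ℓ = ∑ i, ∑ j, perturbationCoeff hh μ ℓ χ α f θ i j •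
      ((eigenmode hh μ ℓ i)ᴴ * eigenmode hh μ ℓ j) := by
  rw [perturbation_eq_blochForm]
  refine Eq.trans ?_ (sum_modes ℓ (fun n a n' b => perturbationCoeff hh μ ℓ χ α f θ (n, a) (n', b) •
    ((eigenmode hh μ ℓ (n, a))ᴴ * eigenmode hh μ ℓ (n', b)))).symm
  refine Finset.sum_congr rfl fun n _ => Finset.sum_congr rfl fun n' _ => ?_
  refine Eq.trans ?_ (smul_blochForm_eq hh μ ℓ
    (θ * (1 / (2 * ℓ + 1)) * potentialWeight ℓ χ α f θ (n - n')) n n' 1)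
  refine congrArg (fun z : ℂ => z • blochForm ℓ (momentum ℓ n) (momentum ℓ n') 1) ?_
  ring

lemma current_eq (ν : Fin 2) (x : ℤ) :
    current h ℓ ν x = ∑ j, ∑ i, currentCoeff hh μ ℓ ν x j i •
      ((eigenmode hh μ ℓ j)ᴴ * eigenmode hh μ ℓ i) := by
  rw [current_eq_blochForm, Finset.sum_comm]
  refine Eq.trans ?_ (sum_modes ℓ (fun n' b n a => currentCoeff hh μ ℓ ν x (n', b) (n, a) •
    ((eigenmode hh μ ℓ (n', b))ᴴ * eigenmode hh μ ℓ (n, a)))).symm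
  refine Finset.sum_congr rfl fun n' _ => Finset.sum_congr rfl fun n _ => ?_
  refine Eq.trans ?_ (smul_blochForm_eq hh μ ℓ (1 / (2 * ℓ + 1) * phase (momentum ℓ (n - n') * x))
    n' n (vertex h ν (momentum ℓ n) (momentum ℓ (n - n'))))
  refine congrArg (fun z : ℂ => z • blochForm ℓ (momentum ℓ n') (momentum ℓ n)
    (vertex h ν (momentum ℓ n) (momentum ℓ (n - n')))) ?_
  ring

/-- The integrand of the first-order response in imaginary time. -/
def thermalPair (β s : ℝ) (ν : Fin 2) (p k : ℝ) : ℂ :=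
  pairSum (shifted_isHermitian hh μ k) (shifted_isHermitian hh μ (k - p))
    (fun x y => Complex.exp (s * (x - y)) * (fermi β x * (1 - fermi β y))) (vertex h ν k p)

/-- The quasi-free cumulant couples the perturbation's transition n' → n with the reverse transition
of the current, so both carry the same transfer r = n - n'. Reindexing by r gives the double
momentum sum. -/
lemma euclidCumulant_eq (χ : ℝ → ℝ) (α : ℝ) (f : ℝ → ℝ) (θ β s : ℝ) (ν : Fin 2) (x : ℤ) :
    euclidCumulant h μ β ℓ s (perturbation M χ α f θ ℓ) (current h ℓ ν x) =
      θ * (1 / (2 * ℓ + 1) : ℂ) ^ 2 * ∑ r, ∑ n, potentialWeight ℓ χ α f θ r *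
        phase (momentum ℓ r * x) * thermalPair hh μ β s ν (momentum ℓ r) (momentum ℓ n) := by
  have h1 := (isCAR_eigenmode hh μ ℓ).thermal_cumulant
    (fun i => ev hh μ (momentum ℓ i.1) i.2) β s
    (perturbationCoeff hh μ ℓ χ α f θ) (currentCoeff hh μ ℓ ν x)
  rw [← perturbation_eq, ← current_eq, ← grandHam_eq_freeHam] at h1
  refine Eq.trans h1 ?_
  have h2 : ∀ r n, thermalPair hh μ β s ν (momentum ℓ r) (momentum ℓ n) =
      pairSum (shifted_isHermitian hh μ (momentum ℓ n))
        (shifted_isHermitian hh μ (momentum ℓ (n - r)))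
        (fun x y => Complex.exp (s * (x - y)) * (fermi β x * (1 - fermi β y)))
        (vertex h ν (momentum ℓ n) (momentum ℓ r)) := by
    intro r n
    obtain ⟨z, hz⟩ := exists_momentum_sub ℓ n r
    exact pairSum_eq_of_eq _ _ _ _ rfl (by rw [hz, shifted_add_two_pi]) _ _
  simp only [h2]
  rw [sum_sub_reindex ℓ (fun r n n' => potentialWeight ℓ χ α f θ r *
        phase (momentum ℓ r * x) * pairSum (shifted_isHermitian hh μ (momentum ℓ n))
        (shifted_isHermitian hh μ (momentum ℓ n'))
        (fun x y => Complex.exp (s * (x - y)) * (fermi β x * (1 - fermi β y)))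
        (vertex h ν (momentum ℓ n) (momentum ℓ r))), Finset.mul_sum]
  refine (sum_modes ℓ (fun n a n' b => Complex.exp (s * (ev hh μ (momentum ℓ n) a -
    ev hh μ (momentum ℓ n') b)) * (fermi β (ev hh μ (momentum ℓ n) a) *
      (1 - fermi β (ev hh μ (momentum ℓ n') b))) * (perturbationCoeff hh μ ℓ χ α f θ (n, a) (n', b) *
        currentCoeff hh μ ℓ ν x (n', b) (n, a)))).trans ?_
  refine Finset.sum_congr rfl fun n _ => ?_
  rw [Finset.mul_sum]
  refine Finset.sum_congr rfl fun n' _ => ?_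
  rw [pairSum, Finset.mul_sum, Finset.mul_sum]
  refine Finset.sum_congr rfl fun a _ => ?_
  rw [Finset.mul_sum, Finset.mul_sum]
  refine Finset.sum_congr rfl fun b _ => ?_
  simp only [ev, perturbationCoeff, currentCoeff, mul_one, overlap]
  ring

end
end LinearResponse
end

noncomputable section
namespace LinearResponse

open MeasureTheory

/-! ### Riemann sums over the quasi-momenta -/

lemma integral_comp_floor (g : ℕ → ℂ) (L : ℕ) :
    ∫ u in (0 : ℝ)..L, g ⌊u⌋₊ = ∑ n ∈ Finset.range L, g n := by
  have h1 : ∀ n : ℕ, Set.EqOn (fun u : ℝ => g ⌊u⌋₊) (fun _ => g n) (Set.Ioo (n : ℝ) (n + 1)) := by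
    intro n u hu
    have : ⌊u⌋₊ = n := (Nat.floor_eq_iff ((Nat.cast_nonneg n).trans hu.1.le)).2 ⟨hu.1.le, hu.2⟩
    simp only [this]
  have h2 : ∀ n : ℕ, IntervalIntegrable (fun u : ℝ => g ⌊u⌋₊) volume (n : ℝ) ((n + 1 : ℕ) : ℝ) := by
    intro n
    push_cast
    refine (intervalIntegrable_iff_integrableOn_Ioo_of_le (by linarith)).2 ?_
    exact (integrableOn_congr_fun (h1 n) measurableSet_Ioo).2 (by simp)
  have h3 := intervalIntegral.sum_integral_adjacent_intervals (f := fun u : ℝ => g ⌊u⌋₊)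
    (μ := volume) (a := fun n : ℕ => (n : ℝ)) (n := L) (fun n _ => h2 n)
  rw [Nat.cast_zero] at h3
  rw [← h3]
  refine Finset.sum_congr rfl fun n _ => ?_
  push_cast
  rw [intervalIntegral.integral_of_le (by linarith), integral_Ioc_eq_integral_Ioo,
    setIntegral_congr_fun measurableSet_Ioo (h1 n)]
  simp

/-- The sum is the integral of a step function, to which dominated convergence applies. Convergence
along moving points is assumed so that the lemma iterates: in a double sum the outer summand depends
on ℓ too. -/
lemma tendsto_momentum_sum {G : ℕ → ℝ → ℂ} {G' : ℝ → ℂ} {C : ℝ} (hC : ∀ ℓ p, ‖G ℓ p‖ ≤ C)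
    (hG : ∀ (p : ℝ) (q : ℕ → ℝ), Filter.Tendsto q Filter.atTop (𝓝 p) →
      Filter.Tendsto (fun ℓ => G ℓ (q ℓ)) Filter.atTop (𝓝 (G' p))) :
    Filter.Tendsto (fun ℓ : ℕ => (1 / (2 * ℓ + 1) : ℂ) * ∑ n, G ℓ (momentum ℓ n)) Filter.atTop
      (𝓝 (∫ u in (0 : ℝ)..1, G' (2 * Real.pi * u))) := by
  have h1 : ∀ ℓ : ℕ, (1 / (2 * ℓ + 1) : ℂ) * ∑ n, G ℓ (momentum ℓ n) =
      ∫ u in (0 : ℝ)..1, G ℓ (2 * Real.pi * ⌊((2 * ℓ + 1 : ℕ) : ℝ) * u⌋₊ / (2 * ℓ + 1)) := by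
    intro ℓ
    have h2 := intervalIntegral.integral_comp_mul_left (a := 0) (b := 1)
      (fun u : ℝ => G ℓ (2 * Real.pi * ⌊u⌋₊ / (2 * ℓ + 1)))
      (c := ((2 * ℓ + 1 : ℕ) : ℝ)) (by positivity)
    rw [h2, mul_zero, mul_one, integral_comp_floor (fun n => G ℓ (2 * Real.pi * n / (2 * ℓ + 1))),
      Finset.sum_range]
    rw [Complex.real_smul]
    push_cast
    rw [one_div]
    rfl
  simp only [h1]
  refine intervalIntegral.tendsto_integral_filter_of_dominated_convergence (fun _ => C) ?_ ?_
    (by simp) ?_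
  · refine Filter.Eventually.of_forall fun ℓ => Measurable.aestronglyMeasurable ?_
    exact (measurable_from_nat (f := fun n : ℕ => G ℓ (2 * Real.pi * n / (2 * ℓ + 1)))).comp
      (Nat.measurable_floor.comp (measurable_const_mul _))
  · exact Filter.Eventually.of_forall fun ℓ => Filter.Eventually.of_forall fun u _ => hC _ _
  · refine Filter.Eventually.of_forall fun u hu => hG _ _ ?_
    rw [Set.uIoc_of_le zero_le_one] at hu
    have h3 : Filter.Tendsto (fun ℓ : ℕ => ((2 * ℓ + 1 : ℕ) : ℝ)) Filter.atTop Filter.atTop :=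
      tendsto_natCast_atTop_atTop.comp (Filter.tendsto_atTop_mono (fun ℓ => by simp only [id]; omega)
        Filter.tendsto_id)
    have h4 := ((tendsto_nat_floor_mul_div_atTop hu.1.le).comp h3).const_mul (2 * Real.pi)
    refine h4.congr fun ℓ => ?_
    simp only [Function.comp]
    push_cast
    rw [mul_comm u, mul_div_assoc]

lemma tendsto_momentum_sum_sum {F : ℝ → ℝ → ℂ} (hF : Continuous fun x : ℝ × ℝ => F x.1 x.2)
    {C : ℝ} (hC : ∀ p k, ‖F p k‖ ≤ C) :
    Filter.Tendsto (fun ℓ : ℕ => (1 / (2 * ℓ + 1) : ℂ) ^ 2 *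
        ∑ r, ∑ n, F (momentum ℓ r) (momentum ℓ n)) Filter.atTop
      (𝓝 (∫ u in (0 : ℝ)..1, ∫ w in (0 : ℝ)..1, F (2 * Real.pi * u) (2 * Real.pi * w))) := by
  have h1 := tendsto_momentum_sum (C := C)
    (G := fun ℓ p => (1 / (2 * ℓ + 1) : ℂ) * ∑ n, F p (momentum ℓ n))
    (G' := fun p => ∫ w in (0 : ℝ)..1, F p (2 * Real.pi * w)) ?_ ?_
  · refine h1.congr fun ℓ => ?_
    rw [← Finset.mul_sum, ← mul_assoc, sq]
  · intro ℓ p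
    have hL : ‖(1 / (2 * ℓ + 1) : ℂ)‖ = 1 / (2 * ℓ + 1) := by
      rw [show (1 / (2 * ℓ + 1) : ℂ) = ((1 / (2 * ℓ + 1) : ℝ) : ℂ) by push_cast; rfl,
        Complex.norm_real, Real.norm_of_nonneg (by positivity)]
    rw [norm_mul, hL]
    refine (mul_le_mul_of_nonneg_left ((norm_sum_le _ _).trans
      (Finset.sum_le_sum fun n _ => hC p _)) (by positivity)).trans ?_
    simp only [Finset.sum_const, Finset.card_univ, Fintype.card_fin, nsmul_eq_mul]
    push_cast
    rw [← mul_assoc, one_div_mul_cancel (by positivity), one_mul]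
  · intro p q hq
    exact tendsto_momentum_sum (C := C) (G := fun ℓ k => F (q ℓ) k) (G' := F p)
      (fun _ _ => hC _ _) fun k k' hk =>
        (hF.tendsto (p, k)).comp (hq.prodMk_nhds hk)

/-! ### The weight of the potential -/

/-- The Fourier coefficients of the potential with large momenta cut off, in infinite volume. -/
def latticeWeight (χ : ℝ → ℝ) (α : ℝ) (f : ℝ → ℝ) (θ p : ℝ) : ℂ :=
  (∑' y : ℤ, (f (θ * y) : ℂ) * phase (-(p * y))) *
    (χ (θ ^ (α - 1) * ‖(p : AddCircle (2 * Real.pi))‖) : ℂ)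

section
variable {f : ℝ → ℝ} {θ : ℝ} (χ : ℝ → ℝ) (α : ℝ)

/-- Unfolding the periodized potential shows that the weight samples a function independent of the
volume. -/
lemma potentialWeight_eq (hc : HasCompactSupport f) (hθ : 0 < θ) (ℓ : ℕ) (r : Fin (2 * ℓ + 1)) :
    potentialWeight ℓ χ α f θ r = latticeWeight χ α f θ (momentum ℓ r) := by
  obtain ⟨s, hs⟩ := exists_finset_eq_zero hc hθ
  rw [potentialWeight, latticeWeight, potentialHat, ← sum_site_tsum ℓ]
  · congr 1
    refine Finset.sum_congr rfl fun x _ => ?_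
    rw [potential, Complex.ofReal_tsum, ← tsum_mul_left]
    refine tsum_congr fun a => ?_
    have h1 := phase_momentum_mul_add ℓ r x.1 a
    rw [← h1, mul_comm]
    push_cast
    rfl
  · refine s.finite_toSet.subset fun y hy => ?_
    by_contra h
    exact hy (by simp only [hs y h]; simp)

lemma exists_latticeWeight_eq (hc : HasCompactSupport f) (hθ : 0 < θ) :
    ∃ s : Finset ℤ, ∀ p, latticeWeight χ α f θ p =
      (∑ y ∈ s, (f (θ * y) : ℂ) * phase (-(p * y))) *
        (χ (θ ^ (α - 1) * ‖(p : AddCircle (2 * Real.pi))‖) : ℂ) := by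
  obtain ⟨s, hs⟩ := exists_finset_eq_zero hc hθ
  refine ⟨s, fun p => ?_⟩
  rw [latticeWeight, tsum_eq_sum fun y hy => by rw [hs y hy]; simp]

lemma continuous_latticeWeight (hc : HasCompactSupport f) (hθ : 0 < θ) {χ : ℝ → ℝ}
    (hχ : IsCutoff χ) : Continuous (latticeWeight χ α f θ) := by
  obtain ⟨s, hs⟩ := exists_latticeWeight_eq χ α hc hθ
  rw [funext hs]
  refine Continuous.mul ?_ (Complex.continuous_ofReal.comp (hχ.smooth.continuous.comp
    (continuous_const.mul (continuous_norm.comp (AddCircle.continuous_mk' _)))))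
  exact continuous_finsetSum _ fun y _ => continuous_const.mul (Continuous.phase (by fun_prop))

lemma exists_norm_latticeWeight_le (hc : HasCompactSupport f) (hθ : 0 < θ) {χ : ℝ → ℝ}
    (hχ : IsCutoff χ) : ∃ C ≥ 0, ∀ p, ‖latticeWeight χ α f θ p‖ ≤ C := by
  obtain ⟨s, hs⟩ := exists_latticeWeight_eq χ α hc hθ
  refine ⟨∑ y ∈ s, ‖(f (θ * y) : ℂ)‖, Finset.sum_nonneg fun _ _ => norm_nonneg _, fun p => ?_⟩
  rw [hs, norm_mul, Complex.norm_real, Real.norm_of_nonneg (hχ.nonneg _)]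
  refine (mul_le_of_le_one_right (norm_nonneg _) (hχ.le_one _)).trans ((norm_sum_le _ _).trans ?_)
  refine Finset.sum_le_sum fun y _ => ?_
  rw [norm_mul, norm_phase, mul_one]

lemma latticeWeight_add_two_pi (f : ℝ → ℝ) (θ p : ℝ) (m : ℤ) :
    latticeWeight χ α f θ (p + 2 * Real.pi * m) = latticeWeight χ α f θ p := by
  have h1 : ((p + 2 * Real.pi * m : ℝ) : AddCircle (2 * Real.pi)) = (p : AddCircle _) := by
    rw [show 2 * Real.pi * (m : ℝ) = m • (2 * Real.pi) by rw [zsmul_eq_mul, mul_comm],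
      AddCircle.coe_add, AddCircle.coe_zsmul, AddCircle.coe_period, smul_zero, add_zero]
  simp only [latticeWeight, phase_add_two_pi_mul_int, h1]

/-- In the first Brillouin zone the distance on the circle is the absolute value, and θ^(α-1) θ =
θ^α. The rest is the Poisson formula `torusFourier_eq`. -/
lemma latticeWeight_neg_mul {f : ℝ → ℝ} (hf : ContDiff ℝ (⊤ : ℕ∞) f) (hc : HasCompactSupport f)
    (hθ : 0 < θ) {q : ℝ} (hq : θ * |q| ≤ Real.pi) :
    θ * latticeWeight χ α f θ (-(θ * q)) = torusFourier f θ (-q) * (χ (θ ^ α * |q|) : ℂ) := by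
  have h1 : ‖((-(θ * q) : ℝ) : AddCircle (2 * Real.pi))‖ = θ * |q| := by
    have h2 : |(-(θ * q))| = θ * |q| := by rw [abs_neg, abs_mul, abs_of_pos hθ]
    rw [(AddCircle.norm_coe_eq_abs_iff _ (by positivity)).2, h2]
    rw [h2, abs_of_pos Real.two_pi_pos]
    linarith
  rw [latticeWeight, h1, torusFourier_eq hf hc hθ, ← mul_assoc, ← mul_assoc, Real.rpow_sub_one hθ.ne',
    div_mul_cancel₀ _ hθ.ne']
  congr 4
  ext y
  congr 2
  ring

end
end LinearResponse
end

noncomputable section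
namespace LinearResponse

open MeasureTheory

/-! ### The thermodynamic limit -/

section Continuity
variable {M : ℕ}

/-- The matrix `e^{sA} (1 + e^{βA})⁻¹`. -/
def thermalMat (β s : ℝ) (A : Matrix (Fin M) (Fin M) ℂ) : Matrix (Fin M) (Fin M) ℂ :=
  NormedSpace.exp ((s : ℂ) • A) * (1 + NormedSpace.exp ((β : ℂ) • A))⁻¹

lemma one_add_exp_mul_fermi (β x : ℝ) : (1 + Complex.exp (β * x)) * (fermi β x : ℂ) = 1 := by
  have h1 : (1 + Real.exp (β * x)) * fermi β x = 1 := by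
    rw [fermi, mul_inv_cancel₀]
    positivity
  exact_mod_cast congrArg (fun t : ℝ => (t : ℂ)) h1

lemma one_add_exp_eq_matFun {A : Matrix (Fin M) (Fin M) ℂ} (hA : A.IsHermitian) (β : ℝ) :
    1 + NormedSpace.exp ((β : ℂ) • A) = matFun hA fun x => 1 + Complex.exp (β * x) := by
  rw [exp_smul_eq_matFun hA, ← matFun_one hA, matFun_add]

lemma thermalMat_eq {A : Matrix (Fin M) (Fin M) ℂ} (hA : A.IsHermitian) (β s : ℝ) :
    thermalMat β s A = matFun hA fun x => Complex.exp (s * x) * fermi β x := by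
  rw [thermalMat, one_add_exp_eq_matFun hA, exp_smul_eq_matFun hA,
    inv_eq_matFun hA (ψ := fun x => (fermi β x : ℂ)) fun a => one_add_exp_mul_fermi β _, matFun_mul]

lemma continuous_matrix_exp {X : Type*} [TopologicalSpace X] {F : X → Matrix (Fin M) (Fin M) ℂ}
    (hF : Continuous F) : Continuous fun x => NormedSpace.exp (F x) := by
  let _ : NormedRing (Matrix (Fin M) (Fin M) ℂ) := Matrix.linftyOpNormedRing
  let _ : NormedAlgebra ℂ (Matrix (Fin M) (Fin M) ℂ) := Matrix.linftyOpNormedAlgebra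
  let _ : NormedAlgebra ℚ (Matrix (Fin M) (Fin M) ℂ) := .restrictScalars ℚ ℂ _
  have h1 : Continuous (NormedSpace.exp : Matrix (Fin M) (Fin M) ℂ → _) :=
    NormedSpace.exp_continuous
  exact h1.comp hF

/-- For Hermitian A the spectrum of 1 + e^{βA} is positive, so its determinant does not vanish and
the inverse is continuous by the adjugate formula. -/
lemma continuous_thermalMat {X : Type*} [TopologicalSpace X] (β : ℝ) {s : X → ℝ}
    {F : X → Matrix (Fin M) (Fin M) ℂ} (hs : Continuous s) (hF : Continuous F)
    (hH : ∀ x, (F x).IsHermitian) : Continuous fun x => thermalMat β (s x) (F x) := by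
  have h1 : Continuous fun x => 1 + NormedSpace.exp ((β : ℂ) • F x) :=
    continuous_const.add (continuous_matrix_exp (F := fun x => (β : ℂ) • F x) (by fun_prop))
  have h2 : ∀ x, (1 + NormedSpace.exp ((β : ℂ) • F x)).det ≠ 0 := by
    intro x h0
    have h3 : (1 + NormedSpace.exp ((β : ℂ) • F x)) *
        matFun (hH x) (fun y => (fermi β y : ℂ)) = 1 := by
      rw [one_add_exp_eq_matFun (hH x), matFun_mul, ← matFun_one (hH x)]
      exact matFun_congr _ fun a => one_add_exp_mul_fermi β _
    have h4 := congrArg Matrix.det h3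
    rw [Matrix.det_mul, h0, zero_mul, Matrix.det_one] at h4
    exact zero_ne_one h4
  unfold thermalMat
  refine (continuous_matrix_exp ((Complex.continuous_ofReal.comp hs).smul hF)).mul ?_
  simp only [Matrix.inv_def, Ring.inverse_eq_inv']
  exact (h1.matrix_det.inv₀ h2).smul h1.matrix_adjugate

end Continuity

/-! ### The thermal polarization and its zero-temperature limit -/

section
variable {M : ℕ} {h : Hopping M} (hh : h.SelfAdjoint) (μ : ℝ)

lemma one_sub_fermi (β x : ℝ) : 1 - fermi β x = fermi (-β) x := by
  rw [fermi, fermi, neg_mul, Real.exp_neg]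
  have := Real.exp_pos (β * x)
  field_simp
  ring

lemma exp_mul_fermi (β x : ℝ) : Real.exp (β * x) * fermi β x = 1 - fermi β x := by
  rw [fermi]
  have := Real.exp_pos (β * x)
  field_simp
  ring

/-- The summand factors into functions of one level each, since 1 - f_β = f_{-β}. The trace form
yields continuity across level crossings. -/
lemma thermalPair_eq_trace (β s : ℝ) (ν : Fin 2) (p k : ℝ) : thermalPair hh μ β s ν p k =
    (vertex h ν k p * thermalMat β s (shifted h μ k) *
      thermalMat (-β) (-s) (shifted h μ (k - p))).trace := by
  rw [thermalMat_eq (shifted_isHermitian hh μ k), thermalMat_eq (shifted_isHermitian hh μ (k - p)),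
    trace_mul_matFun_mul_matFun, thermalPair]
  refine pairSum_congr _ _ _ fun a b => ?_
  rw [← one_sub_fermi, mul_sub, sub_eq_add_neg, Complex.exp_add]
  push_cast
  rw [neg_mul]
  ring

lemma continuous_thermalPair (β : ℝ) (ν : Fin 2) :
    Continuous fun x : (ℝ × ℝ) × ℝ => thermalPair hh μ β x.2 ν x.1.1 x.1.2 := by
  simp only [thermalPair_eq_trace]
  refine Continuous.matrix_trace (Continuous.mul (Continuous.mul ?_ ?_) ?_)
  · exact (continuous_vertex h ν).comp (f := fun x : (ℝ × ℝ) × ℝ => (x.1.2, x.1.1)) (by fun_prop)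
  · exact continuous_thermalMat β continuous_snd ((continuous_shifted h μ).comp (by fun_prop))
      fun x => shifted_isHermitian hh μ _
  · exact continuous_thermalMat (-β) continuous_snd.neg
      ((continuous_shifted h μ).comp (f := fun x : (ℝ × ℝ) × ℝ => x.1.2 - x.1.1) (by fun_prop))
      fun x => shifted_isHermitian hh μ _

/-- The polarization at inverse temperature `β`. -/
def polarization (β η : ℝ) (ν : Fin 2) (p k : ℝ) : ℂ :=
  ∫ s in (0 : ℝ)..β, phase (-(etaBeta β η * s)) * thermalPair hh μ β s ν p k

lemma continuous_polarization (β η : ℝ) (ν : Fin 2) :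
    Continuous fun x : ℝ × ℝ => polarization hh μ β η ν x.1 x.2 := by
  refine intervalIntegral.continuous_parametric_intervalIntegral_of_continuous'
    (f := fun (x : ℝ × ℝ) s => phase (-(etaBeta β η * s)) * thermalPair hh μ β s ν x.1 x.2) ?_ _ _
  refine Continuous.mul (Continuous.phase ?_) (continuous_thermalPair hh μ β ν)
  exact (continuous_const.mul continuous_snd).neg

lemma etaBeta_mul {β : ℝ} (hβ : 0 < β) (η : ℝ) :
    etaBeta β η * β = 2 * Real.pi * ((⌈β * η / (2 * Real.pi)⌉₊ : ℤ) : ℝ) := by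
  rw [etaBeta]
  push_cast
  field_simp

lemma le_etaBeta {β : ℝ} (hβ : 0 < β) (η : ℝ) : η ≤ etaBeta β η := by
  have h1 := Nat.le_ceil (β * η / (2 * Real.pi))
  have h2 := mul_le_mul_of_nonneg_left h1 (by positivity : 0 ≤ 2 * Real.pi / β)
  refine le_trans (le_of_eq ?_) h2
  have := Real.pi_pos
  field_simp

lemma tendsto_etaBeta {η : ℝ} (hη : 0 < η) :
    Filter.Tendsto (fun β => etaBeta β η) Filter.atTop (𝓝 η) := by
  have h1 : Filter.Tendsto (fun β : ℝ => η + 2 * Real.pi / β) Filter.atTop (𝓝 (η + 0)) :=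
    tendsto_const_nhds.add (tendsto_const_nhds.div_atTop Filter.tendsto_id)
  rw [add_zero] at h1
  refine tendsto_of_tendsto_of_tendsto_of_le_of_le' tendsto_const_nhds h1 ?_ ?_
  · filter_upwards [Filter.eventually_gt_atTop 0] with β hβ using le_etaBeta hβ η
  · filter_upwards [Filter.eventually_gt_atTop 0] with β hβ
    have hpi := Real.pi_pos
    have h2 := (Nat.ceil_lt_add_one (a := β * η / (2 * Real.pi)) (by positivity)).le
    have h3 := mul_le_mul_of_nonneg_left h2 (by positivity : 0 ≤ 2 * Real.pi / β)
    refine h3.trans (le_of_eq ?_)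
    field_simp

/-- The divided difference of the Fermi function. -/
def fermiQuotient (β E x y : ℝ) : ℂ :=
  ((fermi β y - fermi β x : ℝ) : ℂ) / (x - y - Complex.I * E)

lemma sub_sub_I_mul_ne_zero {E : ℝ} (hE : E ≠ 0) (x y : ℝ) : (x - y - Complex.I * E : ℂ) ≠ 0 := by
  intro h0
  have := congrArg Complex.im h0
  simp at this
  exact hE this

/-- Because η_β β ∈ 2πℕ, the phase is 1 at both endpoints. The identity e^{βx} f_β(x) = 1 - f_β(x)
then collapses the boundary terms to a difference of Fermi functions. -/
lemma integral_phase_mul_exp {β η : ℝ} (hβ : 0 < β) (hη : 0 < η) (x y : ℝ) :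
    ∫ s in (0 : ℝ)..β, phase (-(etaBeta β η * s)) *
      (Complex.exp (s * (x - y)) * (fermi β x * (1 - fermi β y))) =
      fermiQuotient β (etaBeta β η) x y := by
  have hE : etaBeta β η ≠ 0 := (hη.trans_le (le_etaBeta hβ η)).ne'
  have hz := sub_sub_I_mul_ne_zero hE x y
  have h1 : ∀ s : ℝ, phase (-(etaBeta β η * s)) *
      (Complex.exp (s * (x - y)) * (fermi β x * (1 - fermi β y))) =
      Complex.exp ((x - y - Complex.I * etaBeta β η) * s) * (fermi β x * (1 - fermi β y)) := by
    intro s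
    rw [← mul_assoc, phase, ← Complex.exp_add]
    congr 2
    push_cast
    ring
  simp only [h1]
  rw [intervalIntegral.integral_mul_const, integral_exp_mul_complex hz, fermiQuotient]
  have h2 : Complex.exp ((x - y - Complex.I * etaBeta β η) * β) =
      Complex.exp (β * x) * Complex.exp (-(β * y)) := by
    have h3 : phase (etaBeta β η * β) = 1 := by
      rw [etaBeta_mul hβ, phase_two_pi_int]
    rw [← mul_one (Complex.exp ((x - y - Complex.I * etaBeta β η) * β)), ← h3, phase, ← Complex.exp_add, ← Complex.exp_add]
    congr 1
    push_cast
    ring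
  have h4 : Complex.exp (β * x) * fermi β x = 1 - fermi β x := by
    exact_mod_cast congrArg (fun t : ℝ => (t : ℂ)) (exp_mul_fermi β x)
  have h5 : Complex.exp (-(β * y)) * (1 - fermi β y) = fermi β y := by
    have h6 : Complex.exp (β * y) * fermi β y = 1 - fermi β y := by
      exact_mod_cast congrArg (fun t : ℝ => (t : ℂ)) (exp_mul_fermi β y)
    rw [← h6, ← mul_assoc, ← Complex.exp_add, neg_add_cancel, Complex.exp_zero, one_mul]
  rw [h2, Complex.ofReal_zero, mul_zero, Complex.exp_zero, div_mul_eq_mul_div]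
  congr 1
  push_cast
  linear_combination (Complex.exp (-(β * y)) * (1 - fermi β y)) * h4 + (1 - fermi β x : ℂ) * h5

lemma integral_mul_pairSum {A B : Matrix (Fin M) (Fin M) ℂ} (hA : A.IsHermitian)
    (hB : B.IsHermitian) {g : ℝ → ℂ} {φ : ℝ → ℝ → ℝ → ℂ} (J : Matrix (Fin M) (Fin M) ℂ)
    (hφ : ∀ x y, Continuous fun s => g s * φ s x y) (b : ℝ) :
    ∫ s in (0 : ℝ)..b, g s * pairSum hA hB (φ s) J =
      pairSum hA hB (fun x y => ∫ s in (0 : ℝ)..b, g s * φ s x y) J := by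
  simp only [pairSum, Finset.mul_sum]
  have h1 : ∀ i j, Continuous fun s => g s * (φ s (hA.eigenvalues i) (hB.eigenvalues j) *
      (overlap hA hB i j * ((eigU hB)ᴴ * J * eigU hA) j i)) := by
    intro i j
    simp only [← mul_assoc (g _)]
    exact (hφ _ _).mul continuous_const
  rw [intervalIntegral.integral_finsetSum fun i _ =>
    (continuous_finsetSum _ fun j _ => h1 i j).intervalIntegrable _ _]
  refine Finset.sum_congr rfl fun i _ => ?_
  rw [intervalIntegral.integral_finsetSum fun j _ => (h1 i j).intervalIntegrable _ _]
  refine Finset.sum_congr rfl fun j _ => ?_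
  simp only [← mul_assoc (g _)]
  rw [intervalIntegral.integral_mul_const]

lemma polarization_eq {β η : ℝ} (hβ : 0 < β) (hη : 0 < η) (ν : Fin 2) (p k : ℝ) :
    polarization hh μ β η ν p k = pairSum (shifted_isHermitian hh μ k)
      (shifted_isHermitian hh μ (k - p)) (fermiQuotient β (etaBeta β η)) (vertex h ν k p) := by
  have h1 := integral_mul_pairSum (shifted_isHermitian hh μ k) (shifted_isHermitian hh μ (k - p))
    (g := fun s => phase (-(etaBeta β η * s))) (φ := fun s x y =>
      Complex.exp (s * (x - y)) * (fermi β x * (1 - fermi β y))) (vertex h ν k p)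
    (fun x y => by fun_prop) β
  exact h1.trans (pairSum_congr _ _ _ fun a b => integral_phase_mul_exp hβ hη _ _)

lemma fermi_pos (β x : ℝ) : 0 < fermi β x := by
  unfold fermi; positivity

lemma fermi_le_one (β x : ℝ) : fermi β x ≤ 1 := by
  linarith [one_sub_fermi β x, fermi_pos (-β) x]

/-- The imaginary part of the denominator is the frequency, and η_β ≥ η. The bound does not depend
on β and serves as majorant for β → ∞. -/
lemma norm_fermiQuotient_le (β : ℝ) {E η : ℝ} (hη : 0 < η) (hE : η ≤ E) (x y : ℝ) :
    ‖fermiQuotient β E x y‖ ≤ 1 / η := by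
  rw [fermiQuotient, norm_div, Complex.norm_real]
  have h1 : ‖fermi β y - fermi β x‖ ≤ 1 := by
    rw [Real.norm_eq_abs, abs_le]
    constructor <;> linarith [fermi_pos β x, fermi_pos β y, fermi_le_one β x, fermi_le_one β y]
  have h2 : η ≤ ‖(x - y - Complex.I * E : ℂ)‖ := by
    have h3 := Complex.abs_im_le_norm (x - y - Complex.I * E : ℂ)
    simp at h3
    exact (hE.trans (le_abs_self E)).trans h3
  exact div_le_div₀ zero_le_one h1 hη h2

lemma norm_polarization_le {β η : ℝ} (hβ : 0 < β) (hη : 0 < η) (ν : Fin 2) (p k : ℝ) :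
    ‖polarization hh μ β η ν p k‖ ≤ (M : ℝ) ^ 2 * (1 / η * vertexBound h) := by
  rw [polarization_eq hh μ hβ hη]
  refine (norm_pairSum_le' _ _ _ fun a b => norm_fermiQuotient_le β hη (le_etaBeta hβ η) _ _).trans ?_
  have := entrySum_vertex_le h ν k p
  gcongr

lemma tendsto_fermi {x : ℝ} (hx : x ≠ 0) :
    Filter.Tendsto (fun β => fermi β x) Filter.atTop (𝓝 (occ x)) := by
  unfold fermi occ
  rcases hx.lt_or_gt with hx | hx
  · rw [if_pos hx]
    have h1 : Filter.Tendsto (fun β : ℝ => (1 + Real.exp (β * x))⁻¹) Filter.atTop (𝓝 (1 + 0)⁻¹) :=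
      (tendsto_const_nhds.add (Real.tendsto_exp_atBot.comp
        (Filter.tendsto_id.atTop_mul_const_of_neg hx))).inv₀ (by norm_num)
    simpa using h1
  · rw [if_neg hx.not_gt]
    exact (Filter.tendsto_atTop_add_const_left _ _ (Real.tendsto_exp_atTop.comp
      (Filter.tendsto_id.atTop_mul_const hx))).inv_tendsto_atTop

lemma tendsto_polarization {η : ℝ} (hη : 0 < η) (ν : Fin 2) {p k : ℝ}
    (h1 : ∀ a, ev hh μ k a ≠ 0) (h2 : ∀ a, ev hh μ (k + -p) a ≠ 0) :
    Filter.Tendsto (fun β => polarization hh μ β η ν p k) Filter.atTop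
      (𝓝 (-lindhard hh μ ν η (-p) k)) := by
  have h3 : -lindhard hh μ ν η (-p) k = pairSum (shifted_isHermitian hh μ k)
      (shifted_isHermitian hh μ (k - p)) (fun x y => ((occ y - occ x : ℝ) : ℂ) /
        (x - y - Complex.I * η)) (vertex h ν k p) := by
    rw [lindhard, pairSum_eq_of_eq _ _ (shifted_isHermitian hh μ k)
      (shifted_isHermitian hh μ (k - p)) rfl (by rw [sub_eq_add_neg]), neg_neg, pairSum, pairSum,
      ← Finset.sum_neg_distrib]
    refine Finset.sum_congr rfl fun a _ => ?_
    rw [← Finset.sum_neg_distrib]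
    refine Finset.sum_congr rfl fun b _ => ?_
    rw [← neg_mul, ← neg_div, ← Complex.ofReal_neg, neg_sub]
  rw [h3]
  have h4 : Filter.Tendsto (fun β => pairSum (shifted_isHermitian hh μ k)
      (shifted_isHermitian hh μ (k - p)) (fermiQuotient β (etaBeta β η)) (vertex h ν k p))
      Filter.atTop (𝓝 (pairSum (shifted_isHermitian hh μ k)
      (shifted_isHermitian hh μ (k - p)) (fun x y => ((occ y - occ x : ℝ) : ℂ) /
        (x - y - Complex.I * η)) (vertex h ν k p))) := by
    unfold pairSum
    refine tendsto_finsetSum _ fun a _ => tendsto_finsetSum _ fun b _ => ?_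
    refine Filter.Tendsto.mul_const _ ?_
    unfold fermiQuotient
    refine Filter.Tendsto.div ?_ ?_ (sub_sub_I_mul_ne_zero hη.ne' _ _)
    · refine (Complex.continuous_ofReal.tendsto _).comp ((tendsto_fermi ?_).sub
        (tendsto_fermi (h1 a)))
      have h5 := h2 b
      rwa [← sub_eq_add_neg] at h5
    · exact tendsto_const_nhds.sub (tendsto_const_nhds.mul
        ((Complex.continuous_ofReal.tendsto _).comp (tendsto_etaBeta hη)))
  refine h4.congr' ?_
  filter_upwards [Filter.eventually_gt_atTop 0] with β hβ using (polarization_eq hh μ hβ hη ν p k).symm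

end
end LinearResponse
end

/-! ### The limits L → ∞ and β → ∞ of the first-order response -/

noncomputable section
namespace LinearResponse

open MeasureTheory

section
variable {M N : ℕ} {h : Hopping M} {μ : ℝ} {f : ℝ → ℝ} {θ : ℝ}

/-- The first-order response at inverse temperature `β`, resolved in the momenta. -/
def responseDensity (hh : h.SelfAdjoint) (μ : ℝ) (χ : ℝ → ℝ) (α : ℝ) (f : ℝ → ℝ) (θ η : ℝ)
    (ν : Fin 2) (x : ℤ) (β p k : ℝ) : ℂ :=
  latticeWeight χ α f θ p * phase (p * x) * polarization hh μ β η ν p k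

lemma firstOrderFinite_eq (hh : h.SelfAdjoint) (μ : ℝ) (χ : ℝ → ℝ) (α : ℝ)
    (hc : HasCompactSupport f) (hθ : 0 < θ) (ν : Fin 2) (x : ℤ) (η β : ℝ) (ℓ : ℕ) :
    firstOrderFinite h μ χ α f ν x η θ β ℓ = -((1 / (2 * ℓ + 1) : ℂ) ^ 2 *
      ∑ r, ∑ n, responseDensity hh μ χ α f θ η ν x β (momentum ℓ r) (momentum ℓ n)) := by
  have h1 : ∀ r n : Fin (2 * ℓ + 1), Continuous fun s => latticeWeight χ α f θ (momentum ℓ r) *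
      phase (momentum ℓ r * x) * (phase (-(etaBeta β η * s)) *
        thermalPair hh μ β s ν (momentum ℓ r) (momentum ℓ n)) := fun r n => continuous_const.mul <|
    Continuous.mul (Continuous.phase (by fun_prop)) ((continuous_thermalPair hh μ β ν).comp
      (f := fun s : ℝ => ((momentum ℓ r, momentum ℓ n), s)) (by fun_prop))
  have h2 : ∀ s : ℝ, phase (-(etaBeta β η * s)) *
      euclidCumulant h μ β ℓ s (perturbation M χ α f θ ℓ) (current h ℓ ν x) =
      θ * (1 / (2 * ℓ + 1) : ℂ) ^ 2 * ∑ r, ∑ n, latticeWeight χ α f θ (momentum ℓ r) *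
        phase (momentum ℓ r * x) * (phase (-(etaBeta β η * s)) *
          thermalPair hh μ β s ν (momentum ℓ r) (momentum ℓ n)) := by
    intro s
    rw [euclidCumulant_eq hh, mul_left_comm, Finset.mul_sum]
    congr 1
    refine Finset.sum_congr rfl fun r _ => ?_
    rw [Finset.mul_sum]
    refine Finset.sum_congr rfl fun n _ => ?_
    rw [potentialWeight_eq χ α hc hθ]
    ring
  rw [firstOrderFinite]
  simp only [h2]
  have hθ' : (θ : ℂ) ≠ 0 := by exact_mod_cast hθ.ne'
  rw [intervalIntegral.integral_const_mul, neg_mul, ← mul_assoc, ← mul_assoc,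
    one_div_mul_cancel hθ', one_mul, intervalIntegral.integral_finsetSum fun r _ =>
      (continuous_finsetSum _ fun n _ => h1 r n).intervalIntegrable _ _]
  congr 2
  refine Finset.sum_congr rfl fun r _ => ?_
  rw [intervalIntegral.integral_finsetSum fun n _ =>
    (h1 r n).intervalIntegrable _ _]
  refine Finset.sum_congr rfl fun n _ => ?_
  rw [intervalIntegral.integral_const_mul]
  rfl

lemma continuous_responseDensity (hh : h.SelfAdjoint) (μ : ℝ) {χ : ℝ → ℝ} (hχ : IsCutoff χ) (α : ℝ)
    (hc : HasCompactSupport f) (hθ : 0 < θ) (η : ℝ) (ν : Fin 2) (x : ℤ) (β : ℝ) :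
    Continuous fun y : ℝ × ℝ => responseDensity hh μ χ α f θ η ν x β y.1 y.2 :=
  (((continuous_latticeWeight α hc hθ hχ).comp continuous_fst).mul
    (Continuous.phase (by fun_prop))).mul (continuous_polarization hh μ β η ν)

lemma exists_norm_responseDensity_le (hh : h.SelfAdjoint) (μ : ℝ) {χ : ℝ → ℝ} (hχ : IsCutoff χ)
    (α : ℝ) (hc : HasCompactSupport f) (hθ : 0 < θ) {η : ℝ} (hη : 0 < η) (ν : Fin 2) (x : ℤ) :
    ∃ C, ∀ β > 0, ∀ p k, ‖responseDensity hh μ χ α f θ η ν x β p k‖ ≤ C := by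
  obtain ⟨C, hC, hw⟩ := exists_norm_latticeWeight_le α hc hθ hχ
  refine ⟨C * ((M : ℝ) ^ 2 * (1 / η * vertexBound h)), fun β hβ p k => ?_⟩
  rw [responseDensity, norm_mul, norm_mul, norm_phase, mul_one]
  exact mul_le_mul (hw p) (norm_polarization_le hh μ hβ hη ν p k) (norm_nonneg _) hC

/-- The thermodynamic limit of the first-order response. -/
def thermalResponse (hh : h.SelfAdjoint) (μ : ℝ) (χ : ℝ → ℝ) (α : ℝ) (f : ℝ → ℝ) (θ η : ℝ)
    (ν : Fin 2) (x : ℤ) (β : ℝ) : ℂ :=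
  -∫ u in (0 : ℝ)..1, ∫ w in (0 : ℝ)..1,
    responseDensity hh μ χ α f θ η ν x β (2 * Real.pi * u) (2 * Real.pi * w)

lemma tendsto_firstOrderFinite (hh : h.SelfAdjoint) (μ : ℝ) {χ : ℝ → ℝ} (hχ : IsCutoff χ)
    (α : ℝ) (hc : HasCompactSupport f) (hθ : 0 < θ) {η : ℝ} (hη : 0 < η) (ν : Fin 2) (x : ℤ)
    {β : ℝ} (hβ : 0 < β) :
    Filter.Tendsto (fun ℓ => firstOrderFinite h μ χ α f ν x η θ β ℓ) Filter.atTop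
      (𝓝 (thermalResponse hh μ χ α f θ η ν x β)) := by
  obtain ⟨C, hC⟩ := exists_norm_responseDensity_le hh μ hχ α hc hθ hη ν x
  simp only [firstOrderFinite_eq hh μ χ α hc hθ]
  exact (tendsto_momentum_sum_sum (continuous_responseDensity hh μ hχ α hc hθ η ν x β)
    (hC β hβ)).neg

lemma integral_two_pi_mul (g : ℝ → ℂ) (hg : ∀ k, g (k + 2 * Real.pi) = g k) :
    ∫ w in (0 : ℝ)..1, g (2 * Real.pi * w) =
      (∫ k in Set.Ioc (-Real.pi) Real.pi, g k) / (2 * Real.pi) := by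
  have h1 := intervalIntegral.integral_comp_mul_left (a := 0) (b := 1) g Real.two_pi_pos.ne'
  have h2 := (show Function.Periodic g (2 * Real.pi) from hg).intervalIntegral_add_eq 0 (-Real.pi)
  rw [h1, mul_zero, mul_one]
  rw [zero_add, show -Real.pi + 2 * Real.pi = Real.pi by ring] at h2
  rw [h2, intervalIntegral.integral_of_le (by linarith [Real.pi_pos]), Complex.real_smul]
  push_cast
  rw [div_eq_inv_mul]

lemma ae_ev_ne_zero (hh : h.SelfAdjoint) (A : LowEnergySpectrum h μ N) (p : ℝ) :
    ∀ᵐ w : ℝ, ∀ a, ev hh μ (2 * Real.pi * w + p) a ≠ 0 := by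
  have h1 : Measure.QuasiMeasurePreserving (fun w : ℝ => 2 * Real.pi * w) volume volume := by
    refine ⟨measurable_const_mul _, ?_⟩
    rw [Real.map_volume_mul_left Real.two_pi_pos.ne']
    exact Measure.smul_absolutelyContinuous
  filter_upwards [h1.ae (ae_ne_fermi μ A p)] with w hw a
  exact A.ev_ne_zero hh hw a

lemma integral_lindhard (hh : h.SelfAdjoint) (A : LowEnergySpectrum h μ N) (ν : Fin 2) {η : ℝ}
    (hη : 0 < η) (p : ℝ) :
    ∫ w in (0 : ℝ)..1, lindhard hh μ ν η p (2 * Real.pi * w) = -correlation h μ ν η p := by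
  rw [(correlation_eq hh μ A ν (abs_pos.2 hη.ne') (fun k a b => by
    linarith [abs_nonneg (ev hh μ k a), abs_nonneg (ev hh μ (k + p) b)])).2,
    integral_two_pi_mul _ fun k => ?_]
  · rw [neg_div, neg_neg]
  · simpa using lindhard_add_two_pi hh μ ν η p k 1

/-- Dominated convergence in both momenta. At fixed transfer the Fermi functions converge to
occupations except on the null set of k where a level at k or k - p vanishes. -/
lemma tendsto_thermalResponse (hh : h.SelfAdjoint) (A : LowEnergySpectrum h μ N) {χ : ℝ → ℝ}
    (hχ : IsCutoff χ) (α : ℝ) (hc : HasCompactSupport f) (hθ : 0 < θ) {η : ℝ} (hη : 0 < η)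
    (ν : Fin 2) (x : ℤ) :
    Filter.Tendsto (thermalResponse hh μ χ α f θ η ν x) Filter.atTop
      (𝓝 (-∫ u in (0 : ℝ)..1, latticeWeight χ α f θ (2 * Real.pi * u) *
        phase (2 * Real.pi * u * x) * correlation h μ ν η (-(2 * Real.pi * u)))) := by
  obtain ⟨C, hC⟩ := exists_norm_responseDensity_le hh μ hχ α hc hθ hη ν x
  have hcont := continuous_responseDensity hh μ hχ α hc hθ η ν x
  have hcont' : ∀ β, Continuous fun y : ℝ × ℝ =>
      responseDensity hh μ χ α f θ η ν x β (2 * Real.pi * y.1) (2 * Real.pi * y.2) := fun β =>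
    (hcont β).comp (f := fun y : ℝ × ℝ => (2 * Real.pi * y.1, 2 * Real.pi * y.2)) (by fun_prop)
  refine (intervalIntegral.tendsto_integral_filter_of_dominated_convergence (fun _ => C) ?_ ?_
    (by simp) ?_).neg
  · exact Filter.Eventually.of_forall fun β => Continuous.aestronglyMeasurable
      (intervalIntegral.continuous_parametric_intervalIntegral_of_continuous' (f := fun u w =>
        responseDensity hh μ χ α f θ η ν x β (2 * Real.pi * u) (2 * Real.pi * w)) (hcont' β) 0 1)
  · filter_upwards [Filter.eventually_gt_atTop 0] with β hβ
    refine Filter.Eventually.of_forall fun u _ => ?_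
    refine (intervalIntegral.norm_integral_le_of_norm_le_const fun w _ => hC β hβ _ _).trans ?_
    simp
  · refine Filter.Eventually.of_forall fun u _ => ?_
    have h1 : latticeWeight χ α f θ (2 * Real.pi * u) * phase (2 * Real.pi * u * x) *
        correlation h μ ν η (-(2 * Real.pi * u)) = ∫ w in (0 : ℝ)..1,
        latticeWeight χ α f θ (2 * Real.pi * u) * phase (2 * Real.pi * u * x) *
          -lindhard hh μ ν η (-(2 * Real.pi * u)) (2 * Real.pi * w) := by
      rw [intervalIntegral.integral_const_mul, intervalIntegral.integral_neg,
        integral_lindhard hh A ν hη, neg_neg]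
    rw [h1]
    refine intervalIntegral.tendsto_integral_filter_of_dominated_convergence (fun _ => C) ?_ ?_
      (by simp) ?_
    · exact Filter.Eventually.of_forall fun β => Continuous.aestronglyMeasurable
        ((hcont' β).comp (f := fun w : ℝ => (u, w)) (by fun_prop))
    · filter_upwards [Filter.eventually_gt_atTop 0] with β hβ
      exact Filter.Eventually.of_forall fun w _ => hC β hβ _ _
    · filter_upwards [ae_ev_ne_zero hh A 0, ae_ev_ne_zero hh A (-(2 * Real.pi * u))]
        with w h2 h3 _
      simp only [add_zero] at h2
      exact (tendsto_polarization hh μ hη ν h2 h3).const_mul _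

lemma correlation_add_two_pi (h : Hopping M) (μ : ℝ) (ν : Fin 2) (p₀ p : ℝ) (m : ℤ) :
    correlation h μ ν p₀ (p + 2 * Real.pi * m) = correlation h μ ν p₀ p := by
  have h1 : ∀ k, vertex h ν k (-(p + 2 * Real.pi * m)) = vertex h ν k (-p) := by
    intro k
    have := vertex_add_two_pi h ν k (-p) 0 (-m)
    rw [← this]
    congr 1 <;> push_cast <;> ring
  have h2 : ∀ k₀ k, propagator h μ k₀ (k + (p + 2 * Real.pi * m)) = propagator h μ k₀ (k + p) := by
    intro k₀ k
    rw [propagator, propagator, ← add_assoc, bloch_add_two_pi]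
  simp only [correlation, h1, h2]

/-- The substitution p = -θq: the response at zero temperature is an integral over one period of the
transfer momentum, in either variable. -/
lemma linResp_eq {χ : ℝ → ℝ} (α : ℝ) (hf : ContDiff ℝ (⊤ : ℕ∞) f) (hc : HasCompactSupport f)
    (hθ : 0 < θ) (η : ℝ) (ν : Fin 2) (x : ℤ) :
    linResp h μ χ α f ν x η θ = -∫ u in (0 : ℝ)..1, latticeWeight χ α f θ (2 * Real.pi * u) *
      phase (2 * Real.pi * u * x) * correlation h μ ν η (-(2 * Real.pi * u)) := by
  have hpi := Real.pi_pos
  rw [integral_two_pi_mul (fun p => latticeWeight χ α f θ p * phase (p * x) *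
    correlation h μ ν η (-p)) fun p => ?_, linResp]
  · congr 1
    rw [integral_div]
    congr 1
    have h0 : Real.pi / θ * θ = Real.pi := div_mul_cancel₀ _ hθ.ne'
    have h1 := intervalIntegral.integral_comp_mul_left (a := -(Real.pi / θ)) (b := Real.pi / θ)
      (fun p => latticeWeight χ α f θ p * phase (p * x) * correlation h μ ν η (-p))
      (neg_ne_zero.2 hθ.ne')
    rw [show -θ * -(Real.pi / θ) = Real.pi by linarith,
      show -θ * (Real.pi / θ) = -Real.pi by linarith,
      intervalIntegral.integral_symm (-Real.pi) Real.pi,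
      intervalIntegral.integral_of_le (a := -Real.pi) (by linarith),
      intervalIntegral.integral_of_le (by have := div_pos hpi hθ; linarith)] at h1
    have h2 : (∫ p in Set.Ioc (-Real.pi) Real.pi, latticeWeight χ α f θ p * phase (p * x) *
        correlation h μ ν η (-p)) = θ * ∫ q in Set.Ioc (-(Real.pi / θ)) (Real.pi / θ),
        latticeWeight χ α f θ (-θ * q) * phase (-θ * q * x) * correlation h μ ν η (-(-θ * q)) := by
      have hθ' : (θ : ℂ) ≠ 0 := by exact_mod_cast hθ.ne'
      rw [h1, Complex.real_smul, Complex.ofReal_inv, Complex.ofReal_neg, inv_neg, neg_mul_neg,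
        mul_inv_cancel_left₀ hθ']
    rw [h2, ← integral_const_mul]
    refine setIntegral_congr_fun measurableSet_Ioc fun q hq => ?_
    have h3 : θ * |q| ≤ Real.pi := by
      rw [mul_comm, ← le_div_iff₀ hθ]
      exact abs_le.2 ⟨hq.1.le, hq.2⟩
    simp only [neg_mul, neg_neg]
    rw [← latticeWeight_neg_mul χ α hf hc hθ h3]
    ring
  · have h1 := latticeWeight_add_two_pi χ α f θ p 1
    have h2 := correlation_add_two_pi h μ ν η (-p) (-1)
    have h3 := phase_add_two_pi (p * x) x
    simp only [Int.cast_one, Int.cast_neg, mul_one] at h1 h2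
    rw [h1, ← h2, ← h3]
    congr 2
    · congr 2; ring
    · ring

end
end LinearResponse
end

theorem mainTheorem7 {M N : ℕ} (h : LinearResponse.Hopping M) (hh : h.SelfAdjoint) (μ : ℝ)
    (A : LinearResponse.LowEnergySpectrum h μ N)
    (α : ℝ) (hα : α ∈ Set.Ioo (0 : ℝ) 1) (χ : ℝ → ℝ) (hχ : LinearResponse.IsCutoff χ)
    (μinf : ℝ → ℝ) (hμ : ContDiff ℝ (⊤ : ℕ∞) μinf) (hμc : HasCompactSupport μinf) :
    -- the linear response is the limit `L → ∞`, then `β → ∞`, of the first-order Duhamel term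
    (∀ (ν : Fin 2) (x : ℤ) (η θ : ℝ), 0 < η → 0 < θ →
      ∃ c : ℝ → ℂ,
        (∀ β : ℝ, 0 < β → Filter.Tendsto
          (fun ℓ : ℕ => LinearResponse.firstOrderFinite h μ χ α μinf ν x η θ β ℓ)
          Filter.atTop (𝓝 (c β))) ∧
        Filter.Tendsto c Filter.atTop (𝓝 (LinearResponse.linResp h μ χ α μinf ν x η θ))) ∧
    -- consequence of the continuity equation, which fixes the constant remainder
    (∀ (ν : Fin 2) (p₀ : ℝ), p₀ ≠ 0 → LinearResponse.correlation h μ ν p₀ 0 = 0) ∧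
    (∀ (ν : Fin 2) (δ : ℝ), 0 < δ → Filter.Tendsto
      (fun p : ℝ × ℝ => LinearResponse.remainder A χ δ ν p.1 p.2) (𝓝[≠] 0)
      (𝓝 ((∑ ω, A.v ω ^ (ν : ℕ) / (4 * Real.pi * |A.v ω|) : ℝ) : ℂ))) ∧
    -- the general formula, with `θ = a η`
    (∃ C θ₀ : ℝ, 0 < θ₀ ∧ ∀ (ν : Fin 2) (x : ℤ) (η a : ℝ), 0 < η → 0 < a → a * η < θ₀ →
      ‖LinearResponse.linResp h μ χ α μinf ν x η (a * η) -
        -∑ ω, (A.coeff ν ω : ℂ) * ∫ q : ℝ, LinearResponse.fourier μinf q *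
          LinearResponse.phase (q * (a * η) * x) *
          (((A.v ω * q : ℝ) : ℂ) / (-(Complex.I / (a : ℂ)) + ((A.v ω * q : ℝ) : ℂ))) /
          (2 * Real.pi : ℂ)‖
        ≤ C * (a * η) ^ (1 - α)) ∧
    -- (i) `a → 0`
    (∃ C : ℝ, ∀ a : ℝ → ℝ, (∀ η, 0 < η → 0 < a η) →
      Filter.Tendsto a (𝓝[>] 0) (𝓝 0) →
      ∀ᶠ η in 𝓝[>] (0 : ℝ), ∀ (ν : Fin 2) (x : ℤ),
        ‖LinearResponse.linResp h μ χ α μinf ν x η (a η * η)‖ ≤ C * a η) ∧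
    -- (ii) `a` constant
    (∀ a : ℝ, 0 < a → ∃ C : ℝ, ∀ᶠ η in 𝓝[>] (0 : ℝ), ∀ (ν : Fin 2) (x : ℤ),
        ‖LinearResponse.linResp h μ χ α μinf ν x η (a * η) -
          ((-∑ ω, A.coeff ν ω * (μinf (a * η * x) -
            ∫ y in {y : ℝ | 0 < y / A.v ω}, μinf (a * η * x - y) *
              (1 / (a * |A.v ω|) * Real.exp (-y / (a * A.v ω)))) : ℝ) : ℂ)‖
          ≤ C * η ^ (1 - α)) ∧
    -- (iii) `a → ∞` and `a η → 0`
    (∃ C : ℝ, ∀ a : ℝ → ℝ, (∀ η, 0 < η → 0 < a η) →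
      Filter.Tendsto a (𝓝[>] 0) Filter.atTop →
      Filter.Tendsto (fun η => a η * η) (𝓝[>] 0) (𝓝 0) →
      ∀ᶠ η in 𝓝[>] (0 : ℝ), ∀ (ν : Fin 2) (x : ℤ),
        ‖LinearResponse.linResp h μ χ α μinf ν x η (a η * η) -
          ((-(μinf (a η * η * x) * ∑ ω, A.coeff ν ω) : ℝ) : ℂ)‖
          ≤ C * (1 / a η + (a η * η) ^ (1 - α))) := by
  refine ⟨?_, fun ν p₀ hp₀ => LinearResponse.correlation_zero hh A ν hp₀,
    fun ν δ hδ => A.tendsto_remainder hh hχ ν hδ, ?_, A.linResp_fast hh hχ hμ hμc,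
    fun a ha => A.linResp_balanced hh hα hχ hμ hμc ha, A.linResp_slow hh hα hχ hμ hμc⟩
  · intro ν x η θ hη hθ
    refine ⟨LinearResponse.thermalResponse hh μ χ α μinf θ η ν x,
      fun β hβ => LinearResponse.tendsto_firstOrderFinite hh μ hχ α hμc hθ hη ν x hβ, ?_⟩
    rw [LinearResponse.linResp_eq α hμ hμc hθ]
    exact LinearResponse.tendsto_thermalResponse hh A hχ α hμc hθ hη ν x
  · obtain ⟨C, _, θ₀, hθ₀, hb⟩ := A.exists_linResp_formula hh hα hχ hμ hμc
    exact ⟨C, θ₀, hθ₀, hb⟩
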